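/- **Discrete $r$-sparse dictionary problem.** For $\mathbf A\in\mathbb R^{n\times d}$ and integers $1\le r\le k$, $D\ge 1$, let $\mathcal X$ be the set of $n\times k$ matrices with at most $r$ non-zero entries in each row and with all entries in $\{-D,\dots,D\}\subset\mathbb Z$. A pair $\tilde{\mathbf X}\in\mathcal X$, $\tilde{\mathbf D}\in\mathbb R^{k\times d}$ is a $(1+\epsilon)$-approximate solution if $\|\tilde{\mathbf X}\tilde{\mathbf D}-\mathbf A\|_F\le(1+\epsilon)\min_{\mathbf X\in\mathcal X,\ \mathbf D\in\mathbb R^{k\times d}}\|\mathbf X\mathbf D-\mathbf A\|_F$. Let $\operatorname{vec}(\mathbf A)\in\mathbb R^{nd}$ be the flattening of $\mathbf A$. **Model.** Algorithms are single programs, which work for all values of the parameters, on a real RAM. A memory cell holds either a real number, on which exact field operations and comparisons are available, or an integer machine word. Space is the number of cells declared, and time is the number of assignments and tests carried out. **Theorem.** Fix a constant failure probability $\delta\in(0,1)$. There is a constant $C$, depending only on $\delta$, such that the following hold for all $\epsilon\in(0,1)$, $1\le r\le k$ and $D\ge 1$. (1) For all $n\ge 1$ and $d\ge 0$ there are sizes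 $$s\le C\,\frac k\epsilon,\qquad t\le C\,\frac{r\log(nkD)}{\epsilon^2},\qquad w\le C\,\frac{k^2}{\epsilon^3}\log(nD)$$ and distributions, not depending on $\mathbf A$, of independent random matrices $\mathbf S\in\mathbb R^{s\times n}$, $\mathbf T\in\mathbb R^{d\times t}$, $\mathbf W\in\mathbb R^{w\times nd}$, for which: for every $\mathbf A\in\mathbb R^{n\times d}$, with probability at least $1-\delta$, a fixed recovery program, given only the parameters, $\mathbf S,\mathbf T,\mathbf W$ and the sketches $\mathbf S\mathbf A$, $\mathbf A\mathbf T$, $\mathbf W\operatorname{vec}(\mathbf A)$, halts with a $(1+\epsilon)$-approximate solution to the discrete $r$-sparse dictionary problem for $\mathbf A$. (2) There is a randomized one-pass algorithm for turnstile streams ($\mathbf A$ starts at $0$ and receives updates $\mathbf A_{i,j}\gets\mathbf A_{i,j}+\Delta$ with $\Delta\in\mathbb R$) such that, whenever $n,d>(Ck/\epsilon)^C$, for every stream it outputs, with probability at least $1-\delta$, a $(1+\epsilon)$-approximate solution to the discrete $r$-sparse dictionary problem for the final matrix $\mathbf A$. On every stream and for every outcome of its random bits it uses space at most $$C\left(\frac{nr}{\epsilon^2}+\frac{dk}{\epsilon}\right)\left(1+\log\frac{ndkD}{\epsilon}\right)^{C}=\tilde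 O\!\left(\frac{nr}{\epsilon^2}+\frac{dk}{\epsilon}\right),$$ counting the random bits, the sketches, the working memory and the output (with $\tilde{\mathbf X}$ in sparse form), with integer words of absolute value at most $(ndkD/\epsilon)^{C}$. The time spent before the stream, on each single update, and after the stream is in each case at most $$k^r\cdot (nD)^{C\frac{k^2}{\epsilon}\left(1+\log\frac k\epsilon\right)^{C}}\cdot d^{\,C}=k^r\cdot(nD)^{\tilde O(k^2/\epsilon)}\cdot\operatorname{poly}(d).$$ -/

import Mathlib

open scoped Matrix

/-! ### The discrete sparse dictionary problem -/

namespace SparseDict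

/-- The feasible left factors: `n × k` matrices with at most `r` non-zero entries in each row and
all entries in `{-D, …, D} ⊆ ℤ`. -/
def feasible (n k r D : ℕ) : Set (Matrix (Fin n) (Fin k) ℝ) :=
  {X | ∀ i, {j | X i j ≠ 0}.ncard ≤ r ∧ ∀ j, ∃ z : ℤ, |z| ≤ (D : ℤ) ∧ X i j = (z : ℝ)}

section
attribute [local instance] Matrix.frobeniusNormedAddCommGroup

/-- The objective `‖X Y - A‖_F` (Frobenius norm) of the left factor `X` and the dictionary `Y`. -/
noncomputable def objective {n d k : ℕ} (A : Matrix (Fin n) (Fin d) ℝ)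
    (X : Matrix (Fin n) (Fin k) ℝ) (Y : Matrix (Fin k) (Fin d) ℝ) : ℝ :=
  ‖X * Y - A‖

end

/-- `(X, Y)` is a `(1 + ε)`-approximate solution of the discrete `r`-sparse dictionary problem. -/
def IsApproxSolution {n d k : ℕ} (r D : ℕ) (ε : ℝ) (A : Matrix (Fin n) (Fin d) ℝ)
    (X : Matrix (Fin n) (Fin k) ℝ) (Y : Matrix (Fin k) (Fin d) ℝ) : Prop :=
  X ∈ feasible n k r D ∧
    ∀ X' ∈ feasible n k r D, ∀ Y' : Matrix (Fin k) (Fin d) ℝ,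
      objective A X Y ≤ (1 + ε) * objective A X' Y'

/-- The flattening `vec(A) ∈ ℝ^{nd}`. -/
def flatten {n d : ℕ} (A : Matrix (Fin n) (Fin d) ℝ) : Fin (n * d) → ℝ :=
  fun c => A c.divNat c.modNat

/-- The matrix presented by a turnstile stream: it starts at `0`, and the update `(i, j, Δ)` adds
`Δ` to the entry `(i, j)`. -/
def streamMatrix {n d : ℕ} (us : List (Fin n × Fin d × ℝ)) : Matrix (Fin n) (Fin d) ℝ :=
  us.foldl (fun A u => A + Matrix.single u.1 u.2.1 u.2.2) 0

end SparseDict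

/-! ### A real RAM with bounded integer words

Programs are structured programs over finitely many arrays. An integer array has cells that hold
machine words, i.e. integers of absolute value at most `B`; a real array has cells that hold one
real number each, on which only field operations and comparisons are available. Every access
outside the declared size of an array, every word overflow and every division by zero makes the
program get stuck. A scalar variable is an array used at index `0` only. -/

namespace RealRAM

/-- The contents of the memory: `int a i` and `real a i` are the contents of the `i`-th cell of the
`a`-th integer array and of the `a`-th real array. -/
structure Mem where
  int : ℕ → ℕ → ℤ
  real : ℕ → ℕ → ℝ

/-- The declared sizes of the integer arrays and of the real arrays. An array that is not listed
has size `0`, so none of its cells can be accessed. -/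
structure Layout where
  ints : List ℕ
  reals : List ℕ

/-- The space in words: the total number of integer cells and real cells. -/
def Layout.space (L : Layout) : ℕ := L.ints.sum + L.reals.sum

/-- Integer expressions. -/
inductive IExpr where
  | const (c : ℤ)
  | get (a : ℕ) (i : IExpr)
  | add (e f : IExpr)
  | sub (e f : IExpr)
  | mul (e f : IExpr)
  | div (e f : IExpr)
  | mod (e f : IExpr)

/-- Real expressions. -/
inductive RExpr where
  | ofInt (e : IExpr)
  | get (a : ℕ) (i : IExpr)
  | add (e f : RExpr)
  | sub (e f : RExpr)
  | mul (e f : RExpr)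
  | div (e f : RExpr)

/-- Tests. -/
inductive BExpr where
  | ilt (e f : IExpr)
  | rlt (e f : RExpr)
  | not (b : BExpr)
  | and (b c : BExpr)

/-- Programs: `iset a i e` is the assignment `a[i] := e` to a cell of an integer array, and `rset`
is the same for a real array. -/
inductive Cmd where
  | skip
  | iset (a : ℕ) (i : IExpr) (e : IExpr)
  | rset (a : ℕ) (i : IExpr) (e : RExpr)
  | seq (p q : Cmd)
  | ite (b : BExpr) (p q : Cmd)
  | loop (b : BExpr) (p : Cmd)

/-- An integer as a machine word; overflow fails. -/
def word (B : ℕ) (v : ℤ) : Option ℤ := if |v| ≤ (B : ℤ) then some v else none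

/-- An integer as an index into an array of size `m`; an access out of bounds fails. -/
def index (m : ℕ) (v : ℤ) : Option ℕ := if 0 ≤ v ∧ v < (m : ℤ) then some v.toNat else none

/-- The value of an integer expression, `none` if the evaluation fails. -/
def IExpr.eval (L : Layout) (B : ℕ) (σ : Mem) : IExpr → Option ℤ
  | .const c => word B c
  | .get a i => (i.eval L B σ).bind fun v =>
      (index (L.ints.getD a 0) v).bind fun c => word B (σ.int a c)
  | .add e f => (e.eval L B σ).bind fun x => (f.eval L B σ).bind fun y => word B (x + y)
  | .sub e f => (e.eval L B σ).bind fun x => (f.eval L B σ).bind fun y => word B (x - y)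
  | .mul e f => (e.eval L B σ).bind fun x => (f.eval L B σ).bind fun y => word B (x * y)
  | .div e f => (e.eval L B σ).bind fun x => (f.eval L B σ).bind fun y =>
      if y = 0 then none else word B (x / y)
  | .mod e f => (e.eval L B σ).bind fun x => (f.eval L B σ).bind fun y =>
      if y = 0 then none else word B (x % y)

open Classical in
/-- The value of a real expression, `none` if the evaluation fails. -/
noncomputable def RExpr.eval (L : Layout) (B : ℕ) (σ : Mem) : RExpr → Option ℝ
  | .ofInt e => (e.eval L B σ).map fun v => (v : ℝ)
  | .get a i => (i.eval L B σ).bind fun v =>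
      (index (L.reals.getD a 0) v).map fun c => σ.real a c
  | .add e f => (e.eval L B σ).bind fun x => (f.eval L B σ).map fun y => x + y
  | .sub e f => (e.eval L B σ).bind fun x => (f.eval L B σ).map fun y => x - y
  | .mul e f => (e.eval L B σ).bind fun x => (f.eval L B σ).map fun y => x * y
  | .div e f => (e.eval L B σ).bind fun x => (f.eval L B σ).bind fun y =>
      if y = 0 then none else some (x / y)

open Classical in
/-- The value of a test, `none` if the evaluation fails. -/
noncomputable def BExpr.eval (L : Layout) (B : ℕ) (σ : Mem) : BExpr → Option Bool
  | .ilt e f => (e.eval L B σ).bind fun x => (f.eval L B σ).map fun y => decide (x < y)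
  | .rlt e f => (e.eval L B σ).bind fun x => (f.eval L B σ).map fun y => decide (x < y)
  | .not b => (b.eval L B σ).map fun x => !x
  | .and b c => (b.eval L B σ).bind fun x => (c.eval L B σ).map fun y => x && y

/-- Write an integer cell. -/
def Mem.setInt (σ : Mem) (a c : ℕ) (v : ℤ) : Mem :=
  { σ with int := Function.update σ.int a (Function.update (σ.int a) c v) }

/-- Write a real cell. -/
def Mem.setReal (σ : Mem) (a c : ℕ) (v : ℝ) : Mem :=
  { σ with real := Function.update σ.real a (Function.update (σ.real a) c v) }

/-- `Exec L B p σ T τ`: with array sizes `L` and words bounded by `B`, the program `p` started in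
memory `σ` halts in memory `τ` after `T` steps. Each assignment and each evaluation of a test is
one step (the expressions in a fixed program have constant size). -/
inductive Exec (L : Layout) (B : ℕ) : Cmd → Mem → ℕ → Mem → Prop where
  | skip (σ : Mem) : Exec L B .skip σ 1 σ
  | iset {a : ℕ} {i e : IExpr} {σ : Mem} {x v : ℤ} {c : ℕ}
      (hi : i.eval L B σ = some x) (hc : index (L.ints.getD a 0) x = some c)
      (he : e.eval L B σ = some v) :
      Exec L B (.iset a i e) σ 1 (σ.setInt a c v)
  | rset {a : ℕ} {i : IExpr} {e : RExpr} {σ : Mem} {x : ℤ} {v : ℝ} {c : ℕ}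
      (hi : i.eval L B σ = some x) (hc : index (L.reals.getD a 0) x = some c)
      (he : e.eval L B σ = some v) :
      Exec L B (.rset a i e) σ 1 (σ.setReal a c v)
  | seq {p q : Cmd} {σ σ' τ : Mem} {T T' : ℕ}
      (hp : Exec L B p σ T σ') (hq : Exec L B q σ' T' τ) :
      Exec L B (.seq p q) σ (T + T') τ
  | iteTrue {b : BExpr} {p q : Cmd} {σ τ : Mem} {T : ℕ}
      (hb : b.eval L B σ = some true) (hp : Exec L B p σ T τ) :
      Exec L B (.ite b p q) σ (T + 1) τ
  | iteFalse {b : BExpr} {p q : Cmd} {σ τ : Mem} {T : ℕ}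
      (hb : b.eval L B σ = some false) (hq : Exec L B q σ T τ) :
      Exec L B (.ite b p q) σ (T + 1) τ
  | loopDone {b : BExpr} {p : Cmd} {σ : Mem}
      (hb : b.eval L B σ = some false) :
      Exec L B (.loop b p) σ 1 σ
  | loopStep {b : BExpr} {p : Cmd} {σ σ' τ : Mem} {T T' : ℕ}
      (hb : b.eval L B σ = some true) (hp : Exec L B p σ T σ')
      (hl : Exec L B (.loop b p) σ' T' τ) :
      Exec L B (.loop b p) σ (T + T' + 1) τ

end RealRAM

/-! ### Input and output conventions

Integer arrays `0, …, 4` hold the scalars `n, d, k, r, D`, and real array `0` holds `ε`. Integer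
arrays `8` and `9` and real array `2` hold the output. -/

namespace SparseDict

open RealRAM

/-- The left factor in the memory, in sparse form: for each row `i` there are `r` pairs of a column
index (in integer array `8`) and a value (in integer array `9`). -/
def outX (n k r : ℕ) (σ : Mem) : Matrix (Fin n) (Fin k) ℝ :=
  Matrix.of fun i j => ∑ l ∈ Finset.range r,
    if σ.int 8 (i * r + l) = (j : ℤ) then (σ.int 9 (i * r + l) : ℝ) else 0

/-- The dictionary in the memory: a `k × d` matrix in row-major order in real array `2`. -/
def outY (k d : ℕ) (σ : Mem) : Matrix (Fin k) (Fin d) ℝ :=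
  Matrix.of fun a b => σ.real 2 (a * d + b)

/-- The memory holds a `(1 + ε)`-approximate solution for `A`. -/
def Solved {n d : ℕ} (k r D : ℕ) (ε : ℝ) (A : Matrix (Fin n) (Fin d) ℝ) (σ : Mem) : Prop :=
  IsApproxSolution r D ε A (outX n k r σ) (outY k d σ)

/-- The contents of a real array that holds a matrix in row-major order. -/
noncomputable def rowMajor {a b : ℕ} (M : Matrix (Fin a) (Fin b) ℝ) : ℕ → ℝ :=
  fun c => if h : c < a * b then
    M (Fin.divNat (⟨c, h⟩ : Fin (a * b))) (Fin.modNat (⟨c, h⟩ : Fin (a * b))) else 0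

/-- The contents of a real array that holds a vector. -/
noncomputable def vecCells {a : ℕ} (v : Fin a → ℝ) : ℕ → ℝ :=
  fun c => if h : c < a then v ⟨c, h⟩ else 0

/-- The input of a recovery program: the parameters (with the sketch sizes `s, t, w` in integer
arrays `5, 6, 7`), the sketching matrices `S, T, W` in real arrays `3, 4, 5`, and the three sketches
`S A`, `A T`, `W vec(A)` in real arrays `6, 7, 8`. All other cells are `0`. -/
noncomputable def recoveryInput {n d s t w : ℕ} (k r D : ℕ) (ε : ℝ)
    (S : Matrix (Fin s) (Fin n) ℝ) (T : Matrix (Fin d) (Fin t) ℝ)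
    (W : Matrix (Fin w) (Fin (n * d)) ℝ)
    (SA : Matrix (Fin s) (Fin d) ℝ) (AT : Matrix (Fin n) (Fin t) ℝ) (WA : Fin w → ℝ) : Mem where
  int a c := match a, c with
    | 0, 0 => n | 1, 0 => d | 2, 0 => k | 3, 0 => r | 4, 0 => D
    | 5, 0 => s | 6, 0 => t | 7, 0 => w
    | _, _ => 0
  real a c := match a, c with
    | 0, 0 => ε
    | 3, c => rowMajor S c
    | 4, c => rowMajor T c
    | 5, c => rowMajor W c
    | 6, c => rowMajor SA c
    | 7, c => rowMajor AT c
    | 8, c => vecCells WA c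
    | _, _ => 0

/-- The event, for the drawn matrices `(S, T, W)`, that the recovery program, given these matrices
and the sketches `S A`, `A T`, `W vec(A)` only, halts with a `(1 + ε)`-approximate solution. -/
def RecoverySucceeds {n d s t w : ℕ} (L : Layout) (B : ℕ) (p : Cmd) (k r D : ℕ) (ε : ℝ)
    (A : Matrix (Fin n) (Fin d) ℝ)
    (S : Matrix (Fin s) (Fin n) ℝ) (T : Matrix (Fin d) (Fin t) ℝ)
    (W : Matrix (Fin w) (Fin (n * d)) ℝ) : Prop :=
  ∃ (τ : Mem) (c : ℕ),
    Exec L B p (recoveryInput k r D ε S T W (S * A) (A * T) (W *ᵥ flatten A)) c τ ∧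
      Solved k r D ε A τ

/-- A streaming algorithm: a program that is run before the stream, one that is run on each update
of the stream, and one that is run after the stream, all on the same memory. -/
structure StreamAlg where
  init : Cmd
  update : Cmd
  finish : Cmd

/-- The initial memory of a streaming algorithm: the parameters, and a seed of `m` random bits in
integer array `7`, one bit in each cell. All other cells are `0`. -/
noncomputable def streamInput (n d k r D : ℕ) (ε : ℝ) {m : ℕ} (seed : Fin m → Bool) : Mem where
  int a c := match a, c with
    | 0, 0 => n | 1, 0 => d | 2, 0 => k | 3, 0 => r | 4, 0 => D
    | 7, c => if h : c < m then (if seed ⟨c, h⟩ then 1 else 0) else 0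
    | _, _ => 0
  real a c := match a, c with
    | 0, 0 => ε
    | _, _ => 0

/-- An update `(i, j, Δ)` arrives: `i`, `j`, `Δ` are put into integer arrays `5`, `6` and real
array `1`. -/
def feed {n d : ℕ} (u : Fin n × Fin d × ℝ) (σ : Mem) : Mem :=
  ((σ.setInt 5 0 (u.1 : ℕ)).setInt 6 0 (u.2.1 : ℕ)).setReal 1 0 u.2.2

/-- Processing a stream with the program `p`, in at most `T` steps for each update. -/
inductive Consumes {n d : ℕ} (L : Layout) (B : ℕ) (T : ℝ) (p : Cmd) :
    Mem → List (Fin n × Fin d × ℝ) → Mem → Prop where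
  | nil (σ : Mem) : Consumes L B T p σ [] σ
  | cons {σ σ' τ : Mem} {u : Fin n × Fin d × ℝ} {us : List (Fin n × Fin d × ℝ)} {c : ℕ}
      (hc : (c : ℝ) ≤ T) (hu : Exec L B p (feed u σ) c σ') (hs : Consumes L B T p σ' us τ) :
      Consumes L B T p σ (u :: us) τ

/-- The algorithm `P`, started with the given parameters and seed, processes the stream `us` and
ends in memory `τ`, with array sizes `L` and words bounded by `B` throughout, in at most `T` steps
before the stream, for each update, and after the stream. -/
def StreamRun {n d m : ℕ} (L : Layout) (B : ℕ) (T : ℝ) (P : StreamAlg) (k r D : ℕ) (ε : ℝ)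
    (seed : Fin m → Bool) (us : List (Fin n × Fin d × ℝ)) (τ : Mem) : Prop :=
  ∃ (σ₁ σ₂ : Mem) (c₁ c₂ : ℕ),
    Exec L B P.init (streamInput n d k r D ε seed) c₁ σ₁ ∧ (c₁ : ℝ) ≤ T ∧
    Consumes L B T P.update σ₁ us σ₂ ∧
    Exec L B P.finish σ₂ c₂ τ ∧ (c₂ : ℝ) ≤ T

end SparseDict

namespace RealRAM

/-- Array sizes, a word bound and a bound `V` on the stored integers, where `V` is so small that
no expression of size at most `24` overflows. -/
structure Machine where
  L : Layout
  B : ℕ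
  V : ℕ
  four_le : 4 ≤ V
  pow_le : V ^ 24 ≤ B
  int_pos : ∀ a < 64, 1 ≤ L.ints.getD a 0
  real_pos : ∀ a < 64, 1 ≤ L.reals.getD a 0

/-- The size of an integer array. -/
def Machine.isz (M : Machine) (a : ℕ) : ℕ := M.L.ints.getD a 0

/-- The size of a real array. -/
def Machine.rsz (M : Machine) (a : ℕ) : ℕ := M.L.reals.getD a 0

/-- The value of an integer expression if no access is out of bounds. -/
def IExpr.den (σ : Mem) : IExpr → ℤ
  | .const c => c
  | .get a i => σ.int a (i.den σ).toNat
  | .add e f => e.den σ + f.den σ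
  | .sub e f => e.den σ - f.den σ
  | .mul e f => e.den σ * f.den σ
  | .div e f => e.den σ / f.den σ
  | .mod e f => e.den σ % f.den σ

/-- The number of leaves and accesses of an expression. -/
def IExpr.size : IExpr → ℕ
  | .const _ => 1
  | .get _ i => i.size + 1
  | .add e f => e.size + f.size
  | .sub e f => e.size + f.size
  | .mul e f => e.size + f.size
  | .div e f => e.size + f.size
  | .mod e f => e.size + f.size

/-- All accesses are within bounds and there is no division by zero. -/
def IExpr.Ok (M : Machine) (σ : Mem) : IExpr → Prop
  | .const c => |c| ≤ 4 ∨ |c| ≤ M.V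
  | .get a i => i.Ok M σ ∧ 0 ≤ i.den σ ∧ i.den σ < M.isz a
  | .add e f => e.Ok M σ ∧ f.Ok M σ
  | .sub e f => e.Ok M σ ∧ f.Ok M σ
  | .mul e f => e.Ok M σ ∧ f.Ok M σ
  | .div e f => e.Ok M σ ∧ f.Ok M σ ∧ f.den σ ≠ 0
  | .mod e f => e.Ok M σ ∧ f.Ok M σ ∧ f.den σ ≠ 0

/-- All stored integers are bounded by `V`. -/
def Bdd (V : ℕ) (σ : Mem) : Prop := ∀ a c, |σ.int a c| ≤ (V : ℤ)

theorem IExpr.size_pos (e : IExpr) : 1 ≤ e.size := by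
  induction e <;> simp only [IExpr.size] <;> omega

theorem word_eq {B : ℕ} {v : ℤ} (h : |v| ≤ (B : ℤ)) : word B v = some v := by simp [word, h]

theorem index_eq {m : ℕ} {v : ℤ} (h0 : 0 ≤ v) (h : v < m) : index m v = some v.toNat := by
  simp [index, h0, h]

theorem add_le_pow_add {V x y : ℤ} {m n : ℕ} (hV : 4 ≤ V) (hm : 1 ≤ m) (hn : 1 ≤ n)
    (hx : |x| ≤ V ^ m) (hy : |y| ≤ V ^ n) : |x| + |y| ≤ V ^ (m + n) := by
  have h1 : V ≤ V ^ m := le_self_pow₀ (by omega) (by omega)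
  have h2 : V ≤ V ^ n := le_self_pow₀ (by omega) (by omega)
  rw [pow_add]
  nlinarith

theorem IExpr.den_le (M : Machine) {σ : Mem} (hσ : Bdd M.V σ) (e : IExpr) (he : e.Ok M σ) :
    |e.den σ| ≤ (M.V : ℤ) ^ e.size := by
  have hV : (4 : ℤ) ≤ M.V := by exact_mod_cast M.four_le
  have key : ∀ e f : IExpr, |e.den σ| ≤ (M.V : ℤ) ^ e.size → |f.den σ| ≤ (M.V : ℤ) ^ f.size →
      |e.den σ| + |f.den σ| ≤ (M.V : ℤ) ^ (e.size + f.size) := fun e f h1 h2 =>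
    add_le_pow_add hV e.size_pos f.size_pos h1 h2
  induction e with
  | const c => simp only [IExpr.den, IExpr.size, IExpr.Ok, pow_one] at *; omega
  | get a i ih =>
    simp only [IExpr.den, IExpr.size]
    exact (hσ _ _).trans (le_self_pow₀ (by omega) (by omega))
  | add e f ihe ihf => exact (abs_add_le _ _).trans (key e f (ihe he.1) (ihf he.2))
  | sub e f ihe ihf => exact (abs_sub _ _).trans (key e f (ihe he.1) (ihf he.2))
  | mul e f ihe ihf =>
    simp only [IExpr.den, IExpr.size, abs_mul, pow_add]
    exact mul_le_mul (ihe he.1) (ihf he.2) (abs_nonneg _) (by positivity)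
  | div e f ihe ihf =>
    refine le_trans ?_ (key e f (ihe he.1) (ihf he.2.1))
    have := Int.abs_ediv_le_abs (e.den σ) (f.den σ)
    have := abs_nonneg (f.den σ)
    simp only [IExpr.den]; omega
  | mod e f ihe ihf =>
    refine le_trans ?_ (key e f (ihe he.1) (ihf he.2.1))
    have h1 := Int.emod_nonneg (e.den σ) he.2.2
    have h2 := Int.emod_lt_abs (e.den σ) he.2.2
    have := abs_nonneg (e.den σ)
    simp only [IExpr.den]; rw [abs_of_nonneg h1]; omega

theorem IExpr.eval_eq (M : Machine) {σ : Mem} (hσ : Bdd M.V σ) (e : IExpr) (he : e.Ok M σ)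
    (hs : e.size ≤ 24) : e.eval M.L M.B σ = some (e.den σ) := by
  have hw : ∀ e : IExpr, e.Ok M σ → e.size ≤ 24 → word M.B (e.den σ) = some (e.den σ) := by
    intro e he hs
    refine word_eq ((e.den_le M hσ he).trans ?_)
    have hV := M.four_le
    exact_mod_cast (Nat.pow_le_pow_right (by omega) hs).trans M.pow_le
  induction e with
  | const c => exact hw _ he hs
  | get a i ih =>
    have h1 := ih he.1 (by simp only [IExpr.size] at hs; omega)
    have h2 := index_eq he.2.1 he.2.2
    rw [Machine.isz] at h2
    simp only [IExpr.eval, h1, Option.bind_some, h2]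
    exact hw (.get a i) he hs
  | add e f ihe ihf =>
    have h := hw _ he hs
    simp only [IExpr.size, IExpr.Ok] at he hs
    have := e.size_pos; have := f.size_pos
    simp only [IExpr.eval, ihe he.1 (by omega), ihf he.2 (by omega), Option.bind_some]
    exact h
  | sub e f ihe ihf =>
    have h := hw _ he hs
    simp only [IExpr.size, IExpr.Ok] at he hs
    have := e.size_pos; have := f.size_pos
    simp only [IExpr.eval, ihe he.1 (by omega), ihf he.2 (by omega), Option.bind_some]
    exact h
  | mul e f ihe ihf =>
    have h := hw _ he hs
    simp only [IExpr.size, IExpr.Ok] at he hs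
    have := e.size_pos; have := f.size_pos
    simp only [IExpr.eval, ihe he.1 (by omega), ihf he.2 (by omega), Option.bind_some]
    exact h
  | div e f ihe ihf =>
    have h := hw _ he hs
    simp only [IExpr.size, IExpr.Ok] at he hs
    have := e.size_pos; have := f.size_pos
    simp only [IExpr.eval, ihe he.1 (by omega), ihf he.2.1 (by omega), Option.bind_some, he.2.2,
      if_false]
    exact h
  | mod e f ihe ihf =>
    have h := hw _ he hs
    simp only [IExpr.size, IExpr.Ok] at he hs
    have := e.size_pos; have := f.size_pos
    simp only [IExpr.eval, ihe he.1 (by omega), ihf he.2.1 (by omega), Option.bind_some, he.2.2,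
      if_false]
    exact h

/-- The value of a real expression if no access is out of bounds. -/
noncomputable def RExpr.den (σ : Mem) : RExpr → ℝ
  | .ofInt e => (e.den σ : ℝ)
  | .get a i => σ.real a (i.den σ).toNat
  | .add e f => e.den σ + f.den σ
  | .sub e f => e.den σ - f.den σ
  | .mul e f => e.den σ * f.den σ
  | .div e f => e.den σ / f.den σ

/-- All accesses are within bounds and there is no division by zero. -/
def RExpr.Ok (M : Machine) (σ : Mem) : RExpr → Prop
  | .ofInt e => e.Ok M σ ∧ e.size ≤ 24
  | .get a i => (i.Ok M σ ∧ i.size ≤ 24) ∧ 0 ≤ i.den σ ∧ i.den σ < M.rsz a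
  | .add e f => e.Ok M σ ∧ f.Ok M σ
  | .sub e f => e.Ok M σ ∧ f.Ok M σ
  | .mul e f => e.Ok M σ ∧ f.Ok M σ
  | .div e f => e.Ok M σ ∧ f.Ok M σ ∧ f.den σ ≠ 0

theorem RExpr.eval_eq (M : Machine) {σ : Mem} (hσ : Bdd M.V σ) (e : RExpr) (he : e.Ok M σ) :
    e.eval M.L M.B σ = some (e.den σ) := by
  induction e with
  | ofInt e => simp [RExpr.eval, RExpr.den, e.eval_eq M hσ he.1 he.2]
  | get a i =>
    have h2 := index_eq he.2.1 he.2.2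
    rw [Machine.rsz] at h2
    simp only [RExpr.eval, RExpr.den, i.eval_eq M hσ he.1.1 he.1.2, Option.bind_some, h2,
      Option.map_some]
  | add e f ihe ihf => simp [RExpr.eval, RExpr.den, ihe he.1, ihf he.2]
  | sub e f ihe ihf => simp [RExpr.eval, RExpr.den, ihe he.1, ihf he.2]
  | mul e f ihe ihf => simp [RExpr.eval, RExpr.den, ihe he.1, ihf he.2]
  | div e f ihe ihf => simp [RExpr.eval, RExpr.den, ihe he.1, ihf he.2.1, he.2.2]

/-- The meaning of a test. -/
def BExpr.den (σ : Mem) : BExpr → Prop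
  | .ilt e f => e.den σ < f.den σ
  | .rlt e f => e.den σ < f.den σ
  | .not b => ¬ b.den σ
  | .and b c => b.den σ ∧ c.den σ

/-- All accesses are within bounds and there is no division by zero. -/
def BExpr.Ok (M : Machine) (σ : Mem) : BExpr → Prop
  | .ilt e f => (e.Ok M σ ∧ e.size ≤ 24) ∧ f.Ok M σ ∧ f.size ≤ 24
  | .rlt e f => e.Ok M σ ∧ f.Ok M σ
  | .not b => b.Ok M σ
  | .and b c => b.Ok M σ ∧ c.Ok M σ

open Classical in
theorem BExpr.eval_eq (M : Machine) {σ : Mem} (hσ : Bdd M.V σ) (b : BExpr) (hb : b.Ok M σ) :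
    b.eval M.L M.B σ = some (decide (b.den σ)) := by
  induction b with
  | ilt e f =>
    simp only [BExpr.eval, BExpr.den, e.eval_eq M hσ hb.1.1 hb.1.2, f.eval_eq M hσ hb.2.1 hb.2.2,
      Option.bind_some, Option.map_some]
    congr
  | rlt e f =>
    simp only [BExpr.eval, BExpr.den, e.eval_eq M hσ hb.1, f.eval_eq M hσ hb.2, Option.bind_some,
      Option.map_some]
    congr
  | not b ih =>
    simp only [BExpr.eval, BExpr.den, ih hb, Option.map_some]
    by_cases h : b.den σ <;> simp [h]
  | and b c ihb ihc =>
    simp only [BExpr.eval, BExpr.den, ihb hb.1, ihc hb.2, Option.bind_some, Option.map_some]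
    by_cases h : b.den σ <;> by_cases h' : c.den σ <;> simp [h, h']

theorem BExpr.eval_true (M : Machine) {σ : Mem} (hσ : Bdd M.V σ) {b : BExpr} (hb : b.Ok M σ)
    (h : b.den σ) : b.eval M.L M.B σ = some true := by
  simp [b.eval_eq M hσ hb, h]

theorem BExpr.eval_false (M : Machine) {σ : Mem} (hσ : Bdd M.V σ) {b : BExpr} (hb : b.Ok M σ)
    (h : ¬ b.den σ) : b.eval M.L M.B σ = some false := by
  simp [b.eval_eq M hσ hb, h]

/-- The scalar variable in an integer array. -/
def iv (a : ℕ) : IExpr := .get a (.const 0)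

/-- The scalar variable in a real array. -/
def rv (a : ℕ) : RExpr := .get a (.const 0)

/-- The index `i * w + j`. -/
def ix2 (i w j : IExpr) : IExpr := .add (.mul i w) j

@[simp] theorem den_iv (σ : Mem) (a : ℕ) : (iv a).den σ = σ.int a 0 := by simp [iv, IExpr.den]

@[simp] theorem size_iv (a : ℕ) : (iv a).size = 2 := rfl

@[simp] theorem den_rv (σ : Mem) (a : ℕ) : (rv a).den σ = σ.real a 0 := by
  simp [rv, RExpr.den, IExpr.den]

@[simp] theorem ok_iv (M : Machine) (σ : Mem) {a : ℕ} (ha : a < 64) : (iv a).Ok M σ := by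
  have := M.int_pos a ha
  exact ⟨by simp [IExpr.Ok], le_rfl, Int.natCast_pos.2 this⟩

@[simp] theorem ok_rv (M : Machine) (σ : Mem) {a : ℕ} (ha : a < 64) : (rv a).Ok M σ := by
  have := M.real_pos a ha
  exact ⟨⟨by simp [IExpr.Ok], by simp [IExpr.size]⟩, le_rfl, Int.natCast_pos.2 this⟩

@[simp] theorem size_ix2 (i w j : IExpr) : (ix2 i w j).size = i.size + w.size + j.size := rfl

@[simp] theorem ok_ix2 (M : Machine) (σ : Mem) (i w j : IExpr) :
    (ix2 i w j).Ok M σ ↔ (i.Ok M σ ∧ w.Ok M σ) ∧ j.Ok M σ := Iff.rfl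

@[simp] theorem setInt_real (σ : Mem) (a c : ℕ) (v : ℤ) : (σ.setInt a c v).real = σ.real := rfl

@[simp] theorem setReal_int (σ : Mem) (a c : ℕ) (v : ℝ) : (σ.setReal a c v).int = σ.int := rfl

@[simp] theorem setInt_int_self (σ : Mem) (a c : ℕ) (v : ℤ) : (σ.setInt a c v).int a c = v := by
  simp [Mem.setInt]

@[simp] theorem setReal_real_self (σ : Mem) (a c : ℕ) (v : ℝ) :
    (σ.setReal a c v).real a c = v := by
  simp [Mem.setReal]

@[simp] theorem setInt_int_ne (σ : Mem) {a a' : ℕ} (c : ℕ) (v : ℤ) (h : a' ≠ a) :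
    (σ.setInt a c v).int a' = σ.int a' := by
  simp [Mem.setInt, Function.update_of_ne h]

@[simp] theorem setReal_real_ne (σ : Mem) {a a' : ℕ} (c : ℕ) (v : ℝ) (h : a' ≠ a) :
    (σ.setReal a c v).real a' = σ.real a' := by
  simp [Mem.setReal, Function.update_of_ne h]

theorem setInt_int_cell_ne (σ : Mem) (a : ℕ) {c c' : ℕ} (v : ℤ) (h : c' ≠ c) :
    (σ.setInt a c v).int a c' = σ.int a c' := by
  simp [Mem.setInt, Function.update_of_ne h]

theorem setReal_real_cell_ne (σ : Mem) (a : ℕ) {c c' : ℕ} (v : ℝ) (h : c' ≠ c) :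
    (σ.setReal a c v).real a c' = σ.real a c' := by
  simp [Mem.setReal, Function.update_of_ne h]

/-- Only the listed arrays differ. -/
structure Mods (I R : List ℕ) (σ τ : Mem) : Prop where
  int : ∀ a, a ∉ I → τ.int a = σ.int a
  real : ∀ a, a ∉ R → τ.real a = σ.real a

theorem Mods.refl (I R : List ℕ) (σ : Mem) : Mods I R σ σ := ⟨fun _ _ => rfl, fun _ _ => rfl⟩

theorem Mods.trans {I R : List ℕ} {σ τ υ : Mem} (h : Mods I R σ τ) (h' : Mods I R τ υ) :
    Mods I R σ υ :=
  ⟨fun a ha => (h'.int a ha).trans (h.int a ha), fun a ha => (h'.real a ha).trans (h.real a ha)⟩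

theorem Mods.mono {I R I' R' : List ℕ} {σ τ : Mem} (h : Mods I R σ τ) (hI : I ⊆ I') (hR : R ⊆ R') :
    Mods I' R' σ τ :=
  ⟨fun a ha => h.int a fun h => ha (hI h), fun a ha => h.real a fun h => ha (hR h)⟩

theorem Mods.setInt {I R : List ℕ} {σ τ : Mem} (h : Mods I R σ τ) {a : ℕ} (ha : a ∈ I) (c : ℕ)
    (v : ℤ) : Mods I R σ (τ.setInt a c v) :=
  ⟨fun b hb => by
    have hne : b ≠ a := by rintro rfl; exact hb ha
    rw [setInt_int_ne _ _ _ hne, h.int b hb], fun b hb => h.real b hb⟩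

theorem Mods.setReal {I R : List ℕ} {σ τ : Mem} (h : Mods I R σ τ) {a : ℕ} (ha : a ∈ R) (c : ℕ)
    (v : ℝ) : Mods I R σ (τ.setReal a c v) :=
  ⟨fun b hb => h.int b hb, fun b hb => by
    have hne : b ≠ a := by rintro rfl; exact hb ha
    rw [setReal_real_ne _ _ _ hne, h.real b hb]⟩

theorem Bdd.setInt {V : ℕ} {σ : Mem} (h : Bdd V σ) (a c : ℕ) {v : ℤ} (hv : |v| ≤ V) :
    Bdd V (σ.setInt a c v) := by
  intro a' c'
  by_cases ha : a' = a
  · subst ha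
    by_cases hc : c' = c
    · subst hc; simpa using hv
    · rw [setInt_int_cell_ne _ _ _ hc]; exact h _ _
  · rw [setInt_int_ne _ _ _ ha]; exact h _ _

/-- From `σ`, the program `p` halts within `K * V ^ e` steps, changes only the listed arrays, keeps
the stored integers bounded and establishes `Q`. -/
def Machine.Runs (M : Machine) (K : ℕ) (I R : List ℕ) (p : Cmd) (σ : Mem) (e : ℕ)
    (Q : Mem → Prop) : Prop :=
  Bdd M.V σ → ∃ c τ, Exec M.L M.B p σ c τ ∧ c ≤ K * M.V ^ e ∧ Bdd M.V τ ∧ Mods I R σ τ ∧ Q τ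

namespace Machine

variable {M : Machine} {K : ℕ} {I R : List ℕ} {σ : Mem} {Q : Mem → Prop}

theorem pow_add_pow_le (M : Machine) {a b e : ℕ} (ha : a < e) (hb : b < e) :
    M.V ^ a + M.V ^ b ≤ M.V ^ e := by
  have hV := M.four_le
  have h1 : M.V ^ a ≤ M.V ^ (e - 1) := Nat.pow_le_pow_right (by omega) (by omega)
  have h2 : M.V ^ b ≤ M.V ^ (e - 1) := Nat.pow_le_pow_right (by omega) (by omega)
  have h3 : M.V ^ e = M.V ^ (e - 1) * M.V := by rw [← pow_succ]; congr 1; omega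
  rw [h3]
  have := Nat.mul_le_mul_left (M.V ^ (e - 1)) hV
  omega

theorem one_le_pow (M : Machine) (e : ℕ) : 1 ≤ M.V ^ e :=
  Nat.one_le_pow _ _ (by have := M.four_le; omega)

theorem Runs.mono {I' R' : List ℕ} {p : Cmd} {e e' K' : ℕ} {Q' : Mem → Prop}
    (h : M.Runs K I R p σ e Q) (hK : K ≤ K') (hI : I ⊆ I') (hR : R ⊆ R') (he : e ≤ e')
    (hQ : ∀ τ, Bdd M.V τ → Mods I R σ τ → Q τ → Q' τ) : M.Runs K' I' R' p σ e' Q' := by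
  intro hσ
  obtain ⟨c, τ, h1, h2, h3, h4, h5⟩ := h hσ
  have hV := M.four_le
  exact ⟨c, τ, h1, h2.trans (Nat.mul_le_mul hK (Nat.pow_le_pow_right (by omega) he)), h3,
    h4.mono hI hR, hQ τ h3 h4 h5⟩

theorem Runs.imp {p : Cmd} {e : ℕ} {Q' : Mem → Prop} (h : M.Runs K I R p σ e Q)
    (hQ : ∀ τ, Mods I R σ τ → Q τ → Q' τ) : M.Runs K I R p σ e Q' :=
  h.mono le_rfl (List.Subset.refl _) (List.Subset.refl _) le_rfl fun τ _ => hQ τ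

theorem Runs.skip (hK : 0 < K) {e : ℕ} (hQ : Q σ) : M.Runs K I R .skip σ e Q := fun hσ =>
  ⟨1, σ, .skip σ, Nat.mul_pos hK (M.one_le_pow e), hσ, Mods.refl _ _ _, hQ⟩

theorem Runs.seq {p q : Cmd} {e e₁ e₂ : ℕ} {I₁ R₁ I₂ R₂ : List ℕ} {Q₁ : Mem → Prop}
    (hp : M.Runs K I₁ R₁ p σ e₁ Q₁)
    (hq : ∀ τ, Bdd M.V τ → Mods I₁ R₁ σ τ → Q₁ τ → M.Runs K I₂ R₂ q τ e₂ Q)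
    (hI₁ : I₁ ⊆ I := by simp) (hR₁ : R₁ ⊆ R := by simp)
    (hI₂ : I₂ ⊆ I := by simp) (hR₂ : R₂ ⊆ R := by simp)
    (h₁ : e₁ < e := by norm_num) (h₂ : e₂ < e := by norm_num) :
    M.Runs K I R (.seq p q) σ e Q := by
  intro hσ
  obtain ⟨c, τ, a1, a2, a3, a4, a5⟩ := hp hσ
  obtain ⟨c', υ, b1, b2, b3, b4, b5⟩ := hq τ a3 a4 a5 a3
  refine ⟨c + c', υ, .seq a1 b1, ?_, b3, (a4.mono hI₁ hR₁).trans (b4.mono hI₂ hR₂), b5⟩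
  have := Nat.mul_le_mul_left K (M.pow_add_pow_le h₁ h₂)
  rw [mul_add] at this; omega

theorem Runs.iset (hK : 0 < K) {a : ℕ} {i f : IExpr} {e : ℕ} (hi : i.Ok M σ) (his : i.size ≤ 24)
    (h0 : 0 ≤ i.den σ) (hr : i.den σ < M.isz a) (hf : f.Ok M σ) (hfs : f.size ≤ 24)
    (hv : |f.den σ| ≤ M.V) (ha : a ∈ I) (hQ : Q (σ.setInt a (i.den σ).toNat (f.den σ))) :
    M.Runs K I R (.iset a i f) σ e Q := fun hσ =>
  ⟨1, _, .iset (i.eval_eq M hσ hi his) (index_eq h0 hr) (f.eval_eq M hσ hf hfs),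
    Nat.mul_pos hK (M.one_le_pow e), hσ.setInt _ _ hv, (Mods.refl _ _ _).setInt ha _ _, hQ⟩

theorem Runs.rset (hK : 0 < K) {a : ℕ} {i : IExpr} {f : RExpr} {e : ℕ} (hi : i.Ok M σ)
    (his : i.size ≤ 24) (h0 : 0 ≤ i.den σ) (hr : i.den σ < M.rsz a) (hf : f.Ok M σ)
    (ha : a ∈ R) (hQ : Q (σ.setReal a (i.den σ).toNat (f.den σ))) :
    M.Runs K I R (.rset a i f) σ e Q := fun hσ =>
  ⟨1, _, .rset (i.eval_eq M hσ hi his) (index_eq h0 hr) (f.eval_eq M hσ hf),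
    Nat.mul_pos hK (M.one_le_pow e), hσ, (Mods.refl _ _ _).setReal ha _ _, hQ⟩

/-- Assignment to an integer scalar. -/
theorem Runs.iset_scalar (hK : 0 < K) {a : ℕ} {f : IExpr} {e : ℕ} (ha : a < 64) (hf : f.Ok M σ)
    (hfs : f.size ≤ 24) (hv : |f.den σ| ≤ M.V) (haI : a ∈ I) (hQ : Q (σ.setInt a 0 (f.den σ))) :
    M.Runs K I R (.iset a (.const 0) f) σ e Q := by
  have := M.int_pos a ha
  exact Runs.iset hK (by simp [IExpr.Ok]) (by simp [IExpr.size]) (by simp [IExpr.den])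
    (by simp only [IExpr.den, isz]; omega) hf hfs hv haI (by simpa [IExpr.den] using hQ)

/-- Assignment to a real scalar. -/
theorem Runs.rset_scalar (hK : 0 < K) {a : ℕ} {f : RExpr} {e : ℕ} (ha : a < 64) (hf : f.Ok M σ)
    (haR : a ∈ R) (hQ : Q (σ.setReal a 0 (f.den σ))) :
    M.Runs K I R (.rset a (.const 0) f) σ e Q := by
  have := M.real_pos a ha
  exact Runs.rset hK (by simp [IExpr.Ok]) (by simp [IExpr.size]) (by simp [IExpr.den])
    (by simp only [IExpr.den, rsz]; omega) hf haR (by simpa [IExpr.den] using hQ)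

theorem Runs.ite {b : BExpr} {p q : Cmd} {e e₁ : ℕ} (hK : 0 < K) (hb : b.Ok M σ)
    (hp : b.den σ → M.Runs K I R p σ e₁ Q) (hq : ¬ b.den σ → M.Runs K I R q σ e₁ Q)
    (he : e₁ < e := by norm_num) : M.Runs K I R (.ite b p q) σ e Q := by
  intro hσ
  have hc : K * M.V ^ e₁ + 1 ≤ K * M.V ^ e := by
    have := Nat.mul_le_mul_left K (M.pow_add_pow_le (a := e₁) (b := 0) he (by omega))
    rw [mul_add] at this; simp at this; omega
  by_cases h : b.den σ
  · obtain ⟨c, τ, h1, h2, h3, h4, h5⟩ := hp h hσ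
    exact ⟨c + 1, τ, .iteTrue (b.eval_true M hσ hb h) h1, by omega, h3, h4, h5⟩
  · obtain ⟨c, τ, h1, h2, h3, h4, h5⟩ := hq h hσ
    exact ⟨c + 1, τ, .iteFalse (b.eval_false M hσ hb h) h1, by omega, h3, h4, h5⟩

/-- A loop that is executed exactly `N` times, within `N * (K * V ^ e₁ + 1) + 1` steps. -/
theorem exec_loop {b : BExpr} {p : Cmd} {N e₁ : ℕ} {J : ℕ → Mem → Prop}
    (hb : ∀ i τ, i ≤ N → Mods I R σ τ → J i τ → b.Ok M τ ∧ (b.den τ ↔ i < N))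
    (hp : ∀ i τ, i < N → Mods I R σ τ → J i τ → M.Runs K I R p τ e₁ (J (i + 1)))
    (hJ : J 0 σ) (hσ : Bdd M.V σ) :
    ∃ c τ, Exec M.L M.B (.loop b p) σ c τ ∧ c ≤ N * (K * M.V ^ e₁ + 1) + 1 ∧ Bdd M.V τ ∧
      Mods I R σ τ ∧ J N τ := by
  have key : ∀ m i τ, i + m = N → Mods I R σ τ → J i τ → Bdd M.V τ →
      ∃ c υ, Exec M.L M.B (.loop b p) τ c υ ∧ c ≤ m * (K * M.V ^ e₁ + 1) + 1 ∧ Bdd M.V υ ∧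
        Mods I R σ υ ∧ J N υ := by
    intro m
    induction m with
    | zero =>
      intro i τ hi hm hJ hτ
      obtain ⟨h1, h2⟩ := hb i τ (by omega) hm hJ
      refine ⟨1, τ, .loopDone (b.eval_false M hτ h1 ?_), by simp, hτ, hm, ?_⟩
      · rw [h2]; omega
      · have : i = N := by omega
        exact this ▸ hJ
    | succ m ih =>
      intro i τ hi hm hJ hτ
      obtain ⟨h1, h2⟩ := hb i τ (by omega) hm hJ
      obtain ⟨c, υ, a1, a2, a3, a4, a5⟩ := hp i τ (by omega) hm hJ hτ
      obtain ⟨c', ω, b1, b2, b3, b4, b5⟩ := ih (i + 1) υ (by omega) (hm.trans a4) a5 a3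
      refine ⟨c + c' + 1, ω, .loopStep (b.eval_true M hτ h1 (h2.2 (by omega))) a1 b1, ?_, b3, b4,
        b5⟩
      rw [Nat.succ_mul]; omega
  exact key N 0 σ (by omega) (Mods.refl _ _ _) hJ hσ

theorem Runs.loop (hK : 0 < K) {b : BExpr} {p : Cmd} {N e e₁ : ℕ} {J : ℕ → Mem → Prop}
    (hb : ∀ i τ, i ≤ N → Mods I R σ τ → J i τ → b.Ok M τ ∧ (b.den τ ↔ i < N))
    (hp : ∀ i τ, i < N → Mods I R σ τ → J i τ → M.Runs K I R p τ e₁ (J (i + 1)))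
    (hJ : J 0 σ) (hN : N ≤ M.V) (he : e₁ + 2 ≤ e := by norm_num) :
    M.Runs K I R (.loop b p) σ e (J N) := by
  intro hσ
  obtain ⟨c, τ, h1, h2, h3⟩ := exec_loop hb hp hJ hσ
  refine ⟨c, τ, h1, h2.trans ?_, h3⟩
  have hV := M.four_le
  have hx : 1 ≤ K * M.V ^ e₁ := Nat.mul_pos hK (M.one_le_pow e₁)
  have h5 : K * M.V ^ (e₁ + 2) = (K * M.V ^ e₁) * (M.V * M.V) := by ring
  have h6 : K * M.V ^ (e₁ + 2) ≤ K * M.V ^ e :=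
    Nat.mul_le_mul_left _ (Nat.pow_le_pow_right (by omega) he)
  have h4 : N * (K * M.V ^ e₁ + 1) ≤ M.V * (K * M.V ^ e₁ + 1) := Nat.mul_le_mul_right _ hN
  generalize K * M.V ^ e₁ = X at *
  have : M.V * (X + 1) + 1 ≤ X * (M.V * M.V) := by nlinarith
  omega

/-- A loop with an arbitrary number of iterations. -/
theorem Runs.loop_mul (hK : 0 < K) {b : BExpr} {p : Cmd} {N e e₁ : ℕ} {J : ℕ → Mem → Prop}
    (hb : ∀ i τ, i ≤ N → Mods I R σ τ → J i τ → b.Ok M τ ∧ (b.den τ ↔ i < N))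
    (hp : ∀ i τ, i < N → Mods I R σ τ → J i τ → M.Runs K I R p τ e₁ (J (i + 1)))
    (hJ : J 0 σ) (hN : 0 < N) (he : e₁ + 1 ≤ e := by norm_num) :
    M.Runs (N * K) I R (.loop b p) σ e (J N) := by
  intro hσ
  obtain ⟨c, τ, h1, h2, h3⟩ := exec_loop hb hp hJ hσ
  refine ⟨c, τ, h1, h2.trans ?_, h3⟩
  have hV := M.four_le
  have hx : 1 ≤ K * M.V ^ e₁ := Nat.mul_pos hK (M.one_le_pow e₁)
  have h5 : N * K * M.V ^ (e₁ + 1) = N * (K * M.V ^ e₁) * M.V := by ring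
  have h6 : N * K * M.V ^ (e₁ + 1) ≤ N * K * M.V ^ e :=
    Nat.mul_le_mul_left _ (Nat.pow_le_pow_right (by omega) he)
  generalize K * M.V ^ e₁ = X at *
  have h7 : N ≤ N * X := Nat.le_mul_of_pos_right _ hx
  have : N * (X + 1) + 1 ≤ N * X * M.V := by rw [mul_add]; nlinarith
  omega

end Machine

/-- `for x < n do p`. -/
def Cmd.forN (x : ℕ) (n : IExpr) (p : Cmd) : Cmd :=
  .seq (.iset x (.const 0) (.const 0))
    (.loop (.ilt (iv x) n) (.seq p (.iset x (.const 0) (.add (iv x) (.const 1)))))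

namespace Machine

variable {M : Machine} {K : ℕ} {I R : List ℕ} {σ : Mem} {Q : Mem → Prop}

/-- The rule for `for` loops: `J i` is the invariant after `i` iterations. -/
theorem Runs.forN (hK : 0 < K) {x : ℕ} {n : IExpr} {p : Cmd} {e e₁ : ℕ} {I' : List ℕ} (N : ℕ)
    (J : ℕ → Mem → Prop) (hN : N ≤ M.V) (hn : ∀ τ, Mods I R σ τ → n.Ok M τ ∧ n.den τ = N)
    (hJ : ∀ i τ v, J i τ → J i (τ.setInt x 0 v)) (h0 : J 0 σ)
    (hp : ∀ i τ, i < N → Bdd M.V τ → Mods I R σ τ → τ.int x 0 = i → J i τ →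
      M.Runs K I' R p τ e₁ (J (i + 1)))
    (he : e₁ + 4 ≤ e := by norm_num) (hns : n.size ≤ 24 := by decide)
    (hx : x < 64 := by norm_num) (hxI : x ∈ I := by simp) (hxI' : x ∉ I' := by simp)
    (hI' : I' ⊆ I := by simp) : M.Runs K I R (Cmd.forN x n p) σ e (J N) := by
  have hV := M.four_le
  refine Runs.seq (I₁ := I) (R₁ := R) (I₂ := I) (R₂ := R) (e₁ := 0) (e₂ := e₁ + 3)
    (Q₁ := fun τ => Mods I R σ τ ∧ τ.int x 0 = 0 ∧ J 0 τ)
    (Runs.iset_scalar hK hx (by simp [IExpr.Ok]) (by simp [IExpr.size]) (by simp [IExpr.den]) hxI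
      ⟨(Mods.refl _ _ _).setInt hxI _ _, by simp [IExpr.den], hJ _ _ _ h0⟩) ?_
    (List.Subset.refl _) (List.Subset.refl _) (List.Subset.refl _) (List.Subset.refl _)
    (by omega) (by omega)
  rintro τ - - ⟨hm, hx0, hJ0⟩
  refine (Runs.loop (N := N) (e₁ := e₁ + 1) hK
    (J := fun i υ => υ.int x 0 = i ∧ J i υ) ?_ ?_ ⟨by simpa using hx0, hJ0⟩ hN).imp
      fun υ _ h => h.2
  · rintro i υ hi hmu ⟨h1, h2⟩
    obtain ⟨h3, h4⟩ := hn υ (hm.trans hmu)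
    refine ⟨⟨⟨ok_iv _ _ hx, by simp⟩, h3, hns⟩, ?_⟩
    simp only [BExpr.den, den_iv, h1, h4, Nat.cast_lt]
  · rintro i υ hi hmu ⟨h1, h2⟩
    intro hbu
    refine Runs.seq (Q₁ := J (i + 1)) (I₁ := I') (R₁ := R) (I₂ := I) (R₂ := R) (e₁ := e₁) (e₂ := 0)
      (hp i υ hi hbu (hm.trans hmu) h1 h2) ?_ hI' (List.Subset.refl _) (List.Subset.refl _)
      (List.Subset.refl _) (by omega) (by omega) hbu
    intro ω hω hmw hJw
    have hxw : ω.int x 0 = i := by rw [hmw.int x hxI', h1]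
    refine Runs.iset_scalar hK hx ?_ (by simp [IExpr.size]) ?_ hxI ⟨?_, hJ _ _ _ hJw⟩
    · exact ⟨ok_iv _ _ hx, by simp [IExpr.Ok]⟩
    · simp only [IExpr.den, den_iv, hxw]; rw [abs_of_nonneg (by omega)]; omega
    · simp [IExpr.den, hxw]

end Machine

end RealRAM

namespace RealRAM

/-- `acc := init; for x < n do (pre; acc := acc + t)`. -/
def Cmd.sumN (x : ℕ) (n : IExpr) (acc : ℕ) (init : RExpr) (pre : Cmd) (t : RExpr) : Cmd :=
  .seq (.rset acc (.const 0) init)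
    (Cmd.forN x n (.seq pre (.rset acc (.const 0) (.add (rv acc) t))))

/-- `for x < n do (pre; a[idx] := t)` for a real array `a`. -/
def Cmd.fillReal (x : ℕ) (n : IExpr) (a : ℕ) (idx : IExpr) (pre : Cmd) (t : RExpr) : Cmd :=
  Cmd.forN x n (.seq pre (.rset a idx t))

/-- `for x < n do (pre; a[idx] := t)` for an integer array `a`. -/
def Cmd.fillInt (x : ℕ) (n : IExpr) (a : ℕ) (idx : IExpr) (pre : Cmd) (t : IExpr) : Cmd :=
  Cmd.forN x n (.seq pre (.iset a idx t))

/-- Add `1` to the numeral with base `β` and `len` digits in the array `a`. -/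
def Cmd.inc (a x carry : ℕ) (len β : IExpr) : Cmd :=
  .seq (.iset carry (.const 0) (.const 1))
    (Cmd.forN x len (.ite (.ilt (.const 0) (iv carry))
      (.ite (.ilt (.add (.get a (iv x)) (.const 1)) β)
        (.seq (.iset a (iv x) (.add (.get a (iv x)) (.const 1)))
          (.iset carry (.const 0) (.const 0)))
        (.iset a (iv x) (.const 0)))
      .skip))

/-- Run `p` for each numeral with base `β` and `len` digits, which is put into the array `a`. -/
def Cmd.search (a x carry : ℕ) (len β : IExpr) (p : Cmd) : Cmd :=
  .seq (Cmd.fillInt x len a (iv x) .skip (.const 0))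
    (.seq (.iset carry (.const 0) (.const 0))
      (.loop (.ilt (iv carry) (.const 1)) (.seq p (Cmd.inc a x carry len β))))

namespace Machine

variable {M : Machine} {K : ℕ} {I R : List ℕ} {σ : Mem} {Q : Mem → Prop}

theorem Runs.sumN (hK : 0 < K) {x acc : ℕ} {n : IExpr} {init t : RExpr} {pre : Cmd} {N : ℕ}
    {e e₁ : ℕ} {I' R' : List ℕ} (f : Fin N → ℝ) (hN : N ≤ M.V)
    (hn : ∀ τ, Mods I R σ τ → n.Ok M τ ∧ n.den τ = N) (hinit : init.Ok M σ)
    (hp : ∀ (i : Fin N) τ, Bdd M.V τ → Mods I R σ τ → τ.int x 0 = (i : ℕ) →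
      M.Runs K I' R' pre τ e₁ fun υ => t.Ok M υ ∧ t.den υ = f i)
    (he : e₁ + 6 ≤ e := by norm_num) (hns : n.size ≤ 24 := by decide)
    (hx : x < 64 := by norm_num) (hxI : x ∈ I := by simp) (hxI' : x ∉ I' := by simp)
    (hI' : I' ⊆ I := by simp) (hacc : acc < 64 := by norm_num) (haccR : acc ∈ R := by simp)
    (haccR' : acc ∉ R' := by simp) (hR' : R' ⊆ R := by simp) :
    M.Runs K I R (Cmd.sumN x n acc init pre t) σ e
      fun τ => τ.real acc 0 = init.den σ + ∑ i, f i := by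
  refine Runs.seq (I₁ := I) (R₁ := R) (I₂ := I) (R₂ := R) (e₁ := 0) (e₂ := e₁ + 5)
    (Q₁ := fun τ => τ.real acc 0 = init.den σ)
    (Runs.rset_scalar hK hacc hinit haccR (by simp)) ?_
    (List.Subset.refl _) (List.Subset.refl _) (List.Subset.refl _) (List.Subset.refl _)
    (by omega) (by omega)
  intro τ hτ hm h0
  refine (Runs.forN hK N (e₁ := e₁ + 1) (I' := I') (fun i υ => υ.real acc 0 = init.den σ +
    ∑ j ∈ Finset.range i, if h : j < N then f ⟨j, h⟩ else 0) hN
    (fun υ hu => hn υ (hm.trans hu)) (by simp) (by simpa using h0) ?_ (by omega) hns hx hxI hxI'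
    hI').imp ?_
  · intro i υ hi hb hu hxu hJ
    refine Runs.seq (I₁ := I') (R₁ := R') (I₂ := []) (R₂ := [acc]) (e₁ := e₁) (e₂ := 0)
      (hp ⟨i, hi⟩ υ hb (hm.trans hu) hxu) ?_ (List.Subset.refl _) hR' (by simp)
      (by simpa using haccR) (by omega) (by omega)
    rintro ω hω hmw ⟨h1, h2⟩
    refine Runs.rset_scalar hK hacc ⟨ok_rv _ _ hacc, h1⟩ (by simp) ?_
    simp only [setReal_real_self, RExpr.den, den_rv, h2, hmw.real acc haccR', hJ,
      Finset.sum_range_succ, hi, dite_true]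
    ring
  · intro υ _ h
    rw [h, Finset.sum_range]
    simp

theorem Runs.fillReal (hK : 0 < K) {x a : ℕ} {n idx : IExpr} {t : RExpr} {pre : Cmd} {N : ℕ}
    {e e₁ : ℕ} {I' R' : List ℕ} (O : ℕ) (f : Fin N → ℝ) (hON : O + N ≤ M.rsz a) (hN : N ≤ M.V)
    (hn : ∀ τ, Mods I R σ τ → n.Ok M τ ∧ n.den τ = N)
    (hp : ∀ (i : Fin N) τ, Bdd M.V τ → Mods I R σ τ → τ.int x 0 = (i : ℕ) →
      (∀ c, O + i ≤ c → τ.real a c = σ.real a c) →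
      M.Runs K I' R' pre τ e₁ fun υ => (idx.Ok M υ ∧ idx.den υ = (O + i : ℕ)) ∧
        t.Ok M υ ∧ t.den υ = f i)
    (he : e₁ + 5 ≤ e := by norm_num) (hns : n.size ≤ 24 := by decide)
    (hidx : idx.size ≤ 24 := by decide)
    (hx : x < 64 := by norm_num) (hxI : x ∈ I := by simp) (hxI' : x ∉ I' := by simp)
    (hI' : I' ⊆ I := by simp) (haR : a ∈ R := by simp) (haR' : a ∉ R' := by simp)
    (hR' : R' ⊆ R := by simp) :
    M.Runs K I R (Cmd.fillReal x n a idx pre t) σ e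
      fun τ => (∀ i : Fin N, τ.real a (O + i) = f i) ∧
        ∀ c, c < O ∨ O + N ≤ c → τ.real a c = σ.real a c := by
  refine (Runs.forN hK N (e₁ := e₁ + 1) (I' := I') (fun i υ =>
    (∀ j : Fin N, (j : ℕ) < i → υ.real a (O + j) = f j) ∧
      ∀ c, c < O ∨ O + i ≤ c → υ.real a c = σ.real a c) hN hn (by simp)
    (by simp) ?_ (by omega) hns hx hxI hxI' hI').imp ?_
  · rintro i υ hi hb hu hxu ⟨hJ, hJ'⟩
    refine Runs.seq (I₁ := I') (R₁ := R') (I₂ := []) (R₂ := [a]) (e₁ := e₁) (e₂ := 0)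
      (hp ⟨i, hi⟩ υ hb hu hxu fun c hc => hJ' c (Or.inr hc)) ?_ (List.Subset.refl _) hR' (by simp)
      (by simpa using haR) (by omega) (by omega)
    rintro ω hω hmw ⟨⟨h1, h2⟩, h3, h4⟩
    refine Runs.rset hK h1 hidx (by rw [h2]; omega) (by rw [h2]; push_cast; omega) h3 (by simp) ?_
    rw [h2, Int.toNat_natCast, h4]
    constructor
    · intro j hj
      by_cases hji : (j : ℕ) = i
      · have : j = ⟨i, hi⟩ := Fin.ext hji
        subst this; simp
      · rw [setReal_real_cell_ne _ _ _ (show O + (j : ℕ) ≠ O + i by omega), hmw.real a haR']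
        exact hJ j (by omega)
    · intro c hc
      rw [setReal_real_cell_ne _ _ _ (by rcases hc with h | h <;> simp <;> omega),
        hmw.real a haR']
      exact hJ' c (by omega)
  · rintro υ _ ⟨h, h'⟩
    exact ⟨fun i => h i i.2, h'⟩

theorem Runs.fillInt (hK : 0 < K) {x a : ℕ} {n idx t : IExpr} {pre : Cmd} {N : ℕ}
    {e e₁ : ℕ} {I' R' : List ℕ} (O : ℕ) (f : Fin N → ℤ) (hON : O + N ≤ M.isz a) (hN : N ≤ M.V)
    (hn : ∀ τ, Mods I R σ τ → n.Ok M τ ∧ n.den τ = N)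
    (hp : ∀ (i : Fin N) τ, Bdd M.V τ → Mods I R σ τ → τ.int x 0 = (i : ℕ) →
      (∀ c, O + i ≤ c → τ.int a c = σ.int a c) →
      M.Runs K I' R' pre τ e₁ fun υ => (idx.Ok M υ ∧ idx.den υ = (O + i : ℕ)) ∧
        t.Ok M υ ∧ t.den υ = f i ∧ |f i| ≤ M.V)
    (he : e₁ + 5 ≤ e := by norm_num) (hns : n.size ≤ 24 := by decide)
    (hidx : idx.size ≤ 24 := by decide) (ht : t.size ≤ 24 := by decide)
    (hx : x < 64 := by norm_num) (hxI : x ∈ I := by simp) (hxI' : x ∉ I' := by simp)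
    (hI' : I' ⊆ I := by simp) (haI : a ∈ I := by simp) (haI' : a ∉ I' := by simp)
    (hax : a ≠ x := by simp) (hR' : R' ⊆ R := by simp) :
    M.Runs K I R (Cmd.fillInt x n a idx pre t) σ e
      fun τ => (∀ i : Fin N, τ.int a (O + i) = f i) ∧
        ∀ c, c < O ∨ O + N ≤ c → τ.int a c = σ.int a c := by
  refine (Runs.forN hK N (e₁ := e₁ + 1) (I' := a :: I') (fun i υ =>
    (∀ j : Fin N, (j : ℕ) < i → υ.int a (O + j) = f j) ∧
      ∀ c, c < O ∨ O + i ≤ c → υ.int a c = σ.int a c) hN hn (by simp [hax]) (by simp) ?_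
    (by omega) hns hx hxI (by simp [hax.symm, hxI']) (by simpa using ⟨haI, hI'⟩)).imp ?_
  · rintro i υ hi hb hu hxu ⟨hJ, hJ'⟩
    refine Runs.seq (I₁ := I') (R₁ := R') (I₂ := [a]) (R₂ := []) (e₁ := e₁) (e₂ := 0)
      (hp ⟨i, hi⟩ υ hb hu hxu fun c hc => hJ' c (Or.inr hc)) ?_ (by simp) hR' (by simp)
      (by simp) (by omega) (by omega)
    rintro ω hω hmw ⟨⟨h1, h2⟩, h3, h4, h5⟩
    refine Runs.iset hK h1 hidx (by rw [h2]; omega) (by rw [h2]; push_cast; omega) h3 ht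
      (h4 ▸ h5) (by simp) ?_
    rw [h2, Int.toNat_natCast, h4]
    constructor
    · intro j hj
      by_cases hji : (j : ℕ) = i
      · have : j = ⟨i, hi⟩ := Fin.ext hji
        subst this; simp
      · rw [setInt_int_cell_ne _ _ _ (show O + (j : ℕ) ≠ O + i by omega), hmw.int a haI']
        exact hJ j (by omega)
    · intro c hc
      rw [setInt_int_cell_ne _ _ _ (by rcases hc with h | h <;> simp <;> omega),
        hmw.int a haI']
      exact hJ' c (by omega)
  · rintro υ _ ⟨h, h'⟩
    exact ⟨fun i => h i i.2, h'⟩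

end Machine

theorem succ_div_of_dvd {β N : ℕ} (h : β ∣ N + 1) : (N + 1) / β = N / β + 1 := by
  rw [Nat.succ_div, if_pos h]

/-- The array `a` holds the digits of `N` with base `β`. -/
def Digits (β len N : ℕ) (f : ℕ → ℤ) : Prop := ∀ l < len, f l = (N / β ^ l % β : ℕ)

namespace Machine

variable {M : Machine} {K : ℕ} {I R : List ℕ} {σ : Mem} {Q : Mem → Prop}

theorem Runs.inc (hK : 0 < K) {a x carry : ℕ} {len β : IExpr} {b N n : ℕ} {e : ℕ}
    (hx : x < 64) (hc : carry < 64) (hax : a ≠ x) (hac : a ≠ carry) (hxc : x ≠ carry)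
    (hn : n ≤ M.V) (hna : n ≤ M.isz a) (hb : 1 ≤ b) (hbV : b ≤ M.V)
    (hlen : len.size ≤ 24) (hβ : β.size ≤ 24)
    (hlen' : ∀ τ, Mods [a, x, carry] [] σ τ → len.Ok M τ ∧ len.den τ = n)
    (hβ' : ∀ τ, Mods [a, x, carry] [] σ τ → β.Ok M τ ∧ β.den τ = b)
    (hd : Digits b n N (σ.int a)) (he : 8 ≤ e := by norm_num) :
    M.Runs K [a, x, carry] [] (Cmd.inc a x carry len β) σ e fun τ =>
      Digits b n (N + 1) (τ.int a) ∧ τ.int carry 0 = if b ^ n ∣ N + 1 then 1 else 0 := by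
  have hV := M.four_le
  refine Runs.seq (I₁ := [carry]) (R₁ := []) (I₂ := [a, x, carry]) (R₂ := []) (e₁ := 0) (e₂ := 7)
    (Q₁ := fun τ => τ.int carry 0 = 1)
    (Runs.iset_scalar hK hc (by simp [IExpr.Ok]) (by simp [IExpr.size])
      (by simp [IExpr.den]; omega) (by simp) (by simp [IExpr.den])) ?_ (by simp) (by simp) (by simp) (by simp)
      (by omega) (by omega)
  intro τ hτ hm h1
  have hm' : Mods [a, x, carry] [] σ τ := hm.mono (by simp) (by simp)
  refine (Runs.forN hK n (e₁ := 3) (I' := [a, carry]) (fun i υ =>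
    (∀ l < n, υ.int a l = if l < i then (((N + 1) / b ^ l % b : ℕ) : ℤ) else (N / b ^ l % b : ℕ)) ∧
      υ.int carry 0 = if b ^ i ∣ N + 1 then 1 else 0) hn
    (fun υ hu => hlen' υ (hm'.trans hu)) (by simp [hax, hxc.symm])
    ⟨fun l hl => by rw [hm.int a (by simpa using hac), hd l hl]; simp, by simp [h1]⟩ ?_
    (by norm_num) hlen hx (by simp) (by simp [hax.symm, hxc]) (by simp)).imp ?_
  · rintro i υ hi hbu hu hxu ⟨hJ, hJc⟩
    obtain ⟨hβ1, hβ2⟩ := hβ' υ (hm'.trans hu)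
    have hget : (IExpr.get a (iv x)).Ok M υ := ⟨ok_iv _ _ hx, by simp [hxu], by simp [hxu]; omega⟩
    have hval : υ.int a i = (N / b ^ i % b : ℕ) := by rw [hJ i hi, if_neg (lt_irrefl i)]
    have hden : (IExpr.get a (iv x)).den υ = (N / b ^ i % b : ℕ) := by
      simp only [IExpr.den, den_iv, hxu, Int.toNat_natCast, hval]
    have hmodlt : N / b ^ i % b < b := Nat.mod_lt _ hb
    have hpow : 0 < b ^ i := Nat.pow_pos hb
    refine Runs.ite (e₁ := 2) hK ⟨⟨by simp [IExpr.Ok], by simp [IExpr.size]⟩, ok_iv _ _ hc, by simp⟩ ?_ ?_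
    · intro hcar
      have hdvd : b ^ i ∣ N + 1 := by
        by_contra h
        simp [BExpr.den, IExpr.den, hJc, h] at hcar
      have hdiv : (N + 1) / b ^ i = N / b ^ i + 1 := succ_div_of_dvd hdvd
      have hnext : b ^ (i + 1) ∣ N + 1 ↔ N / b ^ i % b + 1 = b := by
        obtain ⟨c, hcc⟩ := hdvd
        have e1 : N / b ^ i + 1 = c := by rw [← hdiv, hcc, Nat.mul_div_cancel_left _ hpow]
        rw [hcc, pow_succ, Nat.mul_dvd_mul_iff_left hpow, ← e1, Nat.dvd_iff_mod_eq_zero]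
        rcases Nat.lt_or_ge 1 b with hb1 | hb1
        · rw [Nat.add_mod, Nat.mod_eq_of_lt hb1]
          rcases Nat.lt_or_ge (N / b ^ i % b + 1) b with h | h
          · rw [Nat.mod_eq_of_lt h]; omega
          · have : N / b ^ i % b + 1 = b := by omega
            simp [this]
        · have : b = 1 := by omega
          subst this; simp [Nat.mod_one]
      refine Runs.ite (e₁ := 1) hK ⟨⟨⟨hget, by simp [IExpr.Ok]⟩, by simp [IExpr.size]⟩, hβ1, hβ⟩ ?_ ?_
      · intro hlt
        replace hlt : N / b ^ i % b + 1 < b := by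
          simp only [BExpr.den] at hlt
          rw [hβ2, IExpr.den, hden] at hlt
          simp only [IExpr.den] at hlt
          exact_mod_cast hlt
        refine Runs.seq (I₁ := [a]) (R₁ := []) (I₂ := [carry]) (R₂ := []) (e₁ := 0) (e₂ := 0)
          (Q₁ := fun ω => ∀ l < n, ω.int a l = if l < i + 1 then (((N + 1) / b ^ l % b : ℕ) : ℤ)
            else (N / b ^ l % b : ℕ))
          (Runs.iset hK (ok_iv _ _ hx) (by simp) (by simp [hxu]) (by simp [hxu]; omega)
            ⟨hget, by simp [IExpr.Ok]⟩ (by simp [IExpr.size]) ?_ (by simp) ?_) ?_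
        · rw [IExpr.den, hden, abs_of_nonneg (by simp only [IExpr.den]; omega)]
          simp only [IExpr.den]; omega
        · intro l hl
          rw [IExpr.den, hden, den_iv, hxu, Int.toNat_natCast]
          by_cases hli : l = i
          · subst hli
            rw [setInt_int_self, if_pos (by omega), hdiv, Nat.add_mod, Nat.mod_eq_of_lt (a := 1) (by omega),
              Nat.mod_eq_of_lt hlt]
            simp [IExpr.den]
          · rw [setInt_int_cell_ne _ _ _ hli, hJ l hl]
            simp only [show l < i + 1 ↔ l < i by omega]
        · intro ω hω hmw hq
          refine Runs.iset_scalar hK hc (by simp [IExpr.Ok]) (by simp [IExpr.size])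
            (by simp [IExpr.den]) (by simp) ⟨?_, ?_⟩
          · simpa [hac] using hq
          · rw [setInt_int_self, if_neg (by rw [hnext]; omega)]; rfl
      · intro hlt
        replace hlt : N / b ^ i % b + 1 = b := by
          simp only [BExpr.den] at hlt
          rw [hβ2, IExpr.den, hden] at hlt
          simp only [IExpr.den] at hlt
          omega
        refine Runs.iset hK (ok_iv _ _ hx) (by simp) (by simp [hxu]) (by simp [hxu]; omega)
            (by simp [IExpr.Ok]) (by simp [IExpr.size]) (by simp [IExpr.den]) (by simp) ⟨?_, ?_⟩
        · intro l hl
          rw [den_iv, hxu, Int.toNat_natCast]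
          by_cases hli : l = i
          · subst hli
            have h0 : (N + 1) / b ^ l % b = 0 := by
              rw [hdiv, ← Nat.dvd_iff_mod_eq_zero]
              have := hnext.2 hlt
              rw [pow_succ] at this
              rw [← hdiv]
              exact (Nat.dvd_div_iff_mul_dvd hdvd).2 this
            rw [setInt_int_self, if_pos (by omega), h0]; rfl
          · rw [setInt_int_cell_ne _ _ _ hli, hJ l hl]
            simp only [show l < i + 1 ↔ l < i by omega]
        · rw [setInt_int_ne _ _ _ hac.symm, hJc, if_pos hdvd, if_pos (hnext.2 hlt)]
    · intro hcar
      have hdvd : ¬ b ^ i ∣ N + 1 := by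
        intro h
        simp [BExpr.den, IExpr.den, hJc, h] at hcar
      refine Runs.skip hK ⟨?_, ?_⟩
      · intro l hl
        rw [hJ l hl]
        by_cases hli : l = i
        · subst hli
          rw [if_neg (lt_irrefl _), if_pos (by omega), Nat.succ_div, if_neg hdvd, add_zero]
        · simp only [show l < i + 1 ↔ l < i by omega]
      · rw [hJc, if_neg hdvd, if_neg fun h => hdvd ((pow_dvd_pow b (Nat.le_succ i)).trans h)]
  · rintro υ _ ⟨h, h'⟩
    exact ⟨fun l hl => by rw [h l hl, if_pos hl], h'⟩

theorem Runs.search (hK : 0 < K) {a x carry : ℕ} {len β : IExpr} {p : Cmd} {b n : ℕ} {e e₁ : ℕ}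
    {I' R' : List ℕ} (J : ℕ → Mem → Prop) (hn : n ≤ M.V) (hna : n ≤ M.isz a) (hb : 1 ≤ b)
    (hbV : b ≤ M.V) (hlen' : ∀ τ, Mods I R σ τ → len.Ok M τ ∧ len.den τ = n)
    (hβ' : ∀ τ, Mods I R σ τ → β.Ok M τ ∧ β.den τ = b)
    (hJ : ∀ N τ υ, Mods [a, x, carry] [] τ υ → J N τ → J N υ) (h0 : J 0 σ)
    (hp : ∀ N τ, N < b ^ n → Bdd M.V τ → Mods I R σ τ → Digits b n N (τ.int a) → J N τ →
      M.Runs K I' R' p τ e₁ (J (N + 1)))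
    (he₁ : 8 ≤ e₁ := by norm_num) (he : e₁ + 4 ≤ e := by norm_num)
    (hx : x < 64 := by norm_num) (hc : carry < 64 := by norm_num)
    (hax : a ≠ x := by simp) (hac : a ≠ carry := by simp) (hxc : x ≠ carry := by simp)
    (haI' : a ∉ I' := by simp) (hlen : len.size ≤ 24 := by decide)
    (hβ : β.size ≤ 24 := by decide) (hI : [a, x, carry] ⊆ I := by simp)
    (hI' : I' ⊆ I := by simp) (hR' : R' ⊆ R := by simp) :
    M.Runs (b ^ n * K) I R (Cmd.search a x carry len β p) σ e (J (b ^ n)) := by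
  have hV := M.four_le
  have hpow : 0 < b ^ n := Nat.pow_pos hb
  have hK' : 0 < b ^ n * K := Nat.mul_pos hpow hK
  simp only [List.cons_subset, List.nil_subset, and_true] at hI
  have hsub : [a, x, carry] ⊆ I := by simp [hI]
  have hsub2 : [a, x] ⊆ I := by simp [hI]
  refine Runs.seq (I₁ := [a, x]) (R₁ := []) (I₂ := I) (R₂ := R) (e₁ := 5) (e₂ := e₁ + 3)
    (Runs.fillInt hK' (N := n) (I := [a, x]) (R := []) (I' := []) (R' := []) (e₁ := 0) 0
      (fun _ => 0) (by omega) hn (fun τ hτ => hlen' τ (hτ.mono hsub2 (by simp)))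
      (fun i τ _ _ hxi _ => Runs.skip hK' ⟨⟨ok_iv _ _ hx, by simp [hxi]⟩,
        by simp [IExpr.Ok], by simp [IExpr.den], by simp⟩) (by norm_num) hlen (by simp)
        (by simp [IExpr.size]) hx (by simp) (by simp) (by simp) (by simp) (by simp) hax)
      ?_ hsub2 (by simp)
        (List.Subset.refl _) (List.Subset.refl _) (by omega) (by omega)
  rintro τ hτ hm ⟨hz, -⟩
  refine Runs.seq (I₁ := [carry]) (R₁ := []) (I₂ := I) (R₂ := R) (e₁ := 0) (e₂ := e₁ + 2)
    (Q₁ := fun τ => τ.int carry 0 = 0)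
    (Runs.iset_scalar hK' hc (by simp [IExpr.Ok]) (by simp [IExpr.size])
      (by simp [IExpr.den]) (by simp) (by simp [IExpr.den])) ?_ (by simp [hI]) (by simp)
      (List.Subset.refl _) (List.Subset.refl _) (by omega) (by omega)
  intro υ hυ hm2 hcu
  have hm3 : Mods [a, x, carry] [] σ υ :=
    (hm.mono (by simp) (by simp)).trans (hm2.mono (by simp) (by simp))
  have hm4 : Mods I R σ υ := hm3.mono hsub (by simp)
  refine (Runs.loop_mul (e₁ := e₁ + 1) hK (J := fun N ω => Digits b n N (ω.int a) ∧
    ω.int carry 0 = (if N < b ^ n then 0 else 1) ∧ J N ω) ?_ ?_ ⟨?_, ?_, ?_⟩ hpow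
      (by omega)).imp fun ω _ h => h.2.2
  · rintro N ω hN hmw ⟨-, h2, -⟩
    refine ⟨⟨⟨ok_iv _ _ hc, by simp⟩, by simp [IExpr.Ok], by simp [IExpr.size]⟩, ?_⟩
    simp only [BExpr.den, den_iv, h2, IExpr.den]
    split_ifs with h <;> simp [h]
  · rintro N ω hN hmw ⟨h1, h2, h3⟩
    intro hbw
    refine Runs.seq (Q₁ := J (N + 1)) (I₁ := I') (R₁ := R') (I₂ := [a, x, carry]) (R₂ := [])
      (e₁ := e₁) (e₂ := 8) (hp N ω hN hbw (hm4.trans hmw) h1 h3) ?_ hI' hR' hsub (by simp)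
      (by omega) (by omega) hbw
    intro ω' hw' hmw' hJ'
    have hmm : Mods I R σ ω' := (hm4.trans hmw).trans (hmw'.mono hI' hR')
    refine (Runs.inc hK (N := N) hx hc hax hac hxc hn hna hb hbV hlen hβ
      (fun τ hτ => hlen' τ (hmm.trans (hτ.mono hsub (by simp))))
      (fun τ hτ => hβ' τ (hmm.trans (hτ.mono hsub (by simp)))) ?_).imp ?_
    · rw [hmw'.int a haI']; exact h1
    · rintro ω'' hmw'' ⟨h4, h5⟩
      refine ⟨h4, ?_, hJ _ _ _ hmw'' hJ'⟩
      rw [h5]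
      by_cases hlt : N + 1 < b ^ n
      · rw [if_neg fun h => absurd (Nat.le_of_dvd (by omega) h) (by omega), if_pos hlt]
      · have : N + 1 = b ^ n := by omega
        rw [if_pos (by rw [this]), if_neg hlt]
  · intro l hl
    have := hz ⟨l, hl⟩
    simp only [zero_add] at this
    rw [hm2.int a (by simpa using hac), this]; simp
  · rw [hcu, if_pos hpow]
  · exact hJ _ _ _ hm3 h0

end Machine

end RealRAM

namespace RealRAM

/-- The expression can be evaluated and has the value `v`. -/
def IVal (M : Machine) (σ : Mem) (e : IExpr) (v : ℤ) : Prop := e.Ok M σ ∧ e.den σ = v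

/-- The expression can be evaluated and has the value `v`. -/
def RVal (M : Machine) (σ : Mem) (e : RExpr) (v : ℝ) : Prop := e.Ok M σ ∧ e.den σ = v

variable {M : Machine} {σ : Mem}

namespace IVal

theorem const {c : ℤ} (hc : |c| ≤ 4) : IVal M σ (.const c) c := ⟨Or.inl hc, rfl⟩

theorem nat {c : ℕ} (hc : c ≤ M.V) : IVal M σ (.const c) (c : ℤ) :=
  ⟨Or.inr (by rw [Nat.abs_cast]; exact_mod_cast hc), rfl⟩

theorem zero : IVal M σ (.const 0) ((0 : ℕ) : ℤ) := ⟨by simp [IExpr.Ok], rfl⟩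

theorem one : IVal M σ (.const 1) ((1 : ℕ) : ℤ) := ⟨by simp [IExpr.Ok], rfl⟩

theorem scalar {a : ℕ} {v : ℤ} (h : σ.int a 0 = v) (ha : a < 64 := by norm_num) :
    IVal M σ (iv a) v := ⟨ok_iv _ _ ha, by simpa using h⟩

theorem get {a c : ℕ} {e : IExpr} (he : IVal M σ e (c : ℕ)) (hc : c < M.isz a) :
    IVal M σ (.get a e) (σ.int a c) :=
  ⟨⟨he.1, by rw [he.2]; omega, by rw [he.2]; exact_mod_cast hc⟩, by simp [IExpr.den, he.2]⟩

theorem add {e f : IExpr} {x y : ℤ} (he : IVal M σ e x) (hf : IVal M σ f y) :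
    IVal M σ (.add e f) (x + y) := ⟨⟨he.1, hf.1⟩, by simp [IExpr.den, he.2, hf.2]⟩

theorem sub {e f : IExpr} {x y : ℤ} (he : IVal M σ e x) (hf : IVal M σ f y) :
    IVal M σ (.sub e f) (x - y) := ⟨⟨he.1, hf.1⟩, by simp [IExpr.den, he.2, hf.2]⟩

theorem mul {e f : IExpr} {x y : ℤ} (he : IVal M σ e x) (hf : IVal M σ f y) :
    IVal M σ (.mul e f) (x * y) := ⟨⟨he.1, hf.1⟩, by simp [IExpr.den, he.2, hf.2]⟩

theorem natAdd {e f : IExpr} {x y : ℕ} (he : IVal M σ e x) (hf : IVal M σ f y) :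
    IVal M σ (.add e f) ((x + y : ℕ) : ℤ) := by push_cast; exact he.add hf

theorem natMul {e f : IExpr} {x y : ℕ} (he : IVal M σ e x) (hf : IVal M σ f y) :
    IVal M σ (.mul e f) ((x * y : ℕ) : ℤ) := by push_cast; exact he.mul hf

theorem natDiv {e f : IExpr} {x y : ℕ} (he : IVal M σ e x) (hf : IVal M σ f y) (hy : 0 < y) :
    IVal M σ (.div e f) ((x / y : ℕ) : ℤ) :=
  ⟨⟨he.1, hf.1, by rw [hf.2]; omega⟩, by simp [IExpr.den, he.2, hf.2]⟩

theorem natMod {e f : IExpr} {x y : ℕ} (he : IVal M σ e x) (hf : IVal M σ f y) (hy : 0 < y) :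
    IVal M σ (.mod e f) ((x % y : ℕ) : ℤ) :=
  ⟨⟨he.1, hf.1, by rw [hf.2]; omega⟩, by simp [IExpr.den, he.2, hf.2]⟩

theorem ix2 {i w j : IExpr} {a b c : ℕ} (hi : IVal M σ i a) (hw : IVal M σ w b)
    (hj : IVal M σ j c) : IVal M σ (ix2 i w j) ((a * b + c : ℕ) : ℤ) := (hi.natMul hw).natAdd hj

theorem congr {e : IExpr} {x y : ℤ} (he : IVal M σ e x) (h : x = y) : IVal M σ e y := h ▸ he

end IVal

namespace RVal

theorem ofInt {e : IExpr} {v : ℤ} (he : IVal M σ e v) (hs : e.size ≤ 24 := by decide) :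
    RVal M σ (.ofInt e) (v : ℝ) := ⟨⟨he.1, hs⟩, by simp [RExpr.den, he.2]⟩

theorem scalar {a : ℕ} {v : ℝ} (h : σ.real a 0 = v) (ha : a < 64 := by norm_num) :
    RVal M σ (rv a) v := ⟨ok_rv _ _ ha, by simpa using h⟩

theorem get {a c : ℕ} {e : IExpr} (he : IVal M σ e (c : ℕ)) (hc : c < M.rsz a)
    (hs : e.size ≤ 24 := by decide) : RVal M σ (.get a e) (σ.real a c) :=
  ⟨⟨⟨he.1, hs⟩, by rw [he.2]; omega, by rw [he.2]; exact_mod_cast hc⟩,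
    by simp [RExpr.den, he.2]⟩

theorem add {e f : RExpr} {x y : ℝ} (he : RVal M σ e x) (hf : RVal M σ f y) :
    RVal M σ (.add e f) (x + y) := ⟨⟨he.1, hf.1⟩, by simp [RExpr.den, he.2, hf.2]⟩

theorem sub {e f : RExpr} {x y : ℝ} (he : RVal M σ e x) (hf : RVal M σ f y) :
    RVal M σ (.sub e f) (x - y) := ⟨⟨he.1, hf.1⟩, by simp [RExpr.den, he.2, hf.2]⟩

theorem mul {e f : RExpr} {x y : ℝ} (he : RVal M σ e x) (hf : RVal M σ f y) :
    RVal M σ (.mul e f) (x * y) := ⟨⟨he.1, hf.1⟩, by simp [RExpr.den, he.2, hf.2]⟩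

theorem div {e f : RExpr} {x y : ℝ} (he : RVal M σ e x) (hf : RVal M σ f y) (hy : y ≠ 0) :
    RVal M σ (.div e f) (x / y) :=
  ⟨⟨he.1, hf.1, by rwa [hf.2]⟩, by simp [RExpr.den, he.2, hf.2]⟩

theorem congr {e : RExpr} {x y : ℝ} (he : RVal M σ e x) (h : x = y) : RVal M σ e y := h ▸ he

end RVal

theorem ilt_ok {e f : IExpr} {x y : ℤ} (he : IVal M σ e x) (hf : IVal M σ f y)
    (hs : e.size ≤ 24 := by decide) (hs' : f.size ≤ 24 := by decide) :
    (BExpr.ilt e f).Ok M σ ∧ ((BExpr.ilt e f).den σ ↔ x < y) :=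
  ⟨⟨⟨he.1, hs⟩, hf.1, hs'⟩, by simp [BExpr.den, he.2, hf.2]⟩

theorem rlt_ok {e f : RExpr} {x y : ℝ} (he : RVal M σ e x) (hf : RVal M σ f y) :
    (BExpr.rlt e f).Ok M σ ∧ ((BExpr.rlt e f).den σ ↔ x < y) :=
  ⟨⟨he.1, hf.1⟩, by simp [BExpr.den, he.2, hf.2]⟩

theorem not_ok {b : BExpr} {p : Prop} (h : b.Ok M σ ∧ (b.den σ ↔ p)) :
    (BExpr.not b).Ok M σ ∧ ((BExpr.not b).den σ ↔ ¬ p) := ⟨h.1, by simp [BExpr.den, h.2]⟩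

theorem and_ok {b c : BExpr} {p q : Prop} (h : b.Ok M σ ∧ (b.den σ ↔ p))
    (h' : c.Ok M σ ∧ (c.den σ ↔ q)) :
    (BExpr.and b c).Ok M σ ∧ ((BExpr.and b c).den σ ↔ p ∧ q) :=
  ⟨⟨h.1, h'.1⟩, by simp [BExpr.den, h.2, h'.2]⟩

/-- Disjunction. -/
def BExpr.or (b c : BExpr) : BExpr := .not (.and (.not b) (.not c))

theorem or_ok {b c : BExpr} {p q : Prop} (h : b.Ok M σ ∧ (b.den σ ↔ p))
    (h' : c.Ok M σ ∧ (c.den σ ↔ q)) :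
    (BExpr.or b c).Ok M σ ∧ ((BExpr.or b c).den σ ↔ p ∨ q) := by
  have := not_ok (and_ok (not_ok h) (not_ok h'))
  exact ⟨this.1, this.2.trans (by tauto)⟩

/-- Equality of integers. -/
def BExpr.ieq (e f : IExpr) : BExpr := .and (.not (.ilt e f)) (.not (.ilt f e))

theorem ieq_ok {e f : IExpr} {x y : ℤ} (he : IVal M σ e x) (hf : IVal M σ f y)
    (hs : e.size ≤ 24 := by decide) (hs' : f.size ≤ 24 := by decide) :
    (BExpr.ieq e f).Ok M σ ∧ ((BExpr.ieq e f).den σ ↔ x = y) := by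
  have := and_ok (not_ok (ilt_ok he hf hs hs')) (not_ok (ilt_ok hf he hs' hs))
  exact ⟨this.1, this.2.trans (by omega)⟩

/-- The cells hold the matrix in row-major order. -/
def MatAt {p q : ℕ} (f : ℕ → ℝ) (A : Matrix (Fin p) (Fin q) ℝ) : Prop :=
  ∀ (i : Fin p) (j : Fin q), f (i * q + j) = A i j

theorem mul_add_lt {i p j q : ℕ} (hi : i < p) (hj : j < q) : i * q + j < p * q := by
  have := Nat.mul_le_mul_right q (show i + 1 ≤ p from hi)
  rw [Nat.succ_mul] at this
  omega

theorem matAt_of_forall {p q : ℕ} {f : ℕ → ℝ} {A : Matrix (Fin p) (Fin q) ℝ}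
    (h : ∀ x : Fin (p * q), f x = A x.divNat x.modNat) : MatAt f A := by
  intro i j
  have h1 := h ⟨i * q + j, mul_add_lt i.2 j.2⟩
  have hq : 0 < q := Nat.zero_lt_of_lt j.2
  have e1 : (⟨i * q + j, mul_add_lt i.2 j.2⟩ : Fin (p * q)).divNat = i := by
    ext; simp [Fin.divNat, Nat.add_div_of_dvd_right, hq]
  have e2 : (⟨i * q + j, mul_add_lt i.2 j.2⟩ : Fin (p * q)).modNat = j := by
    ext; simp [Fin.modNat, Nat.mod_eq_of_lt j.2]
  rw [e1, e2] at h1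
  exact h1

theorem MatAt.at {p q : ℕ} {f : ℕ → ℝ} {A : Matrix (Fin p) (Fin q) ℝ} (h : MatAt f A)
    (x : Fin (p * q)) : f x = A x.divNat x.modNat := by
  rw [← h x.divNat x.modNat]
  congr 1
  simp [Fin.divNat, Fin.modNat, Nat.div_add_mod']

theorem Fin.pos_of_mul {p q : ℕ} (x : Fin (p * q)) : 0 < q := by
  rcases Nat.eq_zero_or_pos q with h | h
  · exact absurd x.2 (by simp [h])
  · exact h

end RealRAM

namespace SparseDict

open RealRAM

/-! ### Least squares by successive orthogonalization -/

section
variable {s k : ℕ}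

/-- One step of Greville's method: account for the column `j` of `Z` in the left factor `K`. -/
noncomputable def grevilleStep (Z : Matrix (Fin s) (Fin k) ℝ) (j : Fin k)
    (K : Matrix (Fin k) (Fin s) ℝ) : Matrix (Fin k) (Fin s) ℝ :=
  let y : Fin k → ℝ := fun a => ∑ c, K a c * Z c j
  let h : Fin s → ℝ := fun c => Z c j - ∑ a, Z c a * y a
  let α : ℝ := ∑ c, h c * h c
  if 0 < α then Matrix.of fun a c => K a c + ((if a = j then 1 else 0) - y a) * h c / α else K

/-- The left factor for the first `j` columns. -/
noncomputable def greville (Z : Matrix (Fin s) (Fin k) ℝ) : ℕ → Matrix (Fin k) (Fin s) ℝ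
  | 0 => 0
  | j + 1 => if h : j < k then grevilleStep Z ⟨j, h⟩ (greville Z j) else greville Z j

theorem greville_invariant (Z : Matrix (Fin s) (Fin k) ℝ) (m : ℕ) (hm : m ≤ k) :
    (1 - Z * greville Z m)ᵀ = 1 - Z * greville Z m ∧
      (1 - Z * greville Z m) * (1 - Z * greville Z m) = 1 - Z * greville Z m ∧
      ∀ j : Fin k, (j : ℕ) < m → (1 - Z * greville Z m) *ᵥ Z.col j = 0 := by
  induction m with
  | zero => simp [greville]
  | succ m ih =>
    obtain ⟨h1, h2, h3⟩ := ih (by omega)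
    obtain ⟨j, hj⟩ : ∃ j : Fin k, j = ⟨m, hm⟩ := ⟨_, rfl⟩
    obtain ⟨K, hK⟩ : ∃ K, K = greville Z m := ⟨_, rfl⟩
    rw [← hK] at h1 h2 h3
    obtain ⟨P, hP⟩ : ∃ P, P = 1 - Z * K := ⟨_, rfl⟩
    rw [← hP] at h1 h2 h3
    obtain ⟨h, hh⟩ : ∃ h : Fin s → ℝ, h = P *ᵥ Z.col j := ⟨_, rfl⟩
    have hy : (fun a => ∑ c, K a c * Z c j) = K *ᵥ Z.col j := by
      ext a; simp [Matrix.mulVec, dotProduct, Matrix.col]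
    have hhc : (fun c => Z c j - ∑ a, Z c a * (K *ᵥ Z.col j) a) = h := by
      ext c
      simp only [hh, hP, Matrix.sub_mulVec, Matrix.one_mulVec, Pi.sub_apply, ← Matrix.mulVec_mulVec]
      simp [Matrix.mulVec, dotProduct, Matrix.col]
    have hPP : ∀ v, P *ᵥ (P *ᵥ v) = P *ᵥ v := fun v => by rw [Matrix.mulVec_mulVec, h2]
    have hPs : ∀ u v : Fin s → ℝ, u ⬝ᵥ (P *ᵥ v) = (P *ᵥ u) ⬝ᵥ v := fun u v => by
      rw [Matrix.dotProduct_mulVec, ← Matrix.mulVec_transpose, h1]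
    have hα : (∑ c, h c * h c) = h ⬝ᵥ h := rfl
    have hzh : Z.col j ⬝ᵥ h = h ⬝ᵥ h := by
      rw [hh, hPs, ← hPs (Z.col j), ← hPs, hPP]
    have hstep : greville Z (m + 1) = if 0 < h ⬝ᵥ h then
        K + Matrix.vecMulVec (Pi.single j 1 - K *ᵥ Z.col j) ((h ⬝ᵥ h)⁻¹ • h) else K := by
      have hmk : m < k := hm
      rw [greville, dif_pos hmk, ← hK, ← hj]
      simp only [grevilleStep]
      change (if 0 < ∑ c, (Z c j - ∑ a, Z c a * ((fun a => ∑ c, K a c * Z c j) a)) *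
        (Z c j - ∑ a, Z c a * ((fun a => ∑ c, K a c * Z c j) a)) then _ else _) = _
      rw [hy]
      have e1 : (∑ c, (Z c j - ∑ a, Z c a * (K *ᵥ Z.col j) a) *
        (Z c j - ∑ a, Z c a * (K *ᵥ Z.col j) a)) = h ⬝ᵥ h := by
        rw [← hα]; exact Finset.sum_congr rfl fun c _ => by rw [← congrFun hhc c]
      rw [e1]
      congr 1
      ext a c
      have e3 : (∑ c, K a c * Z c j) = (K *ᵥ Z.col j) a := congrFun hy a
      have e4 : ∀ c', Z c' j - ∑ a, Z c' a * ∑ c, K a c * Z c j = h c' := fun c' => by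
        rw [← congrFun hhc c']
        exact congrArg _ (Finset.sum_congr rfl fun a _ => by rw [← congrFun hy a])
      change K a c + ((if a = j then 1 else 0) - ∑ c, K a c * Z c j) *
        (Z c j - ∑ a, Z c a * ∑ c, K a c * Z c j) /
        (∑ c', (Z c' j - ∑ a, Z c' a * ∑ c, K a c * Z c j) *
        (Z c' j - ∑ a, Z c' a * ∑ c, K a c * Z c j)) = _
      simp only [e4, hα, e3, Matrix.add_apply, Matrix.vecMulVec_apply, Pi.sub_apply, Pi.single_apply,
        Pi.smul_apply, smul_eq_mul]
      ring
    by_cases hpos : 0 < h ⬝ᵥ h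
    · have hZ : Z *ᵥ (Pi.single j 1 - K *ᵥ Z.col j) = h := by
        rw [hh, hP, Matrix.mulVec_sub, Matrix.mulVec_mulVec, Matrix.sub_mulVec, Matrix.one_mulVec,
          Matrix.mulVec_single_one]
      have hP' : 1 - Z * greville Z (m + 1) = P - (h ⬝ᵥ h)⁻¹ • Matrix.vecMulVec h h := by
        rw [hstep, if_pos hpos, Matrix.mul_add, Matrix.mul_vecMulVec, hZ, ← sub_sub,
          Matrix.vecMulVec_smul, ← hP]
      have hPh : P *ᵥ h = h := by rw [hh, hPP]
      have hPh2 : P * Matrix.vecMulVec h h = Matrix.vecMulVec h h := by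
        rw [Matrix.mul_vecMulVec, hPh]
      have hPh3 : Matrix.vecMulVec h h * P = Matrix.vecMulVec h h := by
        rw [Matrix.vecMulVec_mul, ← Matrix.mulVec_transpose, h1, hPh]
      have hhh : Matrix.vecMulVec h h * Matrix.vecMulVec h h = (h ⬝ᵥ h) • Matrix.vecMulVec h h := by
        rw [Matrix.vecMulVec_mul_vecMulVec, ← Matrix.vecMulVec_smul]
      have hne : h ⬝ᵥ h ≠ 0 := hpos.ne'
      rw [hP']
      refine ⟨?_, ?_, ?_⟩
      · rw [Matrix.transpose_sub, h1, Matrix.transpose_smul, Matrix.transpose_vecMulVec]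
      · rw [Matrix.sub_mul, Matrix.mul_sub, Matrix.mul_sub, h2, Matrix.mul_smul, Matrix.smul_mul,
          Matrix.smul_mul, Matrix.mul_smul, hPh2, hPh3, hhh, smul_smul, smul_smul,
          mul_assoc, inv_mul_cancel₀ hne, mul_one]
        abel
      · intro i hi
        rw [Matrix.sub_mulVec, Matrix.smul_mulVec, Matrix.vecMulVec_mulVec]
        rcases Nat.lt_succ_iff_lt_or_eq.1 hi with hlt | heq
        · have h0 : h ⬝ᵥ Z.col i = 0 := by
            rw [hh, ← hPs, h3 i hlt, dotProduct_zero]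
          rw [h3 i hlt, h0]; simp
        · have hij : i = j := by rw [hj]; exact Fin.ext heq
          rw [hij, ← hh, dotProduct_comm h (Z.col j), hzh]
          ext c
          simp [hne]
    · have h0 : h = 0 := by
        have : h ⬝ᵥ h = 0 := le_antisymm (not_lt.1 hpos) (Finset.sum_nonneg fun c _ => mul_self_nonneg _)
        exact dotProduct_self_eq_zero.1 this
      rw [hstep, if_neg hpos, ← hP]
      refine ⟨h1, h2, fun i hi => ?_⟩
      rcases Nat.lt_succ_iff_lt_or_eq.1 hi with hlt | heq
      · exact h3 i hlt
      · have hij : i = j := by rw [hj]; exact Fin.ext heq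
        rw [hij, ← hh, h0]

/-- The dictionary obtained from the left factor satisfies the normal equations. -/
theorem greville_normal {d : ℕ} (Z : Matrix (Fin s) (Fin k) ℝ) (A : Matrix (Fin s) (Fin d) ℝ) :
    Zᵀ * (Z * (greville Z k * A) - A) = 0 := by
  obtain ⟨h1, -, h3⟩ := greville_invariant Z k le_rfl
  have hPZ : (1 - Z * greville Z k) * Z = 0 := by
    ext c j
    exact congrFun (h3 j j.2) c
  have hZP : Zᵀ * (1 - Z * greville Z k) = 0 := by
    rw [← h1, ← Matrix.transpose_mul, hPZ, Matrix.transpose_zero]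
  have : Z * (greville Z k * A) - A = -((1 - Z * greville Z k) * A) := by
    rw [Matrix.sub_mul, Matrix.one_mul, Matrix.mul_assoc]; abel
  rw [this, Matrix.mul_neg, ← Matrix.mul_assoc, hZP, Matrix.zero_mul, neg_zero]

end

/-! ### Medians -/

open Classical in
/-- The number of entries which are at most `v l`. -/
noncomputable def rank {q : ℕ} (v : Fin q → ℝ) (l : Fin q) : ℕ :=
  (Finset.univ.filter fun l' => v l' ≤ v l).card

/-- `m` is the least entry which is at least as large as more than half of the entries. -/
def IsMed {q : ℕ} (v : Fin q → ℝ) (m : ℝ) : Prop :=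
  (∃ l, v l = m ∧ q < 2 * rank v l) ∧ ∀ l, q < 2 * rank v l → m ≤ v l

theorem IsMed.unique {q : ℕ} {v : Fin q → ℝ} {m m' : ℝ} (h : IsMed v m) (h' : IsMed v m') :
    m = m' := by
  obtain ⟨⟨l, rfl, hl⟩, h2⟩ := h
  obtain ⟨⟨l', rfl, hl'⟩, h2'⟩ := h'
  exact le_antisymm (h2 _ hl') (h2' _ hl)

theorem exists_isMed {q : ℕ} (hq : 0 < q) (v : Fin q → ℝ) : ∃ m, IsMed v m := by
  classical
  have : Nonempty (Fin q) := ⟨⟨0, hq⟩⟩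
  obtain ⟨l₀, hl₀⟩ := Finite.exists_max v
  have hne : (Finset.univ.filter fun l => q < 2 * rank v l).Nonempty := by
    refine ⟨l₀, ?_⟩
    have : rank v l₀ = q := by simp [rank, hl₀]
    simp [this]; omega
  obtain ⟨l, hl, hmin⟩ := Finset.exists_min_image _ v hne
  exact ⟨v l, ⟨l, rfl, (Finset.mem_filter.1 hl).2⟩, fun l' hl' => hmin l' (by simp [hl'])⟩

open Classical in
/-- The median. -/
noncomputable def med {q : ℕ} (v : Fin q → ℝ) : ℝ := if h : ∃ m, IsMed v m then h.choose else 0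

theorem isMed_med {q : ℕ} (hq : 0 < q) (v : Fin q → ℝ) : IsMed v (med v) := by
  rw [med, dif_pos (exists_isMed hq v)]; exact (exists_isMed hq v).choose_spec

/-- The sums of squares over the groups of `G` consecutive entries. -/
noncomputable def groupSq {q G : ℕ} (x : Fin (q * G) → ℝ) (l : Fin q) : ℝ :=
  ∑ g : Fin G, x (finProdFinEquiv (l, g)) ^ 2

/-- The median of the sums of squares over groups. -/
noncomputable def est {q G : ℕ} (x : Fin (q * G) → ℝ) : ℝ := med (groupSq x)

theorem est_nonneg {q G : ℕ} (hq : 0 < q) (x : Fin (q * G) → ℝ) : 0 ≤ est x := by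
  obtain ⟨⟨l, hl, -⟩, -⟩ := isMed_med hq (groupSq x)
  rw [est, ← hl]
  exact Finset.sum_nonneg fun g _ => sq_nonneg _

/-- `N₀` is the first minimizer of `f` on the `N < b` with `valid N`. -/
def IsSel (b : ℕ) (valid : ℕ → Prop) (f : ℕ → ℝ) (N₀ : ℕ) : Prop :=
  (N₀ < b ∧ valid N₀) ∧ ∀ N < b, valid N → f N₀ ≤ f N ∧ (N < N₀ → f N₀ < f N)

theorem IsSel.unique {b : ℕ} {valid : ℕ → Prop} {f : ℕ → ℝ} {x y : ℕ} (hx : IsSel b valid f x)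
    (hy : IsSel b valid f y) : x = y := by
  rcases lt_trichotomy x y with h | h | h
  · exact absurd ((hy.2 x hx.1.1 hx.1.2).2 h) (not_lt.2 (hx.2 y hy.1.1 hy.1.2).1)
  · exact h
  · exact absurd ((hx.2 y hy.1.1 hy.1.2).2 h) (not_lt.2 (hy.2 x hx.1.1 hx.1.2).1)

open Classical in
/-- The first minimizer. -/
noncomputable def sel (b : ℕ) (valid : ℕ → Prop) (f : ℕ → ℝ) : ℕ :=
  if h : ∃ x, IsSel b valid f x then h.choose else 0

theorem IsSel.eq_sel {b : ℕ} {valid : ℕ → Prop} {f : ℕ → ℝ} {x : ℕ} (hx : IsSel b valid f x) :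
    x = sel b valid f := by
  have h : ∃ x, IsSel b valid f x := ⟨x, hx⟩
  rw [sel, dif_pos h]; exact hx.unique h.choose_spec

/-! ### The candidate solutions -/

/-- The `l`-th digit of `N` with base `b`. -/
def digit (b N l : ℕ) : ℕ := N / b ^ l % b

/-- The column index that the digit `e` stands for. -/
def digitCol (D e : ℕ) : ℕ := e / (2 * D + 1)

/-- The value that the digit `e` stands for. -/
def digitVal (D e : ℕ) : ℤ := (e % (2 * D + 1) : ℕ) - (D : ℤ)

/-- The row with `r` entries that `N` stands for. -/
def rowOf (k r D N : ℕ) (j : Fin k) : ℤ :=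
  ∑ l : Fin r, if digitCol D (digit (k * (2 * D + 1)) N l) = j then
    digitVal D (digit (k * (2 * D + 1)) N l) else 0

/-- All entries of the row are in `{-D, …, D}`. -/
def RowValid (k r D N : ℕ) : Prop := ∀ j, |rowOf k r D N j| ≤ (D : ℤ)

/-- The guess of `S X` that `N` stands for. -/
def guess (s k H N : ℕ) : Matrix (Fin s) (Fin k) ℝ :=
  Matrix.of fun c a => (((digit (2 * H + 1) N (c * k + a) : ℕ) : ℤ) - (H : ℤ) : ℤ)

/-- The dictionary for the guess `Z` of `S X`. -/
noncomputable def dictOf {s k d : ℕ} (Z : Matrix (Fin s) (Fin k) ℝ)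
    (SA : Matrix (Fin s) (Fin d) ℝ) : Matrix (Fin k) (Fin d) ℝ := greville Z k * SA

/-- The sketch of the residual of a row. -/
def rowRes {k t : ℕ} (r D : ℕ) (YT : Matrix (Fin k) (Fin t) ℝ) (a : Fin t → ℝ) (N : ℕ) :
    Fin t → ℝ := fun c => ∑ j, (rowOf k r D N j : ℝ) * YT j c - a c

/-- The number of the best row. -/
noncomputable def bestRow {k q G : ℕ} (r D : ℕ) (YT : Matrix (Fin k) (Fin (q * G)) ℝ)
    (a : Fin (q * G) → ℝ) : ℕ :=
  sel ((k * (2 * D + 1)) ^ r) (RowValid k r D) fun N => est (rowRes r D YT a N)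

/-- The left factor with the best rows for the dictionary with sketch `YT`. -/
noncomputable def factorOf {n k q G : ℕ} (r D : ℕ) (YT : Matrix (Fin k) (Fin (q * G)) ℝ)
    (AT : Matrix (Fin n) (Fin (q * G)) ℝ) : Matrix (Fin n) (Fin k) ℝ :=
  Matrix.of fun i j => (rowOf k r D (bestRow r D YT (AT i)) j : ℝ)

end SparseDict

namespace SparseDict

open RealRAM Machine

/-- The integer arrays which the search for a solution may change. -/
def coreI : List ℕ :=
  [8, 9, 20, 21, 22, 23, 24, 25, 26, 27, 28, 29, 30, 31, 32, 33, 34, 35, 36, 37, 38, 39, 40, 41, 42, 43]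

/-- The real arrays which the search for a solution may change. -/
def coreR : List ℕ := [2, 20, 21, 22, 23, 24, 25, 26, 27, 28, 29, 30, 31, 32, 33]

/-- The setting of the search: the parameters, the sketches, and programs `gT`, `gW` that read
the entries of the sketching matrices (row index in integer array `36`, column index in integer
array `37`) into real array `32`. -/
structure Env where
  M : Machine
  (n d k r D s G qT qW : ℕ)
  SA : Matrix (Fin s) (Fin d) ℝ
  AT : Matrix (Fin n) (Fin (qT * G)) ℝ
  WA : Fin (qW * G) → ℝ
  T : Matrix (Fin d) (Fin (qT * G)) ℝ
  W : Matrix (Fin (qW * G)) (Fin (n * d)) ℝ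
  inv : Mem → Prop
  gT : Cmd
  gW : Cmd
  inv_mods : ∀ σ τ, Mods coreI coreR σ τ → inv σ → inv τ
  gT_spec : ∀ σ, inv σ → ∀ (j : Fin d) (c : Fin (qT * G)), σ.int 36 0 = (j : ℕ) →
    σ.int 37 0 = (c : ℕ) →
    M.Runs 1 [38, 39, 40, 41, 42, 43] [32] gT σ 14 fun τ => τ.real 32 0 = T j c
  gW_spec : ∀ σ, inv σ → ∀ (c : Fin (qW * G)) (x : Fin (n * d)), σ.int 36 0 = (c : ℕ) →
    σ.int 37 0 = (x : ℕ) →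
    M.Runs 1 [38, 39, 40, 41, 42, 43] [32] gW σ 14 fun τ => τ.real 32 0 = W c x
  k_pos : 0 < k
  r_le : r ≤ k
  qT_pos : 0 < qT
  qW_pos : 0 < qW
  le_V : s * k ≤ M.V ∧ k * d ≤ M.V ∧ k * (qT * G) ≤ M.V ∧ n * d ≤ M.V ∧ n * r ≤ M.V ∧
    r * D ≤ M.V ∧ 2 * (n * D) + 1 ≤ M.V ∧ k * (2 * D + 1) ≤ M.V ∧ qT * G ≤ M.V ∧ qW * G ≤ M.V ∧
    n ≤ M.V ∧ d ≤ M.V ∧ k ≤ M.V ∧ s ≤ M.V ∧ G ≤ M.V ∧ qT ≤ M.V ∧ qW ≤ M.V ∧ r ≤ M.V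
  isz_le : n * r ≤ M.isz 8 ∧ n * r ≤ M.isz 9 ∧ s * k ≤ M.isz 20 ∧ r ≤ M.isz 21 ∧ n * r ≤ M.isz 22
  rsz_le : k * d ≤ M.rsz 2 ∧ s * d ≤ M.rsz 6 ∧ n * (qT * G) ≤ M.rsz 7 ∧ qW * G ≤ M.rsz 8 ∧
    k * s ≤ M.rsz 20 ∧ k ≤ M.rsz 21 ∧ s ≤ M.rsz 22 ∧ k * d ≤ M.rsz 25 ∧ k * (qT * G) ≤ M.rsz 26 ∧
    qT * G ≤ M.rsz 27 ∧ qW * G ≤ M.rsz 27 ∧ qT ≤ M.rsz 28 ∧ qW ≤ M.rsz 28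

/-- The part of the memory that the search reads only. -/
structure Env.Static (E : Env) (σ : Mem) : Prop where
  inv : E.inv σ
  n : σ.int 0 0 = E.n
  d : σ.int 1 0 = E.d
  k : σ.int 2 0 = E.k
  r : σ.int 3 0 = E.r
  D : σ.int 4 0 = E.D
  s : σ.int 10 0 = E.s
  t : σ.int 11 0 = (E.qT * E.G : ℕ)
  w : σ.int 12 0 = (E.qW * E.G : ℕ)
  G : σ.int 13 0 = E.G
  qT : σ.int 14 0 = E.qT
  qW : σ.int 15 0 = E.qW
  SA : MatAt (σ.real 6) E.SA
  AT : MatAt (σ.real 7) E.AT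
  WA : ∀ c : Fin (E.qW * E.G), σ.real 8 c = E.WA c

theorem Env.Static.mods {E : Env} {σ τ : Mem} (h : E.Static σ) {I R : List ℕ} (hm : Mods I R σ τ)
    (hI : ∀ a ∈ I, a ∈ coreI := by decide) (hR : ∀ a ∈ R, a ∈ coreR := by decide) :
    E.Static τ := by
  have hm' : Mods coreI coreR σ τ := hm.mono hI hR
  have hi : ∀ a, a ∉ coreI → τ.int a = σ.int a := hm'.int
  have hr : ∀ a, a ∉ coreR → τ.real a = σ.real a := hm'.real
  exact ⟨E.inv_mods σ τ hm' h.inv, by rw [hi 0 (by decide), h.n], by rw [hi 1 (by decide), h.d],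
    by rw [hi 2 (by decide), h.k], by rw [hi 3 (by decide), h.r], by rw [hi 4 (by decide), h.D],
    by rw [hi 10 (by decide), h.s], by rw [hi 11 (by decide), h.t], by rw [hi 12 (by decide), h.w],
    by rw [hi 13 (by decide), h.G], by rw [hi 14 (by decide), h.qT],
    by rw [hi 15 (by decide), h.qW], by rw [hr 6 (by decide)]; exact h.SA,
    by rw [hr 7 (by decide)]; exact h.AT, by rw [hr 8 (by decide)]; exact h.WA⟩

/-- The entry of the guess of `S X` in the given row and column. -/
def guessEntry (i j : IExpr) : RExpr :=
  .ofInt (.sub (.get 20 (ix2 i (iv 2) j)) (.mul (iv 0) (iv 4)))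

theorem Env.Static.guessEntry {E : Env} {σ : Mem} (h : E.Static σ) {N : ℕ}
    (hN : Digits (2 * (E.n * E.D) + 1) (E.s * E.k) N (σ.int 20)) {i j : IExpr} {c : Fin E.s}
    {a : Fin E.k} (hi : IVal E.M σ i (c : ℕ)) (hj : IVal E.M σ j (a : ℕ))
    (his : i.size ≤ 6) (hjs : j.size ≤ 6) :
    RVal E.M σ (guessEntry i j) (guess E.s E.k (E.n * E.D) N c a) := by
  have hlt := mul_add_lt c.2 a.2
  refine RVal.congr (RVal.ofInt (((hi.ix2 (.scalar h.k) hj).get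
    (hlt.trans_le E.isz_le.2.2.1)).sub ((IVal.scalar h.n).mul (.scalar h.D)))
    (by simp [IExpr.size]; omega)) ?_
  rw [hN _ hlt, guess, Matrix.of_apply, digit]
  push_cast; ring

/-- Compute the left factor of the least squares solution for the current guess. -/
def grevilleCmd : Cmd :=
  .seq (Cmd.fillReal 23 (.mul (iv 2) (iv 10)) 20 (iv 23) .skip (.ofInt (.const 0)))
    (Cmd.forN 31 (iv 2)
      (.seq (Cmd.fillReal 23 (iv 2) 21 (iv 23)
          (Cmd.sumN 24 (iv 10) 23 (.ofInt (.const 0)) .skip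
            (.mul (.get 20 (ix2 (iv 23) (iv 10) (iv 24))) (guessEntry (iv 24) (iv 31)))) (rv 23))
        (.seq (Cmd.fillReal 23 (iv 10) 22 (iv 23)
            (Cmd.sumN 24 (iv 2) 23 (.ofInt (.const 0)) .skip
              (.mul (guessEntry (iv 23) (iv 24)) (.get 21 (iv 24))))
            (.sub (guessEntry (iv 23) (iv 31)) (rv 23)))
          (.seq (Cmd.sumN 23 (iv 10) 24 (.ofInt (.const 0)) .skip
              (.mul (.get 22 (iv 23)) (.get 22 (iv 23))))
            (.ite (.rlt (.ofInt (.const 0)) (rv 24))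
              (Cmd.fillReal 23 (.mul (iv 2) (iv 10)) 20 (iv 23)
                (.ite (.ieq (.div (iv 23) (iv 10)) (iv 31))
                  (.rset 23 (.const 0) (.ofInt (.const 1)))
                  (.rset 23 (.const 0) (.ofInt (.const 0))))
                (.add (.get 20 (iv 23))
                  (.div (.mul (.sub (rv 23) (.get 21 (.div (iv 23) (iv 10))))
                    (.get 22 (.mod (iv 23) (iv 10)))) (rv 24))))
              .skip)))))

theorem RVal.zero {M : Machine} {σ : Mem} : RVal M σ (.ofInt (.const 0)) 0 :=
  (RVal.ofInt IVal.zero).congr (by simp)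

theorem den_zero (σ : Mem) : (RExpr.ofInt (.const 0)).den σ = 0 := by
  simp [RExpr.den, IExpr.den]

theorem grevilleCmd_spec (E : Env) {σ : Mem} (hσ : E.Static σ) {N : ℕ}
    (hN : Digits (2 * (E.n * E.D) + 1) (E.s * E.k) N (σ.int 20)) :
    E.M.Runs 1 [23, 24, 31] [20, 21, 22, 23, 24] grevilleCmd σ 19
      fun τ => MatAt (τ.real 20) (greville (guess E.s E.k (E.n * E.D) N) E.k) := by
  obtain ⟨hV1, hV2, hV3, hV4, hV5, hV6, hV7, hV8, hV9, hV10, hV11, hV12, hV13, hV14, hV15, hV16,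
    hV17, hV18⟩ := E.le_V
  obtain ⟨hr1, hr2, hr3, hr4, hr5, hr6, hr7, hr8, hr9, hr10, hr11, hr12, hr13⟩ := E.rsz_le
  set Z := guess E.s E.k (E.n * E.D) N with hZ
  have hks : E.k * E.s ≤ E.M.V := by rw [mul_comm]; exact hV1
  refine Runs.seq (Runs.fillReal (I := [23]) (R := [20]) (I' := []) (R' := []) (e := 5) (e₁ := 0)
    one_pos 0 (fun _ : Fin (E.k * E.s) => 0) (by omega) hks
    (fun τ hm => (IVal.scalar (hσ.mods hm).k).natMul (.scalar (hσ.mods hm).s))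
    (fun i τ _ _ hx _ => Runs.skip one_pos ⟨(IVal.scalar hx).congr (by simp), RVal.zero⟩))
    (I₂ := [23, 24, 31]) (R₂ := [20, 21, 22, 23, 24]) (e₂ := 18) ?_
  rintro τ hτ hm ⟨h0, -⟩
  have hst := hσ.mods hm
  have hNt : Digits (2 * (E.n * E.D) + 1) (E.s * E.k) N (τ.int 20) := by
    rw [hm.int 20 (by decide)]; exact hN
  refine Runs.forN (I' := [23, 24]) (e₁ := 14) one_pos E.k
    (fun m υ => MatAt (υ.real 20) (greville Z m)) hV13
    (fun υ hu => IVal.scalar (hst.mods hu).k) (fun _ _ _ h => h) ?_ ?_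
  · refine matAt_of_forall fun x => ?_
    have := h0 x
    rw [zero_add] at this
    rw [this]; simp [greville]
  intro m υ hmk hbu hu hxu hJ
  have hsu := hst.mods hu
  have hNu : Digits (2 * (E.n * E.D) + 1) (E.s * E.k) N (υ.int 20) := by
    rw [hu.int 20 (by decide)]; exact hNt
  obtain ⟨K, hK⟩ : ∃ K, K = greville Z m := ⟨_, rfl⟩
  rw [← hK] at hJ
  obtain ⟨j, hj⟩ : ∃ j : Fin E.k, j = ⟨m, hmk⟩ := ⟨_, rfl⟩
  replace hxu : υ.int 31 0 = (j : ℕ) := by rw [hxu, hj]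
  have hZe : ∀ {I R : List ℕ} {ω : Mem}, Mods I R υ ω → (∀ a ∈ I, a ∈ [23, 24]) →
      (∀ a ∈ R, a ∈ coreR) → ∀ {e f : IExpr} {c : Fin E.s} {a : Fin E.k}, IVal E.M ω e (c : ℕ) →
      IVal E.M ω f (a : ℕ) → e.size ≤ 6 → f.size ≤ 6 →
      RVal E.M ω (guessEntry e f) (Z c a) := by
    intro I R ω hmw hI hR e f c a he hf hes hfs
    have hI' : ∀ a ∈ I, a ∈ coreI := fun a ha =>
      (by decide : ∀ a ∈ [23, 24], a ∈ coreI) a (hI a ha)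
    refine (hsu.mods hmw hI' hR).guessEntry ?_ he hf hes hfs
    rw [hmw.int 20 fun h => absurd (hI _ h) (by decide)]
    exact hNu
  have hj31 : ∀ {I R : List ℕ} {ω : Mem}, Mods I R υ ω → (∀ a ∈ I, a ∈ [23, 24]) →
      IVal E.M ω (iv 31) (j : ℕ) := fun hmw hI =>
    IVal.scalar (by rw [hmw.int 31 fun h => absurd (hI _ h) (by decide)]; exact hxu)
  refine Runs.seq (Runs.fillReal (I := [23, 24]) (R := [21, 23]) (I' := [24]) (R' := [23])
    (e := 11) (e₁ := 6) one_pos 0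
    (fun a : Fin E.k => ∑ c, K a c * Z c j) (by omega) hV13
    (fun ω hmw => IVal.scalar (hsu.mods hmw).k) (fun a ω _ hmw hx _ =>
    (Runs.sumN (I' := []) (R' := []) (e₁ := 0) one_pos (fun c => K a c * Z c j) hV14
      (fun ω' hm' => IVal.scalar ((hsu.mods hmw).mods hm').s) RVal.zero.1
      (fun c ω' _ hm' hy => ?_)).imp fun ω' hm' h => ?_))
      (I₂ := [23, 24]) (R₂ := [20, 22, 23, 24]) (e₂ := 13) ?_
  · have hmm := (hmw.mono (by simp) (by simp) : Mods [23, 24] [21, 23] υ ω).trans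
      (hm'.mono (by simp) (by simp))
    refine Runs.skip one_pos ?_
    refine (RVal.get ((IVal.scalar ((congrFun (hm'.int 23 (by simp)) 0).trans hx)).ix2
      (.scalar (hsu.mods hmm).s) (.scalar hy)) ((mul_add_lt a.2 c.2).trans_le hr5)).congr ?_ |>.mul
      (hZe hmm (by simp) (by decide) (.scalar hy) (hj31 hmm (by simp)) (by decide) (by decide))
    rw [hmm.real 20 (by simp)]
    exact hJ a c
  · rw [den_zero, zero_add] at h
    exact ⟨(IVal.scalar ((congrFun (hm'.int 23 (by simp)) 0).trans hx)).congr (by simp),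
      RVal.scalar h⟩
  rintro ω₁ hω₁ hm₁ ⟨hy₁, -⟩
  simp only [zero_add] at hy₁
  obtain ⟨y, hy⟩ : ∃ y : Fin E.k → ℝ, y = fun a => ∑ c, K a c * Z c j := ⟨_, rfl⟩
  replace hy₁ : ∀ a : Fin E.k, ω₁.real 21 a = y a := fun a => by rw [hy₁, hy]
  have hs₁ := hsu.mods hm₁
  refine Runs.seq (Runs.fillReal (I := [23, 24]) (R := [22, 23]) (I' := [24]) (R' := [23])
    (e := 11) (e₁ := 6) one_pos 0
    (fun c : Fin E.s => Z c j - ∑ a, Z c a * y a) (by omega) hV14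
    (fun ω hmw => IVal.scalar (hs₁.mods hmw).s) (fun c ω _ hmw hx _ =>
    (Runs.sumN (I' := []) (R' := []) (e₁ := 0) one_pos (fun a => Z c a * y a) hV13
      (fun ω' hm' => IVal.scalar ((hs₁.mods hmw).mods hm').k) RVal.zero.1
      (fun a ω' _ hm' hy => ?_)).imp fun ω' hm' h => ?_))
      (I₂ := [23]) (R₂ := [20, 23, 24]) (e₂ := 12) ?_
  · have hmm := (hmw.mono (by simp) (by simp) : Mods [23, 24] [22, 23] ω₁ ω).trans
      (hm'.mono (by simp) (by simp))
    have hmu := (hm₁.mono (by simp) (by simp) : Mods [23, 24] [21, 22, 23] υ ω₁).trans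
      (hmm.mono (by simp) (by simp))
    refine Runs.skip one_pos ?_
    refine (hZe hmu (by simp) (by decide)
      (IVal.scalar ((congrFun (hm'.int 23 (by simp)) 0).trans hx)) (.scalar hy)
      (by decide) (by decide)).mul ((RVal.get (.scalar hy) (a.2.trans_le hr6)).congr ?_)
    rw [hmm.real 21 (by simp)]
    exact hy₁ a
  · have hmm := (hmw.mono (by simp) (by simp) : Mods [23, 24] [22, 23] ω₁ ω).trans
      (hm'.mono (by simp) (by simp))
    have hmu := (hm₁.mono (by simp) (by simp) : Mods [23, 24] [21, 22, 23] υ ω₁).trans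
      (hmm.mono (by simp) (by simp))
    rw [den_zero, zero_add] at h
    have h23 : IVal E.M ω' (iv 23) (c : ℕ) :=
      IVal.scalar ((congrFun (hm'.int 23 (by simp)) 0).trans hx)
    exact ⟨h23.congr (by simp), (hZe hmu (by simp) (by decide) h23 (hj31 hmu (by simp))
      (by decide) (by decide)).sub (RVal.scalar h)⟩
  rintro ω₂ hω₂ hm₂ ⟨hh₂, -⟩
  simp only [zero_add] at hh₂
  obtain ⟨h, hh⟩ : ∃ h : Fin E.s → ℝ, h = fun c => Z c j - ∑ a, Z c a * y a := ⟨_, rfl⟩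
  replace hh₂ : ∀ c : Fin E.s, ω₂.real 22 c = h c := fun c => by rw [hh₂, hh]
  have hs₂ := hs₁.mods hm₂
  refine Runs.seq (Runs.sumN (I := [23]) (R := [24]) (I' := []) (R' := []) (e := 6) (e₁ := 0)
    one_pos (fun c => h c * h c) hV14 (fun ω hmw => IVal.scalar (hs₂.mods hmw).s) RVal.zero.1
    (fun c ω _ hmw hx => Runs.skip one_pos ?_)) (I₂ := [23]) (R₂ := [20, 23]) (e₂ := 11) ?_
  · have : RVal E.M ω (.get 22 (iv 23)) (h c) :=
      (RVal.get (.scalar hx) (c.2.trans_le hr7)).congr (by rw [hmw.real 22 (by simp), hh₂])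
    exact this.mul this
  intro ω₃ hω₃ hm₃ hα₃
  rw [den_zero, zero_add] at hα₃
  have hs₃ := hs₂.mods hm₃
  have hm₀ : Mods [23, 24] [21, 22, 23, 24] υ ω₃ := ((hm₁.mono (by simp) (by simp)).trans
    (hm₂.mono (by simp) (by simp))).trans (hm₃.mono (by simp) (by simp))
  have hstep : greville Z (m + 1) = if 0 < ∑ c, h c * h c then
      Matrix.of fun a c => K a c + ((if a = j then 1 else 0) - y a) * h c / ∑ c, h c * h c
      else K := by
    rw [greville, dif_pos hmk, ← hK, ← hj, hh, hy]; rfl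
  have hcond := rlt_ok (M := E.M) (σ := ω₃) RVal.zero (RVal.scalar hα₃)
  refine Runs.ite (e₁ := 10) one_pos hcond.1 (fun hpos => ?_) (fun hpos => ?_)
  · rw [hcond.2] at hpos
    rw [hstep, if_pos hpos]
    refine (Runs.fillReal (I' := []) (R' := [23]) (e := 10) (e₁ := 3) one_pos 0
      (fun x : Fin (E.k * E.s) => K x.divNat x.modNat + ((if x.divNat = j then 1 else 0) -
        y x.divNat) * h x.modNat / ∑ c, h c * h c) (by omega) hks
      (fun ω hmw => (IVal.scalar (hs₃.mods hmw).k).natMul (.scalar (hs₃.mods hmw).s))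
      (fun x ω _ hmw hx h20 => ?_)).imp fun ω _ hf => ?_
    · have hs0 : 0 < E.s := Fin.pos_of_mul x
      have hdiv : IVal E.M ω (.div (iv 23) (iv 10)) (x.divNat : ℕ) :=
        (IVal.scalar hx).natDiv (.scalar (hs₃.mods hmw).s) hs0
      have hmod : IVal E.M ω (.mod (iv 23) (iv 10)) (x.modNat : ℕ) :=
        (IVal.scalar hx).natMod (.scalar (hs₃.mods hmw).s) hs0
      have hmw0 : Mods [23, 24] [20, 21, 22, 23, 24] υ ω :=
        (hm₀.mono (by simp) (by simp)).trans (hmw.mono (by simp) (by simp))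
      have hc := ieq_ok hdiv (hj31 hmw0 (by simp))
      have key : ∀ ω' : Mem, Mods [] [23] ω ω' →
          ω'.real 23 0 = (if x.divNat = j then 1 else 0) →
          ((iv 23).Ok E.M ω' ∧ (iv 23).den ω' = (0 + x : ℕ)) ∧ RVal E.M ω'
            (.add (.get 20 (iv 23))
              (.div (.mul (.sub (rv 23) (.get 21 (.div (iv 23) (iv 10))))
                (.get 22 (.mod (iv 23) (iv 10)))) (rv 24)))
            (K x.divNat x.modNat + ((if x.divNat = j then 1 else 0) -
              y x.divNat) * h x.modNat / ∑ c, h c * h c) := by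
        intro ω' hm' hv
        have hx' : IVal E.M ω' (iv 23) (x : ℕ) :=
          .scalar ((congrFun (hm'.int 23 (by simp)) 0).trans hx)
        have hs' : IVal E.M ω' (iv 10) E.s := .scalar (((hs₃.mods hmw).mods hm').s)
        refine ⟨hx'.congr (by simp), ((RVal.get hx' (x.2.trans_le hr5)).congr ?_).add
          ((((RVal.scalar hv).sub ((RVal.get (c := x.divNat) (hx'.natDiv hs' hs0)
            (x.divNat.2.trans_le hr6)).congr ?_)).mul
            ((RVal.get (c := x.modNat) (hx'.natMod hs' hs0)
            (x.modNat.2.trans_le hr7)).congr ?_)).div (.scalar ?_) hpos.ne')⟩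
        · rw [hm'.real 20 (by simp), h20 x (by simp), hm₀.real 20 (by simp)]
          exact hJ.at x
        · rw [hm'.real 21 (by simp), hmw.real 21 (by simp), hm₃.real 21 (by simp),
            hm₂.real 21 (by simp), hy₁]
        · rw [hm'.real 22 (by simp), hmw.real 22 (by simp), hm₃.real 22 (by simp), hh₂]
        · rw [hm'.real 24 (by simp), hmw.real 24 (by simp), hα₃]
      refine Runs.ite (e₁ := 1) one_pos hc.1 (fun hb => ?_) (fun hb => ?_)
      · rw [hc.2] at hb
        refine Runs.rset_scalar one_pos (by norm_num) (RVal.ofInt IVal.one).1 (by simp)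
          (key _ ((Mods.refl _ _ _).setReal (by simp) _ _) ?_)
        rw [if_pos (Fin.ext (by exact_mod_cast hb)), setReal_real_self]
        simp [RExpr.den, IExpr.den]
      · rw [hc.2] at hb
        refine Runs.rset_scalar one_pos (by norm_num) RVal.zero.1 (by simp)
          (key _ ((Mods.refl _ _ _).setReal (by simp) _ _) ?_)
        rw [if_neg fun h => hb (by rw [h]), setReal_real_self]
        simp [RExpr.den, IExpr.den]
    · refine matAt_of_forall fun x => ?_
      have := hf.1 x
      rw [zero_add] at this
      exact this
  · rw [hcond.2] at hpos
    rw [hstep, if_neg hpos]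
    refine Runs.skip one_pos ?_
    rw [hm₀.real 20 (by simp)]
    exact hJ

end SparseDict

namespace SparseDict

open RealRAM Machine

/-! ### Rows in sparse form -/

theorem digit_lt {b : ℕ} (hb : 0 < b) (N l : ℕ) : digit b N l < b := Nat.mod_lt _ hb

theorem digitCol_lt {k D e : ℕ} (h : e < k * (2 * D + 1)) : digitCol D e < k :=
  Nat.div_lt_of_lt_mul (by rwa [mul_comm])

theorem abs_digitVal_le (D e : ℕ) : |digitVal D e| ≤ (D : ℤ) := by
  have := Nat.mod_lt e (show 0 < 2 * D + 1 by omega)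
  rw [digitVal, abs_le]; omega

theorem exists_digits {b : ℕ} (hb : 0 < b) (n : ℕ) (f : ℕ → ℕ) (hf : ∀ l, f l < b) :
    ∃ N < b ^ n, ∀ l < n, digit b N l = f l := by
  induction n generalizing f with
  | zero => exact ⟨0, by simp, by simp⟩
  | succ n ih =>
    obtain ⟨N, hN, h⟩ := ih (fun l => f (l + 1)) fun l => hf _
    refine ⟨f 0 + b * N, ?_, fun l hl => ?_⟩
    · have := Nat.mul_le_mul_left b (show N + 1 ≤ b ^ n from hN)
      have := hf 0
      rw [pow_succ']; rw [mul_add] at *; omega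
    · cases l with
      | zero => simp [digit, Nat.mod_eq_of_lt (hf 0)]
      | succ l =>
        rw [digit, pow_succ', ← Nat.div_div_eq_div_mul, Nat.add_mul_div_left _ _ hb,
          Nat.div_eq_of_lt (hf 0), zero_add]
        exact h l (by omega)

/-- The inner product with a row in sparse form. -/
theorem sum_rowOf_mul {k r D N : ℕ} (hk : 0 < k) (y : Fin k → ℝ) :
    ∑ j, (rowOf k r D N j : ℝ) * y j = ∑ l : Fin r,
      (digitVal D (digit (k * (2 * D + 1)) N l) : ℝ) *
        y ⟨digitCol D (digit (k * (2 * D + 1)) N l),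
          digitCol_lt (digit_lt (Nat.mul_pos hk (by omega)) N l)⟩ := by
  simp only [rowOf, Int.cast_sum, Finset.sum_mul]
  rw [Finset.sum_comm]
  refine Finset.sum_congr rfl fun l _ => ?_
  rw [Finset.sum_eq_single ⟨digitCol D (digit (k * (2 * D + 1)) N l),
          digitCol_lt (digit_lt (Nat.mul_pos hk (by omega)) N l)⟩]
  · simp
  · intro j _ hj
    rw [if_neg fun h => hj (Fin.ext h.symm)]; simp
  · simp

/-- Every row with at most `r` non-zero entries in `{-D, …, D}` has a number. -/
theorem exists_rowOf_eq {k r D : ℕ} (hk : 0 < k) (x : Fin k → ℤ)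
    (hr : (Finset.univ.filter fun j => x j ≠ 0).card ≤ r) (hx : ∀ j, |x j| ≤ (D : ℤ)) :
    ∃ N < (k * (2 * D + 1)) ^ r, ∀ j, rowOf k r D N j = x j := by
  classical
  set S := Finset.univ.filter fun j => x j ≠ 0 with hS
  set φ := S.equivFin
  let f : ℕ → ℕ := fun l => if h : l < S.card then
    (φ.symm ⟨l, h⟩ : Fin k) * (2 * D + 1) + (x (φ.symm ⟨l, h⟩) + D).toNat else D
  have hxb : ∀ j, (x j + D).toNat < 2 * D + 1 := fun j => by
    have := abs_le.1 (hx j); omega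
  have hf : ∀ l, f l < k * (2 * D + 1) := by
    intro l
    by_cases h : l < S.card
    · simp only [f, h, dite_true]
      exact mul_add_lt (Fin.is_lt _) (hxb _)
    · simp only [f, h, dite_false]
      have := Nat.mul_le_mul_right (2 * D + 1) hk
      omega
  obtain ⟨N, hN, hd⟩ := exists_digits (Nat.mul_pos hk (by omega)) r f hf
  refine ⟨N, hN, fun j => ?_⟩
  have hcol : ∀ l (h : l < S.card), digitCol D (f l) = (φ.symm ⟨l, h⟩ : Fin k) := by
    intro l h
    simp only [f, h, dite_true, digitCol]
    rw [mul_comm, Nat.mul_add_div (by omega), Nat.div_eq_of_lt (hxb _), add_zero]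
  have hval : ∀ l (h : l < S.card), digitVal D (f l) = x (φ.symm ⟨l, h⟩) := by
    intro l h
    simp only [f, h, dite_true, digitVal]
    rw [mul_comm, Nat.mul_add_mod, Nat.mod_eq_of_lt (hxb _)]
    have := abs_le.1 (hx (φ.symm ⟨l, h⟩)); omega
  have hval0 : ∀ l, ¬ l < S.card → digitVal D (f l) = 0 := by
    intro l h
    simp only [f, h, dite_false, digitVal]
    rw [Nat.mod_eq_of_lt (by omega)]; simp
  rw [rowOf]
  by_cases hj : x j = 0
  · rw [hj]
    refine Finset.sum_eq_zero fun l _ => ?_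
    rw [hd l l.2]
    split_ifs with h
    · by_cases hl : (l : ℕ) < S.card
      · rw [hval _ hl]
        rw [hcol _ hl] at h
        rw [Fin.ext h, hj]
      · exact hval0 _ hl
    · rfl
  · have hjS : j ∈ S := by simp [hS, hj]
    have hl₀ := (φ ⟨j, hjS⟩).2
    have hφ : φ.symm ⟨(φ ⟨j, hjS⟩ : ℕ), hl₀⟩ = ⟨j, hjS⟩ := by simp
    rw [Finset.sum_eq_single ⟨φ ⟨j, hjS⟩, hl₀.trans_le hr⟩]
    · simp only
      rw [hd _ (hl₀.trans_le hr), hcol _ hl₀, hval _ hl₀, hφ]; simp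
    · intro l _ hl
      rw [hd l l.2]
      by_cases hlS : (l : ℕ) < S.card
      · rw [hcol _ hlS, if_neg]
        intro h
        apply hl
        have h2 : φ.symm ⟨l, hlS⟩ = ⟨j, hjS⟩ := Subtype.ext (Fin.ext h)
        have h3 := congrArg φ h2
        rw [Equiv.apply_symm_apply] at h3
        ext
        simp only [← h3]
      · rw [hval0 _ hlS]; simp
    · simp

/-! ### Parts of the search program -/

/-- `2 D + 1`. -/
def twoD : IExpr := .add (.add (iv 4) (iv 4)) (.const 1)

/-- The column index of a digit. -/
def colE (e : IExpr) : IExpr := .div e twoD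

/-- The value of a digit. -/
def valE (e : IExpr) : IExpr := .sub (.mod e twoD) (iv 4)

namespace Env.Static

variable {E : Env} {σ : Mem}

theorem twoD (h : E.Static σ) : IVal E.M σ twoD ((2 * E.D + 1 : ℕ) : ℤ) :=
  (((IVal.scalar h.D).natAdd (.scalar h.D)).natAdd .one).congr (by push_cast; ring)

theorem colE (h : E.Static σ) {e : IExpr} {x : ℕ} (he : IVal E.M σ e x) :
    IVal E.M σ (colE e) (digitCol E.D x : ℕ) := he.natDiv h.twoD (by omega)

theorem valE (h : E.Static σ) {e : IExpr} {x : ℕ} (he : IVal E.M σ e x) :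
    IVal E.M σ (valE e) (digitVal E.D x) := (he.natMod h.twoD (by omega)).sub (.scalar h.D)

end Env.Static

theorem Mods.cell {I R : List ℕ} {σ τ : Mem} (h : Mods I R σ τ) {a c : ℕ} {v : ℤ}
    (hv : σ.int a c = v) (ha : a ∉ I := by simp) : τ.int a c = v := by rw [h.int a ha, hv]

/-- Compute the dictionary for the current left factor. -/
def dictCmd : Cmd :=
  Cmd.fillReal 23 (.mul (iv 2) (iv 1)) 25 (iv 23)
    (Cmd.sumN 24 (iv 10) 23 (.ofInt (.const 0)) .skip
      (.mul (.get 20 (ix2 (.div (iv 23) (iv 1)) (iv 10) (iv 24)))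
        (.get 6 (ix2 (iv 24) (iv 1) (.mod (iv 23) (iv 1)))))) (rv 23)

theorem dictCmd_spec (E : Env) {σ : Mem} (hσ : E.Static σ) {A : Matrix (Fin E.k) (Fin E.s) ℝ}
    (hA : MatAt (σ.real 20) A) :
    E.M.Runs 1 [23, 24] [23, 25] dictCmd σ 11 fun τ => MatAt (τ.real 25) (A * E.SA) := by
  obtain ⟨hV1, hV2, hV3, hV4, hV5, hV6, hV7, hV8, hV9, hV10, hV11, hV12, hV13, hV14, hV15, hV16,
    hV17, hV18⟩ := E.le_V
  obtain ⟨hr1, hr2, hr3, hr4, hr5, hr6, hr7, hr8, hr9, hr10, hr11, hr12, hr13⟩ := E.rsz_le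
  refine (Runs.fillReal (I' := [24]) (R' := [23]) (e₁ := 6) one_pos 0
    (fun x : Fin (E.k * E.d) => ∑ c, A x.divNat c * E.SA c x.modNat) (by omega) hV2
    (fun τ hm => (IVal.scalar (hσ.mods hm).k).natMul (.scalar (hσ.mods hm).d))
    (fun x τ _ hm hx _ =>
    (Runs.sumN (I' := []) (R' := []) (e₁ := 0) one_pos
      (fun c => A x.divNat c * E.SA c x.modNat) hV14
      (fun υ hu => IVal.scalar ((hσ.mods hm).mods hu).s) RVal.zero.1
      (fun c υ _ hu hy => Runs.skip one_pos ?_)).imp fun υ hu h => ?_)).imp fun τ _ h => ?_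
  · have hd : 0 < E.d := Fin.pos_of_mul x
    have hs := (hσ.mods hm).mods hu
    have hx' : IVal E.M υ (iv 23) (x : ℕ) := .scalar (Mods.cell hu hx)
    refine ((RVal.get ((hx'.natDiv (.scalar hs.d) hd).ix2 (.scalar hs.s) (.scalar hy))
      ((mul_add_lt x.divNat.2 c.2).trans_le hr5)).congr ?_).mul
      ((RVal.get ((IVal.scalar hy).ix2 (.scalar hs.d) (hx'.natMod (.scalar hs.d) hd))
      ((mul_add_lt c.2 x.modNat.2).trans_le hr2)).congr ?_)
    · rw [hu.real 20 (by simp), hm.real 20 (by simp)]; exact hA x.divNat c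
    · exact hs.SA c x.modNat
  · rw [den_zero, zero_add] at h
    exact ⟨(IVal.scalar (Mods.cell hu hx)).congr (by simp), RVal.scalar h⟩
  · refine matAt_of_forall fun x => ?_
    have := h.1 x
    rw [zero_add] at this
    exact this

/-- Compute the sketch of the current dictionary. -/
def sketchCmd (gT : Cmd) : Cmd :=
  Cmd.fillReal 23 (.mul (iv 2) (iv 11)) 26 (iv 23)
    (Cmd.sumN 24 (iv 1) 23 (.ofInt (.const 0))
      (.seq (.iset 36 (.const 0) (iv 24)) (.seq (.iset 37 (.const 0) (.mod (iv 23) (iv 11))) gT))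
      (.mul (.get 25 (ix2 (.div (iv 23) (iv 11)) (iv 1) (iv 24))) (rv 32))) (rv 23)

theorem sketchCmd_spec (E : Env) {σ : Mem} (hσ : E.Static σ) {Y : Matrix (Fin E.k) (Fin E.d) ℝ}
    (hY : MatAt (σ.real 25) Y) :
    E.M.Runs 1 [23, 24, 36, 37, 38, 39, 40, 41, 42, 43] [23, 26, 32] (sketchCmd E.gT) σ 27
      fun τ => MatAt (τ.real 26) (Y * E.T) := by
  obtain ⟨hV1, hV2, hV3, hV4, hV5, hV6, hV7, hV8, hV9, hV10, hV11, hV12, hV13, hV14, hV15, hV16,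
    hV17, hV18⟩ := E.le_V
  obtain ⟨hr1, hr2, hr3, hr4, hr5, hr6, hr7, hr8, hr9, hr10, hr11, hr12, hr13⟩ := E.rsz_le
  refine (Runs.fillReal (I' := [24, 36, 37, 38, 39, 40, 41, 42, 43]) (R' := [23, 32]) (e₁ := 22)
    one_pos 0 (fun x : Fin (E.k * (E.qT * E.G)) => ∑ c, Y x.divNat c * E.T c x.modNat) (by omega)
    hV3 (fun τ hm => (IVal.scalar (hσ.mods hm).k).natMul (.scalar (hσ.mods hm).t))
    (fun x τ _ hm hx _ =>
    (Runs.sumN (I' := [36, 37, 38, 39, 40, 41, 42, 43]) (R' := [32]) (e₁ := 16) one_pos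
      (fun c => Y x.divNat c * E.T c x.modNat) hV12
      (fun υ hu => IVal.scalar ((hσ.mods hm).mods hu).d) RVal.zero.1
      (fun c υ _ hu hy => ?_)).imp fun υ hu h => ?_)).imp fun τ _ h => ?_
  · have ht : 0 < E.qT * E.G := Fin.pos_of_mul x
    have hs := (hσ.mods hm).mods hu
    have hc : |υ.int 24 0| ≤ E.M.V := by rw [hy, Nat.abs_cast]; exact_mod_cast (c.2.le.trans hV12)
    refine Runs.seq (I₁ := [36]) (R₁ := []) (I₂ := [37, 38, 39, 40, 41, 42, 43]) (R₂ := [32])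
      (e₁ := 0) (e₂ := 15) (Q₁ := fun ω => ω.int 36 0 = (c : ℕ))
      (Runs.iset_scalar one_pos (by norm_num) (by simp) (by simp) (by simpa using hc) (by simp)
        (by simpa using hy)) ?_
    intro ω hω hmw h36
    have hmod : IVal E.M ω (.mod (iv 23) (iv 11)) (x.modNat : ℕ) :=
      (IVal.scalar (Mods.cell hmw (Mods.cell hu hx))).natMod (.scalar (hs.mods hmw).t) ht
    refine Runs.seq (I₁ := [37]) (R₁ := []) (I₂ := [38, 39, 40, 41, 42, 43]) (R₂ := [32])
      (e₁ := 0) (e₂ := 14) (Q₁ := fun ω => ω.int 37 0 = (x.modNat : ℕ))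
      (Runs.iset_scalar one_pos (by norm_num) hmod.1 (by decide) ?_ (by simp)
        (by rw [setInt_int_self]; exact hmod.2)) ?_
    · rw [hmod.2, Nat.abs_cast]; exact_mod_cast (x.modNat.2.le.trans hV9)
    intro ω' hω' hmw' h37
    refine (E.gT_spec ω' ((hs.mods hmw).mods hmw').inv c x.modNat (Mods.cell hmw' h36) h37).imp
      fun ω'' hm'' h32 => ?_
    have hs'' := ((hs.mods hmw).mods hmw').mods hm''
    have hx'' : IVal E.M ω'' (iv 23) (x : ℕ) :=
      .scalar (Mods.cell hm'' (Mods.cell hmw' (Mods.cell hmw (Mods.cell hu hx))))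
    refine ((RVal.get ((hx''.natDiv (.scalar hs''.t) ht).ix2 (.scalar hs''.d)
      (.scalar (Mods.cell hm'' (Mods.cell hmw' (Mods.cell hmw hy)))))
      ((mul_add_lt x.divNat.2 c.2).trans_le hr8)).congr ?_).mul (.scalar h32)
    rw [hm''.real 25 (by simp), hmw'.real 25 (by simp), hmw.real 25 (by simp),
      hu.real 25 (by simp), hm.real 25 (by simp)]
    exact hY x.divNat c
  · rw [den_zero, zero_add] at h
    exact ⟨(IVal.scalar (Mods.cell hu hx)).congr (by simp), RVal.scalar h⟩
  · refine matAt_of_forall fun x => ?_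
    have := h.1 x
    rw [zero_add] at this
    exact this

/-- Compute the sketch of the residual of the current row. -/
def rowResCmd : Cmd :=
  Cmd.fillReal 23 (iv 11) 27 (iv 23)
    (Cmd.sumN 24 (iv 3) 23 (.sub (.ofInt (.const 0)) (.get 7 (ix2 (iv 32) (iv 11) (iv 23)))) .skip
      (.mul (.ofInt (valE (.get 21 (iv 24))))
        (.get 26 (ix2 (colE (.get 21 (iv 24))) (iv 11) (iv 23))))) (rv 23)

theorem rowResCmd_spec (E : Env) {σ : Mem} (hσ : E.Static σ)
    {YT : Matrix (Fin E.k) (Fin (E.qT * E.G)) ℝ} (hY : MatAt (σ.real 26) YT) {i : Fin E.n}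
    (hi : σ.int 32 0 = (i : ℕ)) {N : ℕ}
    (hN : Digits (E.k * (2 * E.D + 1)) E.r N (σ.int 21)) :
    E.M.Runs 1 [23, 24] [23, 27] rowResCmd σ 11
      fun τ => ∀ c : Fin (E.qT * E.G), τ.real 27 c = rowRes E.r E.D YT (E.AT i) N c := by
  obtain ⟨hV1, hV2, hV3, hV4, hV5, hV6, hV7, hV8, hV9, hV10, hV11, hV12, hV13, hV14, hV15, hV16,
    hV17, hV18⟩ := E.le_V
  obtain ⟨hr1, hr2, hr3, hr4, hr5, hr6, hr7, hr8, hr9, hr10, hr11, hr12, hr13⟩ := E.rsz_le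
  have hb : 0 < E.k * (2 * E.D + 1) := Nat.mul_pos E.k_pos (by omega)
  have hinit : ∀ {τ : Mem}, Mods [23, 24] [23, 27] σ τ → ∀ {c : Fin (E.qT * E.G)},
      τ.int 23 0 = (c : ℕ) → RVal E.M τ
      (.sub (.ofInt (.const 0)) (.get 7 (ix2 (iv 32) (iv 11) (iv 23)))) (0 - E.AT i c) :=
    fun {τ} hm {c} hx => RVal.zero.sub ((RVal.get ((IVal.scalar (Mods.cell hm hi)).ix2
      (.scalar (hσ.mods hm).t) (.scalar hx)) ((mul_add_lt i.2 c.2).trans_le hr3)).congr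
      ((hσ.mods hm).AT i c))
  refine (Runs.fillReal (I' := [24]) (R' := [23]) (e₁ := 6) one_pos 0
    (fun c => rowRes E.r E.D YT (E.AT i) N c) (by omega) hV9
    (fun τ hm => IVal.scalar (hσ.mods hm).t) (fun c τ _ hm hx _ =>
    (Runs.sumN (I' := []) (R' := []) (e₁ := 0) one_pos
      (fun l : Fin E.r => (digitVal E.D (digit (E.k * (2 * E.D + 1)) N l) : ℝ) *
        YT ⟨digitCol E.D (digit (E.k * (2 * E.D + 1)) N l), digitCol_lt (digit_lt hb N l)⟩ c) hV18
      (fun υ hu => IVal.scalar ((hσ.mods hm).mods hu).r) (hinit hm hx).1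
      (fun l υ _ hu hy => Runs.skip one_pos ?_)).imp fun υ hu h => ?_)).imp fun τ _ h => ?_
  · have hs := (hσ.mods hm).mods hu
    have he : IVal E.M υ (.get 21 (iv 24)) (digit (E.k * (2 * E.D + 1)) N l : ℕ) :=
      ((IVal.scalar hy).get (l.2.trans_le E.isz_le.2.2.2.1)).congr
        (by rw [hu.int 21 (by simp), hm.int 21 (by simp)]; exact hN l l.2)
    refine (RVal.ofInt (hs.valE he)).mul ((RVal.get ((hs.colE he).ix2 (.scalar hs.t)
      (.scalar (Mods.cell hu hx)))
      ((mul_add_lt (digitCol_lt (digit_lt hb N l)) c.2).trans_le hr9)).congr ?_)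
    rw [hu.real 26 (by simp), hm.real 26 (by simp)]
    exact hY ⟨_, digitCol_lt (digit_lt hb N l)⟩ c
  · refine ⟨(IVal.scalar (Mods.cell hu hx)).congr (by simp), RVal.scalar (h.trans ?_)⟩
    rw [(hinit hm hx).2, rowRes, sum_rowOf_mul E.k_pos (fun j => YT j c)]; ring
  · have := h.1
    simpa using this

/-- Set the flag in array `35` if the current row is valid. -/
def validCmd : Cmd :=
  .seq (.iset 35 (.const 0) (.const 1))
    (Cmd.forN 23 (iv 2)
      (.seq (.iset 34 (.const 0) (.const 0))
        (.seq (Cmd.forN 24 (iv 3)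
            (.ite (.ieq (colE (.get 21 (iv 24))) (iv 23))
              (.iset 34 (.const 0) (.add (iv 34) (valE (.get 21 (iv 24))))) .skip))
          (.ite (.or (.ilt (iv 4) (iv 34)) (.ilt (iv 34) (.sub (.const 0) (iv 4))))
            (.iset 35 (.const 0) (.const 0)) .skip))))

open Classical in
theorem validCmd_spec (E : Env) {σ : Mem} (hσ : E.Static σ) {N : ℕ}
    (hN : Digits (E.k * (2 * E.D + 1)) E.r N (σ.int 21)) :
    E.M.Runs 1 [23, 24, 34, 35] [] validCmd σ 12
      fun τ => τ.int 35 0 = if RowValid E.k E.r E.D N then 1 else 0 := by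
  obtain ⟨hV1, hV2, hV3, hV4, hV5, hV6, hV7, hV8, hV9, hV10, hV11, hV12, hV13, hV14, hV15, hV16,
    hV17, hV18⟩ := E.le_V
  have hV := E.M.four_le
  refine Runs.seq (I₁ := [35]) (R₁ := []) (I₂ := [23, 24, 34, 35]) (R₂ := []) (e₁ := 0) (e₂ := 11)
    (Q₁ := fun τ => τ.int 35 0 = 1) (Runs.iset_scalar one_pos (by norm_num) (by simp [IExpr.Ok])
      (by simp [IExpr.size]) (by simp [IExpr.den]; omega) (by simp) (by simp [IExpr.den])) ?_
  intro τ hτ hm h35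
  have hst := hσ.mods hm
  refine (Runs.forN (I' := [24, 34, 35]) (e₁ := 7) one_pos E.k (fun i υ => υ.int 35 0 =
    if ∀ j : Fin E.k, (j : ℕ) < i → |rowOf E.k E.r E.D N j| ≤ (E.D : ℤ) then 1 else 0) hV13
    (fun υ hu => IVal.scalar (hst.mods hu).k) (by simp) (by simpa using h35) ?_).imp ?_
  swap
  · intro υ _ h
    by_cases hv : RowValid E.k E.r E.D N
    · rw [if_pos hv, h, if_pos fun j _ => hv j]
    · rw [if_neg hv, h, if_neg fun h' => hv fun j => h' j j.2]
  intro i υ hi hbu hu hxu hJ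
  have hsu := hst.mods hu
  obtain ⟨g, hg⟩ : ∃ g : ℕ → ℤ, g = fun l =>
    if digitCol E.D (digit (E.k * (2 * E.D + 1)) N l) = i then
      digitVal E.D (digit (E.k * (2 * E.D + 1)) N l) else 0 := ⟨_, rfl⟩
  have hgb : ∀ l, |g l| ≤ (E.D : ℤ) := fun l => by
    rw [hg]; simp only
    split_ifs
    · exact abs_digitVal_le _ _
    · simp
  have hgs : ∀ m ≤ E.r, |∑ l ∈ Finset.range m, g l| ≤ (E.M.V : ℤ) := fun m hm => by
    refine (Finset.abs_sum_le_sum_abs _ _).trans ((Finset.sum_le_sum fun l _ => hgb l).trans ?_)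
    rw [Finset.sum_const, Finset.card_range, nsmul_eq_mul]
    exact_mod_cast (Nat.mul_le_mul_right _ hm).trans hV6
  have hrow : rowOf E.k E.r E.D N ⟨i, hi⟩ = ∑ l ∈ Finset.range E.r, g l := by
    rw [rowOf, Finset.sum_range, hg]
  refine Runs.seq (I₁ := [34]) (R₁ := []) (I₂ := [24, 34, 35]) (R₂ := []) (e₁ := 0) (e₂ := 6)
    (Q₁ := fun τ => τ.int 34 0 = 0) (Runs.iset_scalar one_pos (by norm_num) (by simp [IExpr.Ok])
      (by simp [IExpr.size]) (by simp [IExpr.den]) (by simp) (by simp [IExpr.den])) ?_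
  intro ω hω hmw h34
  have hsw := hsu.mods hmw
  refine Runs.seq (I₁ := [24, 34]) (R₁ := []) (I₂ := [35]) (R₂ := []) (e₁ := 5) (e₂ := 1)
    (Runs.forN (I' := [34]) (e₁ := 1) one_pos E.r
      (fun m ω => ω.int 34 0 = ∑ l ∈ Finset.range m, g l) hV18
      (fun υ hu => IVal.scalar (hsw.mods hu).r) (by simp) (by simpa using h34) ?_) ?_
  · intro l ω' hl hbw hmw' hyw hJ'
    have hs' := hsw.mods hmw'
    have he : IVal E.M ω' (.get 21 (iv 24)) (digit (E.k * (2 * E.D + 1)) N l : ℕ) :=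
      ((IVal.scalar hyw).get (hl.trans_le E.isz_le.2.2.2.1)).congr
        (by rw [hmw'.int 21 (by simp), hmw.int 21 (by simp), hu.int 21 (by simp),
          hm.int 21 (by simp)]; exact hN l hl)
    have hx' : IVal E.M ω' (iv 23) (i : ℕ) := .scalar (Mods.cell hmw' (Mods.cell hmw hxu))
    have hc := ieq_ok (hs'.colE he) hx'
    have hgl := hgs (l + 1) hl
    rw [Finset.sum_range_succ] at hgl
    refine Runs.ite (e₁ := 0) one_pos hc.1 (fun h => ?_) (fun h => ?_)
    · rw [hc.2] at h
      have hgl' : g l = digitVal E.D (digit (E.k * (2 * E.D + 1)) N l) := by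
        rw [hg]; exact if_pos (by exact_mod_cast h)
      have hv := (IVal.scalar (M := E.M) hJ').add (hs'.valE he)
      rw [← hgl'] at hv
      refine Runs.iset_scalar one_pos (by norm_num) hv.1 (by decide) (by rw [hv.2]; exact hgl)
        (by simp) ?_
      rw [setInt_int_self, hv.2, Finset.sum_range_succ]
    · rw [hc.2] at h
      have hgl' : g l = 0 := by
        rw [hg]; exact if_neg (by exact_mod_cast h)
      refine Runs.skip one_pos ?_
      rw [hJ', Finset.sum_range_succ, hgl', add_zero]
  intro ω' hω' hmw' h34'
  have hs' := hsw.mods hmw'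
  rw [← hrow] at h34'
  have h35' : ω'.int 35 0 = _ := Mods.cell hmw' (Mods.cell hmw hJ)
  have hc := or_ok (ilt_ok (IVal.scalar (M := E.M) hs'.D) (.scalar h34'))
    (ilt_ok (IVal.scalar (M := E.M) h34') (IVal.zero.sub (.scalar hs'.D)))
  have hall : (∀ j : Fin E.k, (j : ℕ) < i + 1 → |rowOf E.k E.r E.D N j| ≤ (E.D : ℤ)) ↔
      (∀ j : Fin E.k, (j : ℕ) < i → |rowOf E.k E.r E.D N j| ≤ (E.D : ℤ)) ∧
        |rowOf E.k E.r E.D N ⟨i, hi⟩| ≤ (E.D : ℤ) := by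
    constructor
    · exact fun h => ⟨fun j hj => h j (by omega), h _ (by simp)⟩
    · rintro ⟨h1, h2⟩ j hj
      rcases Nat.lt_succ_iff_lt_or_eq.1 hj with h | h
      · exact h1 j h
      · have : j = ⟨i, hi⟩ := Fin.ext h
        rw [this]; exact h2
  refine Runs.ite (e₁ := 0) one_pos hc.1 (fun h => ?_) (fun h => ?_)
  · rw [hc.2] at h
    refine Runs.iset_scalar one_pos (by norm_num) (by simp [IExpr.Ok]) (by simp [IExpr.size])
      (by simp [IExpr.den]) (by simp) ?_
    rw [setInt_int_self, if_neg]
    · rfl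
    · rw [hall, abs_le]; push_cast at h; omega
  · rw [hc.2] at h
    refine Runs.skip one_pos ?_
    rw [h35']
    have : |rowOf E.k E.r E.D N ⟨i, hi⟩| ≤ (E.D : ℤ) := by
      rw [abs_le]; push_cast at h; omega
    simp only [hall, this, and_true]

end SparseDict

namespace SparseDict

open RealRAM Machine

/-- Compute the median of the sums of squares over the groups of the array `27`; the number of
groups is in array `33`. -/
def medCmd : Cmd :=
  .seq (Cmd.fillReal 23 (iv 33) 28 (iv 23)
      (Cmd.sumN 24 (iv 13) 23 (.ofInt (.const 0)) .skip
        (.mul (.get 27 (ix2 (iv 23) (iv 13) (iv 24))) (.get 27 (ix2 (iv 23) (iv 13) (iv 24)))))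
      (rv 23))
    (.seq (.rset 29 (.const 0) (.ofInt (.const (-1))))
      (Cmd.forN 23 (iv 33)
        (.seq (.iset 34 (.const 0) (.const 0))
          (.seq (Cmd.forN 24 (iv 33)
              (.ite (.rlt (.get 28 (iv 23)) (.get 28 (iv 24))) .skip
                (.iset 34 (.const 0) (.add (iv 34) (.const 1)))))
            (.ite (.and (.ilt (iv 33) (.add (iv 34) (iv 34)))
                (.or (.rlt (rv 29) (.ofInt (.const 0))) (.rlt (.get 28 (iv 23)) (rv 29))))
              (.rset 29 (.const 0) (.get 28 (iv 23))) .skip)))))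

theorem medCmd_spec (E : Env) {σ : Mem} (hσ : E.Static σ) {q : ℕ} (hq : 0 < q)
    (hq33 : σ.int 33 0 = q) (hqV : q ≤ E.M.V) (hq27 : q * E.G ≤ E.M.rsz 27)
    (hq28 : q ≤ E.M.rsz 28) {x : Fin (q * E.G) → ℝ} (hx : ∀ c : Fin (q * E.G), σ.real 27 c = x c) :
    E.M.Runs 1 [23, 24, 34] [23, 28, 29] medCmd σ 14 fun τ => τ.real 29 0 = est x := by
  classical
  have hVG : E.G ≤ E.M.V := E.le_V.2.2.2.2.2.2.2.2.2.2.2.2.2.2.1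
  have hV := E.M.four_le
  refine Runs.seq (Runs.fillReal (I := [23, 24]) (R := [23, 28]) (I' := [24]) (R' := [23]) (e := 11)
    (e₁ := 6) one_pos 0 (groupSq x) (by omega) hqV
    (fun τ hm => IVal.scalar (Mods.cell hm hq33)) (fun l τ _ hm hl _ =>
    (Runs.sumN (I' := []) (R' := []) (e₁ := 0) one_pos
      (fun g : Fin E.G => x (finProdFinEquiv (l, g)) ^ 2) hVG
      (fun υ hu => IVal.scalar ((hσ.mods hm).mods hu).G) RVal.zero.1
      (fun g υ _ hu hy => Runs.skip one_pos ?_)).imp fun υ hu h => ?_))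
    (I₂ := [23, 24, 34]) (R₂ := [29]) (e₂ := 13) ?_
  · have hs := (hσ.mods hm).mods hu
    have hv : RVal E.M υ (.get 27 (ix2 (iv 23) (iv 13) (iv 24))) (x (finProdFinEquiv (l, g))) := by
      refine (RVal.get ((IVal.scalar (Mods.cell hu hl)).ix2 (.scalar hs.G) (.scalar hy))
        ((mul_add_lt l.2 g.2).trans_le hq27)).congr ?_
      rw [hu.real 27 (by simp), hm.real 27 (by simp), ← hx]
      congr 1
      simp [finProdFinEquiv]; ring
    exact (hv.mul hv).congr (by ring)
  · rw [den_zero, zero_add] at h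
    exact ⟨(IVal.scalar (Mods.cell hu hl)).congr (by simp), RVal.scalar h⟩
  rintro τ hτ hm ⟨hv, -⟩
  simp only [zero_add] at hv
  obtain ⟨v, hvx⟩ : ∃ v, v = groupSq x := ⟨_, rfl⟩
  have hest : est x = med v := by rw [hvx]; rfl
  rw [← hvx] at hv
  rw [hest]
  have hv0 : ∀ l, 0 ≤ v l := fun l => by
    rw [hvx]; exact Finset.sum_nonneg fun g _ => sq_nonneg _
  have hst := hσ.mods hm
  refine Runs.seq (I₁ := []) (R₁ := [29]) (I₂ := [23, 24, 34]) (R₂ := [29]) (e₁ := 0) (e₂ := 12)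
    (Q₁ := fun τ => τ.real 29 0 = -1) (Runs.rset_scalar one_pos (by norm_num)
      (RVal.ofInt (IVal.const (by norm_num))).1 (by simp) (by simp [RExpr.den, IExpr.den])) ?_
  intro τ' hτ' hm' h29
  refine (Runs.forN (I' := [24, 34]) (e₁ := 7) one_pos q (fun i υ =>
    (∀ l : Fin q, (l : ℕ) < i → q < 2 * rank v l → 0 ≤ υ.real 29 0 ∧ υ.real 29 0 ≤ v l) ∧
      (υ.real 29 0 = -1 ∨ ∃ l, v l = υ.real 29 0 ∧ q < 2 * rank v l)) hqV
    (fun υ hu => IVal.scalar (Mods.cell hu (Mods.cell hm' (Mods.cell hm hq33)))) (by simp)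
    ⟨by simp, Or.inl h29⟩ ?_).imp ?_
  swap
  · rintro υ _ ⟨h1, h2⟩
    have h1' : ∀ l, q < 2 * rank v l → 0 ≤ υ.real 29 0 ∧ υ.real 29 0 ≤ v l := fun l => h1 l l.2
    refine IsMed.unique ⟨?_, fun l hl => (h1' l hl).2⟩ (isMed_med hq v)
    rcases h2 with h2 | h2
    · obtain ⟨l, -, hl⟩ := (isMed_med hq v).1
      have := (h1' l hl).1
      rw [h2] at this; norm_num at this
    · exact h2
  rintro i υ hi hbu hu hxu ⟨hJ1, hJ2⟩
  have hv28 : ∀ {I R : List ℕ} {ω : Mem}, Mods I R υ ω → 28 ∉ R → ∀ {e : IExpr} {l : Fin q},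
      IVal E.M ω e (l : ℕ) → e.size ≤ 24 → RVal E.M ω (.get 28 e) (v l) := by
    intro I R ω hmw h28 e l he hes
    exact (RVal.get he (l.2.trans_le hq28) hes).congr (by
      rw [hmw.real 28 h28, hu.real 28 (by simp), hm'.real 28 (by simp), hv])
  have hq' : υ.int 33 0 = q := Mods.cell hu (Mods.cell hm' (Mods.cell hm hq33))
  obtain ⟨l, hl⟩ : ∃ l : Fin q, l = ⟨i, hi⟩ := ⟨_, rfl⟩
  replace hxu : υ.int 23 0 = (l : ℕ) := by rw [hxu, hl]
  refine Runs.seq (I₁ := [34]) (R₁ := []) (I₂ := [24, 34]) (R₂ := [29]) (e₁ := 0) (e₂ := 6)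
    (Q₁ := fun τ => τ.int 34 0 = 0) (Runs.iset_scalar one_pos (by norm_num) (by simp [IExpr.Ok])
      (by simp [IExpr.size]) (by simp [IExpr.den]) (by simp) (by simp [IExpr.den])) ?_
  intro ω hω hmw h34
  refine Runs.seq (I₁ := [24, 34]) (R₁ := []) (I₂ := []) (R₂ := [29]) (e₁ := 5) (e₂ := 1)
    (Q₁ := fun ω => ω.int 34 0 = rank v l)
    ((Runs.forN (I' := [34]) (e₁ := 1) one_pos q
      (fun m ω => ω.int 34 0 = ((Finset.univ.filter fun l' : Fin q => (l' : ℕ) < m ∧ v l' ≤ v l).card : ℕ))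
      hqV (fun υ hu => IVal.scalar (Mods.cell hu (Mods.cell hmw hq'))) (by simp)
      (by simpa using h34) ?_).imp ?_) ?_
  · intro m ω' hlm hbw hmw' hyw hJ'
    have hmm : Mods [24, 34] [] υ ω' := (hmw.mono (by simp) (by simp)).trans hmw'
    have hc := rlt_ok (hv28 hmm (by simp) (IVal.scalar (Mods.cell hmm hxu)) (by decide))
      (hv28 hmm (by simp) (l := ⟨m, hlm⟩) (IVal.scalar hyw) (by decide))
    have hsplit : (Finset.univ.filter fun l' : Fin q => (l' : ℕ) < m + 1 ∧ v l' ≤ v l).card =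
        (Finset.univ.filter fun l' : Fin q => (l' : ℕ) < m ∧ v l' ≤ v l).card +
          if v ⟨m, hlm⟩ ≤ v l then 1 else 0 := by
      split_ifs with h
      · rw [← Finset.card_insert_of_notMem (a := (⟨m, hlm⟩ : Fin q)) (by simp)]
        congr 1
        ext l'
        simp only [Finset.mem_filter, Finset.mem_univ, true_and, Finset.mem_insert, Fin.ext_iff]
        constructor
        · rintro ⟨h1, h2⟩
          by_cases h3 : (l' : ℕ) = m
          · exact Or.inl h3
          · exact Or.inr ⟨by omega, h2⟩
        · rintro (h1 | ⟨h1, h2⟩)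
          · have : l' = ⟨m, hlm⟩ := Fin.ext h1
            subst this; exact ⟨by simp, h⟩
          · exact ⟨by omega, h2⟩
      · rw [add_zero]
        congr 1
        ext l'
        simp only [Finset.mem_filter, Finset.mem_univ, true_and]
        constructor
        · rintro ⟨h1, h2⟩
          refine ⟨?_, h2⟩
          rcases Nat.lt_succ_iff_lt_or_eq.1 h1 with h3 | h3
          · exact h3
          · have : l' = ⟨m, hlm⟩ := Fin.ext h3
            subst this; exact absurd h2 h
        · rintro ⟨h1, h2⟩
          exact ⟨by omega, h2⟩
    refine Runs.ite (e₁ := 0) one_pos hc.1 (fun h => ?_) (fun h => ?_)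
    · rw [hc.2] at h
      refine Runs.skip one_pos ?_
      rw [hJ', hsplit, if_neg (not_le.2 h), add_zero]
    · rw [hc.2, not_lt] at h
      have hval := (IVal.scalar (M := E.M) hJ').natAdd IVal.one
      refine Runs.iset_scalar one_pos (by norm_num) hval.1 (by decide) ?_ (by simp) ?_
      · rw [hval.2, Nat.abs_cast]
        have : (Finset.univ.filter fun l' : Fin q => (l' : ℕ) < m + 1 ∧ v l' ≤ v l).card ≤ q := by
          simpa using Finset.card_le_univ (Finset.univ.filter fun l' : Fin q => (l' : ℕ) < m + 1 ∧ v l' ≤ v l)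
        rw [hsplit, if_pos h] at this
        exact_mod_cast this.trans hqV
      · rw [setInt_int_self, hval.2, hsplit, if_pos h]
  · intro ω' _ h
    rw [h, rank]
    simp
  intro ω' hω' hmw' h34'
  have hmm : Mods [24, 34] [] υ ω' := (hmw.mono (by simp) (by simp)).trans hmw'
  have hvl := hv28 hmm (by simp) (IVal.scalar (Mods.cell hmm hxu)) (by decide)
  have h29' : ω'.real 29 0 = υ.real 29 0 := by rw [hmm.real 29 (by simp)]
  have hc := and_ok (ilt_ok (IVal.scalar (M := E.M) (Mods.cell hmm hq'))
    ((IVal.scalar (M := E.M) h34').natAdd (.scalar h34')))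
    (or_ok (rlt_ok (RVal.scalar h29') RVal.zero) (rlt_ok hvl (RVal.scalar h29')))
  refine Runs.ite (e₁ := 0) one_pos hc.1 (fun h => ?_) (fun h => ?_)
  · rw [hc.2] at h
    obtain ⟨h1, h2⟩ := h
    have h1' : q < 2 * rank v l := by push_cast at h1; omega
    refine Runs.rset_scalar one_pos (by norm_num) hvl.1 (by simp) ?_
    rw [setReal_real_self, hvl.2]
    refine ⟨fun l' hl' hr' => ⟨hv0 _, ?_⟩, Or.inr ⟨l, rfl, h1'⟩⟩
    rcases Nat.lt_succ_iff_lt_or_eq.1 hl' with h3 | h3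
    · obtain ⟨h4, h5⟩ := hJ1 l' h3 hr'
      rcases h2 with h2 | h2
      · linarith
      · linarith
    · have : l' = l := by rw [hl]; exact Fin.ext h3
      rw [this]
  · rw [hc.2] at h
    refine Runs.skip one_pos ?_
    rw [h29']
    refine ⟨fun l' hl' hr' => ?_, hJ2⟩
    rcases Nat.lt_succ_iff_lt_or_eq.1 hl' with h3 | h3
    · exact hJ1 l' h3 hr'
    · have : l' = l := by rw [hl]; exact Fin.ext h3
      rw [this] at hr' ⊢
      push Not at h
      obtain ⟨h4, h5⟩ := h (by push_cast; omega)
      exact ⟨h4, h5⟩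

/-- Find the best row for the index in array `32`. -/
def bestRowCmd : Cmd :=
  .seq (.rset 30 (.const 0) (.ofInt (.const (-1))))
    (Cmd.search 21 27 28 (iv 3) (.mul (iv 2) twoD)
      (.seq rowResCmd (.seq (.iset 33 (.const 0) (iv 14)) (.seq medCmd (.seq validCmd
        (.ite (.and (.ilt (.const 0) (iv 35))
            (.or (.rlt (rv 30) (.ofInt (.const 0))) (.rlt (rv 29) (rv 30))))
          (.seq (.rset 30 (.const 0) (rv 29))
            (Cmd.fillInt 23 (iv 3) 22 (ix2 (iv 32) (iv 3) (iv 23)) .skip (.get 21 (iv 23))))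
          .skip))))))

theorem bestRowCmd_spec (E : Env) {σ : Mem} (hσ : E.Static σ)
    {YT : Matrix (Fin E.k) (Fin (E.qT * E.G)) ℝ} (hY : MatAt (σ.real 26) YT) {i : Fin E.n}
    (hi : σ.int 32 0 = (i : ℕ)) :
    E.M.Runs ((E.k * (2 * E.D + 1)) ^ E.r) [21, 22, 23, 24, 27, 28, 33, 34, 35]
      [23, 27, 28, 29, 30] bestRowCmd σ 24
      fun τ => (∀ l < E.r, τ.int 22 (i * E.r + l) =
        (digit (E.k * (2 * E.D + 1)) (bestRow E.r E.D YT (E.AT i)) l : ℕ)) ∧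
        ∀ c < i * E.r, τ.int 22 c = σ.int 22 c := by
  classical
  obtain ⟨hV1, hV2, hV3, hV4, hV5, hV6, hV7, hV8, hV9, hV10, hV11, hV12, hV13, hV14, hV15, hV16,
    hV17, hV18⟩ := E.le_V
  obtain ⟨hr1, hr2, hr3, hr4, hr5, hr6, hr7, hr8, hr9, hr10, hr11, hr12, hr13⟩ := E.rsz_le
  obtain ⟨β, hβ⟩ : ∃ β, β = E.k * (2 * E.D + 1) := ⟨_, rfl⟩
  have hb : 0 < β := by rw [hβ]; exact Nat.mul_pos E.k_pos (by omega)
  have hpow : 0 < β ^ E.r := Nat.pow_pos hb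
  obtain ⟨f, hf⟩ : ∃ f : ℕ → ℝ, f = fun N => est (rowRes E.r E.D YT (E.AT i) N) := ⟨_, rfl⟩
  have hf0 : ∀ N, 0 ≤ f N := fun N => by rw [hf]; exact est_nonneg E.qT_pos _
  refine Runs.seq (I₁ := []) (R₁ := [30]) (I₂ := [21, 22, 23, 24, 27, 28, 33, 34, 35])
    (R₂ := [23, 27, 28, 29, 30]) (e₁ := 0) (e₂ := 23)
    (Q₁ := fun τ => τ.real 30 0 = -1) (Runs.rset_scalar (by rw [← hβ]; exact hpow) (by norm_num)
      (RVal.ofInt (IVal.const (by norm_num))).1 (by simp) (by simp [RExpr.den, IExpr.den])) ?_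
  intro τ hτ hm h30
  have hst := hσ.mods hm
  refine ((Runs.search (M := E.M) (σ := τ) (b := β) (n := E.r) (K := 1) (e₁ := 19)
    (I := [21, 22, 23, 24, 27, 28, 33, 34, 35]) (R := [23, 27, 28, 29, 30]) (e := 23)
    (I' := [22, 23, 24, 33, 34, 35]) (R' := [23, 27, 28, 29, 30]) one_pos (fun N υ =>
      ((υ.real 30 0 = -1 ∧ ∀ N' < N, ¬ RowValid E.k E.r E.D N') ∨ ∃ N₀,
        IsSel N (RowValid E.k E.r E.D) f N₀ ∧ υ.real 30 0 = f N₀ ∧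
          ∀ l < E.r, υ.int 22 (i * E.r + l) = (digit β N₀ l : ℕ)) ∧
      ∀ c < i * E.r, υ.int 22 c = σ.int 22 c) hV18 E.isz_le.2.2.2.1 hb (hβ ▸ hV8)
      (fun υ hu => IVal.scalar (hst.mods hu).r)
      (fun υ hu => ((IVal.scalar (hst.mods hu).k).natMul (hst.mods hu).twoD).congr (by rw [hβ]))
      ?_ ?_ ?_).mono (by simp [hβ]) (List.Subset.refl _) (List.Subset.refl _) le_rfl ?_)
  · intro N υ ω hm h
    rw [hm.real 30 (by simp), hm.int 22 (by simp)]
    exact h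
  · exact ⟨Or.inl ⟨h30, by simp⟩, fun c _ => by rw [hm.int 22 (by simp)]⟩
  · rintro N υ hN hbu hu hd ⟨hJ, hJ'⟩
    rw [hβ] at hd
    have hsu := hst.mods hu
    refine Runs.seq (rowResCmd_spec E hsu (YT := YT) ?_
      (Mods.cell hu (Mods.cell hm hi)) hd) (I₂ := [22, 23, 24, 33, 34, 35])
      (R₂ := [23, 28, 29, 30]) (e₂ := 18) ?_
    · rw [hu.real 26 (by simp), hm.real 26 (by simp)]; exact hY
    intro ω₁ hω₁ hm₁ h27
    have hs₁ := hsu.mods hm₁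
    have hqT := IVal.scalar (M := E.M) hs₁.qT
    refine Runs.seq (I₁ := [33]) (R₁ := []) (I₂ := [22, 23, 24, 34, 35]) (R₂ := [23, 28, 29, 30])
      (e₁ := 0) (e₂ := 17) (Q₁ := fun ω => ω.int 33 0 = E.qT) (Runs.iset_scalar one_pos (by norm_num)
      hqT.1 (by decide) (by rw [hqT.2, Nat.abs_cast]; exact_mod_cast hV16) (by simp)
      (by rw [setInt_int_self, hqT.2])) ?_
    intro ω₂ hω₂ hm₂ h33
    have hs₂ := hs₁.mods hm₂
    refine Runs.seq (medCmd_spec E hs₂ E.qT_pos h33 hV16 hr10 hr12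
      (x := rowRes E.r E.D YT (E.AT i) N) (by rw [hm₂.real 27 (by simp)]; exact h27))
      (I₂ := [22, 23, 24, 34, 35]) (R₂ := [30]) (e₂ := 16) ?_
    intro ω₃ hω₃ hm₃ h29
    have hs₃ := hs₂.mods hm₃
    refine Runs.seq (validCmd_spec E hs₃ (N := N) ?_)
      (I₂ := [22, 23]) (R₂ := [30]) (e₂ := 15) ?_
    · rw [hm₃.int 21 (by simp), hm₂.int 21 (by simp), hm₁.int 21 (by simp)]; exact hd
    intro ω₄ hω₄ hm₄ h35
    have hs₄ := hs₃.mods hm₄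
    have hmm : Mods [23, 24, 33, 34, 35] [23, 27, 28, 29] υ ω₄ :=
      (((hm₁.mono (by simp) (by simp)).trans (hm₂.mono (by simp) (by simp))).trans
        (hm₃.mono (by simp) (by simp))).trans (hm₄.mono (by simp) (by simp))
    have h30' : ω₄.real 30 0 = υ.real 30 0 := by rw [hmm.real 30 (by simp)]
    have h29' : ω₄.real 29 0 = f N := by rw [hm₄.real 29 (by simp), h29, hf]
    have hc := and_ok (ilt_ok IVal.zero (IVal.scalar (M := E.M) h35)) (or_ok (rlt_ok (RVal.scalar h30') RVal.zero)
      (rlt_ok (RVal.scalar h29') (RVal.scalar h30')))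
    have hvalid : (((0 : ℕ) : ℤ) < if RowValid E.k E.r E.D N then 1 else 0) ↔
        RowValid E.k E.r E.D N := by split_ifs with h <;> simp [h]
    rw [hvalid] at hc
    refine Runs.ite (e₁ := 14) one_pos hc.1 (fun h => ?_) (fun h => ?_)
    · rw [hc.2] at h
      obtain ⟨hv, hlt⟩ := h
      refine Runs.seq (I₁ := []) (R₁ := [30]) (I₂ := [22, 23]) (R₂ := []) (e₁ := 0) (e₂ := 13)
        (Q₁ := fun ω => ω.real 30 0 = f N) (Runs.rset_scalar one_pos (by norm_num)
        (RVal.scalar (M := E.M) h29').1 (by simp)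
        (by rw [setReal_real_self]; exact (RVal.scalar (M := E.M) h29').2)) ?_
      intro ω₅ hω₅ hm₅ h5
      have hs₅ := hs₄.mods hm₅
      refine (Runs.fillInt (I' := []) (R' := []) (e₁ := 0) one_pos (i * E.r)
        (fun l : Fin E.r => (digit β N l : ℤ)) ?_ hV18 (fun ω hmw => IVal.scalar (hs₅.mods hmw).r)
        (fun l ω _ hmw hl _ => Runs.skip one_pos ⟨?_, ?_⟩)).imp ?_
      · have := Nat.mul_le_mul_right E.r (show (i : ℕ) + 1 ≤ E.n from i.2)
        rw [Nat.succ_mul] at this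
        exact this.trans E.isz_le.2.2.2.2
      · exact (IVal.scalar (Mods.cell hmw (Mods.cell hm₅ (Mods.cell hmm (Mods.cell hu
          (Mods.cell hm hi)))))).ix2 (.scalar (hs₅.mods hmw).r) (.scalar hl)
      · have := ((IVal.scalar (M := E.M) hl).get (a := 21) (l.2.trans_le E.isz_le.2.2.2.1)).congr
          (y := (digit β N l : ℤ)) (by
            rw [hmw.int 21 (by simp), hm₅.int 21 (by simp), hmm.int 21 (by simp), hβ]
            exact hd l l.2)
        refine ⟨this.1, this.2, ?_⟩
        rw [Nat.abs_cast]
        exact_mod_cast ((digit_lt hb N l).le).trans (hβ ▸ hV8)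
      · rintro ω hmw ⟨h1, h2⟩
        refine ⟨Or.inr ⟨N, ⟨⟨by omega, hv⟩, ?_⟩, ?_, fun l hl => h1 ⟨l, hl⟩⟩, ?_⟩
        · intro N' hN' hv'
          rcases Nat.lt_succ_iff_lt_or_eq.1 hN' with h3 | h3
          · rcases hJ with ⟨h4, h5⟩ | ⟨N₀, ⟨h6, h7⟩, h8, -⟩
            · exact absurd hv' (h5 N' h3)
            · have h9 : f N < f N₀ := by
                rcases hlt with h | h
                · rw [h8] at h; exact absurd h (not_lt.2 (hf0 _))
                · rwa [h8] at h
              have := (h7 N' h3 hv').1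
              exact ⟨by linarith, fun _ => by linarith⟩
          · subst h3; exact ⟨le_rfl, fun h => absurd h (lt_irrefl _)⟩
        · rw [hmw.real 30 (by simp), h5]
        · intro c hc
          rw [h2 c (Or.inl hc), hm₅.int 22 (by simp), hmm.int 22 (by simp)]
          exact hJ' c hc
    · rw [hc.2] at h
      refine Runs.skip one_pos ⟨?_, fun c hc => by rw [hmm.int 22 (by simp)]; exact hJ' c hc⟩
      rw [h30', hmm.int 22 (by simp)]
      rcases hJ with ⟨h4, h5⟩ | ⟨N₀, ⟨h6, h7⟩, h8, h9⟩
      · refine Or.inl ⟨h4, fun N' hN' hv' => ?_⟩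
        rcases Nat.lt_succ_iff_lt_or_eq.1 hN' with h3 | h3
        · exact h5 N' h3 hv'
        · subst h3
          exact h ⟨hv', Or.inl (by rw [h4]; norm_num)⟩
      · refine Or.inr ⟨N₀, ⟨⟨by omega, h6.2⟩, fun N' hN' hv' => ?_⟩, h8, h9⟩
        rcases Nat.lt_succ_iff_lt_or_eq.1 hN' with h3 | h3
        · exact h7 N' h3 hv'
        · subst h3
          push Not at h
          have := (h hv').2
          rw [h8] at this
          exact ⟨this, fun h' => by omega⟩
  · rintro υ - - ⟨hJ, hJ'⟩
    refine ⟨?_, hJ'⟩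
    rcases hJ with ⟨-, h⟩ | ⟨N₀, h1, -, h3⟩
    · exfalso
      obtain ⟨N, hN, hx⟩ := exists_rowOf_eq (r := E.r) (D := E.D) E.k_pos (fun _ => 0) (by simp)
        (by simp)
      exact h N (hβ ▸ hN) fun j => by rw [hx]; simp
    · have : N₀ = bestRow E.r E.D YT (E.AT i) := by
        rw [bestRow, ← hβ, ← hf]; exact h1.eq_sel
      rw [← this, ← hβ]
      exact h3

end SparseDict

namespace SparseDict

open RealRAM Machine

theorem _root_.RealRAM.Machine.Runs.mul_left {M : Machine} {K : ℕ} {I R : List ℕ} {σ : Mem}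
    {Q : Mem → Prop} {p : Cmd} {e : ℕ} (h : M.Runs 1 I R p σ e Q) (hK : 0 < K) :
    M.Runs K I R p σ e Q :=
  h.mono hK (List.Subset.refl _) (List.Subset.refl _) le_rfl fun _ _ _ h => h

/-- The matrix with the given rows in sparse form. -/
def ofRows {n : ℕ} (k r D : ℕ) (rows : Fin n → ℕ) : Matrix (Fin n) (Fin k) ℝ :=
  Matrix.of fun i j => (rowOf k r D (rows i) j : ℝ)

/-- The entry of the array `22` for the current entry of the matrix. -/
def rowEntry : IExpr := .get 22 (ix2 (.div (iv 24) (iv 1)) (iv 3) (iv 25))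

/-- Compute the sketch of the residual. -/
def resCmd (gW : Cmd) : Cmd :=
  Cmd.fillReal 23 (iv 12) 27 (iv 23)
    (Cmd.sumN 24 (.mul (iv 0) (iv 1)) 23 (.sub (.ofInt (.const 0)) (.get 8 (iv 23)))
      (.seq (.iset 36 (.const 0) (iv 23)) (.seq (.iset 37 (.const 0) (iv 24)) (.seq gW
        (Cmd.sumN 25 (iv 3) 33 (.ofInt (.const 0)) .skip
          (.mul (.ofInt (valE rowEntry))
            (.get 25 (ix2 (colE rowEntry) (iv 1) (.mod (iv 24) (iv 1)))))))))
      (.mul (rv 32) (rv 33))) (rv 23)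

theorem resCmd_spec (E : Env) {σ : Mem} (hσ : E.Static σ) {Y : Matrix (Fin E.k) (Fin E.d) ℝ}
    (hY : MatAt (σ.real 25) Y) {rows : Fin E.n → ℕ}
    (hE : ∀ i : Fin E.n, ∀ l < E.r, σ.int 22 (i * E.r + l) =
      (digit (E.k * (2 * E.D + 1)) (rows i) l : ℕ)) :
    E.M.Runs 1 [23, 24, 25, 36, 37, 38, 39, 40, 41, 42, 43] [23, 27, 32, 33] (resCmd E.gW) σ 28
      fun τ => ∀ c : Fin (E.qW * E.G), τ.real 27 c =
        (E.W *ᵥ flatten (ofRows E.k E.r E.D rows * Y) - E.WA) c := by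
  obtain ⟨hV1, hV2, hV3, hV4, hV5, hV6, hV7, hV8, hV9, hV10, hV11, hV12, hV13, hV14, hV15, hV16,
    hV17, hV18⟩ := E.le_V
  obtain ⟨hr1, hr2, hr3, hr4, hr5, hr6, hr7, hr8, hr9, hr10, hr11, hr12, hr13⟩ := E.rsz_le
  have hb : 0 < E.k * (2 * E.D + 1) := Nat.mul_pos E.k_pos (by omega)
  have hinit : ∀ {τ : Mem}, Mods [23, 24, 25, 36, 37, 38, 39, 40, 41, 42, 43] [23, 27, 32, 33] σ τ →
      ∀ {c : Fin (E.qW * E.G)}, τ.int 23 0 = (c : ℕ) → RVal E.M τ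
      (.sub (.ofInt (.const 0)) (.get 8 (iv 23))) (0 - E.WA c) :=
    fun {τ} hm {c} hx => RVal.zero.sub ((RVal.get (IVal.scalar hx) (c.2.trans_le hr4)).congr
      ((hσ.mods hm).WA c))
  refine (Runs.fillReal (I' := [24, 25, 36, 37, 38, 39, 40, 41, 42, 43]) (R' := [23, 32, 33])
    (e₁ := 23) one_pos 0 (fun c => (E.W *ᵥ flatten (ofRows E.k E.r E.D rows * Y) - E.WA) c)
    (by omega) hV10 (fun τ hm => IVal.scalar (hσ.mods hm).w)
    (fun c τ _ hm hx _ =>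
    (Runs.sumN (I' := [25, 36, 37, 38, 39, 40, 41, 42, 43]) (R' := [32, 33]) (e₁ := 17) one_pos
      (fun x => E.W c x * flatten (ofRows E.k E.r E.D rows * Y) x) hV4
      (fun υ hu => (IVal.scalar ((hσ.mods hm).mods hu).n).natMul (.scalar ((hσ.mods hm).mods hu).d))
      (hinit hm hx).1
      (fun x υ _ hu hy => ?_)).imp fun υ hu h => ?_)).imp fun τ _ h => ?_
  · have hd : 0 < E.d := Fin.pos_of_mul x
    have hs := (hσ.mods hm).mods hu
    have hc : |υ.int 23 0| ≤ E.M.V := by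
      rw [Mods.cell hu hx, Nat.abs_cast]; exact_mod_cast (c.2.le.trans hV10)
    have hxV : |υ.int 24 0| ≤ E.M.V := by rw [hy, Nat.abs_cast]; exact_mod_cast (x.2.le.trans hV4)
    refine Runs.seq (I₁ := [36]) (R₁ := []) (I₂ := [25, 37, 38, 39, 40, 41, 42, 43])
      (R₂ := [32, 33]) (e₁ := 0) (e₂ := 16) (Q₁ := fun ω => ω.int 36 0 = (c : ℕ))
      (Runs.iset_scalar one_pos (by norm_num) (by simp) (by simp) (by simpa using hc) (by simp)
        (by simpa using Mods.cell hu hx)) ?_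
    intro ω₁ hω₁ hm₁ h36
    refine Runs.seq (I₁ := [37]) (R₁ := []) (I₂ := [25, 38, 39, 40, 41, 42, 43]) (R₂ := [32, 33])
      (e₁ := 0) (e₂ := 15) (Q₁ := fun ω => ω.int 37 0 = (x : ℕ))
      (Runs.iset_scalar one_pos (by norm_num) (by simp) (by simp)
        (by simpa [hm₁.int 24 (by simp)] using hxV) (by simp)
        (by simpa [hm₁.int 24 (by simp)] using hy)) ?_
    intro ω₂ hω₂ hm₂ h37
    refine Runs.seq (I₂ := [25]) (R₂ := [33]) (e₂ := 6)
      (E.gW_spec ω₂ ((hs.mods hm₁).mods hm₂).inv c x (Mods.cell hm₂ h36) h37) ?_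
    intro ω₃ hω₃ hm₃ h32
    have hs₃ := ((hs.mods hm₁).mods hm₂).mods hm₃
    have hmm : Mods coreI [23, 27, 32, 33] σ ω₃ :=
      (((hm.mono (by decide) (by simp)).trans (hu.mono (by decide) (by simp))).trans
        (hm₁.mono (by decide) (by simp))).trans ((hm₂.mono (by decide) (by simp)).trans
        (hm₃.mono (by decide) (by simp)))
    have h22 : ω₃.int 22 = σ.int 22 := by
      rw [hm₃.int 22 (by simp), hm₂.int 22 (by simp), hm₁.int 22 (by simp), hu.int 22 (by simp),
        hm.int 22 (by simp)]
    have h24 : ω₃.int 24 0 = (x : ℕ) := Mods.cell hm₃ (Mods.cell hm₂ (Mods.cell hm₁ hy))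
    refine (Runs.sumN (I' := []) (R' := []) (e₁ := 0) one_pos
      (fun l : Fin E.r =>
        (digitVal E.D (digit (E.k * (2 * E.D + 1)) (rows x.divNat) l) : ℝ) *
        Y ⟨digitCol E.D (digit (E.k * (2 * E.D + 1)) (rows x.divNat) l),
          digitCol_lt (digit_lt hb _ l)⟩ x.modNat) hV18
      (fun υ hu => IVal.scalar (hs₃.mods hu).r) RVal.zero.1
      (fun l ω _ hmw hz => Runs.skip one_pos ?_)).imp ?_
    · have hs₄ := hs₃.mods hmw
      have h24' : IVal E.M ω (iv 24) (x : ℕ) := .scalar (Mods.cell hmw h24)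
      have he : IVal E.M ω rowEntry (digit (E.k * (2 * E.D + 1)) (rows x.divNat) l : ℕ) :=
        (((h24'.natDiv (.scalar hs₄.d) hd).ix2 (.scalar hs₄.r) (.scalar hz)).get
          (c := x.divNat * E.r + l)
          ((mul_add_lt x.divNat.2 l.2).trans_le E.isz_le.2.2.2.2)).congr
          (by rw [hmw.int 22 (by simp), h22]; exact hE _ l l.2)
      refine (RVal.ofInt (hs₄.valE he)).mul ((RVal.get ((hs₄.colE he).ix2 (.scalar hs₄.d)
        (h24'.natMod (.scalar hs₄.d) hd))
        ((mul_add_lt (digitCol_lt (digit_lt hb _ l)) x.modNat.2).trans_le hr8)).congr ?_)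
      rw [hmw.real 25 (by simp), hmm.real 25 (by simp)]
      exact hY ⟨_, digitCol_lt (digit_lt hb _ l)⟩ x.modNat
    · intro ω hmw h33
      rw [den_zero, zero_add] at h33
      have h32' : ω.real 32 0 = E.W c x := by rw [hmw.real 32 (by simp), h32]
      refine ((RVal.scalar h32').mul (.scalar h33)).congr ?_
      rw [flatten, Matrix.mul_apply]
      simp only [ofRows, Matrix.of_apply]
      rw [sum_rowOf_mul E.k_pos (fun j => Y j x.modNat)]
  · refine ⟨(IVal.scalar (Mods.cell hu hx)).congr (by simp), RVal.scalar (h.trans ?_)⟩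
    rw [(hinit hm hx).2, Pi.sub_apply, Matrix.mulVec, dotProduct]; ring
  · have := h.1
    simpa using this

/-- The dictionary for the guess with number `N`. -/
noncomputable def Env.dict (E : Env) (N : ℕ) : Matrix (Fin E.k) (Fin E.d) ℝ :=
  dictOf (guess E.s E.k (E.n * E.D) N) E.SA

/-- The left factor for the guess with number `N`. -/
noncomputable def Env.factor (E : Env) (N : ℕ) : Matrix (Fin E.n) (Fin E.k) ℝ :=
  factorOf E.r E.D (E.dict N * E.T) E.AT

/-- The estimated error for the guess with number `N`. -/
noncomputable def Env.cost (E : Env) (N : ℕ) : ℝ :=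
  est (E.W *ᵥ flatten (E.factor N * E.dict N) - E.WA)

/-- Compute a candidate solution and its estimated error. -/
def candCmd (gT gW : Cmd) : Cmd :=
  .seq grevilleCmd (.seq dictCmd (.seq (sketchCmd gT) (.seq (Cmd.forN 32 (iv 0) bestRowCmd)
    (.seq (resCmd gW) (.seq (.iset 33 (.const 0) (iv 15)) medCmd)))))

theorem candCmd_spec (E : Env) {σ : Mem} (hσ : E.Static σ) {N : ℕ}
    (hN : Digits (2 * (E.n * E.D) + 1) (E.s * E.k) N (σ.int 20)) :
    E.M.Runs ((E.k * (2 * E.D + 1)) ^ E.r)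
      [21, 22, 23, 24, 25, 27, 28, 31, 32, 33, 34, 35, 36, 37, 38, 39, 40, 41, 42, 43]
      [20, 21, 22, 23, 24, 25, 26, 27, 28, 29, 30, 32, 33] (candCmd E.gT E.gW) σ 34
      fun τ => τ.real 29 0 = E.cost N ∧ MatAt (τ.real 25) (E.dict N) ∧
        ∃ rows : Fin E.n → ℕ, E.factor N = ofRows E.k E.r E.D rows ∧
          ∀ i : Fin E.n, ∀ l < E.r, τ.int 22 (i * E.r + l) =
            (digit (E.k * (2 * E.D + 1)) (rows i) l : ℕ) := by
  obtain ⟨hV1, hV2, hV3, hV4, hV5, hV6, hV7, hV8, hV9, hV10, hV11, hV12, hV13, hV14, hV15, hV16,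
    hV17, hV18⟩ := E.le_V
  obtain ⟨hr1, hr2, hr3, hr4, hr5, hr6, hr7, hr8, hr9, hr10, hr11, hr12, hr13⟩ := E.rsz_le
  have hK : 0 < (E.k * (2 * E.D + 1)) ^ E.r := Nat.pow_pos (Nat.mul_pos E.k_pos (by omega))
  refine Runs.seq ((grevilleCmd_spec E hσ hN).mul_left hK)
    (I₂ := [21, 22, 23, 24, 25, 27, 28, 32, 33, 34, 35, 36, 37, 38, 39, 40, 41, 42, 43])
    (R₂ := [23, 25, 26, 27, 28, 29, 30, 32, 33]) (e₂ := 33) ?_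
  intro τ₁ _ hm₁ h1
  have hs₁ := hσ.mods hm₁
  refine Runs.seq ((dictCmd_spec E hs₁ h1).mul_left hK)
    (I₂ := [21, 22, 23, 24, 25, 27, 28, 32, 33, 34, 35, 36, 37, 38, 39, 40, 41, 42, 43])
    (R₂ := [23, 26, 27, 28, 29, 30, 32, 33]) (e₂ := 32) ?_
  intro τ₂ _ hm₂ h2
  change MatAt (τ₂.real 25) (E.dict N) at h2
  have hs₂ := hs₁.mods hm₂
  refine Runs.seq ((sketchCmd_spec E hs₂ h2).mul_left hK)
    (I₂ := [21, 22, 23, 24, 25, 27, 28, 32, 33, 34, 35, 36, 37, 38, 39, 40, 41, 42, 43])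
    (R₂ := [23, 27, 28, 29, 30, 32, 33]) (e₂ := 31) ?_
  intro τ₃ _ hm₃ h3
  have hs₃ := hs₂.mods hm₃
  obtain ⟨rows, hrows⟩ : ∃ rows : Fin E.n → ℕ,
    rows = fun i => bestRow E.r E.D (E.dict N * E.T) (E.AT i) := ⟨_, rfl⟩
  refine Runs.seq (I₁ := [21, 22, 23, 24, 27, 28, 32, 33, 34, 35]) (R₁ := [23, 27, 28, 29, 30])
    (e₁ := 28)
    (Runs.forN (I' := [21, 22, 23, 24, 27, 28, 33, 34, 35]) (e₁ := 24) hK E.n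
      (fun m υ => ∀ i : Fin E.n, (i : ℕ) < m → ∀ l < E.r, υ.int 22 (i * E.r + l) =
            (digit (E.k * (2 * E.D + 1)) (rows i) l : ℕ)) hV11
      (fun υ hu => IVal.scalar (hs₃.mods hu).n) (fun i τ v h => by simpa using h) (by simp) ?_)
    (I₂ := [23, 24, 25, 33, 34, 36, 37, 38, 39, 40, 41, 42, 43])
    (R₂ := [23, 27, 28, 29, 32, 33]) (e₂ := 30) ?_
  · intro m υ hmn _ hu hx hJ
    refine (bestRowCmd_spec E (hs₃.mods hu) (YT := E.dict N * E.T) (i := ⟨m, hmn⟩) ?_ hx).imp ?_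
    · rw [hu.real 26 (by simp)]; exact h3
    · rintro ω - ⟨h4, h5⟩ i hi l hl
      rcases Nat.lt_succ_iff_lt_or_eq.1 hi with h | h
      · rw [h5 _ ((mul_add_lt h hl)), hJ i h l hl]
      · have : i = ⟨m, hmn⟩ := Fin.ext h
        subst this
        rw [h4 l hl, hrows]
  intro τ₄ _ hm₄ h4
  replace h4 := fun i : Fin E.n => h4 i i.2
  have hs₄ := hs₃.mods hm₄
  have h25 : MatAt (τ₄.real 25) (E.dict N) := by
    rw [hm₄.real 25 (by simp), hm₃.real 25 (by simp)]; exact h2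
  refine Runs.seq ((resCmd_spec E hs₄ h25 h4).mul_left hK)
    (I₂ := [23, 24, 33, 34]) (R₂ := [23, 28, 29]) (e₂ := 29) ?_
  intro τ₅ _ hm₅ h5
  have hs₅ := hs₄.mods hm₅
  have hqW := IVal.scalar (M := E.M) hs₅.qW
  refine Runs.seq (I₁ := [33]) (R₁ := []) (I₂ := [23, 24, 34]) (R₂ := [23, 28, 29])
    (e₁ := 0) (e₂ := 14) (Q₁ := fun ω => ω.int 33 0 = E.qW) (Runs.iset_scalar hK (by norm_num)
    hqW.1 (by decide) (by rw [hqW.2, Nat.abs_cast]; exact_mod_cast hV17) (by simp)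
    (by rw [setInt_int_self, hqW.2])) ?_
  intro τ₆ _ hm₆ h33
  have hs₆ := hs₅.mods hm₆
  have hfac : E.factor N = ofRows E.k E.r E.D rows := by rw [hrows]; rfl
  refine ((medCmd_spec E hs₆ E.qW_pos h33 hV17 hr11 hr13
      (x := E.W *ᵥ flatten (E.factor N * E.dict N) - E.WA) ?_).mul_left hK).imp ?_
  · rw [hm₆.real 27 (by simp), hfac]; exact h5
  · intro τ₇ hm₇ h7
    refine ⟨h7, ?_, rows, hfac, ?_⟩
    · rw [hm₇.real 25 (by simp), hm₆.real 25 (by simp), hm₅.real 25 (by simp)]; exact h25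
    · rw [hm₇.int 22 (by simp), hm₆.int 22 (by simp), hm₅.int 22 (by simp)]; exact h4

/-- Write the candidate solution to the output. -/
def saveCmd : Cmd :=
  .seq (Cmd.fillInt 23 (.mul (iv 0) (iv 3)) 8 (iv 23) .skip (colE (.get 22 (iv 23))))
    (.seq (Cmd.fillInt 23 (.mul (iv 0) (iv 3)) 9 (iv 23) .skip (valE (.get 22 (iv 23))))
      (Cmd.fillReal 23 (.mul (iv 2) (iv 1)) 2 (iv 23) .skip (.get 25 (iv 23))))

theorem outX_eq {n k r D : ℕ} {σ : Mem} {rows : Fin n → ℕ}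
    (h8 : ∀ i : Fin n, ∀ l < r, σ.int 8 (i * r + l) =
      (digitCol D (digit (k * (2 * D + 1)) (rows i) l) : ℕ))
    (h9 : ∀ i : Fin n, ∀ l < r, σ.int 9 (i * r + l) =
      digitVal D (digit (k * (2 * D + 1)) (rows i) l)) :
    outX n k r σ = ofRows k r D rows := by
  ext i j
  simp only [outX, ofRows, Matrix.of_apply, rowOf, Finset.sum_range, Int.cast_sum]
  refine Finset.sum_congr rfl fun l _ => ?_
  rw [h8 i l l.2, h9 i l l.2]
  split_ifs with h1 h2 h2
  · rfl
  · exact absurd (by exact_mod_cast h1) h2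
  · exact absurd (by exact_mod_cast h2) h1
  · simp

theorem saveCmd_spec (E : Env) {σ : Mem} (hσ : E.Static σ) {Y : Matrix (Fin E.k) (Fin E.d) ℝ}
    (hY : MatAt (σ.real 25) Y) {rows : Fin E.n → ℕ}
    (hE : ∀ i : Fin E.n, ∀ l < E.r, σ.int 22 (i * E.r + l) =
      (digit (E.k * (2 * E.D + 1)) (rows i) l : ℕ)) :
    E.M.Runs 1 [8, 9, 23] [2] saveCmd σ 7
      fun τ => outX E.n E.k E.r τ = ofRows E.k E.r E.D rows ∧ outY E.k E.d τ = Y := by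
  obtain ⟨hV1, hV2, hV3, hV4, hV5, hV6, hV7, hV8, hV9, hV10, hV11, hV12, hV13, hV14, hV15, hV16,
    hV17, hV18⟩ := E.le_V
  obtain ⟨hr1, hr2, hr3, hr4, hr5, hr6, hr7, hr8, hr9, hr10, hr11, hr12, hr13⟩ := E.rsz_le
  obtain ⟨hi1, hi2, hi3, hi4, hi5⟩ := E.isz_le
  have hb : 0 < E.k * (2 * E.D + 1) := Nat.mul_pos E.k_pos (by omega)
  obtain ⟨g, hg⟩ : ∃ g : Fin (E.n * E.r) → ℕ, g = fun x =>
    digit (E.k * (2 * E.D + 1)) (rows x.divNat) x.modNat := ⟨_, rfl⟩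
  have hcell : ∀ {I R : List ℕ} {τ : Mem}, Mods I R σ τ → 22 ∉ I → ∀ {x : Fin (E.n * E.r)},
      τ.int 23 0 = (x : ℕ) → IVal E.M τ (.get 22 (iv 23)) (g x : ℕ) := by
    intro I R τ hm h22 x hx
    refine ((IVal.scalar hx).get (x.2.trans_le hi5)).congr ?_
    rw [hm.int 22 h22, hg, ← hE x.divNat x.modNat x.modNat.2]
    congr 1
    simp [Fin.divNat, Fin.modNat, Nat.div_add_mod']
  have hglt : ∀ x, g x < E.k * (2 * E.D + 1) := fun x => by rw [hg]; exact digit_lt hb _ _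
  have hDV : E.D ≤ E.M.V := by
    have : E.D ≤ E.k * (2 * E.D + 1) := by nlinarith [E.k_pos]
    omega
  have hsplit : ∀ (i : Fin E.n) (l : ℕ) (hl : l < E.r),
      g ⟨i * E.r + l, mul_add_lt i.2 hl⟩ = digit (E.k * (2 * E.D + 1)) (rows i) l := by
    intro i l hl
    have hr0 : 0 < E.r := by omega
    have e1 : (⟨i * E.r + l, mul_add_lt i.2 hl⟩ : Fin (E.n * E.r)).divNat = i := by
      ext; simp [Fin.divNat, Nat.add_div_of_dvd_right, hr0, Nat.div_eq_of_lt hl]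
    have e2 : ((⟨i * E.r + l, mul_add_lt i.2 hl⟩ : Fin (E.n * E.r)).modNat : ℕ) = l := by
      simp [Fin.modNat, Nat.mod_eq_of_lt hl]
    rw [hg]; simp only [e1, e2]
  refine Runs.seq (Runs.fillInt (I := [8, 23]) (R := []) (I' := []) (R' := []) (e := 5) (e₁ := 0)
    one_pos 0 (fun x => (digitCol E.D (g x) : ℤ)) (by omega) hV5
    (fun τ hm => (IVal.scalar (hσ.mods hm).n).natMul (.scalar (hσ.mods hm).r))
    (fun x τ _ hm hx _ => Runs.skip one_pos ?_)) (I₂ := [9, 23]) (R₂ := [2]) (e₂ := 6) ?_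
  · have := (hσ.mods hm).colE (hcell hm (by simp) hx)
    refine ⟨(IVal.scalar hx).congr (by simp), this.1, this.2, ?_⟩
    rw [Nat.abs_cast]
    exact_mod_cast (digitCol_lt (hglt x)).le.trans hV13
  rintro τ₁ _ hm₁ ⟨h1, -⟩
  have hs₁ := hσ.mods hm₁
  refine Runs.seq (Runs.fillInt (I := [9, 23]) (R := []) (I' := []) (R' := []) (e := 5) (e₁ := 0)
    one_pos 0 (fun x => digitVal E.D (g x)) (by omega) hV5
    (fun τ hm => (IVal.scalar (hs₁.mods hm).n).natMul (.scalar (hs₁.mods hm).r))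
    (fun x τ _ hm hx _ => Runs.skip one_pos ?_)) (I₂ := [23]) (R₂ := [2]) (e₂ := 5) ?_
  · have hmm := (hm₁.mono (by simp) (by simp) : Mods [8, 9, 23] [] σ τ₁).trans
      (hm.mono (by simp) (by simp))
    have := (hs₁.mods hm).valE (hcell hmm (by simp) hx)
    refine ⟨(IVal.scalar hx).congr (by simp), this.1, this.2, ?_⟩
    have := abs_digitVal_le E.D (g x)
    omega
  rintro τ₂ _ hm₂ ⟨h2, -⟩
  have hs₂ := hs₁.mods hm₂
  have hkd : E.k * E.d ≤ E.M.rsz 25 := hr8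
  refine (Runs.fillReal (I' := []) (R' := []) (e₁ := 0)
    one_pos 0 (fun x : Fin (E.k * E.d) => Y x.divNat x.modNat) (by omega) hV2
    (fun τ hm => (IVal.scalar (hs₂.mods hm).k).natMul (.scalar (hs₂.mods hm).d))
    (fun x τ _ hm hx _ => Runs.skip one_pos ?_)).imp ?_
  · refine ⟨(IVal.scalar hx).congr (by simp),
      (RVal.get (IVal.scalar hx) (x.2.trans_le hr8)).congr ?_⟩
    rw [hm.real 25 (by simp), hm₂.real 25 (by simp), hm₁.real 25 (by simp)]
    exact hY.at x
  · rintro τ₃ hm₃ ⟨h3, -⟩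
    constructor
    · refine outX_eq (fun i l hl => ?_) fun i l hl => ?_
      · have := h1 ⟨i * E.r + l, mul_add_lt i.2 hl⟩
        rw [zero_add, hsplit i l hl] at this
        rw [hm₃.int 8 (by simp), hm₂.int 8 (by simp)]; exact this
      · have := h2 ⟨i * E.r + l, mul_add_lt i.2 hl⟩
        rw [zero_add, hsplit i l hl] at this
        rw [hm₃.int 9 (by simp)]; exact this
    · have : MatAt (τ₃.real 2) Y := matAt_of_forall fun x => by simpa using h3 x
      ext i j
      exact this i j

/-- Search for a solution. -/
def searchCmd (gT gW : Cmd) : Cmd :=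
  .seq (.rset 31 (.const 0) (.ofInt (.const (-1))))
    (Cmd.search 20 29 30 (.mul (iv 10) (iv 2))
      (.add (.add (.mul (iv 0) (iv 4)) (.mul (iv 0) (iv 4))) (.const 1))
      (.seq (candCmd gT gW)
        (.ite (.or (.rlt (rv 31) (.ofInt (.const 0))) (.rlt (rv 29) (rv 31)))
          (.seq (.rset 31 (.const 0) (rv 29)) saveCmd) .skip)))

theorem searchCmd_spec (E : Env) {σ : Mem} (hσ : E.Static σ) :
    E.M.Runs ((2 * (E.n * E.D) + 1) ^ (E.s * E.k) * (E.k * (2 * E.D + 1)) ^ E.r)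
      coreI coreR (searchCmd E.gT E.gW) σ 40
      fun τ => ∃ N₀ < (2 * (E.n * E.D) + 1) ^ (E.s * E.k),
        (∀ N < (2 * (E.n * E.D) + 1) ^ (E.s * E.k), E.cost N₀ ≤ E.cost N) ∧
        outX E.n E.k E.r τ = E.factor N₀ ∧ outY E.k E.d τ = E.dict N₀ := by
  obtain ⟨hV1, hV2, hV3, hV4, hV5, hV6, hV7, hV8, hV9, hV10, hV11, hV12, hV13, hV14, hV15, hV16,
    hV17, hV18⟩ := E.le_V
  have hK : 0 < (E.k * (2 * E.D + 1)) ^ E.r := Nat.pow_pos (Nat.mul_pos E.k_pos (by omega))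
  obtain ⟨b, hb⟩ : ∃ b, b = 2 * (E.n * E.D) + 1 := ⟨_, rfl⟩
  have hbpos : 0 < b ^ (E.s * E.k) := Nat.pow_pos (by omega)
  have hc0 : ∀ N, 0 ≤ E.cost N := fun N => est_nonneg E.qW_pos _
  rw [← hb]
  refine Runs.seq (I₁ := []) (R₁ := [31]) (I₂ := coreI)
    (R₂ := coreR) (e₁ := 0) (e₂ := 39)
    (Q₁ := fun τ => τ.real 31 0 = -1) (Runs.rset_scalar (Nat.mul_pos hbpos hK) (by norm_num)
      (RVal.ofInt (IVal.const (by norm_num))).1 (by simp) (by simp [RExpr.den, IExpr.den])) ?_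
      (by decide) (by decide) (by simp) (by simp)
  intro τ _ hm h31
  have hst := hσ.mods hm
  refine (Runs.search (M := E.M) (σ := τ) (b := b) (n := E.s * E.k)
    (e₁ := 35) (I' := coreI.filter (· ≠ 20)) (R' := coreR) hK (fun N υ =>
      (υ.real 31 0 = -1 ∧ N = 0) ∨ ∃ N₀ < N, (∀ N' < N, E.cost N₀ ≤ E.cost N') ∧
        υ.real 31 0 = E.cost N₀ ∧ outX E.n E.k E.r υ = E.factor N₀ ∧ outY E.k E.d υ = E.dict N₀)
    hV1 E.isz_le.2.2.1 (by omega) (hb ▸ hV7)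
    (fun υ hu => (IVal.scalar (hst.mods hu (by simp) (by simp)).s).natMul
      (.scalar (hst.mods hu (by simp) (by simp)).k))
    (fun υ hu => ?_) ?_ (Or.inl ⟨h31, rfl⟩) ?_ (haI' := by decide) (hI := by decide)
      (hI' := by simp) (hR' := by simp)).imp ?_
  · have hs := hst.mods hu (by simp) (by simp)
    have h := (IVal.scalar (M := E.M) hs.n).natMul (.scalar hs.D)
    exact ((h.natAdd h).natAdd .one).congr (by rw [hb]; push_cast; ring)
  · intro N υ ω hm h
    have e1 : outX E.n E.k E.r ω = outX E.n E.k E.r υ := by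
      simp only [outX, hm.int 8 (by simp), hm.int 9 (by simp)]
    have e2 : outY E.k E.d ω = outY E.k E.d υ := by simp only [outY, hm.real 2 (by simp)]
    rw [hm.real 31 (by simp), e1, e2]; exact h
  · intro N υ hN hbu hu hd hJ
    rw [hb] at hd
    have hsu := hst.mods hu (by simp) (by simp)
    refine Runs.seq (candCmd_spec E hsu hd) (I₂ := [8, 9, 23]) (R₂ := [2, 31]) (e₂ := 10) ?_
      (by decide) (by decide) (by decide) (by decide)
    rintro ω₁ _ hm₁ ⟨h29, h25, rows, hrows, h22⟩
    have hs₁ := hsu.mods hm₁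
    have h31' : ω₁.real 31 0 = υ.real 31 0 := by rw [hm₁.real 31 (by simp)]
    have hc := or_ok (rlt_ok (M := E.M) (RVal.scalar h31') RVal.zero)
      (rlt_ok (RVal.scalar h29) (RVal.scalar h31'))
    refine Runs.ite (e₁ := 9) hK hc.1 (fun h => ?_) (fun h => ?_)
    · rw [hc.2] at h
      refine Runs.seq (I₁ := []) (R₁ := [31]) (I₂ := [8, 9, 23]) (R₂ := [2]) (e₁ := 0) (e₂ := 7)
        (Q₁ := fun ω => ω.real 31 0 = E.cost N) (Runs.rset_scalar hK (by norm_num)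
        (RVal.scalar (M := E.M) h29).1 (by simp)
        (by rw [setReal_real_self]; exact (RVal.scalar (M := E.M) h29).2)) ?_
      intro ω₂ _ hm₂ h2
      have hs₂ := hs₁.mods hm₂
      refine ((saveCmd_spec E hs₂ (Y := E.dict N) (rows := rows) ?_ ?_).mul_left hK).imp ?_
      · rw [hm₂.real 25 (by simp)]; exact h25
      · rw [hm₂.int 22 (by simp)]; exact h22
      · rintro ω₃ hm₃ ⟨h4, h5⟩
        refine Or.inr ⟨N, by omega, fun N' hN' => ?_, ?_, by rw [h4, hrows], h5⟩
        · rcases Nat.lt_succ_iff_lt_or_eq.1 hN' with h3 | h3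
          · rcases hJ with ⟨h6, h7⟩ | ⟨N₀, h6, h7, h8, -⟩
            · omega
            · rw [h8] at h
              rcases h with h | h
              · exact absurd h (not_lt.2 (hc0 _))
              · exact h.le.trans (h7 N' h3)
          · rw [h3]
        · rw [hm₃.real 31 (by simp), h2]
    · rw [hc.2] at h
      refine Runs.skip hK ?_
      have e1 : outX E.n E.k E.r ω₁ = outX E.n E.k E.r υ := by
        simp only [outX, hm₁.int 8 (by simp), hm₁.int 9 (by simp)]
      have e2 : outY E.k E.d ω₁ = outY E.k E.d υ := by simp only [outY, hm₁.real 2 (by simp)]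
      rw [h31', e1, e2]
      push Not at h
      rcases hJ with ⟨h6, h7⟩ | ⟨N₀, h6, h7, h8, h9⟩
      · rw [h6] at h; exact absurd h.1 (by norm_num)
      · refine Or.inr ⟨N₀, by omega, fun N' hN' => ?_, h8, h9⟩
        rcases Nat.lt_succ_iff_lt_or_eq.1 hN' with h3 | h3
        · exact h7 N' h3
        · rw [h3, ← h8]; exact h.2
  · rintro υ - (⟨-, h⟩ | ⟨N₀, h1, h2, -, h3⟩)
    · omega
    · exact ⟨N₀, h1, h2, h3⟩

end SparseDict

namespace SparseDict

/-! ### Averages over finite probability spaces -/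

section
variable {Ω Ω' ι : Type*} [Fintype Ω] [Fintype Ω']

/-- The average of a function on a finite type. -/
noncomputable def avg (f : Ω → ℝ) : ℝ := (∑ ω, f ω) / Fintype.card Ω

open Classical in
/-- The fraction of the elements with a property. -/
noncomputable def pr (p : Ω → Prop) : ℝ := avg fun ω => if p ω then 1 else 0

theorem avg_add (f g : Ω → ℝ) : avg (fun ω => f ω + g ω) = avg f + avg g := by
  simp [avg, Finset.sum_add_distrib, add_div]

theorem avg_sub (f g : Ω → ℝ) : avg (fun ω => f ω - g ω) = avg f - avg g := by
  simp [avg, Finset.sum_sub_distrib, sub_div]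

theorem avg_const_mul (c : ℝ) (f : Ω → ℝ) : avg (fun ω => c * f ω) = c * avg f := by
  simp [avg, ← Finset.mul_sum, mul_div_assoc]

theorem avg_sum (s : Finset ι) (f : ι → Ω → ℝ) :
    avg (fun ω => ∑ i ∈ s, f i ω) = ∑ i ∈ s, avg (f i) := by
  simp only [avg]
  rw [Finset.sum_comm, Finset.sum_div]

theorem avg_const [Nonempty Ω] (c : ℝ) : avg (fun _ : Ω => c) = c := by
  simp [avg, mul_div_cancel_left₀]

theorem avg_mono {f g : Ω → ℝ} (h : ∀ ω, f ω ≤ g ω) : avg f ≤ avg g :=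
  div_le_div_of_nonneg_right (Finset.sum_le_sum fun ω _ => h ω) (Nat.cast_nonneg _)

theorem avg_nonneg {f : Ω → ℝ} (h : ∀ ω, 0 ≤ f ω) : 0 ≤ avg f :=
  div_nonneg (Finset.sum_nonneg fun ω _ => h ω) (Nat.cast_nonneg _)

theorem avg_equiv (e : Ω ≃ Ω') (f : Ω' → ℝ) : avg (fun ω => f (e ω)) = avg f := by
  rw [avg, avg, Equiv.sum_comp, Fintype.card_congr e]

theorem avg_prod (f : Ω × Ω' → ℝ) : avg f = avg fun a => avg fun b => f (a, b) := by
  simp only [avg, Fintype.sum_prod_type, Fintype.card_prod, ← Finset.sum_div]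
  push_cast
  rw [div_div, mul_comm]

theorem avg_pi_prod [Fintype ι] [DecidableEq ι] (f : ι → Ω → ℝ) :
    avg (fun ω : ι → Ω => ∏ i, f i (ω i)) = ∏ i, avg (f i) := by
  simp only [avg]
  rw [Finset.prod_div_distrib, Finset.prod_univ_sum]
  simp

theorem avg_pi_single [Fintype ι] [DecidableEq ι] [Nonempty Ω] (i : ι) (f : Ω → ℝ) :
    avg (fun ω : ι → Ω => f (ω i)) = avg f := by
  have h := avg_pi_prod (Ω := Ω) fun l : ι => if l = i then f else fun _ => 1
  have e1 : ∀ ω : ι → Ω, ∏ l, (if l = i then f else fun _ => 1) (ω l) = f (ω i) := fun ω => by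
    rw [Finset.prod_eq_single i] <;> simp +contextual
  have e2 : ∏ l, avg (if l = i then f else fun _ => (1 : ℝ)) = avg f := by
    rw [Finset.prod_eq_single i] <;> simp +contextual [avg_const]
  simpa only [e1, e2] using h

theorem avg_pi_pair [Fintype ι] [DecidableEq ι] [Nonempty Ω] {i j : ι} (hij : i ≠ j)
    (f g : Ω → ℝ) : avg (fun ω : ι → Ω => f (ω i) * g (ω j)) = avg f * avg g := by
  have h := avg_pi_prod (Ω := Ω) fun l : ι => if l = i then f else if l = j then g else fun _ => 1
  have key : ∀ F : (Ω → ℝ) → ι → ℝ, (∀ l, F (fun _ => 1) l = 1) →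
      ∏ l, F (if l = i then f else if l = j then g else fun _ => (1 : ℝ)) l = F f i * F g j := by
    intro F hF
    rw [← Finset.mul_prod_erase _ _ (Finset.mem_univ i),
      ← Finset.mul_prod_erase _ _ (show j ∈ Finset.univ.erase i by simp [hij.symm]),
      Finset.prod_eq_one]
    · simp [hij.symm]
    · intro l hl
      simp only [Finset.mem_erase, Finset.mem_univ, and_true] at hl
      simp [hl.1, hl.2, hF]
  have e1 := fun ω : ι → Ω => key (fun f l => f (ω l)) (fun _ => rfl)
  have e2 := key (fun f _ => avg f) (fun _ => avg_const _)
  simpa only [e1, e2] using h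

theorem pr_mono {p q : Ω → Prop} (h : ∀ ω, p ω → q ω) : pr p ≤ pr q := by
  classical
  refine avg_mono fun ω => ?_
  by_cases hp : p ω
  · simp [hp, h ω hp]
  · simp only [hp, if_false]; split_ifs <;> norm_num

theorem pr_or_le (p q : Ω → Prop) : pr (fun ω => p ω ∨ q ω) ≤ pr p + pr q := by
  classical
  rw [pr, pr, pr, ← avg_add]
  refine avg_mono fun ω => ?_
  by_cases hp : p ω <;> by_cases hq : q ω <;> simp [hp, hq]

theorem pr_exists_le (s : Finset ι) (p : ι → Ω → Prop) :
    pr (fun ω => ∃ i ∈ s, p i ω) ≤ ∑ i ∈ s, pr (p i) := by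
  classical
  simp only [pr]
  rw [← avg_sum]
  refine avg_mono fun ω => ?_
  split_ifs with h
  · obtain ⟨i, hi, hp⟩ := h
    refine le_trans ?_ (Finset.single_le_sum (f := fun i => if p i ω then (1 : ℝ) else 0)
      (fun j _ => by split_ifs <;> norm_num) hi)
    simp [hp]
  · exact Finset.sum_nonneg fun j _ => by split_ifs <;> norm_num

theorem pr_prod_le {p : Ω × Ω' → Prop} {c : ℝ} (hc : 0 ≤ c)
    (h : ∀ a, pr (fun b => p (a, b)) ≤ c) : pr p ≤ c := by
  classical
  rw [pr, avg_prod]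
  rcases isEmpty_or_nonempty Ω with h' | h'
  · simpa [avg] using hc
  · exact (avg_mono (g := fun _ => c) h).trans (avg_const c).le

theorem pr_fst [Nonempty Ω'] (p : Ω → Prop) : pr (fun x : Ω × Ω' => p x.1) = pr p := by
  classical
  rw [pr, avg_prod]
  exact congrArg avg (funext fun a => avg_const (if p a then (1 : ℝ) else 0))

/-- Markov's inequality. -/
theorem markov {f : Ω → ℝ} {a τ : ℝ} (hf : ∀ ω, 0 ≤ f ω) (ha : avg f ≤ a) (hτ : 0 < τ) :
    pr (fun ω => τ * a < f ω) ≤ 1 / τ := by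
  classical
  rcases isEmpty_or_nonempty Ω with h | h
  · simp [pr, avg, hτ.le]
  have ha0 : 0 ≤ a := (avg_nonneg hf).trans ha
  rcases ha0.eq_or_lt with h0 | h0
  · have hz : ∀ ω, f ω = 0 := by
      have h1 : avg f = 0 := le_antisymm (h0 ▸ ha) (avg_nonneg hf)
      have hc : (Fintype.card Ω : ℝ) ≠ 0 := by simp
      rw [avg, div_eq_zero_iff] at h1
      have h2 := (Finset.sum_eq_zero_iff_of_nonneg fun ω _ => hf ω).1 (h1.resolve_right hc)
      exact fun ω => h2 ω (Finset.mem_univ _)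
    have : pr (fun ω => τ * a < f ω) = 0 := by
      simp [pr, hz, ← h0, avg]
    rw [this]; positivity
  · have : pr (fun ω => τ * a < f ω) ≤ avg fun ω => (1 / (τ * a)) * f ω := by
      refine avg_mono fun ω => ?_
      split_ifs with h'
      · rw [one_div, ← div_eq_inv_mul, one_le_div (by positivity)]; exact h'.le
      · exact mul_nonneg (by positivity) (hf ω)
    rw [avg_const_mul] at this
    refine this.trans ((mul_le_mul_of_nonneg_left ha (by positivity)).trans (le_of_eq ?_))
    field_simp

/-- Chebyshev's inequality for independent copies of a random variable. -/
theorem chebyshev [Nonempty Ω] {G : ℕ} {f : Ω → ℝ} {μ v a : ℝ} (hμ : avg f = μ)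
    (hv : avg (fun ω => f ω ^ 2) ≤ v + μ ^ 2) (ha : 0 < a) :
    pr (fun ω : Fin G → Ω => a < |∑ g, f (ω g) - G * μ|) ≤ G * v / a ^ 2 := by
  classical
  have h1 : avg (fun ω : Fin G → Ω => (∑ g, f (ω g) - G * μ) ^ 2) ≤ G * v := by
    have e : ∀ ω : Fin G → Ω, (∑ g, f (ω g) - G * μ) ^ 2 =
        ∑ g, ∑ g', (f (ω g) - μ) * (f (ω g') - μ) := fun ω => by
      rw [← Finset.sum_mul_sum, ← sq, Finset.sum_sub_distrib]; simp
    simp only [e]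
    rw [avg_sum]
    have : ∀ g : Fin G, avg (fun ω : Fin G → Ω => ∑ g', (f (ω g) - μ) * (f (ω g') - μ)) ≤ v := by
      intro g
      rw [avg_sum, Finset.sum_eq_single g]
      · rw [avg_pi_single g fun ω => (f ω - μ) * (f ω - μ)]
        have e2 : ∀ ω, (f ω - μ) * (f ω - μ) = f ω ^ 2 - ((2 * μ) * f ω - μ ^ 2) := fun ω => by ring
        simp only [e2]
        rw [avg_sub, avg_sub, avg_const_mul, avg_const, hμ]
        linarith
      · intro g' _ hg
        rw [avg_pi_pair hg.symm (fun ω => f ω - μ) fun ω => f ω - μ, avg_sub, avg_const, hμ]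
        simp
      · simp
    refine (Finset.sum_le_sum fun g _ => this g).trans ?_
    simp
  have h2 : pr (fun ω : Fin G → Ω => a < |∑ g, f (ω g) - G * μ|) ≤
      avg fun ω : Fin G → Ω => (1 / a ^ 2) * (∑ g, f (ω g) - G * μ) ^ 2 := by
    refine avg_mono fun ω => ?_
    split_ifs with h
    · rw [one_div, ← div_eq_inv_mul, one_le_div (by positivity), ← sq_abs (_ - _)]
      exact pow_le_pow_left₀ ha.le h.le 2
    · positivity
  rw [avg_const_mul] at h2
  refine h2.trans ((mul_le_mul_of_nonneg_left h1 (by positivity)).trans (le_of_eq ?_))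
  ring

open Classical in
/-- Among `q` independent events of probability at most `1 / 64`, half happen with probability
at most `4 ^ (-q)` only. -/
theorem pr_majority_le [Nonempty Ω] {q : ℕ} (p : Ω → Prop) (hp : pr p ≤ 1 / 64) :
    pr (fun ω : Fin q → Ω => q ≤ 2 * (Finset.univ.filter fun l => p (ω l)).card) ≤ (1 / 4) ^ q := by
  have h1 : avg (fun ω : Fin q → Ω => ∏ l, (1 + 63 * if p (ω l) then (1 : ℝ) else 0)) ≤ 2 ^ q := by
    rw [avg_pi_prod (fun _ ω => 1 + 63 * if p ω then (1 : ℝ) else 0)]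
    have : avg (fun ω => 1 + 63 * if p ω then (1 : ℝ) else 0) ≤ 2 := by
      rw [avg_add, avg_const, avg_const_mul]
      change 1 + 63 * pr p ≤ 2
      linarith
    rw [Finset.prod_const, Finset.card_univ, Fintype.card_fin]
    exact pow_le_pow_left₀ (avg_nonneg fun ω => by positivity) this q
  have h2 : pr (fun ω : Fin q → Ω => q ≤ 2 * (Finset.univ.filter fun l => p (ω l)).card) ≤
      avg fun ω : Fin q → Ω => (1 / 8) ^ q * ∏ l, (1 + 63 * if p (ω l) then (1 : ℝ) else 0) := by
    refine avg_mono fun ω => ?_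
    have e : ∏ l, (1 + 63 * if p (ω l) then (1 : ℝ) else 0) =
        64 ^ (Finset.univ.filter fun l => p (ω l)).card := by
      rw [← Finset.prod_const, Finset.prod_filter]
      exact Finset.prod_congr rfl fun l _ => by split_ifs <;> norm_num
    rw [e]
    split_ifs with h
    · have h3 : (8 : ℝ) ^ q ≤ 64 ^ (Finset.univ.filter fun l => p (ω l)).card := by
        rw [show (64 : ℝ) = 8 ^ 2 by norm_num, ← pow_mul]
        exact pow_le_pow_right₀ (by norm_num) h
      rw [one_div, inv_pow, ← div_eq_inv_mul, one_le_div (by positivity)]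
      exact h3
    · positivity
  rw [avg_const_mul] at h2
  refine h2.trans ((mul_le_mul_of_nonneg_left h1 (by positivity)).trans (le_of_eq ?_))
  rw [← mul_pow]; norm_num

end

/-! ### Four-wise independent signs -/

/-- Random signs such that the products of two or four different ones have mean zero. -/
structure FourWise {Ω : Type*} [Fintype Ω] {N : ℕ} (σ : Ω → Fin N → ℝ) : Prop where
  sq : ∀ ω x, σ ω x * σ ω x = 1
  two : ∀ x y, x ≠ y → avg (fun ω => σ ω x * σ ω y) = 0
  four : ∀ x y z w, x ≠ y → x ≠ z → x ≠ w → y ≠ z → y ≠ w → z ≠ w →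
    avg (fun ω => σ ω x * σ ω y * (σ ω z * σ ω w)) = 0

namespace FourWise

variable {Ω : Type*} [Fintype Ω] [Nonempty Ω] {N : ℕ} {σ : Ω → Fin N → ℝ}

theorem avg_two (h : FourWise σ) (x y : Fin N) :
    avg (fun ω => σ ω x * σ ω y) = if x = y then 1 else 0 := by
  split_ifs with hxy
  · subst hxy; simp only [h.sq]; exact avg_const 1
  · exact h.two x y hxy

theorem avg_four (h : FourWise σ) (x y z w : Fin N) :
    avg (fun ω => σ ω x * σ ω y * (σ ω z * σ ω w)) =
      (if x = y then 1 else 0) * (if z = w then 1 else 0) +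
      (if x = z then 1 else 0) * (if y = w then 1 else 0) +
      (if x = w then 1 else 0) * (if y = z then 1 else 0) -
      2 * (if x = y ∧ x = z ∧ x = w then 1 else 0) := by
  by_cases hxy : x = y
  · subst hxy
    simp only [h.sq, one_mul]
    rw [h.avg_two]
    by_cases hxz : x = z <;> by_cases hxw : x = w <;> by_cases hzw : z = w <;> simp_all
    norm_num
  by_cases hzw : z = w
  · subst hzw
    simp only [h.sq, mul_one]
    rw [h.avg_two]
    by_cases hxz : x = z <;> by_cases hyz : y = z <;> simp_all
  by_cases hxz : x = z
  · subst hxz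
    have : ∀ ω, σ ω x * σ ω y * (σ ω x * σ ω w) = σ ω y * σ ω w := fun ω => by
      linear_combination (σ ω y * σ ω w) * h.sq ω x
    simp only [this]
    rw [h.avg_two]
    by_cases hyw : y = w <;> simp_all [Ne.symm hxy]
  by_cases hxw : x = w
  · subst hxw
    have : ∀ ω, σ ω x * σ ω y * (σ ω z * σ ω x) = σ ω y * σ ω z := fun ω => by
      linear_combination (σ ω y * σ ω z) * h.sq ω x
    simp only [this]
    rw [h.avg_two]
    by_cases hyz : y = z <;> simp_all
  by_cases hyz : y = z
  · subst hyz
    have : ∀ ω, σ ω x * σ ω y * (σ ω y * σ ω w) = σ ω x * σ ω w := fun ω => by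
      linear_combination (σ ω x * σ ω w) * h.sq ω y
    simp only [this]
    rw [h.avg_two]
    simp_all
  by_cases hyw : y = w
  · subst hyw
    have : ∀ ω, σ ω x * σ ω y * (σ ω z * σ ω y) = σ ω x * σ ω z := fun ω => by
      linear_combination (σ ω x * σ ω z) * h.sq ω y
    simp only [this]
    rw [h.avg_two]
    simp_all
  rw [h.four x y z w hxy hxz hxw hyz hyw hzw]
  simp [hxy, hxz, hxw]

theorem avg_dot_mul_dot (h : FourWise σ) (u v : Fin N → ℝ) :
    avg (fun ω => (u ⬝ᵥ σ ω) * (v ⬝ᵥ σ ω)) = u ⬝ᵥ v := by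
  have e : ∀ ω, (u ⬝ᵥ σ ω) * (v ⬝ᵥ σ ω) = ∑ x, ∑ y, (u x * v y) * (σ ω x * σ ω y) := fun ω => by
    rw [dotProduct, dotProduct, Finset.sum_mul_sum]
    exact Finset.sum_congr rfl fun x _ => Finset.sum_congr rfl fun y _ => by ring
  simp only [e]
  rw [avg_sum]
  simp only [avg_sum, avg_const_mul, h.avg_two]
  simp [dotProduct]

theorem avg_dot_sq_mul_dot_sq_le (h : FourWise σ) (u v : Fin N → ℝ) :
    avg (fun ω => (u ⬝ᵥ σ ω) ^ 2 * (v ⬝ᵥ σ ω) ^ 2) ≤ (u ⬝ᵥ u) * (v ⬝ᵥ v) + 2 * (u ⬝ᵥ v) ^ 2 := by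
  have e : ∀ ω, (u ⬝ᵥ σ ω) ^ 2 * (v ⬝ᵥ σ ω) ^ 2 =
      ∑ x, ∑ y, ∑ z, ∑ w, (u x * u y * (v z * v w)) * (σ ω x * σ ω y * (σ ω z * σ ω w)) := fun ω => by
    rw [pow_two, pow_two, dotProduct, dotProduct, Finset.sum_mul_sum, Finset.sum_mul_sum,
      Finset.sum_mul_sum]
    simp only [Finset.sum_mul_sum]
    refine Finset.sum_congr rfl fun x _ => ?_
    rw [Finset.sum_comm]
    refine Finset.sum_congr rfl fun y _ => Finset.sum_congr rfl fun z _ =>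
      Finset.sum_congr rfl fun w _ => by ring
  simp only [e]
  rw [avg_sum]
  simp only [avg_sum, avg_const_mul, h.avg_four]
  have e1 : ∑ x, ∑ y, ∑ z, ∑ w, u x * u y * (v z * v w) *
      ((if x = y then 1 else 0) * (if z = w then 1 else 0)) = (u ⬝ᵥ u) * (v ⬝ᵥ v) := by
    simp [dotProduct, Finset.sum_mul_sum]
  have e2 : ∑ x, ∑ y, ∑ z, ∑ w, u x * u y * (v z * v w) *
      ((if x = z then 1 else 0) * (if y = w then 1 else 0)) = (u ⬝ᵥ v) ^ 2 := by
    simp only [dotProduct, mul_ite, mul_one, mul_zero, Finset.sum_ite_eq, Finset.mem_univ, if_true]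
    rw [pow_two, Finset.sum_mul_sum]
    exact Finset.sum_congr rfl fun x _ => Finset.sum_congr rfl fun y _ => by ring
  have e3 : ∑ x, ∑ y, ∑ z, ∑ w, u x * u y * (v z * v w) *
      ((if x = w then 1 else 0) * (if y = z then 1 else 0)) = (u ⬝ᵥ v) ^ 2 := by
    simp only [dotProduct, mul_ite, mul_one, mul_zero, Finset.sum_ite_eq, Finset.mem_univ, if_true,
      Finset.sum_ite_irrel, Finset.sum_const_zero]
    rw [pow_two, Finset.sum_mul_sum]
    exact Finset.sum_congr rfl fun x _ => Finset.sum_congr rfl fun y _ => by ring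
  have e4 : 0 ≤ ∑ x, ∑ y, ∑ z, ∑ w, u x * u y * (v z * v w) *
      (2 * (if x = y ∧ x = z ∧ x = w then (1 : ℝ) else 0)) := by
    refine Finset.sum_nonneg fun x _ => Finset.sum_nonneg fun y _ => Finset.sum_nonneg fun z _ =>
      Finset.sum_nonneg fun w _ => ?_
    split_ifs with h
    · obtain ⟨rfl, rfl, rfl⟩ := h
      have : 0 ≤ u x * u x * (v x * v x) := mul_nonneg (mul_self_nonneg _) (mul_self_nonneg _)
      linarith
    · simp
  simp only [mul_sub, mul_add, Finset.sum_add_distrib, Finset.sum_sub_distrib]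
  rw [e1, e2, e3]
  linarith

end FourWise

end SparseDict

namespace SparseDict

/-! ### Random sign matrices -/

/-- The matrix of signs for the given seeds. -/
def signMat {Ω : Type*} {N m : ℕ} (σ : Ω → Fin N → ℝ) (ω : Fin m → Ω) :
    Matrix (Fin m) (Fin N) ℝ := Matrix.of fun c x => σ (ω c) x

theorem signMat_mulVec {Ω : Type*} {N m : ℕ} (σ : Ω → Fin N → ℝ) (ω : Fin m → Ω)
    (u : Fin N → ℝ) (c : Fin m) : (signMat σ ω *ᵥ u) c = u ⬝ᵥ σ (ω c) := by
  rw [dotProduct_comm]; rfl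

theorem dotProduct_self_nonneg' {N : ℕ} (u : Fin N → ℝ) : 0 ≤ u ⬝ᵥ u :=
  Finset.sum_nonneg fun _ _ => mul_self_nonneg _

open Classical in
theorem med_mem {q : ℕ} (v : Fin q → ℝ) (bad : Fin q → Prop)
    (hbad : 2 * (Finset.univ.filter bad).card < q) {lo hi : ℝ}
    (h : ∀ l, ¬ bad l → lo ≤ v l ∧ v l ≤ hi) : lo ≤ med v ∧ med v ≤ hi := by
  have hcard : (Finset.univ.filter bad).card + (Finset.univ.filter fun l => ¬ bad l).card = q := by
    rw [Finset.card_filter_add_card_filter_not]; simp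
  obtain ⟨⟨l, hl, hr⟩, h2⟩ := isMed_med (by omega : 0 < q) v
  constructor
  · by_contra hlt
    push Not at hlt
    have hsub : (Finset.univ.filter fun l' => v l' ≤ v l) ⊆ Finset.univ.filter bad := by
      intro l' hl'
      simp only [Finset.mem_filter, Finset.mem_univ, true_and] at hl' ⊢
      by_contra hb
      have := (h l' hb).1
      linarith
    have := Finset.card_le_card hsub
    rw [rank] at hr; omega
  · have hne : (Finset.univ.filter fun l => ¬ bad l).Nonempty := by
      rw [← Finset.card_pos]; omega
    obtain ⟨m, hm, hmax⟩ := Finset.exists_max_image _ v hne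
    refine (h2 m ?_).trans (h m (Finset.mem_filter.1 hm).2).2
    have hsub : (Finset.univ.filter fun l => ¬ bad l) ⊆ Finset.univ.filter fun l' => v l' ≤ v m :=
      fun l' hl' => by simpa using hmax l' hl'
    have := Finset.card_le_card hsub
    rw [rank]; omega

/-- Seeds for `q` groups of `G` rows each. -/
def groupEquiv (Ω : Type*) (q G : ℕ) : (Fin (q * G) → Ω) ≃ (Fin q → Fin G → Ω) :=
  (Equiv.arrowCongr finProdFinEquiv.symm (Equiv.refl Ω)).trans (Equiv.curry _ _ _)

theorem groupEquiv_apply {Ω : Type*} {q G : ℕ} (ω : Fin (q * G) → Ω) (l : Fin q) (g : Fin G) :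
    groupEquiv Ω q G ω l g = ω (finProdFinEquiv (l, g)) := rfl

theorem sum_groups {q G : ℕ} (f : Fin (q * G) → ℝ) :
    ∑ c, f c = ∑ l, ∑ g, f (finProdFinEquiv (l, g)) := by
  rw [← Equiv.sum_comp finProdFinEquiv, Fintype.sum_prod_type]

section
variable {Ω : Type*} [Fintype Ω] [Nonempty Ω] {N : ℕ} {σ : Ω → Fin N → ℝ}

theorem pr_equiv {Ω Ω' : Type*} [Fintype Ω] [Fintype Ω'] (e : Ω ≃ Ω') (p : Ω' → Prop) :
    pr (fun ω => p (e ω)) = pr p := by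
  classical
  exact avg_equiv e fun ω => if p ω then 1 else 0

/-- The sum of squares over a group is far from its mean. -/
def GroupBad (σ : Ω → Fin N → ℝ) (u : Fin N → ℝ) (η : ℝ) {G : ℕ} (ω : Fin G → Ω) : Prop :=
  η * (G * (u ⬝ᵥ u)) < |∑ g, (u ⬝ᵥ σ (ω g)) ^ 2 - G * (u ⬝ᵥ u)|

theorem pr_groupBad_le (h : FourWise σ) (u : Fin N → ℝ) {η : ℝ} (hη : 0 < η) {G : ℕ}
    (hG : 128 / η ^ 2 ≤ G) : pr (fun ω : Fin G → Ω => GroupBad σ u η ω) ≤ 1 / 64 := by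
  classical
  have hG0 : (0 : ℝ) < G := lt_of_lt_of_le (by positivity) hG
  rcases (dotProduct_self_nonneg' u).eq_or_lt with h0 | h0
  · have hu : u = 0 := dotProduct_self_eq_zero.1 h0.symm
    subst hu
    simp [GroupBad, pr, avg]
  · have hμ : avg (fun ω => (u ⬝ᵥ σ ω) ^ 2) = u ⬝ᵥ u := by
      simp only [pow_two]; exact h.avg_dot_mul_dot u u
    refine (chebyshev (v := 2 * (u ⬝ᵥ u) ^ 2) (a := η * (G * (u ⬝ᵥ u))) hμ ?_
      (by positivity)).trans ?_
    · have := h.avg_dot_sq_mul_dot_sq_le u u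
      have e : ∀ ω, ((u ⬝ᵥ σ ω) ^ 2) ^ 2 = (u ⬝ᵥ σ ω) ^ 2 * (u ⬝ᵥ σ ω) ^ 2 := fun ω => by ring
      simp only [e]
      linarith
    · rw [div_le_iff₀ (by positivity)] at hG ⊢
      have : (G : ℝ) * (2 * (u ⬝ᵥ u) ^ 2) = (2 * G * (u ⬝ᵥ u) ^ 2) := by ring
      have h2 : 1 / 64 * (η * (G * (u ⬝ᵥ u))) ^ 2 = (G * η ^ 2) / 64 * (G * (u ⬝ᵥ u) ^ 2) := by ring
      rw [this, h2]
      have h3 : 0 ≤ (G : ℝ) * (u ⬝ᵥ u) ^ 2 := by positivity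
      nlinarith

/-- The estimate from the sketch is accurate. -/
def Accurate (G : ℕ) (η e ν : ℝ) : Prop := (1 - η) * (G * ν) ≤ e ∧ e ≤ (1 + η) * (G * ν)

theorem pr_not_accurate_le (h : FourWise σ) (u : Fin N → ℝ) {η : ℝ} (hη : 0 < η) {q G : ℕ}
    (hG : 128 / η ^ 2 ≤ G) :
    pr (fun ω : Fin (q * G) → Ω => ¬ Accurate G η (est (signMat σ ω *ᵥ u)) (u ⬝ᵥ u)) ≤
      (1 / 4) ^ q := by
  classical
  refine le_trans ?_ (pr_majority_le (q := q) _ (pr_groupBad_le h u hη hG))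
  rw [← pr_equiv (groupEquiv Ω q G)]
  refine pr_mono fun ω hω => ?_
  by_contra hlt
  push Not at hlt
  refine hω (med_mem (groupSq (signMat σ ω *ᵥ u)) _ hlt fun l hl => ?_)
  have e : groupSq (signMat σ ω *ᵥ u) l = ∑ g, (u ⬝ᵥ σ (groupEquiv Ω q G ω l g)) ^ 2 := by
    rw [groupSq]; exact Finset.sum_congr rfl fun g _ => by rw [signMat_mulVec, groupEquiv_apply]
  rw [GroupBad, not_lt, ← e, abs_le] at hl
  constructor <;> nlinarith [hl.1, hl.2]

theorem pr_norm_small_le (h : FourWise σ) (u : Fin N → ℝ) {q : ℕ} :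
    pr (fun ω : Fin (q * 512) → Ω => ∑ c, (u ⬝ᵥ σ (ω c)) ^ 2 < 128 * q * (u ⬝ᵥ u)) ≤
      (1 / 4) ^ q := by
  classical
  refine le_trans ?_ (pr_majority_le (q := q) _ (pr_groupBad_le h u (η := 1 / 2) (G := 512)
    (by norm_num) (by norm_num)))
  rw [← pr_equiv (groupEquiv Ω q 512)]
  refine pr_mono fun ω hω => ?_
  by_contra hlt
  push Not at hlt
  refine absurd hω (not_lt.2 ?_)
  set bad := Finset.univ.filter fun l => GroupBad σ u (1 / 2) (groupEquiv Ω q 512 ω l) with hb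
  set good := Finset.univ.filter fun l => ¬ GroupBad σ u (1 / 2) (groupEquiv Ω q 512 ω l) with hg
  have hcard : bad.card + good.card = q := by
    rw [hb, hg, Finset.card_filter_add_card_filter_not]; simp
  have hgc : (q : ℝ) ≤ 2 * good.card := by
    have : q ≤ 2 * good.card := by omega
    exact_mod_cast this
  rw [sum_groups]
  have h1 : ∑ l ∈ good, 256 * (u ⬝ᵥ u) ≤
      ∑ l : Fin q, ∑ g : Fin 512, (u ⬝ᵥ σ (ω (finProdFinEquiv (l, g)))) ^ 2 := by
    refine (Finset.sum_le_sum fun l hl => ?_).trans (Finset.sum_le_univ_sum_of_nonneg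
      fun l => Finset.sum_nonneg fun g _ => sq_nonneg _)
    rw [hg, Finset.mem_filter] at hl
    have h2 := hl.2
    simp only [GroupBad, not_lt, abs_le, groupEquiv_apply] at h2
    push_cast at h2
    linarith [h2.1]
  rw [Finset.sum_const, nsmul_eq_mul] at h1
  have := dotProduct_self_nonneg' u
  nlinarith

end

/-! ### The smallest singular value of a sketched basis -/

/-- Round the coordinates in a set to integers. -/
theorem exists_rounding {s k : ℕ} (a : Fin s → Fin k → ℝ) (y : Fin k → ℝ) (T : Finset (Fin k)) :
    ∃ w : Fin k → ℝ, (∀ i ∈ T, ∃ z : ℤ, w i = z) ∧ (∀ i ∉ T, w i = y i) ∧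
      (∀ i, |w i - y i| ≤ 1) ∧
      ∑ c, (∑ i, w i * a c i) ^ 2 ≤ ∑ c, (∑ i, y i * a c i) ^ 2 + 1 / 4 * ∑ i ∈ T, ∑ c, a c i ^ 2 := by
  classical
  induction T using Finset.induction_on with
  | empty => exact ⟨y, by simp, by simp, by simp, by simp⟩
  | insert j T hj ih =>
    obtain ⟨w, h1, h2, h3, h4⟩ := ih
    set f := Int.fract (w j) with hf
    have hf0 : 0 ≤ f := Int.fract_nonneg _
    have hf1 : f < 1 := Int.fract_lt_one _
    have hupd : ∀ t : ℝ, ∑ c, (∑ i, Function.update w j (w j + t) i * a c i) ^ 2 =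
        ∑ c, (∑ i, w i * a c i) ^ 2 + 2 * t * ∑ c, a c j * ∑ i, w i * a c i +
          t ^ 2 * ∑ c, a c j ^ 2 := by
      intro t
      have e : ∀ c, ∑ i, Function.update w j (w j + t) i * a c i = ∑ i, w i * a c i + t * a c j := by
        intro c
        rw [← Finset.add_sum_erase _ _ (Finset.mem_univ j),
          ← Finset.add_sum_erase (a := j) _ (fun i => w i * a c i) (Finset.mem_univ j),
          Function.update_self,
          Finset.sum_congr rfl fun i hi => by rw [Function.update_of_ne (Finset.ne_of_mem_erase hi)]]
        ring
      simp only [e, add_sq, Finset.sum_add_distrib, Finset.mul_sum]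
      congr 1
      · congr 1
        refine Finset.sum_congr rfl fun c _ => ?_
        rw [Finset.sum_mul]
        exact Finset.sum_congr rfl fun x _ => by ring
      · exact Finset.sum_congr rfl fun c _ => by ring
    have hA : 0 ≤ ∑ c, a c j ^ 2 := Finset.sum_nonneg fun _ _ => sq_nonneg _
    have key : ∃ t : ℝ, (∃ z : ℤ, w j + t = z) ∧ |t| ≤ 1 ∧
        2 * t * (∑ c, a c j * ∑ i, w i * a c i) + t ^ 2 * ∑ c, a c j ^ 2 ≤
          1 / 4 * ∑ c, a c j ^ 2 := by
      by_contra hcon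
      push Not at hcon
      have g1 := hcon (-f) ⟨⌊w j⌋, by rw [hf]; linarith [Int.floor_add_fract (w j)]⟩
        (by rw [abs_neg, abs_of_nonneg hf0]; exact hf1.le)
      have g2 := hcon (1 - f) ⟨⌊w j⌋ + 1, by rw [hf]; push_cast; linarith [Int.floor_add_fract (w j)]⟩
        (by rw [abs_of_nonneg (by linarith)]; linarith)
      have g3 : f * (1 - f) * ∑ c, a c j ^ 2 ≤ 1 / 4 * ∑ c, a c j ^ 2 :=
        mul_le_mul_of_nonneg_right (by nlinarith [sq_nonneg (f - 1 / 2)]) hA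
      rcases hf0.eq_or_lt with hz | hz
      · rw [← hz] at g1; simp at g1; linarith
      · nlinarith [mul_lt_mul_of_pos_left g2 hz,
          mul_lt_mul_of_pos_left g1 (show 0 < 1 - f by linarith)]
    obtain ⟨t, ht1, ht2, ht3⟩ := key
    refine ⟨Function.update w j (w j + t), ?_, ?_, ?_, ?_⟩
    · intro i hi
      by_cases hij : i = j
      · subst hij; simpa using ht1
      · rw [Function.update_of_ne hij]
        exact h1 i ((Finset.mem_insert.1 hi).resolve_left hij)
    · intro i hi
      rw [Finset.mem_insert, not_or] at hi
      rw [Function.update_of_ne hi.1, h2 i hi.2]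
    · intro i
      by_cases hij : i = j
      · subst hij
        rw [Function.update_self, h2 i hj]; simpa using ht2
      · rw [Function.update_of_ne hij]; exact h3 i
    · rw [hupd, Finset.sum_insert hj]
      linarith

theorem norm_ge_of_grid {s k k' : ℕ} (hk : 0 < k) (hk' : k' ≤ k) {τ : ℕ} (hτ : 1 ≤ τ)
    (a : Fin s → Fin k' → ℝ) (ha : ∑ i, ∑ c, a c i ^ 2 ≤ τ * (s * k))
    (hz : ∀ z : Fin k' → ℤ, ∑ i, z i ^ 2 ≤ (32 * τ * k : ℕ) →
      (s : ℝ) / 4 * ∑ i, (z i : ℝ) ^ 2 ≤ ∑ c, (∑ i, z i * a c i) ^ 2) (y : Fin k' → ℝ) :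
    (s : ℝ) / 32 * ∑ i, y i ^ 2 ≤ ∑ c, (∑ i, y i * a c i) ^ 2 := by
  have hτ' : (1 : ℝ) ≤ τ := by exact_mod_cast hτ
  have hkR : (1 : ℝ) ≤ k := by exact_mod_cast hk
  have hk'R : (k' : ℝ) ≤ k := by exact_mod_cast hk'
  have hs0 : (0 : ℝ) ≤ s := Nat.cast_nonneg s
  set R : ℝ := 8 * τ * k with hR
  have hRpos : 0 < R := by positivity
  have key : ∀ y : Fin k' → ℝ, ∑ i, y i ^ 2 = R →
      (s : ℝ) / 32 * ∑ i, y i ^ 2 ≤ ∑ c, (∑ i, y i * a c i) ^ 2 := by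
    intro y hy
    obtain ⟨w, h1, -, h3, h4⟩ := exists_rounding a y Finset.univ
    choose z hzw using fun i => h1 i (Finset.mem_univ i)
    have hd : ∑ i, (w i - y i) ^ 2 ≤ k := by
      refine (Finset.sum_le_sum (g := fun _ => (1 : ℝ)) fun i _ => ?_).trans (by simpa using hk'R)
      rw [← sq_abs]; exact pow_le_one₀ (abs_nonneg _) (h3 i)
    have hlow : ∑ i, y i ^ 2 ≤ 2 * ∑ i, w i ^ 2 + 2 * ∑ i, (w i - y i) ^ 2 := by
      rw [Finset.mul_sum, Finset.mul_sum, ← Finset.sum_add_distrib]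
      exact Finset.sum_le_sum fun i _ => by nlinarith [sq_nonneg (2 * w i - y i)]
    have hup : ∑ i, w i ^ 2 ≤ 2 * ∑ i, y i ^ 2 + 2 * ∑ i, (w i - y i) ^ 2 := by
      rw [Finset.mul_sum, Finset.mul_sum, ← Finset.sum_add_distrib]
      exact Finset.sum_le_sum fun i _ => by nlinarith [sq_nonneg (w i - 2 * y i)]
    have hkR' : (k : ℝ) ≤ R / 8 := by rw [hR]; nlinarith
    have h5 : (s : ℝ) / 4 * ∑ i, w i ^ 2 ≤ ∑ c, (∑ i, w i * a c i) ^ 2 := by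
      have := hz z ?_
      · simpa only [hzw] using this
      · have h6 : ∑ i, (z i : ℝ) ^ 2 ≤ 32 * τ * k := by
          simp only [hzw] at hup hd
          rw [hy] at hup
          simp only [hR] at hup hkR'
          nlinarith
        exact_mod_cast h6
    rw [hy] at hlow ⊢
    have h6 : 3 / 8 * R ≤ ∑ i, w i ^ 2 := by linarith
    have h7 : (τ : ℝ) * (s * k) = s * R / 8 := by rw [hR]; ring
    rw [h7] at ha
    have h8 := mul_le_mul_of_nonneg_left h6 (show 0 ≤ (s : ℝ) / 4 by positivity)
    have h9 : 0 ≤ s * R := by positivity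
    nlinarith
  have h0 : 0 ≤ ∑ i, y i ^ 2 := Finset.sum_nonneg fun _ _ => sq_nonneg _
  rcases h0.eq_or_lt with h | h
  · rw [← h, mul_zero]; exact Finset.sum_nonneg fun _ _ => sq_nonneg _
  · set t := Real.sqrt (R / ∑ i, y i ^ 2) with ht
    have ht2 : t ^ 2 = R / ∑ i, y i ^ 2 := Real.sq_sqrt (by positivity)
    have ht0 : 0 < t ^ 2 := by rw [ht2]; positivity
    have e1 : ∑ i, (t * y i) ^ 2 = t ^ 2 * ∑ i, y i ^ 2 := by
      rw [Finset.mul_sum]; exact Finset.sum_congr rfl fun i _ => by ring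
    have e2 : ∑ c, (∑ i, t * y i * a c i) ^ 2 = t ^ 2 * ∑ c, (∑ i, y i * a c i) ^ 2 := by
      rw [Finset.mul_sum]
      refine Finset.sum_congr rfl fun c _ => ?_
      rw [← mul_pow, Finset.mul_sum]
      simp only [mul_assoc]
    have := key (fun i => t * y i) (by rw [e1, ht2]; field_simp)
    rw [e1, e2, mul_left_comm] at this
    exact le_of_mul_le_mul_left this ht0

/-- The integer points in a ball. -/
noncomputable def ballPoints (k R : ℕ) : Finset (Fin k → ℤ) :=
  (Fintype.piFinset fun _ => Finset.Icc (-(R : ℤ)) R).filter fun z => ∑ i, z i ^ 2 ≤ (R : ℤ)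

theorem mem_ballPoints {k R : ℕ} {z : Fin k → ℤ} (h : ∑ i, z i ^ 2 ≤ (R : ℤ)) :
    z ∈ ballPoints k R := by
  rw [ballPoints, Finset.mem_filter, Fintype.mem_piFinset]
  refine ⟨fun i => ?_, h⟩
  have h1 : z i ^ 2 ≤ R :=
    (Finset.single_le_sum (f := fun i => z i ^ 2) (fun i _ => sq_nonneg _) (Finset.mem_univ i)).trans h
  rw [Finset.mem_Icc]
  constructor <;> nlinarith

theorem sum_two_pow_le (R : ℕ) :
    ∑ z ∈ Finset.Icc (-(R : ℤ)) R, (1 / 2 : ℝ) ^ (z ^ 2).toNat ≤ 3 - 2 * (1 / 2) ^ R := by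
  induction R with
  | zero => norm_num
  | succ R ih =>
    have e : Finset.Icc (-((R + 1 : ℕ) : ℤ)) ((R + 1 : ℕ) : ℤ) =
        insert (-((R + 1 : ℕ) : ℤ)) (insert ((R + 1 : ℕ) : ℤ) (Finset.Icc (-(R : ℤ)) R)) := by
      ext z
      simp only [Finset.mem_insert, Finset.mem_Icc]
      push_cast; omega
    rw [e, Finset.sum_insert, Finset.sum_insert]
    · have h1 : ((((R + 1 : ℕ) : ℤ)) ^ 2).toNat = (R + 1) ^ 2 := by
        rw [← Nat.cast_pow, Int.toNat_natCast]
      rw [neg_sq, h1]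
      have h2 : (1 / 2 : ℝ) ^ ((R + 1) ^ 2) ≤ (1 / 2) ^ (R + 1) :=
        pow_le_pow_of_le_one (by norm_num) (by norm_num) (by nlinarith)
      have h3 : (1 / 2 : ℝ) ^ (R + 1) = 1 / 2 * (1 / 2) ^ R := by ring
      linarith
    · simp
    · simp only [Finset.mem_insert, Finset.mem_Icc]; push_cast; omega

theorem card_ballPoints_le (k R : ℕ) : ((ballPoints k R).card : ℝ) ≤ 2 ^ R * 3 ^ k := by
  have h1 : ((ballPoints k R).card : ℝ) ≤
      ∑ z ∈ ballPoints k R, 2 ^ R * ∏ i, (1 / 2 : ℝ) ^ (z i ^ 2).toNat := by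
    rw [Finset.card_eq_sum_ones, Nat.cast_sum]
    refine Finset.sum_le_sum fun z hz => ?_
    rw [ballPoints, Finset.mem_filter] at hz
    rw [Finset.prod_pow_eq_pow_sum, one_div, inv_pow, ← div_eq_mul_inv, Nat.cast_one,
      one_le_div (by positivity)]
    refine pow_le_pow_right₀ (by norm_num) ?_
    have : ((∑ i, (z i ^ 2).toNat : ℕ) : ℤ) ≤ R := by
      rw [Nat.cast_sum]
      exact le_trans (le_of_eq (Finset.sum_congr rfl fun i _ =>
        Int.toNat_of_nonneg (sq_nonneg (z i)))) hz.2
    exact_mod_cast this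
  refine h1.trans ?_
  rw [← Finset.mul_sum]
  refine mul_le_mul_of_nonneg_left ?_ (by positivity)
  refine (Finset.sum_le_sum_of_subset_of_nonneg (Finset.filter_subset _ _)
    fun z _ _ => Finset.prod_nonneg fun i _ => pow_nonneg (by norm_num : (0 : ℝ) ≤ 1 / 2) _).trans ?_
  rw [← Finset.prod_univ_sum (fun _ => Finset.Icc (-(R : ℤ)) R)
    (fun _ z => (1 / 2 : ℝ) ^ (z ^ 2).toNat), Finset.prod_const, Finset.card_univ, Fintype.card_fin]
  have h0 : (0 : ℝ) ≤ ∑ z ∈ Finset.Icc (-(R : ℤ)) R, (1 / 2 : ℝ) ^ (z ^ 2).toNat :=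
    Finset.sum_nonneg fun z _ => pow_nonneg (by norm_num) _
  have h3 : ∑ z ∈ Finset.Icc (-(R : ℤ)) R, (1 / 2 : ℝ) ^ (z ^ 2).toNat ≤ 3 := by
    have h4 := sum_two_pow_le R
    have : (0 : ℝ) ≤ (1 / 2) ^ R := by positivity
    linarith
  exact pow_le_pow_left₀ h0 h3 k

end SparseDict

namespace SparseDict

/-! ### Sums of squares -/

/-- The square of the Frobenius norm. -/
def sqNorm {m n : ℕ} (A : Matrix (Fin m) (Fin n) ℝ) : ℝ := ∑ i, ∑ j, A i j ^ 2

theorem sqNorm_nonneg {m n : ℕ} (A : Matrix (Fin m) (Fin n) ℝ) : 0 ≤ sqNorm A :=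
  Finset.sum_nonneg fun _ _ => Finset.sum_nonneg fun _ _ => sq_nonneg _

theorem sqNorm_eq_rows {m n : ℕ} (A : Matrix (Fin m) (Fin n) ℝ) :
    sqNorm A = ∑ i, A i ⬝ᵥ A i :=
  Finset.sum_congr rfl fun _ _ => Finset.sum_congr rfl fun _ _ => pow_two _

theorem sqNorm_eq_cols {m n : ℕ} (A : Matrix (Fin m) (Fin n) ℝ) :
    sqNorm A = ∑ j, Aᵀ j ⬝ᵥ Aᵀ j := by
  rw [sqNorm, Finset.sum_comm]
  exact Finset.sum_congr rfl fun _ _ => Finset.sum_congr rfl fun _ _ => pow_two _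

theorem objective_eq {n d k : ℕ} (A : Matrix (Fin n) (Fin d) ℝ) (X : Matrix (Fin n) (Fin k) ℝ)
    (Y : Matrix (Fin k) (Fin d) ℝ) : objective A X Y = √(sqNorm (X * Y - A)) := by
  rw [objective, Matrix.frobenius_norm_def, Real.sqrt_eq_rpow, sqNorm]
  congr 1
  exact Finset.sum_congr rfl fun i _ => Finset.sum_congr rfl fun j _ => by
    rw [Real.norm_eq_abs, Real.rpow_two, sq_abs]

theorem sqNorm_flatten {n d : ℕ} (A : Matrix (Fin n) (Fin d) ℝ) :
    flatten A ⬝ᵥ flatten A = sqNorm A := by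
  rw [dotProduct, ← Equiv.sum_comp finProdFinEquiv, Fintype.sum_prod_type, sqNorm]
  refine Finset.sum_congr rfl fun i _ => Finset.sum_congr rfl fun j _ => ?_
  have h : ((finProdFinEquiv (i, j)).divNat, (finProdFinEquiv (i, j)).modNat) = (i, j) :=
    finProdFinEquiv.symm_apply_apply (i, j)
  rw [Prod.ext_iff] at h
  obtain ⟨h1, h2⟩ := h
  dsimp only at h1 h2
  rw [flatten, h1, h2, pow_two]

theorem sqNorm_mul_add {n d k : ℕ} {X : Matrix (Fin n) (Fin k) ℝ} {B : Matrix (Fin n) (Fin d) ℝ}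
    (h : Xᵀ * B = 0) (C : Matrix (Fin k) (Fin d) ℝ) :
    sqNorm (X * C + B) = sqNorm (X * C) + sqNorm B := by
  have h1 : ∀ j, (X * C)ᵀ j ⬝ᵥ Bᵀ j = 0 := by
    intro j
    have : ((X * C)ᵀ * B) j j = 0 := by
      rw [Matrix.transpose_mul, Matrix.mul_assoc, h, Matrix.mul_zero]; rfl
    exact this
  rw [sqNorm_eq_cols, sqNorm_eq_cols, sqNorm_eq_cols, ← Finset.sum_add_distrib]
  refine Finset.sum_congr rfl fun j _ => ?_
  rw [Matrix.transpose_add]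
  change ((X * C)ᵀ j + Bᵀ j) ⬝ᵥ ((X * C)ᵀ j + Bᵀ j) = _
  rw [add_dotProduct, dotProduct_add, dotProduct_add, h1, dotProduct_comm (Bᵀ j), h1]
  ring

/-- The least squares solution. -/
noncomputable def lsq {n d k : ℕ} (X : Matrix (Fin n) (Fin k) ℝ) (A : Matrix (Fin n) (Fin d) ℝ) :
    Matrix (Fin k) (Fin d) ℝ := greville X k * A

theorem sqNorm_lsq_add {n d k : ℕ} (X : Matrix (Fin n) (Fin k) ℝ) (A : Matrix (Fin n) (Fin d) ℝ)
    (Y : Matrix (Fin k) (Fin d) ℝ) :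
    sqNorm (X * Y - A) = sqNorm (X * (Y - lsq X A)) + sqNorm (X * lsq X A - A) := by
  have h : sqNorm (X * (Y - lsq X A) + (X * lsq X A - A)) = _ :=
    sqNorm_mul_add (greville_normal X A) _
  refine Eq.trans ?_ h
  rw [Matrix.mul_sub]
  congr 1; abel

theorem sqNorm_lsq_le {n d k : ℕ} (X : Matrix (Fin n) (Fin k) ℝ) (A : Matrix (Fin n) (Fin d) ℝ)
    (Y : Matrix (Fin k) (Fin d) ℝ) : sqNorm (X * lsq X A - A) ≤ sqNorm (X * Y - A) := by
  rw [sqNorm_lsq_add X A Y]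
  linarith [sqNorm_nonneg (X * (Y - lsq X A))]

theorem exists_orthonormal_span {n k : ℕ} (X : Matrix (Fin n) (Fin k) ℝ) :
    ∃ k' ≤ k, ∃ u : Fin k' → Fin n → ℝ, (∀ i j, u i ⬝ᵥ u j = if i = j then 1 else 0) ∧
      (∀ i, ∃ v, u i = X *ᵥ v) ∧ ∀ v, ∃ c : Fin k' → ℝ, X *ᵥ v = ∑ i, c i • u i := by
  set V := LinearMap.range (Matrix.toEuclideanLin X) with hV
  have hfin : Module.finrank ℝ V ≤ k := by
    have := LinearMap.finrank_range_le (Matrix.toEuclideanLin X)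
    rwa [finrank_euclideanSpace_fin] at this
  set b := stdOrthonormalBasis ℝ V with hb
  refine ⟨_, hfin, fun i => WithLp.ofLp (b i : EuclideanSpace ℝ (Fin n)), ?_, ?_, ?_⟩
  · intro i j
    have h := orthonormal_iff_ite.1 b.orthonormal i j
    rw [Submodule.coe_inner, EuclideanSpace.inner_eq_star_dotProduct] at h
    rw [dotProduct_comm]
    simpa using h
  · intro i
    obtain ⟨v, hv⟩ := (b i).2
    exact ⟨WithLp.ofLp v, (congrArg WithLp.ofLp hv).symm⟩
  · intro v
    have hmem : Matrix.toEuclideanLin X (WithLp.toLp 2 v) ∈ V := ⟨_, rfl⟩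
    refine ⟨fun i => b.repr ⟨_, hmem⟩ i, ?_⟩
    have h := congrArg (fun x : V => WithLp.ofLp (x : EuclideanSpace ℝ (Fin n)))
      (b.sum_repr ⟨_, hmem⟩)
    simp only [Submodule.coe_sum, Submodule.coe_smul] at h
    rw [WithLp.ofLp_sum] at h
    simp only [WithLp.ofLp_smul] at h
    rw [h]; rfl

/-! ### Sketched regression -/

section
variable {Ω : Type*} [Fintype Ω] [Nonempty Ω]

theorem avg_sum_sq {s : ℕ} {f : Ω → ℝ} (hf : avg f = 0) :
    avg (fun ω : Fin s → Ω => (∑ c, f (ω c)) ^ 2) = s * avg fun ω => f ω ^ 2 := by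
  simp only [pow_two, Finset.sum_mul_sum]
  rw [avg_sum]
  have : ∀ c : Fin s, avg (fun ω : Fin s → Ω => ∑ c', f (ω c) * f (ω c')) =
      avg fun ω => f ω * f ω := by
    intro c
    rw [avg_sum, Finset.sum_eq_single c]
    · exact avg_pi_single c fun ω => f ω * f ω
    · intro c' _ hc
      rw [avg_pi_pair hc.symm, hf, zero_mul]
    · simp
  simp [this]

/-- Every solution of the sketched normal equations is a good solution. -/
def RegGood {n d k s : ℕ} (X : Matrix (Fin n) (Fin k) ℝ) (A : Matrix (Fin n) (Fin d) ℝ) (ρ : ℝ)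
    (S : Matrix (Fin s) (Fin n) ℝ) : Prop :=
  ∀ Y : Matrix (Fin k) (Fin d) ℝ, (S * X)ᵀ * (S * X * Y - S * A) = 0 →
    sqNorm (X * Y - A) ≤ (1 + ρ) * sqNorm (X * lsq X A - A)

theorem regGood_of_bounds {n d k k' s τ : ℕ} (hs : 0 < s) {X : Matrix (Fin n) (Fin k) ℝ}
    {A : Matrix (Fin n) (Fin d) ℝ} {ρ : ℝ} (hρ : 1024 * τ * k / s ≤ ρ)
    {u : Fin k' → Fin n → ℝ} (hu : ∀ i j, u i ⬝ᵥ u j = if i = j then 1 else 0)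
    (hu1 : ∀ i, ∃ v, u i = X *ᵥ v) (hu2 : ∀ v, ∃ c : Fin k' → ℝ, X *ᵥ v = ∑ i, c i • u i)
    {S : Matrix (Fin s) (Fin n) ℝ}
    (h1 : ∀ y : Fin k' → ℝ, (s : ℝ) / 32 * ∑ i, y i ^ 2 ≤ ∑ c, (∑ i, y i * (S *ᵥ u i) c) ^ 2)
    (h2 : ∑ i, ∑ j, ((S *ᵥ u i) ⬝ᵥ (S *ᵥ (X * lsq X A - A)ᵀ j)) ^ 2 ≤
      τ * (s * k * sqNorm (X * lsq X A - A))) : RegGood X A ρ S := by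
  intro Y hY
  obtain ⟨B, hB⟩ : ∃ B, B = X * lsq X A - A := ⟨_, rfl⟩
  have hsR : (0 : ℝ) < s := by exact_mod_cast hs
  rw [sqNorm_lsq_add X A Y]
  rw [← hB] at h2 ⊢
  choose v' hv' using hu1
  choose c hc using fun j => hu2 ((Y - lsq X A)ᵀ j)
  have hXA : X * Y - A = X * (Y - lsq X A) + B := by rw [hB, Matrix.mul_sub]; abel
  have hcol : ∀ j, (X * Y - A)ᵀ j = ∑ i, c j i • u i + Bᵀ j := by
    intro j
    rw [hXA, ← hc]; rfl
  have hnorm : sqNorm (X * (Y - lsq X A)) = ∑ j, ∑ i, c j i ^ 2 := by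
    rw [sqNorm_eq_cols]
    refine Finset.sum_congr rfl fun j _ => ?_
    have : (X * (Y - lsq X A))ᵀ j = ∑ i, c j i • u i := by rw [← hc]; rfl
    rw [this, sum_dotProduct]
    simp only [dotProduct_sum, smul_dotProduct, dotProduct_smul, hu, smul_eq_mul]
    simp [pow_two]
  have hnormal : ∀ i j, (S *ᵥ u i) ⬝ᵥ (S *ᵥ (X * Y - A)ᵀ j) = 0 := by
    intro i j
    have e : S *ᵥ (X * Y - A)ᵀ j = (S * X * Y - S * A)ᵀ j := by
      rw [Matrix.mul_assoc, ← Matrix.mul_sub]; rfl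
    have e2 : (S * X)ᵀ *ᵥ ((S * X * Y - S * A)ᵀ j) = 0 := by
      ext a
      exact congrFun (congrFun hY a) j
    rw [e, hv', Matrix.mulVec_mulVec, dotProduct_comm, Matrix.dotProduct_mulVec,
      ← Matrix.mulVec_transpose, e2, zero_dotProduct]
  obtain ⟨E, hE⟩ : ∃ E : Fin k' → Fin d → ℝ, E = fun i j => (S *ᵥ u i) ⬝ᵥ (S *ᵥ Bᵀ j) := ⟨_, rfl⟩
  have hSum : ∀ j, S *ᵥ (∑ i, c j i • u i) = ∑ i, c j i • (S *ᵥ u i) := fun j => by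
    rw [Matrix.mulVec_sum]
    exact Finset.sum_congr rfl fun i _ => Matrix.mulVec_smul _ _ _
  have hj : ∀ j, ((s : ℝ) / 32) ^ 2 * ∑ i, c j i ^ 2 ≤ ∑ i, E i j ^ 2 := by
    intro j
    set w : Fin s → ℝ := ∑ i, c j i • (S *ᵥ u i) with hw
    have g1 : ∀ i, (S *ᵥ u i) ⬝ᵥ w = -E i j := by
      intro i
      have := hnormal i j
      rw [hcol, Matrix.mulVec_add, hSum, dotProduct_add] at this
      rw [hE]; linarith
    have g2 : w ⬝ᵥ w = -∑ i, c j i * E i j := by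
      conv_lhs => rw [hw]
      rw [sum_dotProduct, ← Finset.sum_neg_distrib]
      exact Finset.sum_congr rfl fun i _ => by rw [smul_dotProduct, g1, smul_eq_mul]; ring
    have g3 : ∑ c', (∑ i, c j i * (S *ᵥ u i) c') ^ 2 = w ⬝ᵥ w := by
      rw [dotProduct]
      refine Finset.sum_congr rfl fun c' _ => ?_
      rw [hw, Finset.sum_apply, pow_two]; rfl
    have g4 := h1 (c j)
    rw [g3, g2] at g4
    obtain ⟨L, hL⟩ : ∃ L : ℝ, L = s / 32 := ⟨_, rfl⟩
    rw [← hL] at g4 ⊢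
    have hL0 : 0 < L := by rw [hL]; positivity
    have g5 : -(2 * L) * ∑ i, c j i * E i j ≤ L ^ 2 * ∑ i, c j i ^ 2 + ∑ i, E i j ^ 2 := by
      rw [Finset.mul_sum, Finset.mul_sum, ← Finset.sum_add_distrib]
      exact Finset.sum_le_sum fun i _ => by nlinarith [sq_nonneg (L * c j i + E i j)]
    have g6 := mul_le_mul_of_nonneg_left g4 (show 0 ≤ 2 * L by positivity)
    nlinarith
  have hsum : ((s : ℝ) / 32) ^ 2 * sqNorm (X * (Y - lsq X A)) ≤ τ * (s * k * sqNorm B) := by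
    rw [hnorm, Finset.mul_sum]
    refine (Finset.sum_le_sum fun j _ => hj j).trans ?_
    rw [Finset.sum_comm]
    exact (le_of_eq (by rw [hE])).trans h2
  have hB0 := sqNorm_nonneg B
  have h3 : sqNorm (X * (Y - lsq X A)) ≤ 1024 * τ * k / s * sqNorm B := by
    rw [div_mul_eq_mul_div, le_div_iff₀ hsR]
    have e1 : ((s : ℝ) / 32) ^ 2 * sqNorm (X * (Y - lsq X A)) =
      s / 1024 * (sqNorm (X * (Y - lsq X A)) * s) := by ring
    have e2 : (τ : ℝ) * (s * k * sqNorm B) = s / 1024 * (1024 * τ * k * sqNorm B) := by ring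
    rw [e1, e2] at hsum
    exact le_of_mul_le_mul_left hsum (by positivity)
  have h4 := mul_le_mul_of_nonneg_right hρ hB0
  linarith

theorem pr_not_regGood_le {n d k q τ : ℕ} (hk : 0 < k) (hτ : 1 ≤ τ) (hq : 0 < q)
    {σ : Ω → Fin n → ℝ} (h : FourWise σ) (X : Matrix (Fin n) (Fin k) ℝ)
    (A : Matrix (Fin n) (Fin d) ℝ) {ρ : ℝ} (hρ : 2 * τ * k / q ≤ ρ) :
    pr (fun ω : Fin (q * 512) → Ω => ¬ RegGood X A ρ (signMat σ ω)) ≤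
      2 / τ + 2 ^ (32 * τ * k) * 3 ^ k * (1 / 4) ^ q := by
  classical
  obtain ⟨k', hk', u, hu, hu1, hu2⟩ := exists_orthonormal_span X
  set B := X * lsq X A - A with hB
  have hτR : (0 : ℝ) < τ := by exact_mod_cast hτ
  have hqR : (0 : ℝ) < q := by exact_mod_cast hq
  have hk'R : (k' : ℝ) ≤ k := by exact_mod_cast hk'
  have hXB : Xᵀ * B = 0 := greville_normal X A
  have huB : ∀ i j, u i ⬝ᵥ Bᵀ j = 0 := by
    intro i j
    obtain ⟨v, hv⟩ := hu1 i
    rw [hv, dotProduct_comm, Matrix.dotProduct_mulVec, ← Matrix.mulVec_transpose]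
    have : Xᵀ *ᵥ Bᵀ j = 0 := by
      ext a
      exact congrFun (congrFun hXB a) j
    rw [this, zero_dotProduct]
  let p1 : (Fin (q * 512) → Ω) → Prop := fun ω =>
    (τ : ℝ) * ((q * 512 : ℕ) * k) < ∑ i, ∑ c, (u i ⬝ᵥ σ (ω c)) ^ 2
  let p2 : (Fin (q * 512) → Ω) → Prop := fun ω => ∃ z ∈ ballPoints k' (32 * τ * k),
    ∑ c, ((∑ i, (z i : ℝ) • u i) ⬝ᵥ σ (ω c)) ^ 2 <
      128 * q * ((∑ i, (z i : ℝ) • u i) ⬝ᵥ (∑ i, (z i : ℝ) • u i))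
  let p3 : (Fin (q * 512) → Ω) → Prop := fun ω => (τ : ℝ) * ((q * 512 : ℕ) * k * sqNorm B) <
    ∑ i, ∑ j, (∑ c, (u i ⬝ᵥ σ (ω c)) * (Bᵀ j ⬝ᵥ σ (ω c))) ^ 2
  have e1 : pr p1 ≤ 1 / τ := by
    refine markov (fun ω => Finset.sum_nonneg fun _ _ => Finset.sum_nonneg fun _ _ => sq_nonneg _)
      ?_ hτR
    rw [avg_sum]
    have : ∀ i, avg (fun ω : Fin (q * 512) → Ω => ∑ c, (u i ⬝ᵥ σ (ω c)) ^ 2) = (q * 512 : ℕ) := by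
      intro i
      rw [avg_sum]
      have e : ∀ c : Fin (q * 512), avg (fun ω : Fin (q * 512) → Ω => (u i ⬝ᵥ σ (ω c)) ^ 2) = 1 := by
        intro c
        rw [avg_pi_single c fun ω => (u i ⬝ᵥ σ ω) ^ 2]
        simp only [pow_two]
        rw [h.avg_dot_mul_dot, hu, if_pos rfl]
      simp [e]
    simp only [this, Finset.sum_const, Finset.card_univ, Fintype.card_fin, nsmul_eq_mul]
    rw [mul_comm]
    exact mul_le_mul_of_nonneg_left hk'R (Nat.cast_nonneg _)
  have e2 : pr p2 ≤ 2 ^ (32 * τ * k) * 3 ^ k * (1 / 4) ^ q := by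
    refine (pr_exists_le _ _).trans ((Finset.sum_le_sum fun z _ =>
      pr_norm_small_le h (∑ i, (z i : ℝ) • u i)).trans ?_)
    rw [Finset.sum_const, nsmul_eq_mul]
    refine mul_le_mul_of_nonneg_right ((card_ballPoints_le _ _).trans ?_) (by positivity)
    exact mul_le_mul_of_nonneg_left (pow_le_pow_right₀ (by norm_num) hk') (by positivity)
  have e3 : pr p3 ≤ 1 / τ := by
    refine markov (fun ω => Finset.sum_nonneg fun _ _ => Finset.sum_nonneg fun _ _ => sq_nonneg _)
      ?_ hτR
    rw [avg_sum]
    have : ∀ i, avg (fun ω : Fin (q * 512) → Ω =>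
        ∑ j, (∑ c, (u i ⬝ᵥ σ (ω c)) * (Bᵀ j ⬝ᵥ σ (ω c))) ^ 2) ≤ (q * 512 : ℕ) * sqNorm B := by
      intro i
      rw [avg_sum, sqNorm_eq_cols, Finset.mul_sum]
      refine Finset.sum_le_sum fun j _ => ?_
      rw [avg_sum_sq (f := fun ω => (u i ⬝ᵥ σ ω) * (Bᵀ j ⬝ᵥ σ ω))
        (by rw [h.avg_dot_mul_dot, huB])]
      refine mul_le_mul_of_nonneg_left ?_ (Nat.cast_nonneg _)
      simp only [mul_pow]
      refine (h.avg_dot_sq_mul_dot_sq_le _ _).trans (le_of_eq ?_)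
      rw [hu, if_pos rfl, huB]; ring
    refine (Finset.sum_le_sum fun i _ => this i).trans ?_
    rw [Finset.sum_const, Finset.card_univ, Fintype.card_fin, nsmul_eq_mul]
    have := mul_le_mul_of_nonneg_right hk'R
      (mul_nonneg (Nat.cast_nonneg (q * 512)) (sqNorm_nonneg B) : (0 : ℝ) ≤ (q * 512 : ℕ) * sqNorm B)
    refine this.trans (le_of_eq (by ring))
  have hsub : pr (fun ω : Fin (q * 512) → Ω => ¬ RegGood X A ρ (signMat σ ω)) ≤
      pr fun ω => p1 ω ∨ p2 ω ∨ p3 ω := by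
    refine pr_mono fun ω hω => ?_
    by_contra hcon
    push Not at hcon
    obtain ⟨g1, g2, g3⟩ := hcon
    refine hω (regGood_of_bounds (s := q * 512) (τ := τ) (by positivity) ?_ hu hu1 hu2 ?_ ?_)
    · refine le_trans (le_of_eq ?_) hρ
      push_cast; field_simp; norm_num
    · refine norm_ge_of_grid hk hk' hτ _ ?_ ?_
      · simp only [signMat_mulVec]
        exact not_lt.1 g1
      · intro z hz
        simp only [p2, not_exists, not_and, not_lt] at g2
        have g4 := g2 z (mem_ballPoints hz)
        have g5 : (∑ i, (z i : ℝ) • u i) ⬝ᵥ (∑ i, (z i : ℝ) • u i) = ∑ i, (z i : ℝ) ^ 2 := by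
          rw [sum_dotProduct]
          simp only [dotProduct_sum, smul_dotProduct, dotProduct_smul, hu, smul_eq_mul]
          simp [pow_two]
        rw [g5] at g4
        simp only [signMat_mulVec]
        refine le_trans (le_of_eq (by push_cast; ring)) (g4.trans (le_of_eq ?_))
        refine Finset.sum_congr rfl fun c _ => ?_
        rw [sum_dotProduct]
        simp only [smul_dotProduct, smul_eq_mul]
    · simp only [dotProduct, signMat_mulVec] at g3 ⊢
      exact not_lt.1 g3
  refine hsub.trans ((pr_or_le _ _).trans ?_)
  have := pr_or_le p2 p3
  have e4 : (2 : ℝ) / τ = 1 / τ + 1 / τ := by ring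
  rw [e4]
  linarith

end

end SparseDict

namespace SparseDict

/-! ### The quality of the candidate solutions -/

theorem exists_isSel {b : ℕ} {valid : ℕ → Prop} (f : ℕ → ℝ) (h : ∃ N < b, valid N) :
    ∃ N₀, IsSel b valid f N₀ := by
  classical
  obtain ⟨N, hN, hv⟩ := h
  obtain ⟨M, hM, hmin⟩ := Finset.exists_min_image ((Finset.range b).filter valid) f
    ⟨N, by simp [hN, hv]⟩
  rw [Finset.mem_filter, Finset.mem_range] at hM
  have hex : ∃ N₀, N₀ < b ∧ valid N₀ ∧ f N₀ = f M := ⟨M, hM.1, hM.2, rfl⟩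
  obtain ⟨h1, h2, h3⟩ := Nat.find_spec hex
  refine ⟨Nat.find hex, ⟨h1, h2⟩, fun N hN hv => ?_⟩
  have h4 : f M ≤ f N := hmin N (by simp [hN, hv])
  refine ⟨h3.trans_le h4, fun hlt => ?_⟩
  rw [h3]
  exact lt_of_le_of_ne h4 fun heq => Nat.find_min hex hlt ⟨hN, hv, heq.symm⟩

/-- The vector of the entries of a row in sparse form. -/
def rowVec (k r D N : ℕ) : Fin k → ℝ := fun j => (rowOf k r D N j : ℝ)

theorem exists_valid {k : ℕ} (hk : 0 < k) (r D : ℕ) :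
    ∃ N < (k * (2 * D + 1)) ^ r, RowValid k r D N := by
  obtain ⟨N, hN, h⟩ := exists_rowOf_eq (r := r) (D := D) hk (fun _ => 0) (by simp) (by simp)
  exact ⟨N, hN, fun j => by rw [h]; simp⟩

theorem isSel_bestRow {k q G : ℕ} (hk : 0 < k) (r D : ℕ) (YT : Matrix (Fin k) (Fin (q * G)) ℝ)
    (a : Fin (q * G) → ℝ) : IsSel ((k * (2 * D + 1)) ^ r) (RowValid k r D)
      (fun N => est (rowRes r D YT a N)) (bestRow r D YT a) := by
  obtain ⟨N₀, h⟩ := exists_isSel (fun N => est (rowRes r D YT a N)) (exists_valid hk r D)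
  rw [bestRow, ← h.eq_sel]; exact h

theorem ofRows_mem_feasible {n k r D : ℕ} (hk : 0 < k) {rows : Fin n → ℕ}
    (h : ∀ i, RowValid k r D (rows i)) : ofRows k r D rows ∈ feasible n k r D := by
  intro i
  refine ⟨?_, fun j => ⟨_, h i j, rfl⟩⟩
  let c : Fin r → Fin k := fun l => ⟨digitCol D (digit (k * (2 * D + 1)) (rows i) l),
    digitCol_lt (digit_lt (Nat.mul_pos hk (by omega)) _ l)⟩
  have hsub : {j | ofRows k r D rows i j ≠ 0} ⊆ Set.range c := by
    intro j hj
    by_contra hcon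
    apply hj
    simp only [ofRows, Matrix.of_apply, Int.cast_eq_zero]
    refine Finset.sum_eq_zero fun l _ => if_neg fun h => hcon ⟨l, Fin.ext h⟩
  refine (Set.ncard_le_ncard hsub (Set.finite_range c)).trans ?_
  rw [← Set.image_univ]
  refine (Set.ncard_image_le Set.finite_univ).trans ?_
  simp

theorem exists_ofRows {n k r D : ℕ} (hk : 0 < k) {X : Matrix (Fin n) (Fin k) ℝ}
    (hX : X ∈ feasible n k r D) : ∃ rows : Fin n → ℕ,
      (∀ i, rows i < (k * (2 * D + 1)) ^ r ∧ RowValid k r D (rows i)) ∧ ofRows k r D rows = X := by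
  classical
  have key : ∀ i, ∃ N < (k * (2 * D + 1)) ^ r, ∀ j, X i j = rowOf k r D N j ∧
      |rowOf k r D N j| ≤ (D : ℤ) := by
    intro i
    obtain ⟨h1, h2⟩ := hX i
    choose x hx1 hx2 using h2
    have e : {j | X i j ≠ 0} = ((Finset.univ.filter fun j => x j ≠ 0 : Finset (Fin k)) : Set _) := by
      ext j; simp [hx2]
    rw [e, Set.ncard_coe_finset] at h1
    obtain ⟨N, hN, h⟩ := exists_rowOf_eq hk x h1 hx1
    exact ⟨N, hN, fun j => ⟨by rw [h, hx2], by rw [h]; exact hx1 j⟩⟩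
  choose rows h1 h2 using key
  exact ⟨rows, fun i => ⟨h1 i, fun j => (h2 i j).2⟩, by
    ext i j; rw [(h2 i j).1]; rfl⟩

/-- An optimal left factor. -/
theorem exists_optimal {n d k : ℕ} (hk : 0 < k) (r D : ℕ) (A : Matrix (Fin n) (Fin d) ℝ) :
    ∃ rows : Fin n → ℕ, (∀ i, rows i < (k * (2 * D + 1)) ^ r ∧ RowValid k r D (rows i)) ∧
      ∀ X ∈ feasible n k r D, ∀ Y : Matrix (Fin k) (Fin d) ℝ,
        sqNorm (ofRows k r D rows * lsq (ofRows k r D rows) A - A) ≤ sqNorm (X * Y - A) := by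
  classical
  obtain ⟨N, hN, hv⟩ := exists_valid hk r D
  obtain ⟨rows, hr, hmin⟩ := Finset.exists_min_image
    ((Fintype.piFinset fun _ : Fin n => Finset.range ((k * (2 * D + 1)) ^ r)).filter
      fun rows => ∀ i, RowValid k r D (rows i))
    (fun rows => sqNorm (ofRows k r D rows * lsq (ofRows k r D rows) A - A))
    ⟨fun _ => N, by simp [hN, hv]⟩
  simp only [Finset.mem_filter, Fintype.mem_piFinset, Finset.mem_range] at hr hmin
  refine ⟨rows, fun i => ⟨hr.1 i, hr.2 i⟩, fun X hX Y => ?_⟩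
  obtain ⟨rows', h1, rfl⟩ := exists_ofRows hk hX
  exact (hmin rows' ⟨fun i => (h1 i).1, fun i => (h1 i).2⟩).trans (sqNorm_lsq_le _ _ _)

theorem exists_guess {s n k r D : ℕ} (hk : 0 < k) {Ω : Type*} {σ : Ω → Fin n → ℝ}
    (hσ : ∀ ω x, σ ω x = 1 ∨ σ ω x = -1) (ω : Fin s → Ω) {rows : Fin n → ℕ}
    (h : ∀ i, RowValid k r D (rows i)) :
    ∃ N < (2 * (n * D) + 1) ^ (s * k), guess s k (n * D) N = signMat σ ω * ofRows k r D rows := by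
  have key : ∀ (c : Fin s) (a : Fin k), ∃ z : ℤ, |z| ≤ (n * D : ℕ) ∧
      (signMat σ ω * ofRows k r D rows) c a = z := by
    intro c a
    have : ∀ x, ∃ z : ℤ, σ (ω c) x = z ∧ |z| = 1 := fun x => by
      rcases hσ (ω c) x with h | h
      · exact ⟨1, by simp [h], by simp⟩
      · exact ⟨-1, by simp [h], by simp⟩
    choose z hz1 hz2 using this
    refine ⟨∑ x, z x * rowOf k r D (rows x) a, ?_, ?_⟩
    · refine (Finset.abs_sum_le_sum_abs _ _).trans ((Finset.sum_le_sum (g := fun _ => (D : ℤ))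
        fun x _ => ?_).trans (by simp))
      rw [abs_mul, hz2, one_mul]; exact h x a
    · rw [Matrix.mul_apply]
      push_cast
      exact Finset.sum_congr rfl fun x _ => by rw [← hz1]; rfl
  choose z hz1 hz2 using key
  obtain ⟨N, hN, hd⟩ := exists_digits (b := 2 * (n * D) + 1) (by omega) (s * k)
    (fun l => if h : l < s * k then
      (z (⟨l, h⟩ : Fin (s * k)).divNat (⟨l, h⟩ : Fin (s * k)).modNat + (n * D : ℕ)).toNat else 0) (by
      intro l
      split_ifs with h
      · have := abs_le.1 (hz1 (⟨l, h⟩ : Fin (s * k)).divNat (⟨l, h⟩ : Fin (s * k)).modNat)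
        omega
      · omega)
  refine ⟨N, hN, ?_⟩
  ext c a
  have hl : (c : ℕ) * k + a < s * k := RealRAM.mul_add_lt c.2 a.2
  have e1 : (⟨c * k + a, hl⟩ : Fin (s * k)).divNat = c := by
    ext; simp [Fin.divNat, Nat.add_div_of_dvd_right, hk]
  have e2 : (⟨c * k + a, hl⟩ : Fin (s * k)).modNat = a := by
    ext; simp [Fin.modNat, Nat.mod_eq_of_lt a.2]
  rw [guess, Matrix.of_apply, hd _ hl, dif_pos hl, e1, e2, hz2]
  have := abs_le.1 (hz1 c a)
  congr 1
  omega

section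
variable {n d k s qT qW G : ℕ} (r D : ℕ) (S : Matrix (Fin s) (Fin n) ℝ)
  (T : Matrix (Fin d) (Fin (qT * G)) ℝ) (W : Matrix (Fin (qW * G)) (Fin (n * d)) ℝ)
  (A : Matrix (Fin n) (Fin d) ℝ)

/-- The dictionary for a guess. -/
noncomputable def candDict (k N : ℕ) : Matrix (Fin k) (Fin d) ℝ :=
  dictOf (guess s k (n * D) N) (S * A)

/-- The left factor for a guess. -/
noncomputable def candFactor (k N : ℕ) : Matrix (Fin n) (Fin k) ℝ :=
  factorOf r D (candDict D S A k N * T) (A * T)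

/-- The estimated error for a guess. -/
noncomputable def candCost (k N : ℕ) : ℝ :=
  est (W *ᵥ flatten (candFactor r D S T A k N * candDict D S A k N) - W *ᵥ flatten A)

/-- The sketches are good: every best candidate is an approximate solution. -/
def SketchGood (k : ℕ) (ε : ℝ) : Prop :=
  ∀ N₀ < (2 * (n * D) + 1) ^ (s * k),
    (∀ N < (2 * (n * D) + 1) ^ (s * k), candCost r D S T W A k N₀ ≤ candCost r D S T W A k N) →
    IsApproxSolution r D ε A (candFactor r D S T A k N₀) (candDict D S A k N₀)

variable {r D S T W A}

theorem flatten_sub (X Y : Matrix (Fin n) (Fin d) ℝ) : flatten (X - Y) = flatten X - flatten Y := rfl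

theorem rowRes_mul (Y : Matrix (Fin k) (Fin d) ℝ) (a : Fin d → ℝ) (N : ℕ) :
    rowRes r D (Y * T) (a ᵥ* T) N = (rowVec k r D N ᵥ* Y - a) ᵥ* T := by
  rw [Matrix.sub_vecMul, Matrix.vecMul_vecMul]
  rfl

theorem sketchGood_of_accurate {ε η ρ : ℝ} (hk : 0 < k) (hG : 0 < G) (hη0 : 0 < η) (hη1 : η < 1)
    (hε : 0 < ε) (hratio : ((1 + η) / (1 - η)) ^ 2 * (1 + ρ) ≤ (1 + ε) ^ 2)
    {rows : Fin n → ℕ} (hrows : ∀ i, rows i < (k * (2 * D + 1)) ^ r ∧ RowValid k r D (rows i))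
    (hopt : ∀ X ∈ feasible n k r D, ∀ Y : Matrix (Fin k) (Fin d) ℝ,
      sqNorm (ofRows k r D rows * lsq (ofRows k r D rows) A - A) ≤ sqNorm (X * Y - A))
    (hS : RegGood (ofRows k r D rows) A ρ S) {N' : ℕ} (hN' : N' < (2 * (n * D) + 1) ^ (s * k))
    (hguess : guess s k (n * D) N' = S * ofRows k r D rows)
    (hT : ∀ i, ∀ N < (k * (2 * D + 1)) ^ r, Accurate G η
      (est ((rowVec k r D N ᵥ* candDict D S A k N' - A i) ᵥ* T))
      ((rowVec k r D N ᵥ* candDict D S A k N' - A i) ⬝ᵥ (rowVec k r D N ᵥ* candDict D S A k N' - A i)))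
    (hW : ∀ N < (2 * (n * D) + 1) ^ (s * k), Accurate G η (candCost r D S T W A k N)
      (sqNorm (candFactor r D S T A k N * candDict D S A k N - A))) :
    SketchGood r D S T W A k ε := by
  intro N₀ hN₀ hmin
  obtain ⟨opt, hoptd⟩ : ∃ opt, opt = sqNorm (ofRows k r D rows * lsq (ofRows k r D rows) A - A) :=
    ⟨_, rfl⟩
  rw [← hoptd] at hopt
  have hopt0 : 0 ≤ opt := hoptd ▸ sqNorm_nonneg _
  have hGR : (0 : ℝ) < G := by exact_mod_cast hG
  have h1η : 0 < 1 - η := by linarith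
  set Y := candDict D S A k N' with hY
  -- the dictionary for the right guess
  have h1 : sqNorm (ofRows k r D rows * Y - A) ≤ (1 + ρ) * opt := by
    rw [hoptd]
    refine hS Y ?_
    rw [hY, candDict, hguess]
    exact greville_normal _ _
  -- the best rows for this dictionary
  have h2 : (1 - η) * sqNorm (candFactor r D S T A k N' * Y - A) ≤
      (1 + η) * sqNorm (ofRows k r D rows * Y - A) := by
    rw [sqNorm_eq_rows, sqNorm_eq_rows, Finset.mul_sum, Finset.mul_sum]
    refine Finset.sum_le_sum fun i _ => ?_
    have hsel := isSel_bestRow hk r D (Y * T) ((A * T) i)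
    have hA : (A * T) i = A i ᵥ* T := rfl
    have hcmp := (hsel.2 (rows i) (hrows i).1 (hrows i).2).1
    simp only [hA, rowRes_mul] at hcmp hsel
    have e1 : (candFactor r D S T A k N' * Y - A) i =
        rowVec k r D (bestRow r D (Y * T) (A i ᵥ* T)) ᵥ* Y - A i := rfl
    have e2 : (ofRows k r D rows * Y - A) i = rowVec k r D (rows i) ᵥ* Y - A i := rfl
    rw [e1, e2]
    have h3 := (hT i _ hsel.1.1).1
    have h4 := (hT i _ (hrows i).1).2
    have h5 := h3.trans (hcmp.trans h4)
    refine le_of_mul_le_mul_left ?_ hGR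
    linarith
  have h3 : (1 - η) * sqNorm (candFactor r D S T A k N₀ * candDict D S A k N₀ - A) ≤
      (1 + η) * sqNorm (candFactor r D S T A k N' * Y - A) := by
    have h5 := (hW N₀ hN₀).1.trans ((hmin N' hN').trans (hW N' hN').2)
    refine le_of_mul_le_mul_left ?_ hGR
    linarith
  have h4 : sqNorm (candFactor r D S T A k N₀ * candDict D S A k N₀ - A) ≤ (1 + ε) ^ 2 * opt := by
    refine le_trans ?_ (mul_le_mul_of_nonneg_right hratio hopt0)
    have h5 : sqNorm (candFactor r D S T A k N' * Y - A) ≤ (1 + η) / (1 - η) * ((1 + ρ) * opt) := by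
      rw [div_mul_eq_mul_div, le_div_iff₀ h1η, mul_comm]
      exact h2.trans (mul_le_mul_of_nonneg_left h1 (by linarith))
    have h6 : sqNorm (candFactor r D S T A k N₀ * candDict D S A k N₀ - A) ≤
        (1 + η) / (1 - η) * ((1 + η) / (1 - η) * ((1 + ρ) * opt)) := by
      rw [div_mul_eq_mul_div (1 + η) (1 - η) ((1 + η) / (1 - η) * _), le_div_iff₀ h1η, mul_comm]
      exact h3.trans (mul_le_mul_of_nonneg_left h5 (by linarith))
    refine h6.trans (le_of_eq (by ring))
  constructor
  · refine ofRows_mem_feasible hk fun i => ?_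
    exact (isSel_bestRow hk r D _ _).1.2
  · intro X hX Y'
    rw [objective_eq, objective_eq]
    refine (Real.sqrt_le_sqrt (h4.trans (mul_le_mul_of_nonneg_left (hopt X hX Y')
      (by positivity)))).trans ?_
    rw [Real.sqrt_mul (by positivity), Real.sqrt_sq (by linarith)]

end

section
variable {Ω : Type*} [Fintype Ω] [Nonempty Ω]

theorem pr_not_sketchGood_le {n d k r D qS qT qW G τ : ℕ} {ε η : ℝ} (hk : 0 < k) (hτ : 1 ≤ τ)
    (hqS : 0 < qS) (hη0 : 0 < η) (hη1 : η < 1) (hε : 0 < ε) {ρ : ℝ}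
    (hratio : ((1 + η) / (1 - η)) ^ 2 * (1 + ρ) ≤ (1 + ε) ^ 2)
    (hG : 128 / η ^ 2 ≤ G) (hρ : 2 * τ * k / qS ≤ ρ)
    {σS : Ω → Fin n → ℝ} (hσS : FourWise σS) {σT : Ω → Fin d → ℝ} (hσT : FourWise σT)
    {σW : Ω → Fin (n * d) → ℝ} (hσW : FourWise σW) (A : Matrix (Fin n) (Fin d) ℝ) :
    pr (fun ω : (Fin (qS * 512) → Ω) × (Fin (qT * G) → Ω) × (Fin (qW * G) → Ω) =>
      ¬ SketchGood r D (signMat σS ω.1) (signMat σT ω.2.1)ᵀ (signMat σW ω.2.2) A k ε) ≤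
      (2 / τ + 2 ^ (32 * τ * k) * 3 ^ k * (1 / 4) ^ qS) +
      n * (k * (2 * D + 1)) ^ r * (1 / 4) ^ qT +
      (2 * (n * D) + 1) ^ (qS * 512 * k) * (1 / 4) ^ qW := by
  classical
  obtain ⟨rows, hrows, hopt⟩ := exists_optimal hk r D A
  have hsign : ∀ ω x, σS ω x = 1 ∨ σS ω x = -1 := fun ω x => mul_self_eq_one_iff.1 (hσS.sq ω x)
  choose N' hN' hguess using fun ω : Fin (qS * 512) → Ω =>
    exists_guess hk hsign ω fun i => (hrows i).2
  have hGR : (0 : ℝ) < G := lt_of_lt_of_le (by positivity) hG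
  have hG0 : 0 < G := by exact_mod_cast hGR
  let v : (Fin (qS * 512) → Ω) → Fin n → ℕ → Fin d → ℝ := fun ωS i N =>
    rowVec k r D N ᵥ* candDict D (signMat σS ωS) A k (N' ωS) - A i
  let X : (Fin (qS * 512) → Ω) → (Fin (qT * G) → Ω) → ℕ → Matrix (Fin n) (Fin d) ℝ := fun ωS ωT N =>
    candFactor r D (signMat σS ωS) (signMat σT ωT)ᵀ A k N * candDict D (signMat σS ωS) A k N - A
  let p1 : (Fin (qS * 512) → Ω) → Prop := fun ωS => ¬ RegGood (ofRows k r D rows) A ρ (signMat σS ωS)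
  let p2 : (Fin (qS * 512) → Ω) → (Fin (qT * G) → Ω) → Prop := fun ωS ωT =>
    ∃ x ∈ (Finset.univ : Finset (Fin n)) ×ˢ Finset.range ((k * (2 * D + 1)) ^ r),
      ¬ Accurate G η (est (signMat σT ωT *ᵥ v ωS x.1 x.2)) (v ωS x.1 x.2 ⬝ᵥ v ωS x.1 x.2)
  let p3 : (Fin (qS * 512) → Ω) → (Fin (qT * G) → Ω) → (Fin (qW * G) → Ω) → Prop := fun ωS ωT ωW =>
    ∃ N ∈ Finset.range ((2 * (n * D) + 1) ^ (qS * 512 * k)),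
      ¬ Accurate G η (est (signMat σW ωW *ᵥ flatten (X ωS ωT N)))
        (flatten (X ωS ωT N) ⬝ᵥ flatten (X ωS ωT N))
  have hsub : pr (fun ω : (Fin (qS * 512) → Ω) × (Fin (qT * G) → Ω) × (Fin (qW * G) → Ω) =>
      ¬ SketchGood r D (signMat σS ω.1) (signMat σT ω.2.1)ᵀ (signMat σW ω.2.2) A k ε) ≤
      pr fun ω : (Fin (qS * 512) → Ω) × (Fin (qT * G) → Ω) × (Fin (qW * G) → Ω) =>
        (p1 ω.1 ∨ p2 ω.1 ω.2.1) ∨ p3 ω.1 ω.2.1 ω.2.2 := by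
    refine pr_mono fun ω hω => ?_
    by_contra hcon
    push Not at hcon
    obtain ⟨⟨g1, g2⟩, g3⟩ := hcon
    refine hω (sketchGood_of_accurate hk hG0 hη0 hη1 hε hratio hrows hopt (not_not.1 g1)
      (hN' ω.1) (hguess ω.1) ?_ ?_)
    · intro i N hN
      simp only [p2, not_exists, not_and, not_not] at g2
      rw [Matrix.vecMul_transpose]
      exact g2 (i, N) (by simp [hN])
    · intro N hN
      simp only [p3, not_exists, not_and, not_not] at g3
      have := g3 N (by simpa using hN)
      rw [sqNorm_flatten, flatten_sub, Matrix.mulVec_sub] at this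
      exact this
  refine hsub.trans ((pr_or_le _ _).trans (add_le_add ((pr_or_le _ _).trans (add_le_add ?_ ?_)) ?_))
  · exact (pr_fst p1).le.trans (pr_not_regGood_le hk hτ hqS hσS _ A hρ)
  · refine pr_prod_le (by positivity) fun ωS => ?_
    refine (pr_fst (Ω' := Fin (qW * G) → Ω) (p2 ωS)).le.trans ((pr_exists_le _ _).trans
      ((Finset.sum_le_sum fun x _ => pr_not_accurate_le hσT _ hη0 hG).trans ?_))
    rw [Finset.sum_const, nsmul_eq_mul, Finset.card_product, Finset.card_univ, Fintype.card_fin,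
      Finset.card_range]
    push_cast
    exact le_rfl
  · have key : ∀ ωS ωT, pr (p3 ωS ωT) ≤
        (2 * (n * D) + 1) ^ (qS * 512 * k) * (1 / 4) ^ qW := by
      intro ωS ωT
      refine (pr_exists_le _ _).trans
        ((Finset.sum_le_sum fun x _ => pr_not_accurate_le hσW _ hη0 hG).trans ?_)
      rw [Finset.sum_const, nsmul_eq_mul, Finset.card_range]
      push_cast
      exact le_rfl
    refine pr_prod_le (by positivity) fun ωS => ?_
    refine pr_prod_le (p := fun x : (Fin (qT * G) → Ω) × (Fin (qW * G) → Ω) => p3 ωS x.1 x.2)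
      (by positivity) (key ωS)

end

end SparseDict

namespace SparseDict

open RealRAM Machine

/-! ### A four-wise independent family of signs -/

/-- The sign of `x` is the parity of the quadratic form with random coefficients at the bits
of `x`. -/
def sgn {b : ℕ} (ω : Fin b × Fin b → Bool) (x : ℕ) : ℝ :=
  ∏ α : Fin b, ∏ β : Fin b, if ω (α, β) ∧ x.testBit α ∧ x.testBit β then -1 else 1

/-- The factor of the sign that belongs to a pair of bits. -/
def bitSign {b : ℕ} (x : ℕ) (p : Fin b × Fin b) (c : Bool) : ℝ :=
  if c ∧ x.testBit p.1 ∧ x.testBit p.2 then -1 else 1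

theorem sgn_eq {b : ℕ} (ω : Fin b × Fin b → Bool) (x : ℕ) : sgn ω x = ∏ p, bitSign x p (ω p) := by
  rw [sgn, Fintype.prod_prod_type]; rfl

theorem avg_prod_eq_zero {ι : Type*} [Fintype ι] [DecidableEq ι] (g : ι → Bool → ℝ)
    (h : ∃ p, g p true = -g p false) : avg (fun ω : ι → Bool => ∏ p, g p (ω p)) = 0 := by
  obtain ⟨p, hp⟩ := h
  rw [avg_pi_prod]
  refine Finset.prod_eq_zero (Finset.mem_univ p) ?_
  simp [avg, hp]

theorem exists_testBit_ne {b x y : ℕ} (hx : x < 2 ^ b) (hy : y < 2 ^ b) (h : x ≠ y) :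
    ∃ α : Fin b, x.testBit α ≠ y.testBit α := by
  by_contra hcon
  push Not at hcon
  refine h (Nat.eq_of_testBit_eq fun i => ?_)
  by_cases hi : i < b
  · exact hcon ⟨i, hi⟩
  · rw [Nat.testBit_lt_two_pow (hx.trans_le (Nat.pow_le_pow_right (by norm_num) (by omega))),
      Nat.testBit_lt_two_pow (hy.trans_le (Nat.pow_le_pow_right (by norm_num) (by omega)))]

theorem exists_quadratic_ne {ι : Type*} (x y z w : ι → Bool) (hxy : ∃ α, x α ≠ y α)
    (hyz : ∃ α, y α ≠ z α) (hxz : ∃ α, x α ≠ z α) :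
    ∃ α β, (((x α && x β) ^^ (y α && y β)) ^^ ((z α && z β) ^^ (w α && w β))) = true := by
  by_contra hcon
  push Not at hcon
  obtain ⟨α, hα⟩ := hxy
  obtain ⟨β, hβ⟩ := hyz
  obtain ⟨γ, hγ⟩ := hxz
  have h1 := hcon α α
  have h2 := hcon β β
  have h3 := hcon γ γ
  have h4 := hcon α β
  have h5 := hcon α γ
  have key : ∀ x1 x2 x3 y1 y2 y3 z1 z2 z3 w1 w2 w3 : Bool, w1 = ((x1 ^^ y1) ^^ z1) →
      w2 = ((x2 ^^ y2) ^^ z2) → w3 = ((x3 ^^ y3) ^^ z3) → x1 ≠ y1 → y2 ≠ z2 → x3 ≠ z3 →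
      (((x1 && x2) ^^ (y1 && y2)) ^^ ((z1 && z2) ^^ (w1 && w2))) = true ∨
      (((x1 && x3) ^^ (y1 && y3)) ^^ ((z1 && z3) ^^ (w1 && w3))) = true := by
    intro x1 x2 x3 y1 y2 y3 z1 z2 z3 w1 w2 w3 e1 e2 e3
    subst e1 e2 e3
    revert x1 x2 x3 y1 y2 y3 z1 z2 z3
    decide
  have diag : ∀ x y z w : Bool, (((x && x) ^^ (y && y)) ^^ ((z && z) ^^ (w && w))) ≠ true →
      w = ((x ^^ y) ^^ z) := by decide
  exact (key _ _ _ _ _ _ _ _ _ _ _ _ (diag _ _ _ _ h1) (diag _ _ _ _ h2) (diag _ _ _ _ h3)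
    hα hβ hγ).elim h4 h5

theorem fourWise_sgn {b N : ℕ} (hN : N ≤ 2 ^ b) :
    FourWise fun (ω : Fin b × Fin b → Bool) (x : Fin N) => sgn ω x := by
  have hlt : ∀ x : Fin N, (x : ℕ) < 2 ^ b := fun x => x.2.trans_le hN
  have hne : ∀ {x y : Fin N}, x ≠ y → ∃ α : Fin b, (x : ℕ).testBit α ≠ (y : ℕ).testBit α :=
    fun h => exists_testBit_ne (hlt _) (hlt _) fun h' => h (Fin.ext h')
  refine ⟨fun ω x => ?_, fun x y hxy => ?_, fun x y z w hxy hxz hxw hyz hyw hzw => ?_⟩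
  · rw [sgn_eq, ← Finset.prod_mul_distrib]
    exact Finset.prod_eq_one fun p _ => by rw [bitSign]; split_ifs <;> norm_num
  · simp only [sgn_eq, ← Finset.prod_mul_distrib]
    refine avg_prod_eq_zero (fun p c => bitSign (x : ℕ) p c * bitSign (y : ℕ) p c) ?_
    obtain ⟨α, hα⟩ := hne hxy
    refine ⟨(α, α), ?_⟩
    simp only [bitSign]
    revert hα
    generalize (x : ℕ).testBit α = a
    generalize (y : ℕ).testBit α = c
    cases a <;> cases c <;> simp
  · simp only [sgn_eq, ← Finset.prod_mul_distrib]
    refine avg_prod_eq_zero (fun p c => bitSign (x : ℕ) p c * bitSign (y : ℕ) p c *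
      (bitSign (z : ℕ) p c * bitSign (w : ℕ) p c)) ?_
    obtain ⟨α, β, h⟩ := exists_quadratic_ne (fun α : Fin b => (x : ℕ).testBit α)
      (fun α : Fin b => (y : ℕ).testBit α) (fun α : Fin b => (z : ℕ).testBit α)
      (fun α : Fin b => (w : ℕ).testBit α) (hne hxy) (hne hyz) (hne hxz)
    refine ⟨(α, β), ?_⟩
    have e : ∀ v : ℕ, bitSign v (α, β) true = if (v.testBit α && v.testBit β) then -1 else 1 :=
      fun v => by simp [bitSign]
    have e' : ∀ v : ℕ, bitSign v (α, β) false = 1 := fun v => by simp [bitSign]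
    simp only [e, e']
    revert h
    generalize ((x : ℕ).testBit α && (x : ℕ).testBit β) = a
    generalize ((y : ℕ).testBit α && (y : ℕ).testBit β) = c
    generalize ((z : ℕ).testBit α && (z : ℕ).testBit β) = a'
    generalize ((w : ℕ).testBit α && (w : ℕ).testBit β) = c'
    cases a <;> cases c <;> cases a' <;> cases c' <;> simp

/-! ### Computation of the signs -/

/-- Put the sign of `x` for the seed with number `ρ` in the array `7` into the real array `32`. -/
def signCmd (ρ x : IExpr) : Cmd :=
  .seq (.rset 32 (.const 0) (.ofInt (.const 1))) (.seq (.iset 39 (.const 0) x)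
    (Cmd.forN 38 (iv 16) (.seq (.iset 41 (.const 0) x) (.seq
      (Cmd.forN 40 (iv 16) (.seq
        (.ite (.ilt (.const 0) (.mul (.mul (.get 7 (ix2 (ix2 ρ (iv 16) (iv 38)) (iv 16) (iv 40)))
            (.mod (iv 39) (.const 2))) (.mod (iv 41) (.const 2))))
          (.rset 32 (.const 0) (.sub (.ofInt (.const 0)) (rv 32))) .skip)
        (.iset 41 (.const 0) (.div (iv 41) (.const 2)))))
      (.iset 39 (.const 0) (.div (iv 39) (.const 2)))))))

theorem testBit_iff (x i : ℕ) : x.testBit i = true ↔ x / 2 ^ i % 2 = 1 := by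
  rw [Nat.testBit_eq_decide_div_mod_eq, decide_eq_true_iff]

/-- The seed with number `ρ` is in the array. -/
def SeedAt {b : ℕ} (f : ℕ → ℤ) (ρ : ℕ) (ω : Fin b × Fin b → Bool) : Prop :=
  ∀ α β : Fin b, f ((ρ * b + α) * b + β) = if ω (α, β) then 1 else 0

theorem signCmd_spec {M : Machine} {σ : Mem} {b c v : ℕ} {ρ x : IExpr} {ω : Fin b × Fin b → Bool}
    (hρs : ρ.size ≤ 6) (hxs : x.size ≤ 6) (hbV : b ≤ M.V) (hvV : v ≤ M.V) (hc : (c + 1) * (b * b) ≤ M.isz 7)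
    (hρ : ∀ τ, Mods [38, 39, 40, 41] [32] σ τ → IVal M τ ρ (c : ℕ))
    (hx : ∀ τ, Mods [38, 39, 40, 41] [32] σ τ → IVal M τ x (v : ℕ)) (hb : σ.int 16 0 = b)
    (hω : SeedAt (σ.int 7) c ω) :
    M.Runs 1 [38, 39, 40, 41] [32] (signCmd ρ x) σ 14 fun τ => τ.real 32 0 = sgn ω v := by
  obtain ⟨g, hg⟩ : ∃ g : ℕ → ℕ → ℝ, g = fun α β => if h : α < b ∧ β < b then
    (if ω (⟨α, h.1⟩, ⟨β, h.2⟩) ∧ v.testBit α ∧ v.testBit β then -1 else 1) else 1 := ⟨_, rfl⟩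
  have hsgn : sgn ω v = ∏ α ∈ Finset.range b, ∏ β ∈ Finset.range b, g α β := by
    rw [sgn, Finset.prod_range]
    refine Finset.prod_congr rfl fun α _ => ?_
    rw [Finset.prod_range]
    refine Finset.prod_congr rfl fun β _ => ?_
    rw [hg]; simp only [α.2, β.2, and_self, dite_true]
  have hdivV : ∀ i, v / 2 ^ i ≤ M.V := fun i => (Nat.div_le_self _ _).trans hvV
  have hset : ∀ {τ : Mem} {I R : List ℕ} {a : ℕ} {e : IExpr} {y : ℕ} {ee : ℕ}, a < 64 → a ∈ I →
      IVal M τ e (y : ℕ) → e.size ≤ 24 → y ≤ M.V →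
      M.Runs 1 I R (.iset a (.const 0) e) τ ee fun τ => τ.int a 0 = y := by
    intro τ I R a e y ee ha haI he hes hy
    exact Runs.iset_scalar one_pos ha he.1 hes (by rw [he.2, Nat.abs_cast]; exact_mod_cast hy) haI
      (by rw [setInt_int_self, he.2])
  refine Runs.seq (I₁ := []) (R₁ := [32]) (I₂ := [38, 39, 40, 41]) (R₂ := [32]) (e₁ := 0)
    (e₂ := 13) (Q₁ := fun τ => τ.real 32 0 = 1) (Runs.rset_scalar one_pos (by norm_num)
      (RVal.ofInt IVal.one).1 (by simp) (by simp [RExpr.den, IExpr.den])) ?_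
  intro τ₁ _ hm₁ h32
  have hm₁' : Mods [38, 39, 40, 41] [32] σ τ₁ := hm₁.mono (by simp) (by simp)
  refine Runs.seq (I₁ := [39]) (R₁ := []) (I₂ := [38, 39, 40, 41]) (R₂ := [32]) (e₁ := 0)
    (e₂ := 12) (hset (by norm_num) (by simp) (hx _ hm₁') (by omega) hvV) ?_
  intro τ₂ _ hm₂ h39
  have hm₂' : Mods [38, 39, 40, 41] [32] σ τ₂ := hm₁'.trans (hm₂.mono (by simp) (by simp))
  refine (Runs.forN (I' := [39, 40, 41]) (e₁ := 8) one_pos b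
    (fun α υ => υ.int 39 0 = (v / 2 ^ α : ℕ) ∧
      υ.real 32 0 = ∏ α ∈ Finset.range α, ∏ β ∈ Finset.range b, g α β) hbV
    (fun υ hu => IVal.scalar (Mods.cell (hm₂'.trans hu) hb)) (by simp) ⟨by simpa using h39, ?_⟩ ?_).imp
    fun υ _ h => by rw [h.2, hsgn]
  · rw [hm₂.real 32 (by simp)]; simpa using h32
  rintro α τ₃ hα _ hm₃ h38 ⟨hJ1, hJ2⟩
  have hm₃' := hm₂'.trans hm₃
  refine Runs.seq (I₁ := [41]) (R₁ := []) (I₂ := [39, 40, 41]) (R₂ := [32]) (e₁ := 0)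
    (e₂ := 7) (hset (by norm_num) (by simp) (hx _ hm₃') (by omega) hvV) ?_
  intro τ₄ _ hm₄ h41
  have hm₄' : Mods [38, 39, 40, 41] [32] σ τ₄ := hm₃'.trans (hm₄.mono (by simp) (by simp))
  refine Runs.seq (I₁ := [40, 41]) (R₁ := [32]) (I₂ := [39]) (R₂ := []) (e₁ := 6) (e₂ := 0)
    (Runs.forN (I' := [41]) (e₁ := 2) one_pos b
      (fun β υ => υ.int 41 0 = (v / 2 ^ β : ℕ) ∧
        υ.real 32 0 = (∏ α ∈ Finset.range α, ∏ β ∈ Finset.range b, g α β) *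
          ∏ β ∈ Finset.range β, g α β) hbV
      (fun υ hu => IVal.scalar (Mods.cell (hm₄'.trans (hu.mono (by simp) (by simp))) hb)) (by simp)
      ⟨by simpa using h41, ?_⟩ ?_) ?_
  · rw [hm₄.real 32 (by simp), hJ2]; simp
  · rintro β τ₅ hβ _ hm₅ h40 ⟨hJ3, hJ4⟩
    have hm₅' : Mods [38, 39, 40, 41] [32] σ τ₅ := hm₄'.trans (hm₅.mono (by simp) (by simp))
    have h38' : τ₅.int 38 0 = (α : ℕ) := Mods.cell hm₅ (Mods.cell hm₄ h38)
    have h39' : τ₅.int 39 0 = (v / 2 ^ α : ℕ) := Mods.cell hm₅ (Mods.cell hm₄ hJ1)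
    have hb' := IVal.scalar (M := M) (Mods.cell hm₅' hb)
    have two : IVal M τ₅ (.const 2) ((2 : ℕ) : ℤ) := IVal.const (by norm_num)
    have hseed : IVal M τ₅ (.get 7 (ix2 (ix2 ρ (iv 16) (iv 38)) (iv 16) (iv 40)))
        ((if ω (⟨α, hα⟩, ⟨β, hβ⟩) then 1 else 0 : ℕ) : ℤ) := by
      refine (((((hρ _ hm₅').ix2 hb' (.scalar h38')).ix2 hb' (.scalar h40)).get ?_)).congr ?_
      · have h1 : (c * b + α) * b + β < (c * b + b) * b := mul_add_lt (by omega) hβ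
        have h2 : (c * b + b) * b = (c + 1) * (b * b) := by ring
        omega
      · rw [hm₅'.int 7 (by simp)]
        have := hω ⟨α, hα⟩ ⟨β, hβ⟩
        simp only at this
        rw [this]; push_cast; rfl
    have hbit : ∀ {a : ℕ} {i : ℕ}, τ₅.int a 0 = (v / 2 ^ i : ℕ) → a < 64 →
        IVal M τ₅ (.mod (iv a) (.const 2)) ((v / 2 ^ i % 2 : ℕ) : ℤ) := fun h ha =>
      (IVal.scalar h ha).natMod two (by norm_num)
    have hcond := ilt_ok (M := M) (σ := τ₅) IVal.zero
      ((hseed.natMul (hbit h39' (by norm_num))).natMul (hbit hJ3 (by norm_num)))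
      (by decide) (by simp [IExpr.size]; omega)
    have hval : g α β = if ((0 : ℕ) : ℤ) < (((if ω (⟨α, hα⟩, ⟨β, hβ⟩) then 1 else 0) *
        (v / 2 ^ α % 2) * (v / 2 ^ β % 2) : ℕ) : ℤ) then -1 else 1 := by
      have m1 := Nat.mod_two_eq_zero_or_one (v / 2 ^ α)
      have m2 := Nat.mod_two_eq_zero_or_one (v / 2 ^ β)
      rw [hg]
      simp only [hα, hβ, and_self, dite_true, testBit_iff]
      rcases m1 with m1 | m1 <;> rcases m2 with m2 | m2 <;> rw [m1, m2] <;>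
        by_cases hw : ω (⟨α, hα⟩, ⟨β, hβ⟩) = true <;> simp [hw]
    refine Runs.seq (I₁ := []) (R₁ := [32]) (I₂ := [41]) (R₂ := []) (e₁ := 1) (e₂ := 0)
      (Q₁ := fun υ => υ.real 32 0 = (∏ α ∈ Finset.range α, ∏ β ∈ Finset.range b, g α β) *
          ∏ β ∈ Finset.range (β + 1), g α β) (Runs.ite (e₁ := 0) one_pos hcond.1 (fun h => ?_)
      (fun h => ?_)) ?_
    · rw [hcond.2] at h
      have hv := RVal.zero.sub (RVal.scalar (M := M) hJ4)
      refine Runs.rset_scalar one_pos (by norm_num) hv.1 (by simp) ?_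
      rw [setReal_real_self, hv.2, Finset.prod_range_succ, hval, if_pos h]; ring
    · rw [hcond.2] at h
      refine Runs.skip one_pos ?_
      rw [hJ4, Finset.prod_range_succ _ β, hval, if_neg h, mul_one]
    · intro τ₆ _ hm₆ h6
      refine (hset (by norm_num) (by simp)
        ((IVal.scalar (M := M) (Mods.cell hm₆ hJ3)).natDiv (.const (by norm_num) : IVal M τ₆ (.const 2) ((2 : ℕ) : ℤ))
          (by norm_num)) (by decide) ((Nat.div_le_self _ _).trans (hdivV β))).imp fun υ hu h => ?_
      exact ⟨by rw [h, Nat.div_div_eq_div_mul, pow_succ], by rw [hu.real 32 (by simp), h6]⟩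
  · rintro τ₆ _ hm₆ ⟨-, h6⟩
    refine (hset (by norm_num) (by simp)
        ((IVal.scalar (M := M) (Mods.cell hm₆ (Mods.cell hm₄ hJ1))).natDiv
          (.const (by norm_num) : IVal M τ₆ (.const 2) ((2 : ℕ) : ℤ))
          (by norm_num)) (by decide) ((Nat.div_le_self _ _).trans (hdivV α))).imp fun υ hu h => ?_
    exact ⟨by rw [h, Nat.div_div_eq_div_mul, pow_succ], by
      rw [hu.real 32 (by simp), h6, ← Finset.prod_range_succ (fun α => ∏ β ∈ Finset.range b, g α β)]⟩

end SparseDict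

namespace SparseDict

open RealRAM Machine

/-! ### The sizes of the sketches -/

theorem Runs.iset_nat {M : Machine} {σ : Mem} {I R : List ℕ} {a : ℕ} {f : IExpr} {y e : ℕ}
    (hf : IVal M σ f (y : ℕ)) (hy : y ≤ M.V) (hfs : f.size ≤ 24 := by decide)
    (ha : a < 64 := by norm_num) (haI : a ∈ I := by simp) :
    M.Runs 1 I R (.iset a (.const 0) f) σ e fun τ => τ.int a 0 = y :=
  Runs.iset_scalar one_pos ha hf.1 hfs (by rw [hf.2, Nat.abs_cast]; exact_mod_cast hy) haI
    (by rw [setInt_int_self, hf.2])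

/-- `a := ⌈num / den⌉`. -/
def ceilCmd (a : ℕ) (num den : RExpr) : Cmd :=
  .seq (.iset a (.const 0) (.const 0))
    (.loop (.rlt (.mul (.ofInt (iv a)) den) num) (.iset a (.const 0) (.add (iv a) (.const 1))))

theorem ceilCmd_spec {M : Machine} {σ : Mem} {a e : ℕ} {num den : RExpr} {x y : ℝ} (hy : 0 < y)
    (hV : ⌈x / y⌉₊ ≤ M.V) (hx : ∀ τ, Mods [a] [] σ τ → RVal M τ num x)
    (hd : ∀ τ, Mods [a] [] σ τ → RVal M τ den y) (ha : a < 64 := by norm_num)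
    (he : 3 ≤ e := by norm_num) :
    M.Runs 1 [a] [] (ceilCmd a num den) σ e fun τ => τ.int a 0 = ⌈x / y⌉₊ := by
  refine Runs.seq (I₁ := [a]) (R₁ := []) (I₂ := [a]) (R₂ := []) (e₁ := 0) (e₂ := 2)
    (Runs.iset_nat (y := 0) (R := []) IVal.zero (by omega) (by decide) ha) ?_ (h₁ := by omega)
    (h₂ := by omega)
  intro τ _ hm h0
  refine Runs.loop (e₁ := 0) one_pos (N := ⌈x / y⌉₊) (J := fun i υ => υ.int a 0 = (i : ℕ))
    (fun i υ _ hu hJ => ?_) (fun i υ hi hu hJ => ?_) h0 hV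
  · have h := rlt_ok (M := M) ((RVal.ofInt (IVal.scalar hJ ha) (by simp)).mul (hd υ (hm.trans hu)))
      (hx υ (hm.trans hu))
    refine ⟨h.1, h.2.trans ?_⟩
    rw [Nat.lt_ceil, lt_div_iff₀ hy]; push_cast; rfl
  · exact Runs.iset_nat ((IVal.scalar hJ ha).natAdd .one) (by omega) (by simp [IExpr.size]) ha

/-- `a := ⌈log₂ m⌉`, with the scratch variable `p`. -/
def clogCmd (a p : ℕ) (m : IExpr) : Cmd :=
  .seq (.iset a (.const 0) (.const 0)) (.seq (.iset p (.const 0) (.const 1))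
    (.loop (.ilt (iv p) m) (.seq (.iset p (.const 0) (.add (iv p) (iv p)))
      (.iset a (.const 0) (.add (iv a) (.const 1))))))

theorem clog_two_le (m : ℕ) : Nat.clog 2 m ≤ m := Nat.clog_le_of_le_pow Nat.lt_two_pow_self.le

theorem clogCmd_spec {M : Machine} {σ : Mem} {a p m e : ℕ} {f : IExpr} (hV : 2 * m ≤ M.V)
    (hf : ∀ τ, Mods [a, p] [] σ τ → IVal M τ f (m : ℕ)) (hap : a ≠ p := by norm_num)
    (ha : a < 64 := by norm_num) (hp : p < 64 := by norm_num) (hfs : f.size ≤ 24 := by decide)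
    (he : 5 ≤ e := by norm_num) :
    M.Runs 1 [a, p] [] (clogCmd a p f) σ e fun τ => τ.int a 0 = Nat.clog 2 m := by
  have h4 := M.four_le
  refine Runs.seq (I₁ := [a, p]) (R₁ := []) (I₂ := [a, p]) (R₂ := []) (e₁ := 0) (e₂ := 4)
    (Runs.iset_nat (y := 0) (R := []) IVal.zero (by omega) (by decide) ha) ?_ (h₁ := by omega)
    (h₂ := by omega)
  intro τ _ hm h0
  refine Runs.seq (I₁ := [p]) (R₁ := []) (I₂ := [a, p]) (R₂ := []) (e₁ := 0) (e₂ := 3)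
    (Runs.iset_nat (y := 1) (R := []) IVal.one (by omega) (by decide) hp) ?_
  intro τ₁ _ hm₁ h1
  have hm' : Mods [a, p] [] σ τ₁ := hm.trans (hm₁.mono (by simp) (by simp))
  refine (Runs.loop (e₁ := 1) one_pos (N := Nat.clog 2 m)
    (J := fun i υ => υ.int a 0 = (i : ℕ) ∧ υ.int p 0 = (2 ^ i : ℕ))
    (fun i υ _ hu hJ => ?_) (fun i υ hi hu hJ => ?_)
    ⟨by rw [hm₁.int a (by simpa using hap)]; exact h0, by simpa using h1⟩
    ((clog_two_le m).trans (by omega))).imp fun _ _ h => h.1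
  · have h := ilt_ok (M := M) (IVal.scalar hJ.2 hp) (hf υ (hm'.trans hu)) (by simp) hfs
    refine ⟨h.1, h.2.trans ?_⟩
    rw [Nat.lt_clog_iff_pow_lt one_lt_two]
    norm_cast
  · have hlt := Nat.pow_lt_of_lt_clog hi
    refine Runs.seq (I₁ := [p]) (R₁ := []) (I₂ := [a]) (R₂ := []) (e₁ := 0) (e₂ := 0)
      (Runs.iset_nat (y := 2 ^ i + 2 ^ i) (R := [])
        ((IVal.scalar hJ.2 hp).natAdd (.scalar hJ.2 hp)) (by omega) (by simp [IExpr.size]) hp) ?_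
    intro υ₁ _ hu₁ h2
    have ha' : υ₁.int a 0 = (i : ℕ) := by rw [hu₁.int a (by simpa using hap), hJ.1]
    refine (Runs.iset_nat ((IVal.scalar ha' ha).natAdd .one) ?_ (by simp [IExpr.size]) ha
      (by simp)).imp fun υ₂ hu₂ h3 => ⟨h3, ?_⟩
    · have := clog_two_le m; omega
    · rw [hu₂.int p (by simpa using hap.symm), h2, pow_succ, mul_two]

/-- The parameters of the problem and the constant `κ` which determines the failure probability. -/
structure Params where
  (κ n d k r D : ℕ)
  ε : ℝ

namespace Params

variable (P : Params)

/-- The number of rows of `S`, divided by `512`. -/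
noncomputable def qS : ℕ := ⌈(P.κ : ℝ) * P.k / P.ε⌉₊

/-- The number of rows of `S`. -/
noncomputable def s : ℕ := P.qS * 512

/-- The size of the groups of rows of `Tᵀ` and of `W`. -/
noncomputable def G : ℕ := ⌈12800 / (P.ε * P.ε)⌉₊

/-- The number of groups of columns of `T`. -/
def qT : ℕ := 2 * P.κ * P.r * Nat.clog 2 (P.n * P.k * P.D)

/-- The number of groups of rows of `W`. -/
noncomputable def qW : ℕ := 2 * P.κ * P.s * P.k * Nat.clog 2 (P.n * P.D)

/-- The length of the indices. -/
def b : ℕ := Nat.clog 2 (P.n * P.d + P.n + P.d)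

/-- The memory holds the parameters. -/
structure Input (σ : Mem) : Prop where
  n : σ.int 0 0 = P.n
  d : σ.int 1 0 = P.d
  k : σ.int 2 0 = P.k
  r : σ.int 3 0 = P.r
  D : σ.int 4 0 = P.D
  ε : σ.real 0 0 = P.ε

variable {P}

theorem Input.mods {σ τ : Mem} (h : P.Input σ) {I R : List ℕ} (hm : Mods I R σ τ)
    (hI : ∀ a < 5, a ∉ I := by decide) (hR : 0 ∉ R := by decide) : P.Input τ :=
  ⟨by rw [hm.int 0 (hI 0 (by norm_num)), h.n], by rw [hm.int 1 (hI 1 (by norm_num)), h.d],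
    by rw [hm.int 2 (hI 2 (by norm_num)), h.k], by rw [hm.int 3 (hI 3 (by norm_num)), h.r],
    by rw [hm.int 4 (hI 4 (by norm_num)), h.D], by rw [hm.real 0 hR, h.ε]⟩

variable (P)

/-- The memory holds the sizes. -/
structure Sizes (σ : Mem) : Prop where
  input : P.Input σ
  s : σ.int 10 0 = P.s
  t : σ.int 11 0 = (P.qT * P.G : ℕ)
  w : σ.int 12 0 = (P.qW * P.G : ℕ)
  G : σ.int 13 0 = P.G
  qT : σ.int 14 0 = P.qT
  qW : σ.int 15 0 = P.qW
  b : σ.int 16 0 = P.b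

end Params

/-- Compute the sizes. -/
def sizesCmd (κ : ℕ) : Cmd :=
  .seq (ceilCmd 10 (.mul (.ofInt (.const (κ : ℕ))) (.ofInt (iv 2))) (rv 0)) <|
  .seq (.iset 10 (.const 0) (.mul (iv 10) (.const (512 : ℕ)))) <|
  .seq (ceilCmd 13 (.ofInt (.const (12800 : ℕ))) (.mul (rv 0) (rv 0))) <|
  .seq (clogCmd 14 17 (.mul (.mul (iv 0) (iv 2)) (iv 4))) <|
  .seq (.iset 14 (.const 0) (.mul (.mul (.mul (.const 2) (.const (κ : ℕ))) (iv 3)) (iv 14))) <|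
  .seq (.iset 11 (.const 0) (.mul (iv 14) (iv 13))) <|
  .seq (clogCmd 15 17 (.mul (iv 0) (iv 4))) <|
  .seq (.iset 15 (.const 0)
    (.mul (.mul (.mul (.mul (.const 2) (.const (κ : ℕ))) (iv 10)) (iv 2)) (iv 15))) <|
  .seq (.iset 12 (.const 0) (.mul (iv 15) (iv 13)))
    (clogCmd 16 17 (.add (.add (.mul (iv 0) (iv 1)) (iv 0)) (iv 1)))

theorem sizesCmd_spec {M : Machine} {P : Params} {σ : Mem} (hσ : P.Input σ) (hε : 0 < P.ε)
    (hκ : P.κ ≤ M.V) (hc : 12800 ≤ M.V) (hs : P.s ≤ M.V) (hG : P.G ≤ M.V)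
    (h1 : 2 * (P.n * P.k * P.D) ≤ M.V) (h2 : 2 * (P.n * P.D) ≤ M.V)
    (h3 : 2 * (P.n * P.d + P.n + P.d) ≤ M.V) (hT : P.qT ≤ M.V) (hW : P.qW ≤ M.V)
    (ht : P.qT * P.G ≤ M.V) (hw : P.qW * P.G ≤ M.V) :
    M.Runs 1 [10, 11, 12, 13, 14, 15, 16, 17] [] (sizesCmd P.κ) σ 15 P.Sizes := by
  refine Runs.seq (I₁ := [10]) (R₁ := []) (I₂ := [10, 11, 12, 13, 14, 15, 16, 17]) (R₂ := [])
    (e₁ := 4) (e₂ := 14) (ceilCmd_spec hε (x := (P.κ : ℝ) * P.k) (y := P.ε) ?_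
      (fun τ hm => ?_) fun τ hm => .scalar (hσ.mods hm).ε) ?_
  · rw [Params.s, Params.qS] at hs; omega
  · exact ((RVal.ofInt (IVal.nat hκ) (by simp [IExpr.size])).mul
      (RVal.ofInt (.scalar (hσ.mods hm).k))).congr (by push_cast; rfl)
  intro τ₁ _ hm₁ h10
  have i₁ := hσ.mods hm₁
  refine Runs.seq (I₁ := [10]) (R₁ := []) (I₂ := [11, 12, 13, 14, 15, 16, 17]) (R₂ := [])
    (e₁ := 0) (e₂ := 13) (Runs.iset_nat (y := P.s)
      ((IVal.scalar h10).natMul (.nat (by omega))) hs) ?_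
  intro τ₂ _ hm₂ hs₂
  have i₂ := i₁.mods hm₂
  refine Runs.seq (I₁ := [13]) (R₁ := []) (I₂ := [11, 12, 14, 15, 16, 17]) (R₂ := [])
    (e₁ := 3) (e₂ := 12) (ceilCmd_spec (mul_pos hε hε) (x := 12800) hG
      (fun τ hm => (RVal.ofInt (IVal.nat hc)).congr (by push_cast; rfl))
      fun τ hm => (RVal.scalar (i₂.mods hm).ε).mul (.scalar (i₂.mods hm).ε)) ?_
  intro τ₃ _ hm₃ hG₃
  have i₃ := i₂.mods hm₃
  refine Runs.seq (I₁ := [14, 17]) (R₁ := []) (I₂ := [11, 12, 14, 15, 16, 17]) (R₂ := [])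
    (e₁ := 5) (e₂ := 11) (clogCmd_spec h1 fun τ hm => ((IVal.scalar (i₃.mods hm).n).natMul
      (.scalar (i₃.mods hm).k)).natMul (.scalar (i₃.mods hm).D)) ?_
  intro τ₄ _ hm₄ h14
  have i₄ := i₃.mods hm₄
  have two : ∀ {τ : Mem}, IVal M τ (.const 2) ((2 : ℕ) : ℤ) := IVal.const (by norm_num)
  refine Runs.seq (I₁ := [14]) (R₁ := []) (I₂ := [11, 12, 15, 16, 17]) (R₂ := [])
    (e₁ := 0) (e₂ := 10) (Runs.iset_nat (y := P.qT)
      (((two.natMul (.nat hκ)).natMul (.scalar i₄.r)).natMul (.scalar h14)) hT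
        (by simp [IExpr.size])) ?_
  intro τ₅ _ hm₅ hT₅
  have i₅ := i₄.mods hm₅
  have hG₅ : τ₅.int 13 0 = P.G := Mods.cell hm₅ (Mods.cell hm₄ hG₃)
  refine Runs.seq (I₁ := [11]) (R₁ := []) (I₂ := [12, 15, 16, 17]) (R₂ := [])
    (e₁ := 0) (e₂ := 9) (Runs.iset_nat ((IVal.scalar hT₅).natMul (.scalar hG₅)) ht) ?_
  intro τ₆ _ hm₆ ht₆
  have i₆ := i₅.mods hm₆
  refine Runs.seq (I₁ := [15, 17]) (R₁ := []) (I₂ := [12, 15, 16, 17]) (R₂ := [])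
    (e₁ := 5) (e₂ := 8) (clogCmd_spec h2 fun τ hm => (IVal.scalar (i₆.mods hm).n).natMul
      (.scalar (i₆.mods hm).D)) ?_
  intro τ₇ _ hm₇ h15
  have i₇ := i₆.mods hm₇
  have hs₇ : τ₇.int 10 0 = P.s :=
    Mods.cell hm₇ (Mods.cell hm₆ (Mods.cell hm₅ (Mods.cell hm₄ (Mods.cell hm₃ hs₂))))
  refine Runs.seq (I₁ := [15]) (R₁ := []) (I₂ := [12, 16, 17]) (R₂ := [])
    (e₁ := 0) (e₂ := 7) (Runs.iset_nat (y := P.qW)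
      ((((two.natMul (.nat hκ)).natMul (.scalar hs₇)).natMul (.scalar i₇.k)).natMul
        (.scalar h15)) hW (by simp [IExpr.size])) ?_
  intro τ₈ _ hm₈ hW₈
  have i₈ := i₇.mods hm₈
  have hG₈ : τ₈.int 13 0 = P.G := Mods.cell hm₈ (Mods.cell hm₇ (Mods.cell hm₆ hG₅))
  refine Runs.seq (I₁ := [12]) (R₁ := []) (I₂ := [16, 17]) (R₂ := [])
    (e₁ := 0) (e₂ := 6) (Runs.iset_nat ((IVal.scalar hW₈).natMul (.scalar hG₈)) hw) ?_
  intro τ₉ _ hm₉ hw₉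
  have i₉ := i₈.mods hm₉
  refine (clogCmd_spec h3 fun τ hm => ((((IVal.scalar (i₉.mods hm).n).natMul
    (.scalar (i₉.mods hm).d)).natAdd (.scalar (i₉.mods hm).n)).natAdd
      (.scalar (i₉.mods hm).d))).imp fun υ hm hb => ?_
  exact ⟨i₉.mods hm, Mods.cell hm (Mods.cell hm₉ (Mods.cell hm₈ hs₇)),
    Mods.cell hm (Mods.cell hm₉ (Mods.cell hm₈ (Mods.cell hm₇ ht₆))), Mods.cell hm hw₉,
    Mods.cell hm (Mods.cell hm₉ hG₈),
    Mods.cell hm (Mods.cell hm₉ (Mods.cell hm₈ (Mods.cell hm₇ (Mods.cell hm₆ hT₅)))),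
    Mods.cell hm (Mods.cell hm₉ hW₈), hb⟩

end SparseDict

namespace SparseDict

open RealRAM Machine

namespace Params

variable (P : Params)

/-- A bound on all stored integers. -/
noncomputable def V : ℕ :=
  P.κ + 12800 + P.s + P.G + 2 * (P.n * P.k * P.D) + 2 * (P.n * P.D) +
    2 * (P.n * P.d + P.n + P.d) + P.qT + P.qW + P.qT * P.G + P.qW * P.G + P.s * P.k + P.k * P.d +
    P.k * (P.qT * P.G) + P.n * P.r + P.r * P.D + P.k * (2 * P.D + 1) + P.k + P.r + P.D

/-- The sizes of the integer arrays, minus `1`, if the array `7` has `m` cells. -/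
noncomputable def intCells (m : ℕ) : ℕ → ℕ
  | 7 => m
  | 8 => P.n * P.r
  | 9 => P.n * P.r
  | 20 => P.s * P.k
  | 21 => P.r
  | 22 => P.n * P.r
  | _ => 0

/-- The sizes of the real arrays, minus `1`, if the arrays `4` and `5` have `m₄` and `m₅` cells. -/
noncomputable def realCells (m₄ m₅ : ℕ) : ℕ → ℕ
  | 2 => P.k * P.d
  | 4 => m₄
  | 5 => m₅
  | 6 => P.s * P.d
  | 7 => P.n * (P.qT * P.G)
  | 8 => P.qW * P.G
  | 20 => P.k * P.s
  | 21 => P.k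
  | 22 => P.s
  | 25 => P.k * P.d
  | 26 => P.k * (P.qT * P.G)
  | 27 => P.qT * P.G + P.qW * P.G
  | 28 => P.qT + P.qW
  | _ => 0

theorem getD_map_range (f : ℕ → ℕ) {a : ℕ} (ha : a < 64) :
    ((List.range 64).map f).getD a 0 = f a := by
  simp [List.getD, List.getElem?_map, List.getElem?_range ha]

/-- The machine with sufficient space. -/
noncomputable def machine (m m₄ m₅ : ℕ) : Machine where
  L := ⟨(List.range 64).map fun a => P.intCells m a + 1,
    (List.range 64).map fun a => P.realCells m₄ m₅ a + 1⟩
  B := P.V ^ 24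
  V := P.V
  four_le := by rw [V]; omega
  pow_le := le_rfl
  int_pos a ha := by rw [getD_map_range _ ha]; omega
  real_pos a ha := by rw [getD_map_range _ ha]; omega

variable {P} {m m₄ m₅ : ℕ}

theorem isz_machine {a : ℕ} (ha : a < 64) : (P.machine m m₄ m₅).isz a = P.intCells m a + 1 :=
  getD_map_range (fun a => P.intCells m a + 1) ha

theorem rsz_machine {a : ℕ} (ha : a < 64) :
    (P.machine m m₄ m₅).rsz a = P.realCells m₄ m₅ a + 1 :=
  getD_map_range (fun a => P.realCells m₄ m₅ a + 1) ha

theorem V_machine : (P.machine m m₄ m₅).V = P.V := rfl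

theorem b_le_V : P.b ≤ P.V := (clog_two_le _).trans (by rw [V]; omega)

theorem sizesCmd_runs {σ : Mem} (hσ : P.Input σ) (hε : 0 < P.ε) :
    (P.machine m m₄ m₅).Runs 1 [10, 11, 12, 13, 14, 15, 16, 17] [] (sizesCmd P.κ) σ 15 P.Sizes := by
  refine sizesCmd_spec hσ hε ?_ ?_ ?_ ?_ ?_ ?_ ?_ ?_ ?_ ?_ ?_ <;> rw [V_machine, V] <;> omega

variable (P)

/-- The setting of the search for the given sketches and programs. -/
noncomputable def env (m m₄ m₅ : ℕ) (hk : 0 < P.k) (hr : P.r ≤ P.k) (hT : 0 < P.qT)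
    (hW : 0 < P.qW) (S : Matrix (Fin P.s) (Fin P.n) ℝ) (T : Matrix (Fin P.d) (Fin (P.qT * P.G)) ℝ)
    (W : Matrix (Fin (P.qW * P.G)) (Fin (P.n * P.d)) ℝ) (A : Matrix (Fin P.n) (Fin P.d) ℝ)
    (inv : Mem → Prop) (gT gW : Cmd)
    (inv_mods : ∀ σ τ, Mods coreI coreR σ τ → inv σ → inv τ)
    (gT_spec : ∀ σ, inv σ → ∀ (j : Fin P.d) (c : Fin (P.qT * P.G)), σ.int 36 0 = (j : ℕ) →
      σ.int 37 0 = (c : ℕ) → (P.machine m m₄ m₅).Runs 1 [38, 39, 40, 41, 42, 43] [32] gT σ 14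
        fun τ => τ.real 32 0 = T j c)
    (gW_spec : ∀ σ, inv σ → ∀ (c : Fin (P.qW * P.G)) (x : Fin (P.n * P.d)), σ.int 36 0 = (c : ℕ) →
      σ.int 37 0 = (x : ℕ) → (P.machine m m₄ m₅).Runs 1 [38, 39, 40, 41, 42, 43] [32] gW σ 14
        fun τ => τ.real 32 0 = W c x) : Env where
  M := P.machine m m₄ m₅
  n := P.n
  d := P.d
  k := P.k
  r := P.r
  D := P.D
  s := P.s
  G := P.G
  qT := P.qT
  qW := P.qW
  SA := S * A
  AT := A * T
  WA := W *ᵥ flatten A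
  T := T
  W := W
  inv := inv
  gT := gT
  gW := gW
  inv_mods := inv_mods
  gT_spec := gT_spec
  gW_spec := gW_spec
  k_pos := hk
  r_le := hr
  qT_pos := hT
  qW_pos := hW
  le_V := by
    rw [V_machine, V]
    refine ⟨?_, ?_, ?_, ?_, ?_, ?_, ?_, ?_, ?_, ?_, ?_, ?_, ?_, ?_, ?_, ?_, ?_, ?_⟩ <;> omega
  isz_le := by
    simp only [isz_machine (show 8 < 64 by norm_num), isz_machine (show 9 < 64 by norm_num),
      isz_machine (show 20 < 64 by norm_num), isz_machine (show 21 < 64 by norm_num),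
      isz_machine (show 22 < 64 by norm_num), intCells]
    refine ⟨?_, ?_, ?_, ?_, ?_⟩ <;> omega
  rsz_le := by
    simp only [rsz_machine (show 2 < 64 by norm_num), rsz_machine (show 6 < 64 by norm_num),
      rsz_machine (show 7 < 64 by norm_num), rsz_machine (show 8 < 64 by norm_num),
      rsz_machine (show 20 < 64 by norm_num), rsz_machine (show 21 < 64 by norm_num),
      rsz_machine (show 22 < 64 by norm_num), rsz_machine (show 25 < 64 by norm_num),
      rsz_machine (show 26 < 64 by norm_num), rsz_machine (show 27 < 64 by norm_num),
      rsz_machine (show 28 < 64 by norm_num), realCells]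
    refine ⟨?_, ?_, ?_, ?_, ?_, ?_, ?_, ?_, ?_, ?_, ?_, ?_, ?_⟩ <;> omega

theorem env_static {hk hr hT hW S T W A inv gT gW h₁ h₂ h₃} {σ : Mem} (hσ : P.Sizes σ)
    (hinv : inv σ) (hSA : MatAt (σ.real 6) (S * A)) (hAT : MatAt (σ.real 7) (A * T))
    (hWA : ∀ c : Fin (P.qW * P.G), σ.real 8 c = (W *ᵥ flatten A) c) :
    (P.env m m₄ m₅ hk hr hT hW S T W A inv gT gW h₁ h₂ h₃).Static σ :=
  ⟨hinv, hσ.input.n, hσ.input.d, hσ.input.k, hσ.input.r, hσ.input.D, hσ.s, hσ.t, hσ.w, hσ.G,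
    hσ.qT, hσ.qW, hSA, hAT, hWA⟩

theorem searchCmd_runs (hk : 0 < P.k) (hr : P.r ≤ P.k) (hT : 0 < P.qT)
    (hW : 0 < P.qW) {S : Matrix (Fin P.s) (Fin P.n) ℝ}
    {T : Matrix (Fin P.d) (Fin (P.qT * P.G)) ℝ} {W : Matrix (Fin (P.qW * P.G)) (Fin (P.n * P.d)) ℝ}
    {A : Matrix (Fin P.n) (Fin P.d) ℝ} {inv : Mem → Prop} {gT gW : Cmd}
    (inv_mods : ∀ σ τ, Mods coreI coreR σ τ → inv σ → inv τ)
    (gT_spec : ∀ σ, inv σ → ∀ (j : Fin P.d) (c : Fin (P.qT * P.G)), σ.int 36 0 = (j : ℕ) →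
      σ.int 37 0 = (c : ℕ) → (P.machine m m₄ m₅).Runs 1 [38, 39, 40, 41, 42, 43] [32] gT σ 14
        fun τ => τ.real 32 0 = T j c)
    (gW_spec : ∀ σ, inv σ → ∀ (c : Fin (P.qW * P.G)) (x : Fin (P.n * P.d)), σ.int 36 0 = (c : ℕ) →
      σ.int 37 0 = (x : ℕ) → (P.machine m m₄ m₅).Runs 1 [38, 39, 40, 41, 42, 43] [32] gW σ 14
        fun τ => τ.real 32 0 = W c x)
    {σ : Mem} (hσ : P.Sizes σ)
    (hinv : inv σ) (hSA : MatAt (σ.real 6) (S * A)) (hAT : MatAt (σ.real 7) (A * T))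
    (hWA : ∀ c : Fin (P.qW * P.G), σ.real 8 c = (W *ᵥ flatten A) c) :
    (P.machine m m₄ m₅).Runs
      ((2 * (P.n * P.D) + 1) ^ (P.s * P.k) * (P.k * (2 * P.D + 1)) ^ P.r) coreI coreR
      (searchCmd gT gW) σ 40
      fun τ => SketchGood P.r P.D S T W A P.k P.ε → Solved P.k P.r P.D P.ε A τ := by
  refine (searchCmd_spec (P.env m m₄ m₅ hk hr hT hW S T W A inv gT gW inv_mods gT_spec gW_spec)
    (P.env_static hσ hinv hSA hAT hWA)).imp ?_
  rintro τ - ⟨N₀, h1, h2, h3, h4⟩ hgood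
  have := hgood N₀ h1 h2
  rw [Solved]
  change outX P.n P.k P.r τ = _ at h3
  change outY P.k P.d τ = _ at h4
  rw [h3, h4]
  exact this

/-- A seed for one row of a sketching matrix. -/
abbrev Seed : Type := Fin P.b × Fin P.b → Bool

/-- The seeds for the three sketching matrices. -/
abbrev Rand : Type :=
  (Fin P.s → P.Seed) × (Fin (P.qT * P.G) → P.Seed) × (Fin (P.qW * P.G) → P.Seed)

variable {P}

/-- The sketching matrix `S`. -/
noncomputable def matS (ω : P.Rand) : Matrix (Fin P.s) (Fin P.n) ℝ := signMat (fun η x => sgn η x) ω.1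

/-- The sketching matrix `T`. -/
noncomputable def matT (ω : P.Rand) : Matrix (Fin P.d) (Fin (P.qT * P.G)) ℝ :=
  (signMat (fun η x => sgn η x) ω.2.1)ᵀ

/-- The sketching matrix `W`. -/
noncomputable def matW (ω : P.Rand) : Matrix (Fin (P.qW * P.G)) (Fin (P.n * P.d)) ℝ :=
  signMat (fun η x => sgn η x) ω.2.2

/-- The array holds the seeds. -/
structure SeedsAt (ω : P.Rand) (f : ℕ → ℤ) : Prop where
  S : ∀ c : Fin P.s, SeedAt f c (ω.1 c)
  T : ∀ c : Fin (P.qT * P.G), SeedAt f (P.s + c) (ω.2.1 c)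
  W : ∀ c : Fin (P.qW * P.G), SeedAt f (P.s + P.qT * P.G + c) (ω.2.2 c)

variable (P)

/-- The number of random bits. -/
noncomputable def bits : ℕ := (P.s + P.qT * P.G + P.qW * P.G) * (P.b * P.b)

variable {P}

theorem signCmd_runs {σ : Mem} {c v : ℕ} {ρ x : IExpr} {η : P.Seed}
    (hρs : ρ.size ≤ 6) (hxs : x.size ≤ 6) (hvV : v ≤ P.V)
    (hc : c < P.s + P.qT * P.G + P.qW * P.G)
    (hρ : ∀ τ, Mods [38, 39, 40, 41] [32] σ τ → IVal (P.machine P.bits m₄ m₅) τ ρ (c : ℕ))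
    (hx : ∀ τ, Mods [38, 39, 40, 41] [32] σ τ → IVal (P.machine P.bits m₄ m₅) τ x (v : ℕ))
    (hb : σ.int 16 0 = P.b) (hη : SeedAt (σ.int 7) c η) :
    (P.machine P.bits m₄ m₅).Runs 1 [38, 39, 40, 41] [32] (signCmd ρ x) σ 14
      fun τ => τ.real 32 0 = sgn η v := by
  refine signCmd_spec hρs hxs b_le_V hvV ?_ hρ hx hb hη
  rw [isz_machine (by norm_num)]
  exact (Nat.mul_le_mul_right (P.b * P.b) hc).trans (Nat.le_succ _)

end Params

/-! ### The streaming algorithm -/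

/-- `for c < n do (pre; a[idx] := a[idx] + Δ * x)`, where `Δ` is in the real array `1` and `pre`
puts `x` into the real array `32`. -/
def addCmd (n : IExpr) (a : ℕ) (idx : IExpr) (pre : Cmd) : Cmd :=
  Cmd.forN 36 n (.seq pre (.rset a idx (.add (.get a idx) (.mul (rv 1) (rv 32)))))

theorem addCmd_spec {M : Machine} {σ : Mem} {N a : ℕ} {n idx : IExpr} {pre : Cmd} {g : ℕ → ℕ}
    {f : Fin N → ℝ} {Δ : ℝ} (hN : N ≤ M.V)
    (hn : ∀ τ, Mods [36, 38, 39, 40, 41] [a, 32] σ τ → IVal M τ n (N : ℕ))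
    (hidx : ∀ (i : ℕ) τ, Mods [36, 38, 39, 40, 41] [a, 32] σ τ → τ.int 36 0 = i →
      IVal M τ idx (g i : ℕ))
    (hpre : ∀ (i : Fin N) τ, Mods [36, 38, 39, 40, 41] [a, 32] σ τ → τ.int 36 0 = (i : ℕ) →
      M.Runs 1 [38, 39, 40, 41] [32] pre τ 14 fun υ => υ.real 32 0 = f i)
    (hg : ∀ i < N, g i < M.rsz a) (hinj : ∀ i < N, ∀ j < N, g i = g j → i = j)
    (hΔ : σ.real 1 0 = Δ) (ha : a ≠ 32 := by norm_num) (ha' : a ≠ 1 := by norm_num)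
    (hns : n.size ≤ 24 := by decide) (his : idx.size ≤ 24 := by decide) :
    M.Runs 1 [36, 38, 39, 40, 41] [a, 32] (addCmd n a idx pre) σ 19 fun τ =>
      (∀ i : Fin N, τ.real a (g i) = σ.real a (g i) + Δ * f i) ∧
        ∀ c, (∀ i < N, g i ≠ c) → τ.real a c = σ.real a c := by
  refine (Runs.forN (I' := [38, 39, 40, 41]) (e₁ := 15) one_pos N (fun i υ =>
    (∀ j : Fin N, (j : ℕ) < i → υ.real a (g j) = σ.real a (g j) + Δ * f j) ∧
      ∀ c, (∀ j < i, g j ≠ c) → υ.real a c = σ.real a c) hN hn (by simp) (by simp) ?_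
      (hns := hns)).imp
    fun υ _ h => ⟨fun i => h.1 i i.2, h.2⟩
  rintro i τ hi _ hm h36 ⟨hJ, hJ'⟩
  refine Runs.seq (I₁ := [38, 39, 40, 41]) (R₁ := [32]) (I₂ := []) (R₂ := [a]) (e₁ := 14)
    (e₂ := 0) (hpre ⟨i, hi⟩ τ hm h36) ?_
  intro υ _ hu h32
  have hu' := hm.trans (hu.mono (I' := [36, 38, 39, 40, 41]) (R' := [a, 32]) (by simp) (by simp))
  have hx := hidx i υ hu' (Mods.cell hu h36)
  have h1 : υ.real 1 0 = Δ := by rw [hu'.real 1 (by simp [ha'.symm]), hΔ]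
  have hv := (RVal.get hx (hg i hi) his).add ((RVal.scalar h1).mul (.scalar h32))
  have e : υ.real a = τ.real a := hu.real a (by simpa using ha)
  refine Runs.rset one_pos hx.1 his (by rw [hx.2]; omega) (by rw [hx.2]; exact_mod_cast hg i hi)
    hv.1 (by simp) ?_
  rw [hv.2, hx.2, Int.toNat_natCast, e, hJ' (g i) fun j hj h => by
    have := hinj j (by omega) i hi h; omega]
  refine ⟨fun j hj => ?_, fun c hc => ?_⟩
  · by_cases hji : (j : ℕ) = i
    · have : j = ⟨i, hi⟩ := Fin.ext hji
      subst this; simp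
    · rw [setReal_real_cell_ne _ _ _ fun h => hji (hinj _ j.2 i hi h), e]
      exact hJ j (by omega)
  · rw [setReal_real_cell_ne _ _ _ (hc i (by omega)).symm, e]
    exact hJ' c fun j hj => hc j (by omega)

/-- Process an update of the stream. -/
def updateCmd : Cmd :=
  .seq (addCmd (iv 10) 6 (ix2 (iv 36) (iv 1) (iv 6)) (signCmd (iv 36) (iv 5)))
    (.seq (addCmd (iv 11) 7 (ix2 (iv 5) (iv 11) (iv 36)) (signCmd (.add (iv 10) (iv 36)) (iv 6)))
      (addCmd (iv 12) 8 (iv 36)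
        (signCmd (.add (.add (iv 10) (iv 11)) (iv 36)) (ix2 (iv 5) (iv 1) (iv 6)))))

namespace Params

variable {P : Params} {m m₄ m₅ : ℕ}

/-- The memory holds the sketches of `A`. -/
structure Stream (ω : P.Rand) (A : Matrix (Fin P.n) (Fin P.d) ℝ) (σ : Mem) : Prop where
  sizes : P.Sizes σ
  seeds : SeedsAt ω (σ.int 7)
  SA : MatAt (σ.real 6) (matS ω * A)
  AT : MatAt (σ.real 7) (A * matT ω)
  WA : ∀ c : Fin (P.qW * P.G), σ.real 8 c = (matW ω *ᵥ flatten A) c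

theorem Sizes.mods {σ τ : Mem} (h : P.Sizes σ) {I R : List ℕ} (hm : Mods I R σ τ)
    (hI : ∀ a < 17, 5 ≤ a ∨ a ∉ I := by decide) (hI' : ∀ a < 17, a < 10 ∨ a ∉ I := by decide)
    (hR : 0 ∉ R := by decide) : P.Sizes τ := by
  have hi : ∀ a < 17, 10 ≤ a → τ.int a = σ.int a := fun a h1 h2 =>
    hm.int a ((hI' a h1).resolve_left (by omega))
  exact ⟨h.input.mods hm (fun a ha => (hI a (by omega)).resolve_left (by omega)) hR,
    by rw [hi 10 (by norm_num) (by norm_num), h.s], by rw [hi 11 (by norm_num) (by norm_num), h.t],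
    by rw [hi 12 (by norm_num) (by norm_num), h.w], by rw [hi 13 (by norm_num) (by norm_num), h.G],
    by rw [hi 14 (by norm_num) (by norm_num), h.qT],
    by rw [hi 15 (by norm_num) (by norm_num), h.qW],
    by rw [hi 16 (by norm_num) (by norm_num), h.b]⟩

theorem mul_add_inj {q i i' j j' : ℕ} (hj : j < q) (hj' : j' < q) (h : i * q + j = i' * q + j') :
    i = i' ∧ j = j' := by
  have h1 := congrArg (· / q) h
  have h2 := congrArg (· % q) h
  have hq : 0 < q := by omega
  simp only [Nat.mul_add_mod_of_lt hj, Nat.mul_add_mod_of_lt hj', hj, hj',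
    Nat.add_div_of_dvd_right (dvd_mul_left q _),
    Nat.mul_div_cancel _ hq,
    Nat.div_eq_of_lt, add_zero] at h1 h2
  exact ⟨h1, h2⟩

theorem updateCmd_spec {σ : Mem} {ω : P.Rand} {A : Matrix (Fin P.n) (Fin P.d) ℝ}
    (hσ : Stream ω A σ) {i : Fin P.n} {j : Fin P.d} {Δ : ℝ} (h5 : σ.int 5 0 = (i : ℕ))
    (h6 : σ.int 6 0 = (j : ℕ)) (hΔ : σ.real 1 0 = Δ) :
    (P.machine P.bits m₄ m₅).Runs 1 [36, 38, 39, 40, 41] [6, 7, 8, 32] updateCmd σ 22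
      (Stream ω (A + Matrix.single i j Δ)) := by
  have hij : (i : ℕ) * P.d + j < P.n * P.d := mul_add_lt i.2 j.2
  have hnV : P.n ≤ P.V ∧ P.d ≤ P.V ∧ P.n * P.d ≤ P.V ∧ P.s ≤ P.V ∧ P.qT * P.G ≤ P.V ∧
      P.qW * P.G ≤ P.V := by rw [V]; omega
  obtain ⟨V1, V2, V3, V4, V5, V6⟩ := hnV
  refine Runs.seq (I₁ := [36, 38, 39, 40, 41]) (R₁ := [6, 32]) (I₂ := [36, 38, 39, 40, 41])
    (R₂ := [7, 8, 32]) (e₁ := 19) (e₂ := 21)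
    (addCmd_spec (N := P.s) (g := fun c => c * P.d + j) (f := fun c => matS ω c i) V4
      (fun τ hm => .scalar (hσ.sizes.mods hm).s)
      (fun c τ hm hc => (IVal.scalar hc).ix2 (.scalar (hσ.sizes.mods hm).input.d)
        (.scalar (Mods.cell hm h6)))
      (fun c τ hm hc => signCmd_runs (v := i) (by decide) (by decide) (by omega)
        (by have := c.2; omega) (fun υ hu => .scalar (Mods.cell hu hc))
        (fun υ hu => .scalar (Mods.cell hu (Mods.cell hm h5))) (hσ.sizes.mods hm).b
        (by rw [hm.int 7 (by simp)]; exact hσ.seeds.S c))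
      (fun c hc => by
        rw [rsz_machine (by norm_num)]
        exact (mul_add_lt hc j.2).trans (Nat.lt_succ_self _))
      (fun c _ c' _ h => (mul_add_inj j.2 j.2 h).1) hΔ) ?_
  rintro τ₁ _ hm₁ ⟨hS, hS'⟩
  have s₁ := hσ.sizes.mods hm₁
  refine Runs.seq (I₁ := [36, 38, 39, 40, 41]) (R₁ := [7, 32]) (I₂ := [36, 38, 39, 40, 41])
    (R₂ := [8, 32]) (e₁ := 19) (e₂ := 19)
    (addCmd_spec (N := P.qT * P.G) (g := fun c => i * (P.qT * P.G) + c)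
      (f := fun c => matT ω j c) V5
      (fun τ hm => .scalar (s₁.mods hm).t)
      (fun c τ hm hc => (IVal.scalar (Mods.cell hm (Mods.cell hm₁ h5))).ix2
        (.scalar (s₁.mods hm).t) (.scalar hc))
      (fun c τ hm hc => signCmd_runs (v := j) (c := P.s + c) (by decide) (by decide) (by omega)
        (by have := c.2; omega)
        (fun υ hu => (IVal.scalar ((s₁.mods hm).mods hu).s).natAdd (.scalar (Mods.cell hu hc)))
        (fun υ hu => .scalar (Mods.cell hu (Mods.cell hm (Mods.cell hm₁ h6)))) (s₁.mods hm).b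
        (by rw [hm.int 7 (by simp), hm₁.int 7 (by simp)]; exact hσ.seeds.T c))
      (fun c hc => by
        rw [rsz_machine (by norm_num)]
        exact (mul_add_lt i.2 hc).trans (Nat.lt_succ_self _))
      (fun c _ c' _ h => by simpa using h) (by rw [hm₁.real 1 (by simp), hΔ])) ?_
  rintro τ₂ _ hm₂ ⟨hT, hT'⟩
  have s₂ := s₁.mods hm₂
  refine (addCmd_spec (M := P.machine P.bits m₄ m₅) (a := 8) (N := P.qW * P.G) (g := fun c => c)
      (f := fun c => matW ω c ⟨i * P.d + j, hij⟩) V6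
      (fun τ hm => .scalar (s₂.mods hm).w)
      (fun c τ hm hc => IVal.scalar hc)
      (fun c τ hm hc => signCmd_runs (v := i * P.d + j) (c := P.s + P.qT * P.G + c) (by decide)
        (by decide) (by omega) (by have := c.2; omega)
        (fun υ hu => ((IVal.scalar ((s₂.mods hm).mods hu).s).natAdd
          (.scalar ((s₂.mods hm).mods hu).t)).natAdd (.scalar (Mods.cell hu hc)))
        (fun υ hu => (IVal.scalar (Mods.cell hu (Mods.cell hm (Mods.cell hm₂
          (Mods.cell hm₁ h5))))).ix2 (.scalar ((s₂.mods hm).mods hu).input.d)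
          (.scalar (Mods.cell hu (Mods.cell hm (Mods.cell hm₂ (Mods.cell hm₁ h6))))))
        (s₂.mods hm).b
        (by rw [hm.int 7 (by simp), hm₂.int 7 (by simp), hm₁.int 7 (by simp)]; exact hσ.seeds.W c))
      (fun c hc => by
        rw [rsz_machine (by norm_num)]
        exact hc.trans (Nat.lt_succ_self _))
      (fun c _ c' _ h => h) (by rw [hm₂.real 1 (by simp), hm₁.real 1 (by simp), hΔ])).imp ?_
  rintro τ₃ hm₃ ⟨hW, hW'⟩
  refine ⟨s₂.mods hm₃, ?_, fun c a => ?_, fun a c => ?_, fun c => ?_⟩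
  · rw [hm₃.int 7 (by simp), hm₂.int 7 (by simp), hm₁.int 7 (by simp)]; exact hσ.seeds
  · rw [hm₃.real 6 (by simp), hm₂.real 6 (by simp), Matrix.mul_add, Matrix.add_apply]
    by_cases ha : a = j
    · subst ha
      rw [hS c, hσ.SA c a, Matrix.mul_single_apply_same, mul_comm]
    · rw [Matrix.mul_single_apply_of_ne _ _ _ _ _ (by simpa using ha), add_zero, ← hσ.SA c a]
      exact hS' _ fun c' _ h => ha (Fin.ext (mul_add_inj j.2 a.2 h).2.symm)
  · rw [hm₃.real 7 (by simp), Matrix.add_mul, Matrix.add_apply]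
    have e : τ₁.real 7 = σ.real 7 := hm₁.real 7 (by simp)
    by_cases ha : a = i
    · subst ha
      rw [hT c, e, hσ.AT a c, Matrix.single_mul_apply_same]
    · rw [Matrix.single_mul_apply_of_ne _ _ _ _ _ (by simpa using ha), add_zero, ← hσ.AT a c, ← e]
      exact hT' _ fun c' hc' h => ha (Fin.ext (mul_add_inj hc' c.2 h).1.symm)
  · have e : flatten (A + Matrix.single i j Δ) =
        flatten A + Pi.single (⟨i * P.d + j, hij⟩ : Fin (P.n * P.d)) Δ := by
      ext x
      have hd : 0 < P.d := Nat.zero_lt_of_lt j.2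
      rw [Pi.add_apply, flatten, flatten, Matrix.add_apply]
      congr 1
      rw [Matrix.single_apply, Pi.single_apply]
      refine if_congr ?_ rfl rfl
      constructor
      · rintro ⟨rfl, rfl⟩
        ext; simp [Fin.divNat, Fin.modNat, Nat.div_add_mod']
      · intro h
        subst h
        constructor
        · ext; simp [Fin.divNat, Nat.add_div_of_dvd_right, hd]
        · ext; simp [Fin.modNat, Nat.mod_eq_of_lt j.2]
    rw [hW c, hm₂.real 8 (by simp), hm₁.real 8 (by simp), hσ.WA c, e, Matrix.mulVec_add,
      Pi.add_apply, Matrix.mulVec_single]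
    simp [mul_comm, Matrix.col]

end Params

end SparseDict

namespace SparseDict

open RealRAM Machine

namespace Params

variable {P : Params} {m m₄ m₅ : ℕ}

/-- The search after the stream. -/
def finishCmd : Cmd :=
  searchCmd (signCmd (.add (iv 10) (iv 37)) (iv 36))
    (signCmd (.add (.add (iv 10) (iv 11)) (iv 36)) (iv 37))

theorem finishCmd_spec (hk : 0 < P.k) (hr : P.r ≤ P.k) (hT : 0 < P.qT) (hW : 0 < P.qW)
    {ω : P.Rand} {A : Matrix (Fin P.n) (Fin P.d) ℝ} {σ : Mem} (hσ : Stream ω A σ) :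
    (P.machine P.bits m₄ m₅).Runs
      ((2 * (P.n * P.D) + 1) ^ (P.s * P.k) * (P.k * (2 * P.D + 1)) ^ P.r) coreI coreR
      finishCmd σ 40 fun τ => SketchGood P.r P.D (matS ω) (matT ω) (matW ω) A P.k P.ε →
        Solved P.k P.r P.D P.ε A τ := by
  have hV : P.d ≤ P.V ∧ P.n * P.d ≤ P.V := by rw [V]; omega
  refine searchCmd_runs (P := P) (m := P.bits) (m₄ := m₄) (m₅ := m₅) hk hr hT hW
    (inv := fun τ => P.Sizes τ ∧ SeedsAt ω (τ.int 7)) ?_ ?_ ?_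
    hσ.sizes ⟨hσ.sizes, hσ.seeds⟩ hσ.SA hσ.AT hσ.WA
  · rintro σ τ hm ⟨h1, h2⟩
    exact ⟨h1.mods hm, by rw [hm.int 7 (by decide)]; exact h2⟩
  · rintro σ ⟨h1, h2⟩ j c h36 h37
    exact (signCmd_runs (v := j) (c := P.s + c) (by decide) (by decide)
      (by omega) (by have := c.2; omega)
      (fun υ hu => (IVal.scalar (h1.mods hu).s).natAdd (.scalar (Mods.cell hu h37)))
      (fun υ hu => .scalar (Mods.cell hu h36)) h1.b (h2.T c)).mono le_rfl (by simp)
      (by simp) le_rfl fun τ _ _ h => h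
  · rintro σ ⟨h1, h2⟩ c x h36 h37
    exact (signCmd_runs (v := x) (c := P.s + P.qT * P.G + c) (by decide) (by decide)
      (by have := x.2; omega) (by have := c.2; omega)
      (fun υ hu => ((IVal.scalar (h1.mods hu).s).natAdd
        (.scalar (h1.mods hu).t)).natAdd (.scalar (Mods.cell hu h36)))
      (fun υ hu => .scalar (Mods.cell hu h37)) h1.b (h2.W c)).mono le_rfl (by simp)
      (by simp) le_rfl fun τ _ _ h => h

theorem consumes {ω : P.Rand} {T : ℝ} (hT : (P.V : ℝ) ^ 22 ≤ T)
    (us : List (Fin P.n × Fin P.d × ℝ)) (A : Matrix (Fin P.n) (Fin P.d) ℝ) (σ : Mem)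
    (hb : Bdd P.V σ) (hσ : Stream ω A σ) :
    ∃ τ, Consumes (P.machine P.bits m₄ m₅).L (P.machine P.bits m₄ m₅).B T updateCmd σ us τ ∧
      Bdd P.V τ ∧
      Stream ω (us.foldl (fun A u => A + Matrix.single u.1 u.2.1 u.2.2) A) τ := by
  induction us generalizing A σ with
  | nil => exact ⟨σ, .nil σ, hb, hσ⟩
  | cons u us ih =>
    have hV : P.n ≤ P.V ∧ P.d ≤ P.V := by rw [V]; omega
    have hm : Mods [5, 6] [1] σ (feed u σ) :=
      (((Mods.refl _ _ _).setInt (by simp) _ _).setInt (by simp) _ _).setReal (by simp) _ _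
    have hf : Stream ω A (feed u σ) := by
      refine ⟨hσ.sizes.mods hm, ?_, ?_, ?_, ?_⟩
      · rw [hm.int 7 (by simp)]; exact hσ.seeds
      · rw [hm.real 6 (by simp)]; exact hσ.SA
      · rw [hm.real 7 (by simp)]; exact hσ.AT
      · rw [hm.real 8 (by simp)]; exact hσ.WA
    have hbf : Bdd P.V (feed u σ) := by
      have h1 := u.1.2
      have h2 := u.2.1.2
      exact (hb.setInt 5 0 (v := (u.1 : ℕ)) (by rw [Nat.abs_cast]; omega)).setInt 6 0
        (v := (u.2.1 : ℕ)) (by rw [Nat.abs_cast]; omega)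
    obtain ⟨c, τ, h1, h2, h3, -, h5⟩ := updateCmd_spec (m₄ := m₄) (m₅ := m₅) hf (i := u.1)
      (j := u.2.1) (Δ := u.2.2) (by simp [feed]) (by simp [feed]) (by simp [feed]) hbf
    obtain ⟨υ, h6, h7, h8⟩ := ih _ τ h3 h5
    refine ⟨υ, .cons (le_trans ?_ hT) h1 h6, h7, h8⟩
    rw [one_mul, V_machine] at h2
    exact_mod_cast h2

/-- Random bits, arranged as seeds. -/
def bitsEquiv (s t w b : ℕ) : (Fin ((s + t + w) * (b * b)) → Bool) ≃
    (Fin s → Fin b × Fin b → Bool) × (Fin t → Fin b × Fin b → Bool) ×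
      (Fin w → Fin b × Fin b → Bool) :=
  (finProdFinEquiv.symm.arrowCongr (Equiv.refl Bool)).trans <| (Equiv.curry _ _ _).trans <|
    (finSumFinEquiv.symm.arrowCongr (finProdFinEquiv.symm.arrowCongr (Equiv.refl Bool))).trans <|
    (Equiv.sumArrowEquivProdArrow _ _ _).trans <|
    (((finSumFinEquiv.symm.arrowCongr (Equiv.refl _)).trans
      (Equiv.sumArrowEquivProdArrow _ _ _)).prodCongr (Equiv.refl _)).trans (Equiv.prodAssoc _ _ _)

theorem bitsEquiv_apply {s t w b : ℕ} (seed : Fin ((s + t + w) * (b * b)) → Bool) (α β : Fin b) :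
    (∀ c, (bitsEquiv s t w b seed).1 c (α, β) =
      seed (finProdFinEquiv (Fin.castAdd w (Fin.castAdd t c), finProdFinEquiv (α, β)))) ∧
    (∀ c, (bitsEquiv s t w b seed).2.1 c (α, β) =
      seed (finProdFinEquiv (Fin.castAdd w (Fin.natAdd s c), finProdFinEquiv (α, β)))) ∧
    ∀ c, (bitsEquiv s t w b seed).2.2 c (α, β) =
      seed (finProdFinEquiv (Fin.natAdd (s + t) c, finProdFinEquiv (α, β))) :=
  ⟨fun _ => rfl, fun _ => rfl, fun _ => rfl⟩

variable (P)

/-- The random bits, arranged as seeds. -/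
noncomputable def seedEquiv : (Fin P.bits → Bool) ≃ P.Rand :=
  bitsEquiv P.s (P.qT * P.G) (P.qW * P.G) P.b

variable {P}

theorem seedsAt_streamInput (seed : Fin P.bits → Bool) :
    SeedsAt (P.seedEquiv seed) ((streamInput P.n P.d P.k P.r P.D P.ε seed).int 7) := by
  have key : ∀ (c : Fin (P.s + P.qT * P.G + P.qW * P.G)) (α β : Fin P.b) (ρ : ℕ),
      (c : ℕ) = ρ → (streamInput P.n P.d P.k P.r P.D P.ε seed).int 7 ((ρ * P.b + α) * P.b + β) =
      if seed (finProdFinEquiv (c, finProdFinEquiv (α, β))) then 1 else 0 := by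
    rintro c α β _ rfl
    obtain ⟨x, hx⟩ : ∃ x : Fin P.bits, x = finProdFinEquiv (c, finProdFinEquiv (α, β)) := ⟨_, rfl⟩
    have e : (c * P.b + α) * P.b + β = (x : ℕ) := by
      rw [hx]; simp [finProdFinEquiv]; ring
    rw [e, ← hx]
    simp only [streamInput, Fin.is_lt, dite_true, Fin.eta]
  have h := fun α β => bitsEquiv_apply (s := P.s) (t := P.qT * P.G) (w := P.qW * P.G) seed α β
  refine ⟨fun c α β => ?_, fun c α β => ?_, fun c α β => ?_⟩
  · exact (key (Fin.castAdd (P.qW * P.G) (Fin.castAdd (P.qT * P.G) c)) α β _ (by simp)).trans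
      (congrArg (fun x : Bool => if x then (1 : ℤ) else 0) ((h α β).1 c).symm)
  · exact (key (Fin.castAdd (P.qW * P.G) (Fin.natAdd P.s c)) α β _ (by simp)).trans
      (congrArg (fun x : Bool => if x then (1 : ℤ) else 0) ((h α β).2.1 c).symm)
  · exact (key (Fin.natAdd _ c) α β _ (by simp)).trans
      (congrArg (fun x : Bool => if x then (1 : ℤ) else 0) ((h α β).2.2 c).symm)

theorem bdd_streamInput (seed : Fin m → Bool) :
    Bdd P.V (streamInput P.n P.d P.k P.r P.D P.ε seed) := by
  have hV : P.n ≤ P.V ∧ P.d ≤ P.V ∧ P.k ≤ P.V ∧ P.r ≤ P.V ∧ P.D ≤ P.V ∧ 1 ≤ P.V := by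
    rw [V]; omega
  intro a c
  simp only [streamInput]
  split <;> (try split_ifs) <;> simp <;> omega

theorem streamRun (hε : 0 < P.ε) (hk : 0 < P.k) (hr : P.r ≤ P.k) (hT : 0 < P.qT) (hW : 0 < P.qW)
    {T : ℝ} (hT' : ((2 * (P.n * P.D) + 1) ^ (P.s * P.k) * (P.k * (2 * P.D + 1)) ^ P.r : ℕ) *
      (P.V : ℝ) ^ 40 ≤ T) (us : List (Fin P.n × Fin P.d × ℝ)) (seed : Fin P.bits → Bool) :
    ∃ τ, StreamRun (P.machine P.bits 0 0).L (P.machine P.bits 0 0).B T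
      ⟨sizesCmd P.κ, updateCmd, finishCmd⟩ P.k P.r P.D P.ε seed us τ ∧
      (SketchGood P.r P.D (matS (P.seedEquiv seed)) (matT (P.seedEquiv seed))
        (matW (P.seedEquiv seed)) (streamMatrix us) P.k P.ε →
        Solved P.k P.r P.D P.ε (streamMatrix us) τ) := by
  obtain ⟨K, hK⟩ : ∃ K, K = (2 * (P.n * P.D) + 1) ^ (P.s * P.k) * (P.k * (2 * P.D + 1)) ^ P.r :=
    ⟨_, rfl⟩
  have hK1 : 1 ≤ K := hK ▸ Nat.mul_pos (Nat.pow_pos (by omega)) (Nat.pow_pos (by positivity))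
  have hV1 : (1 : ℝ) ≤ P.V := by exact_mod_cast (show 1 ≤ P.V by rw [V]; omega)
  have hle : ∀ e ≤ 40, (P.V : ℝ) ^ e ≤ T := fun e he => by
    refine le_trans ?_ hT'
    rw [← hK]
    have h1 : (P.V : ℝ) ^ e ≤ P.V ^ 40 := pow_le_pow_right₀ hV1 he
    have h2 : (1 : ℝ) ≤ K := by exact_mod_cast hK1
    exact h1.trans (le_mul_of_one_le_left (by positivity) h2)
  obtain ⟨c₁, σ₁, a1, a2, a3, a4, a5⟩ := sizesCmd_runs (P := P) (m := P.bits) (m₄ := 0) (m₅ := 0)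
    (σ := streamInput P.n P.d P.k P.r P.D P.ε seed) ⟨rfl, rfl, rfl, rfl, rfl, rfl⟩ hε
    (bdd_streamInput seed)
  have hst : Stream (P.seedEquiv seed) 0 σ₁ := by
    refine ⟨a5, ?_, ?_, ?_, ?_⟩
    · rw [a4.int 7 (by simp)]; exact seedsAt_streamInput seed
    · intro i j; rw [a4.real 6 (by simp), Matrix.mul_zero]; rfl
    · intro i j; rw [a4.real 7 (by simp), Matrix.zero_mul]; rfl
    · intro c
      have : flatten (0 : Matrix (Fin P.n) (Fin P.d) ℝ) = 0 := rfl
      rw [a4.real 8 (by simp), this, Matrix.mulVec_zero]; rfl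
  obtain ⟨σ₂, b1, b2, b3⟩ := consumes (m₄ := 0) (m₅ := 0) (hle 22 (by norm_num)) us 0 σ₁ a3 hst
  obtain ⟨c₂, τ, d1, d2, -, -, d5⟩ := finishCmd_spec (m₄ := 0) (m₅ := 0) hk hr hT hW b3 b2
  refine ⟨τ, ⟨σ₁, σ₂, c₁, c₂, a1, le_trans ?_ (hle 15 (by norm_num)), b1, d1, le_trans ?_ hT'⟩, d5⟩
  · rw [one_mul, V_machine] at a2
    exact_mod_cast a2
  · rw [V_machine] at d2
    exact_mod_cast d2

end Params

end SparseDict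

namespace SparseDict

open RealRAM Machine

/-- The recovery program in the case `n = D = 1`. -/
def copyCmd : Cmd :=
  .seq (Cmd.fillReal 23 (iv 1) 2 (iv 23) .skip (.get 6 (iv 23))) (.iset 9 (.const 0) (.const 1))

/-- The recovery program. -/
def recoverCmd (κ : ℕ) : Cmd :=
  .seq (sizesCmd κ) (.ite (.ilt (.mul (iv 0) (iv 4)) (.const 2)) copyCmd
    (searchCmd (.rset 32 (.const 0) (.get 4 (ix2 (iv 36) (iv 11) (iv 37))))
      (.rset 32 (.const 0) (.get 5 (ix2 (iv 36) (.mul (iv 0) (iv 1)) (iv 37))))))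

theorem matAt_rowMajor {p q : ℕ} (A : Matrix (Fin p) (Fin q) ℝ) : MatAt (rowMajor A) A :=
  matAt_of_forall fun x => by simp [rowMajor]

namespace Params

variable {P : Params} {m m₄ m₅ : ℕ}

theorem bdd_recoveryInput {s t w : ℕ} (S : Matrix (Fin s) (Fin P.n) ℝ)
    (T : Matrix (Fin P.d) (Fin t) ℝ) (W : Matrix (Fin w) (Fin (P.n * P.d)) ℝ)
    (SA : Matrix (Fin s) (Fin P.d) ℝ) (AT : Matrix (Fin P.n) (Fin t) ℝ) (WA : Fin w → ℝ)
    (hs : s ≤ P.V) (ht : t ≤ P.V) (hw : w ≤ P.V) :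
    Bdd P.V (recoveryInput P.k P.r P.D P.ε S T W SA AT WA) := by
  have hV : P.n ≤ P.V ∧ P.d ≤ P.V ∧ P.k ≤ P.V ∧ P.r ≤ P.V ∧ P.D ≤ P.V := by
    rw [V]; omega
  intro a c
  simp only [recoveryInput]
  split <;> simp <;> omega

theorem recover_succeeds (hε : 0 < P.ε) (hk : 0 < P.k) (hr : P.r ≤ P.k) (hT : 0 < P.qT)
    (hW : 0 < P.qW) (hnD : 2 ≤ P.n * P.D) (S : Matrix (Fin P.s) (Fin P.n) ℝ)
    (T : Matrix (Fin P.d) (Fin (P.qT * P.G)) ℝ)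
    (W : Matrix (Fin (P.qW * P.G)) (Fin (P.n * P.d)) ℝ) (A : Matrix (Fin P.n) (Fin P.d) ℝ)
    (h : SketchGood P.r P.D S T W A P.k P.ε) :
    RecoverySucceeds (P.machine 0 (P.d * (P.qT * P.G)) (P.qW * P.G * (P.n * P.d))).L
      (P.machine 0 (P.d * (P.qT * P.G)) (P.qW * P.G * (P.n * P.d))).B (recoverCmd P.κ)
      P.k P.r P.D P.ε A S T W := by
  have hV : P.s ≤ P.V ∧ P.qT * P.G ≤ P.V ∧ P.qW * P.G ≤ P.V := by rw [V]; omega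
  obtain ⟨σ, hσ⟩ : ∃ σ, σ = recoveryInput P.k P.r P.D P.ε S T W (S * A) (A * T)
    (W *ᵥ flatten A) := ⟨_, rfl⟩
  have hb : Bdd P.V σ := hσ ▸ bdd_recoveryInput S T W _ _ _ hV.1 hV.2.1 hV.2.2
  have hin : P.Input σ := by subst hσ; exact ⟨rfl, rfl, rfl, rfl, rfl, rfl⟩
  obtain ⟨c₁, σ₁, a1, -, a3, a4, a5⟩ := sizesCmd_runs (m := 0) (m₄ := P.d * (P.qT * P.G))
    (m₅ := P.qW * P.G * (P.n * P.d)) hin hε hb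
  have hc := ilt_ok (M := P.machine 0 (P.d * (P.qT * P.G)) (P.qW * P.G * (P.n * P.d)))
    ((IVal.scalar a5.input.n).natMul (.scalar a5.input.D)) (.const (c := 2) (by norm_num))
  have key : (P.machine 0 (P.d * (P.qT * P.G)) (P.qW * P.G * (P.n * P.d))).Runs
      ((2 * (P.n * P.D) + 1) ^ (P.s * P.k) * (P.k * (2 * P.D + 1)) ^ P.r) coreI coreR
      (searchCmd (.rset 32 (.const 0) (.get 4 (ix2 (iv 36) (iv 11) (iv 37))))
        (.rset 32 (.const 0) (.get 5 (ix2 (iv 36) (.mul (iv 0) (iv 1)) (iv 37))))) σ₁ 40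
      fun τ => SketchGood P.r P.D S T W A P.k P.ε → Solved P.k P.r P.D P.ε A τ := by
    refine searchCmd_runs (P := P) hk hr hT hW
      (inv := fun τ => P.Sizes τ ∧ MatAt (τ.real 4) T ∧ MatAt (τ.real 5) W) ?_ ?_ ?_ a5
      ⟨a5, ?_, ?_⟩ ?_ ?_ ?_
    · rintro τ υ hm ⟨h1, h2, h3⟩
      exact ⟨h1.mods hm, by rw [hm.real 4 (by decide)]; exact h2,
        by rw [hm.real 5 (by decide)]; exact h3⟩
    · rintro τ ⟨h1, h2, -⟩ j c h36 h37
      have hv := RVal.get (a := 4)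
        (((IVal.scalar (M := P.machine 0 (P.d * (P.qT * P.G)) (P.qW * P.G * (P.n * P.d)))
          h36).ix2 (.scalar h1.t) (.scalar h37)))
        (by rw [rsz_machine (by norm_num)]; exact (mul_add_lt j.2 c.2).trans (Nat.lt_succ_self _))
      exact Runs.rset_scalar one_pos (by norm_num) hv.1 (by simp)
        (by rw [setReal_real_self, hv.2]; exact h2 j c)
    · rintro τ ⟨h1, -, h3⟩ c x h36 h37
      have hv := RVal.get (a := 5)
        (((IVal.scalar (M := P.machine 0 (P.d * (P.qT * P.G)) (P.qW * P.G * (P.n * P.d)))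
          h36).ix2 ((IVal.scalar h1.input.n).natMul (.scalar h1.input.d)) (.scalar h37)))
        (by rw [rsz_machine (by norm_num)]; exact (mul_add_lt c.2 x.2).trans (Nat.lt_succ_self _))
      exact Runs.rset_scalar one_pos (by norm_num) hv.1 (by simp)
        (by rw [setReal_real_self, hv.2]; exact h3 c x)
    · rw [a4.real 4 (by simp), hσ]; exact matAt_rowMajor T
    · rw [a4.real 5 (by simp), hσ]; exact matAt_rowMajor W
    · rw [a4.real 6 (by simp), hσ]; exact matAt_rowMajor _
    · rw [a4.real 7 (by simp), hσ]; exact matAt_rowMajor _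
    · intro c
      rw [a4.real 8 (by simp), hσ]
      exact dif_pos c.2
  obtain ⟨c₂, τ, d1, -, -, -, d5⟩ := key a3
  refine ⟨τ, c₁ + (c₂ + 1), ?_, d5 h⟩
  rw [← hσ]
  refine .seq a1 (.iteFalse (BExpr.eval_false _ a3 hc.1 ?_) d1)
  rw [hc.2]
  exact_mod_cast not_lt.2 hnD

theorem copy_succeeds (hε : 0 < P.ε) (hκ : 0 < P.κ) (hk : 0 < P.k) (hr : 0 < P.r) (hn : P.n = 1)
    (hD : P.D = 1) (T : Matrix (Fin P.d) (Fin 0) ℝ) (W : Matrix (Fin 0) (Fin (P.n * P.d)) ℝ)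
    (A : Matrix (Fin P.n) (Fin P.d) ℝ) :
    RecoverySucceeds (P.machine 0 0 0).L (P.machine 0 0 0).B (recoverCmd P.κ)
      P.k P.r P.D P.ε A (Matrix.of fun _ _ => 1 : Matrix (Fin 1) (Fin P.n) ℝ) T W := by
  have hV : 1 ≤ P.V ∧ P.d ≤ P.V := by rw [V]; omega
  obtain ⟨S, hS⟩ : ∃ S, S = (Matrix.of fun _ _ => 1 : Matrix (Fin 1) (Fin P.n) ℝ) := ⟨_, rfl⟩
  rw [← hS]
  obtain ⟨σ, hσ⟩ : ∃ σ, σ = recoveryInput P.k P.r P.D P.ε S T W (S * A) (A * T)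
    (W *ᵥ flatten A) := ⟨_, rfl⟩
  have hb : Bdd P.V σ := hσ ▸ bdd_recoveryInput S T W _ _ _ hV.1 (Nat.zero_le _) (Nat.zero_le _)
  have hin : P.Input σ := by subst hσ; exact ⟨rfl, rfl, rfl, rfl, rfl, rfl⟩
  obtain ⟨c₁, σ₁, a1, -, a3, a4, a5⟩ := sizesCmd_runs (m := 0) (m₄ := 0) (m₅ := 0) hin hε hb
  have hc := ilt_ok (M := P.machine 0 0 0)
    ((IVal.scalar a5.input.n).natMul (.scalar a5.input.D)) (.const (c := 2) (by norm_num))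
  have hs : 1 ≤ P.s := by
    have : 0 < P.qS := Nat.ceil_pos.2 (by positivity)
    rw [s]; omega
  have hSA : ∀ (i : Fin P.n) (b : Fin P.d), σ₁.real 6 b = A i b := by
    intro i b
    have h1 := matAt_rowMajor (S * A) 0 b
    rw [a4.real 6 (by simp), hσ]
    simp only [Fin.val_zero, zero_mul, zero_add] at h1
    refine h1.trans ?_
    rw [Matrix.mul_apply, hS]
    have : Subsingleton (Fin P.n) := by rw [hn]; infer_instance
    simp only [Matrix.of_apply, one_mul]
    rw [Fintype.sum_subsingleton _ i]
  have key : (P.machine 0 0 0).Runs 1 [9, 23] [2] copyCmd σ₁ 7 fun τ =>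
      τ.int 9 0 = 1 ∧ (∀ c, 1 ≤ c → τ.int 9 c = 0) ∧ (∀ (b : Fin P.d), τ.real 2 b = σ₁.real 6 b) ∧
        ∀ c, P.d ≤ c → τ.real 2 c = 0 := by
    have hkd : P.d ≤ P.k * P.d := Nat.le_mul_of_pos_left _ hk
    have hsd : P.d ≤ P.s * P.d := Nat.le_mul_of_pos_left _ hs
    refine Runs.seq (I₁ := [23]) (R₁ := [2]) (I₂ := [9]) (R₂ := []) (e₁ := 6) (e₂ := 0)
      (Runs.fillReal (I' := []) (R' := []) (e₁ := 0) one_pos 0 (fun b : Fin P.d => σ₁.real 6 b)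
        (by rw [rsz_machine (by norm_num)]; simp only [realCells]; omega) hV.2
        (fun τ hm => IVal.scalar (a5.input.mods hm).d)
        (fun x τ _ hm hx _ => Runs.skip one_pos
          ⟨(IVal.scalar hx).congr (by simp), (RVal.get (IVal.scalar hx) (by
            rw [rsz_machine (by norm_num)]; simp only [realCells]; have := x.2; omega)).congr
              (by rw [hm.real 6 (by simp)])⟩)) ?_
    rintro τ - hm ⟨h1, h2⟩
    refine Runs.iset_scalar one_pos (by norm_num) (IVal.one (M := P.machine 0 0 0)).1 (by decide)
      (by rw [(IVal.one (M := P.machine 0 0 0)).2]; exact_mod_cast hV.1) (by simp) ⟨by simp [IExpr.den], fun c hc => ?_,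
        fun b => by simpa using h1 b, fun c hc => ?_⟩
    · rw [setInt_int_cell_ne _ _ _ (by omega), hm.int 9 (by simp), a4.int 9 (by simp), hσ]; rfl
    · rw [setInt_real, h2 c (by omega), a4.real 2 (by simp), hσ]; rfl
  obtain ⟨c₂, τ, d1, -, -, d4, d5, d6, d7, d8⟩ := key a3
  refine ⟨τ, c₁ + (c₂ + 1), by rw [← hσ]; exact .seq a1 (.iteTrue (BExpr.eval_true _ a3 hc.1 (by
    rw [hc.2, hn, hD]; norm_num)) d1), ?_⟩
  have hX : outX P.n P.k P.r τ = Matrix.of fun (_ : Fin P.n) (j : Fin P.k) => if (j : ℕ) = 0 then (1 : ℝ) else 0 := by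
    ext i j
    have hi : (i : ℕ) = 0 := by have := i.2; omega
    have h8 : ∀ c, τ.int 8 c = 0 := fun c => by
      rw [d4.int 8 (by simp), a4.int 8 (by simp), hσ]; rfl
    simp only [outX, Matrix.of_apply, hi, zero_mul, zero_add, h8]
    rw [Finset.sum_eq_single 0]
    · rw [d5]
      by_cases hj : (j : ℕ) = 0
      · simp [hj]
      · have : ¬ (0 : ℤ) = ((j : ℕ) : ℤ) := by omega
        simp [hj, this]
    · intro c _ hc
      rw [d6 c (by omega)]; simp
    · intro h; simp [hr.ne'] at h
  have hobj : outX P.n P.k P.r τ * outY P.k P.d τ = A := by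
    ext i b
    rw [Matrix.mul_apply, Finset.sum_eq_single (⟨0, hk⟩ : Fin P.k)]
    · simp only [hX, Matrix.of_apply, outY, if_true, one_mul, zero_mul, zero_add]
      rw [d7 b, hSA i b]
    · intro j _ hj
      have : ¬ (j : ℕ) = 0 := fun h => hj (Fin.ext h)
      simp [hX, this]
    · simp
  refine ⟨fun i => ⟨?_, fun j => ?_⟩, fun X' _ Y' => ?_⟩
  · refine (Set.ncard_le_ncard (t := {⟨0, hk⟩}) (fun j hj => ?_) (Set.finite_singleton _)).trans
      (by rw [Set.ncard_singleton]; exact hr)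
    rw [Set.mem_ofPred_eq, hX, Matrix.of_apply] at hj
    by_contra h
    exact hj (if_neg fun h' => h (Fin.ext h'))
  · rw [hX, Matrix.of_apply]
    split_ifs
    · exact ⟨1, by rw [hD]; norm_num, by norm_num⟩
    · exact ⟨0, by simp, by norm_num⟩
  · rw [objective_eq, objective_eq, hobj, sub_self, show sqNorm (0 : Matrix (Fin P.n) (Fin P.d) ℝ) = 0 by
      simp [sqNorm], Real.sqrt_zero]
    exact mul_nonneg (by linarith) (Real.sqrt_nonneg _)

end Params

end SparseDict

namespace SparseDict

namespace Params

variable {P : Params}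

theorem ratio_le {ε : ℝ} (h0 : 0 < ε) (h1 : ε < 1) :
    ((1 + ε / 10) / (1 - ε / 10)) ^ 2 * (1 + ε / 10) ≤ (1 + ε) ^ 2 := by
  obtain ⟨e, rfl⟩ : ∃ e, ε = 10 * e := ⟨ε / 10, by ring⟩
  have e1 : 10 * e / 10 = e := by ring
  rw [e1]
  have h2 : 0 < e := by linarith
  have h3 : e < 1 / 10 := by linarith
  have h4 : (1 + e) / (1 - e) ≤ 1 + 3 * e := by
    rw [div_le_iff₀ (by linarith)]; nlinarith
  have h5 : 0 ≤ (1 + e) / (1 - e) := div_nonneg (by linarith) (by linarith)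
  calc ((1 + e) / (1 - e)) ^ 2 * (1 + e) ≤ (1 + 3 * e) ^ 2 * (1 + e) ^ 2 :=
        mul_le_mul (pow_le_pow_left₀ h5 h4 2) (by nlinarith) (by linarith) (by positivity)
    _ = ((1 + 3 * e) * (1 + e)) ^ 2 := by ring
    _ ≤ (1 + 10 * e) ^ 2 := pow_le_pow_left₀ (by positivity) (by nlinarith) 2

theorem le_qS (hε : 0 < P.ε) : (P.κ : ℝ) * P.k ≤ P.ε * P.qS := by
  have := Nat.le_ceil ((P.κ : ℝ) * P.k / P.ε)
  rw [div_le_iff₀ hε] at this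
  rw [qS]; linarith

theorem le_G (hε : 0 < P.ε) : 128 / (P.ε / 10) ^ 2 ≤ P.G := by
  refine le_trans (le_of_eq ?_) (Nat.le_ceil _)
  field_simp; norm_num

theorem half_pow_le {τ : ℕ} (hτ : 1 ≤ τ) : (1 / 2 : ℝ) ^ τ ≤ 1 / τ := by
  rw [one_div_pow]
  refine one_div_le_one_div_of_le (by exact_mod_cast hτ) ?_
  exact_mod_cast Nat.lt_two_pow_self.le

theorem two_pow_mul_quarter_pow_le {x : ℝ} {a q τ : ℕ} (hx : x ≤ 2 ^ a) (h : a + τ ≤ 2 * q) :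
    x * (1 / 4) ^ q ≤ (1 / 2) ^ τ := by
  have h2 : (1 / 4 : ℝ) ^ q = (1 / 2) ^ (2 * q) := by rw [pow_mul]; norm_num
  have h3 : (2 : ℝ) ^ a * (1 / 2) ^ a = 1 := by rw [← mul_pow]; norm_num
  calc x * (1 / 4) ^ q ≤ 2 ^ a * (1 / 2) ^ (a + τ) := by
        rw [h2]
        exact mul_le_mul hx (pow_le_pow_of_le_one (by norm_num) (by norm_num) h) (by positivity)
          (by positivity)
    _ = (1 / 2) ^ τ := by rw [pow_add, ← mul_assoc, h3, one_mul]

theorem three_mul_le_two_pow {m : ℕ} (hm : 2 ≤ m) : 3 * m ≤ 2 ^ (3 * Nat.clog 2 m) := by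
  have h1 := Nat.le_pow_clog one_lt_two m
  have h2 : 1 ≤ Nat.clog 2 m := Nat.clog_pos one_lt_two hm
  have h3 : 2 ^ 2 ≤ 2 ^ (2 * Nat.clog 2 m) := Nat.pow_le_pow_right (by norm_num) (by omega)
  calc 3 * m ≤ 2 ^ (2 * Nat.clog 2 m) * 2 ^ Nat.clog 2 m := Nat.mul_le_mul (by omega) h1
    _ = 2 ^ (3 * Nat.clog 2 m) := by rw [← pow_add]; congr 1; ring

theorem qS_pos (hκ : 0 < P.κ) (hk : 0 < P.k) (hε : 0 < P.ε) : 0 < P.qS :=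
  Nat.ceil_pos.2 (by positivity)

theorem s_pos (hκ : 0 < P.κ) (hk : 0 < P.k) (hε : 0 < P.ε) : 0 < P.s :=
  Nat.mul_pos (qS_pos hκ hk hε) (by norm_num)

theorem qT_pos (hκ : 0 < P.κ) (hk : 0 < P.k) (hr : 0 < P.r) (hnD : 2 ≤ P.n * P.D) : 0 < P.qT := by
  have : 0 < Nat.clog 2 (P.n * P.k * P.D) := Nat.clog_pos one_lt_two (by nlinarith)
  rw [qT]; positivity

theorem qW_pos (hκ : 0 < P.κ) (hk : 0 < P.k) (hε : 0 < P.ε) (hnD : 2 ≤ P.n * P.D) : 0 < P.qW := by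
  have : 0 < Nat.clog 2 (P.n * P.D) := Nat.clog_pos one_lt_two hnD
  have := s_pos hκ hk hε
  rw [qW]; positivity

/-- The probability that the sketches are not good. -/
theorem pr_not_good_le {τ : ℕ} (hτ : 1 ≤ τ) (hκ : P.κ = 20 * τ) (hr : 0 < P.r) (hrk : P.r ≤ P.k)
    (hD : 1 ≤ P.D) (hε0 : 0 < P.ε) (hε1 : P.ε < 1) (hnD : 2 ≤ P.n * P.D)
    (A : Matrix (Fin P.n) (Fin P.d) ℝ) :
    pr (fun ω : P.Rand => ¬ SketchGood P.r P.D (matS ω) (matT ω) (matW ω) A P.k P.ε) ≤ 5 / τ := by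
  have hk : 0 < P.k := by omega
  have hκ0 : 0 < P.κ := by omega
  have hn : 1 ≤ P.n := by
    rcases Nat.eq_zero_or_pos P.n with h | h
    · simp [h] at hnD
    · exact h
  have hb : P.n * P.d + P.n + P.d ≤ 2 ^ P.b := Nat.le_pow_clog one_lt_two _
  have hq := le_qS hε0
  have hqS := qS_pos hκ0 hk hε0
  have hqSR : (0 : ℝ) < P.qS := by exact_mod_cast hqS
  have hτR : (1 : ℝ) ≤ τ := by exact_mod_cast hτ
  have hkR : (1 : ℝ) ≤ P.k := by exact_mod_cast hk
  have hκR : (P.κ : ℝ) = 20 * τ := by rw [hκ]; push_cast; rfl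
  refine (pr_not_sketchGood_le (Ω := P.Seed) (η := P.ε / 10) (ρ := P.ε / 10) (τ := τ) hk hτ hqS
    (by linarith) (by linarith) hε0 (ratio_le hε0 hε1) (le_G hε0) ?_
    (fourWise_sgn (b := P.b) (N := P.n) (by omega)) (fourWise_sgn (b := P.b) (by omega))
    (fourWise_sgn (b := P.b) (by omega)) A).trans ?_
  · rw [div_le_iff₀ hqSR]
    rw [hκR] at hq
    nlinarith
  have hhalf := half_pow_le hτ
  have t1 : (2 : ℝ) ^ (32 * τ * P.k) * 3 ^ P.k * (1 / 4) ^ P.qS ≤ (1 / 2) ^ τ := by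
    refine two_pow_mul_quarter_pow_le (a := 32 * τ * P.k + 2 * P.k) ?_ ?_
    · rw [pow_add, pow_mul 2 2]
      exact mul_le_mul_of_nonneg_left (pow_le_pow_left₀ (by norm_num) (by norm_num) _)
        (by positivity)
    · have h1 : (P.κ : ℝ) * P.k ≤ P.qS := hq.trans (by nlinarith)
      have h2 : P.κ * P.k ≤ P.qS := by exact_mod_cast h1
      rw [hκ] at h2
      nlinarith
  have t2 : (P.n : ℝ) * (P.k * (2 * P.D + 1)) ^ P.r * (1 / 4) ^ P.qT ≤ (1 / 2) ^ τ := by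
    have hm : 2 ≤ P.n * P.k * P.D := by nlinarith
    have hℓ : 1 ≤ Nat.clog 2 (P.n * P.k * P.D) := Nat.clog_pos one_lt_two hm
    refine two_pow_mul_quarter_pow_le (a := 3 * Nat.clog 2 (P.n * P.k * P.D) * P.r) ?_ ?_
    · have h1 := three_mul_le_two_pow hm
      have h2 : P.n * (P.k * (2 * P.D + 1)) ^ P.r ≤ (3 * (P.n * P.k * P.D)) ^ P.r := by
        calc P.n * (P.k * (2 * P.D + 1)) ^ P.r ≤ P.n ^ P.r * (P.k * (3 * P.D)) ^ P.r :=
              Nat.mul_le_mul (Nat.le_self_pow (by omega) _) (Nat.pow_le_pow_left (by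
                exact Nat.mul_le_mul_left _ (by omega)) _)
          _ = _ := by rw [← mul_pow]; congr 1; ring
      have h3 := h2.trans (Nat.pow_le_pow_left h1 P.r)
      rw [← pow_mul] at h3
      exact_mod_cast h3
    · rw [qT, hκ]
      have hx : 1 ≤ Nat.clog 2 (P.n * P.k * P.D) * P.r := Nat.mul_pos hℓ hr
      generalize Nat.clog 2 (P.n * P.k * P.D) = ℓ at *
      have : 2 * (2 * (20 * τ) * P.r * ℓ) = 80 * τ * (ℓ * P.r) := by ring
      rw [this, mul_assoc]
      nlinarith
  have t3 : (2 * ((P.n : ℝ) * P.D) + 1) ^ (P.qS * 512 * P.k) * (1 / 4) ^ P.qW ≤ (1 / 2) ^ τ := by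
    have hℓ : 1 ≤ Nat.clog 2 (P.n * P.D) := Nat.clog_pos one_lt_two hnD
    have hs : 1 ≤ P.s := s_pos hκ0 hk hε0
    rw [← s]
    refine two_pow_mul_quarter_pow_le (a := 3 * Nat.clog 2 (P.n * P.D) * (P.s * P.k)) ?_ ?_
    · have h1 := three_mul_le_two_pow hnD
      have h3 := Nat.pow_le_pow_left ((show 2 * (P.n * P.D) + 1 ≤ 3 * (P.n * P.D) by
        omega).trans h1) (P.s * P.k)
      rw [← pow_mul] at h3
      exact_mod_cast h3
    · rw [qW, hκ]
      have hx : 1 ≤ Nat.clog 2 (P.n * P.D) * (P.s * P.k) := Nat.mul_pos hℓ (Nat.mul_pos hs hk)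
      generalize Nat.clog 2 (P.n * P.D) = ℓ at *
      have : 2 * (2 * (20 * τ) * P.s * P.k * ℓ) = 80 * τ * (ℓ * (P.s * P.k)) := by ring
      rw [this, mul_assoc]
      nlinarith
  have : (5 : ℝ) / τ = 2 / τ + 1 / τ + 1 / τ + 1 / τ := by ring
  rw [this]
  linarith

end Params

end SparseDict

namespace SparseDict

/-! ### Bounds for the sizes of the sketches -/

theorem clog_le_log {m : ℕ} (hm : 2 ≤ m) : (Nat.clog 2 m : ℝ) ≤ 3 * Real.log m := by
  have h2 : (0.69 : ℝ) < Real.log 2 := by linarith [Real.log_two_gt_d9]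
  have hlog : Real.log 2 ≤ Real.log m :=
    Real.log_le_log (by norm_num) (by exact_mod_cast hm)
  have h1 : ((2 ^ (Nat.clog 2 m).pred : ℕ) : ℝ) ≤ m := by
    exact_mod_cast (Nat.pow_pred_clog_lt_self one_lt_two hm).le
  have h3 := Real.log_le_log (by positivity) h1
  push_cast at h3
  rw [Real.log_pow] at h3
  have h4 : (((Nat.clog 2 m).pred : ℕ) : ℝ) = Nat.clog 2 m - 1 := by
    have : 1 ≤ Nat.clog 2 m := Nat.clog_pos one_lt_two hm
    rw [Nat.pred_eq_sub_one, Nat.cast_sub this, Nat.cast_one]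
  rw [h4] at h3
  have hc : (0 : ℝ) ≤ Nat.clog 2 m := Nat.cast_nonneg _
  nlinarith

namespace Params

variable {P : Params}

theorem s_le (hk : 1 ≤ P.k) (hε0 : 0 < P.ε) (hε1 : P.ε < 1) :
    (P.s : ℝ) ≤ 512 * (P.κ + 1) * (P.k / P.ε) := by
  have h1 : (P.qS : ℝ) ≤ P.κ * P.k / P.ε + 1 := (Nat.ceil_lt_add_one (by positivity)).le
  have h2 : (1 : ℝ) ≤ P.k / P.ε := by
    rw [le_div_iff₀ hε0]
    have : (1 : ℝ) ≤ P.k := by exact_mod_cast hk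
    linarith
  rw [s]
  push_cast
  have h3 : (P.κ : ℝ) * P.k / P.ε = P.κ * (P.k / P.ε) := by ring
  rw [h3] at h1
  nlinarith

theorem G_le (hε0 : 0 < P.ε) (hε1 : P.ε < 1) : (P.G : ℝ) ≤ 12801 / P.ε ^ 2 := by
  have h1 : (P.G : ℝ) ≤ 12800 / (P.ε * P.ε) + 1 := (Nat.ceil_lt_add_one (by positivity)).le
  have h2 : (1 : ℝ) ≤ 1 / P.ε ^ 2 := by
    rw [le_div_iff₀ (by positivity)]
    nlinarith
  have h3 : (12801 : ℝ) / P.ε ^ 2 = 12800 / (P.ε * P.ε) + 1 / P.ε ^ 2 := by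
    field_simp; norm_num
  linarith

theorem t_le (hε0 : 0 < P.ε) (hε1 : P.ε < 1) (hm : 2 ≤ P.n * P.k * P.D) :
    ((P.qT * P.G : ℕ) : ℝ) ≤
      76806 * P.κ * (P.r * Real.log (P.n * P.k * P.D) / P.ε ^ 2) := by
  have h1 := clog_le_log hm
  have h2 := G_le hε0 hε1
  push_cast at h1
  have h0 : (0 : ℝ) ≤ Real.log (P.n * P.k * P.D) := by
    exact_mod_cast Real.log_natCast_nonneg (P.n * P.k * P.D)
  rw [qT]
  push_cast
  calc (2 * P.κ * P.r * Nat.clog 2 (P.n * P.k * P.D) : ℝ) * P.G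
      ≤ 2 * P.κ * P.r * (3 * Real.log (P.n * P.k * P.D)) * (12801 / P.ε ^ 2) := by gcongr
    _ = _ := by ring

theorem w_le (hk : 1 ≤ P.k) (hε0 : 0 < P.ε) (hε1 : P.ε < 1) (hm : 2 ≤ P.n * P.D) :
    ((P.qW * P.G : ℕ) : ℝ) ≤
      39324672 * P.κ * (P.κ + 1) * (P.k ^ 2 / P.ε ^ 3 * Real.log (P.n * P.D)) := by
  have h1 := clog_le_log hm
  have h2 := G_le hε0 hε1
  have h3 := s_le hk hε0 hε1
  push_cast at h1
  have h0 : (0 : ℝ) ≤ Real.log (P.n * P.D) := by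
    exact_mod_cast Real.log_natCast_nonneg (P.n * P.D)
  rw [qW]
  push_cast
  calc (2 * P.κ * P.s * P.k * Nat.clog 2 (P.n * P.D) : ℝ) * P.G
      ≤ 2 * P.κ * (512 * (P.κ + 1) * (P.k / P.ε)) * P.k * (3 * Real.log (P.n * P.D)) *
          (12801 / P.ε ^ 2) := by gcongr
    _ = _ := by ring

end Params

/-! ### Distributions of the sketching matrices -/

theorem pr_eq_card {Ω : Type*} [Fintype Ω] (p : Ω → Prop) : pr p = {ω | p ω}.ncard / Fintype.card Ω := by
  classical
  rw [pr, avg, Finset.sum_boole]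
  congr 2
  rw [← Set.ncard_coe_finset]
  congr 1
  ext ω; simp

section
variable {Ω : Type*} [Fintype Ω] [Nonempty Ω]

theorem pr_not (p : Ω → Prop) : pr (fun ω => ¬ p ω) = 1 - pr p := by
  classical
  have h := avg_const (Ω := Ω) 1
  rw [← h, pr, pr, ← avg_sub]
  congr 1
  ext ω
  by_cases hp : p ω <;> simp [hp]

theorem toOuterMeasure_uniform (p : Ω → Prop) :
    (PMF.uniformOfFintype Ω).toOuterMeasure {ω | p ω} = ENNReal.ofReal (pr p) := by
  classical
  rw [PMF.toOuterMeasure_uniformOfFintype_apply, pr_eq_card,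
    ENNReal.ofReal_div_of_pos (by exact_mod_cast Fintype.card_pos), ENNReal.ofReal_natCast,
    ENNReal.ofReal_natCast, ← Nat.card_coe_set_eq, Nat.card_eq_fintype_card]

theorem uniform_prod {Ω' : Type*} [Fintype Ω'] [Nonempty Ω'] :
    (PMF.uniformOfFintype Ω).bind (fun a => (PMF.uniformOfFintype Ω').map (Prod.mk a)) =
      PMF.uniformOfFintype (Ω × Ω') := by
  classical
  ext ⟨a, b⟩
  simp only [PMF.bind_apply, PMF.map_apply, PMF.uniformOfFintype_apply, tsum_fintype,
    Prod.mk.injEq, Fintype.card_prod]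
  rw [Finset.sum_eq_single a, Finset.sum_eq_single b]
  · simp only [and_self, if_true]
    rw [Nat.cast_mul, ENNReal.mul_inv (Or.inr (by simp)) (Or.inl (by simp))]
  · intro b' _ hb
    simp [Ne.symm hb]
  · simp
  · intro a' _ ha
    simp [Ne.symm ha]
  · simp

theorem uniform_sketches {Ω₁ Ω₂ Ω₃ α β γ : Type*} [Fintype Ω₁] [Nonempty Ω₁] [Fintype Ω₂]
    [Nonempty Ω₂] [Fintype Ω₃] [Nonempty Ω₃] (f : Ω₁ → α) (g : Ω₂ → β) (h : Ω₃ → γ) :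
    (((PMF.uniformOfFintype Ω₁).map f).bind fun S => ((PMF.uniformOfFintype Ω₂).map g).bind fun T =>
      ((PMF.uniformOfFintype Ω₃).map h).map fun W => (S, T, W)) =
    (PMF.uniformOfFintype (Ω₁ × Ω₂ × Ω₃)).map fun ω => (f ω.1, g ω.2.1, h ω.2.2) := by
  rw [← uniform_prod, ← uniform_prod]
  simp only [PMF.map_bind, PMF.bind_map, PMF.map_comp]
  rfl

end

namespace Params

variable {P : Params}

/-- Sketches of small size suffice. -/
theorem exists_sketches {τ : ℕ} {δ : ℝ} (hδ0 : 0 < δ) (hτδ : 5 / δ ≤ τ) (hκ : P.κ = 20 * τ)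
    (hn : 1 ≤ P.n) (hr : 1 ≤ P.r) (hrk : P.r ≤ P.k) (hD : 1 ≤ P.D) (hε0 : 0 < P.ε)
    (hε1 : P.ε < 1) :
    ∃ (s t w : ℕ) (μS : PMF (Matrix (Fin s) (Fin P.n) ℝ)) (μT : PMF (Matrix (Fin P.d) (Fin t) ℝ))
      (μW : PMF (Matrix (Fin w) (Fin (P.n * P.d)) ℝ)) (L : RealRAM.Layout) (B : ℕ),
      (s : ℝ) ≤ (39324672 * (P.κ + 1) ^ 2 : ℕ) * (P.k / P.ε) ∧
      (t : ℝ) ≤ (39324672 * (P.κ + 1) ^ 2 : ℕ) *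
        (P.r * Real.log (P.n * P.k * P.D) / P.ε ^ 2) ∧
      (w : ℝ) ≤ (39324672 * (P.κ + 1) ^ 2 : ℕ) *
        (P.k ^ 2 / P.ε ^ 3 * Real.log (P.n * P.D)) ∧
      ∀ A : Matrix (Fin P.n) (Fin P.d) ℝ,
        ENNReal.ofReal (1 - δ) ≤
          (μS.bind fun S => μT.bind fun T => μW.map fun W => (S, T, W)).toOuterMeasure
            {x | RecoverySucceeds L B (recoverCmd P.κ) P.k P.r P.D P.ε A x.1 x.2.1 x.2.2} := by
  have hτ0 : (0 : ℝ) < τ := lt_of_lt_of_le (by positivity) hτδ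
  have hτ : 1 ≤ τ := by exact_mod_cast hτ0
  have hk : 1 ≤ P.k := hr.trans hrk
  have hκ0 : 0 < P.κ := by omega
  have hκR : (0 : ℝ) ≤ P.κ := Nat.cast_nonneg _
  have hkε : (1 : ℝ) ≤ P.k / P.ε := by
    rw [le_div_iff₀ hε0]
    have : (1 : ℝ) ≤ P.k := by exact_mod_cast hk
    linarith
  have hl1 : (0 : ℝ) ≤ Real.log (P.n * P.k * P.D) := by
    exact_mod_cast Real.log_natCast_nonneg (P.n * P.k * P.D)
  have hl2 : (0 : ℝ) ≤ Real.log (P.n * P.D) := by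
    exact_mod_cast Real.log_natCast_nonneg (P.n * P.D)
  push_cast
  by_cases hnD : 2 ≤ P.n * P.D
  · have hm : 2 ≤ P.n * P.k * P.D := by nlinarith
    refine ⟨P.s, P.qT * P.G, P.qW * P.G,
      (PMF.uniformOfFintype _).map (signMat fun (η : P.Seed) x => sgn η x),
      (PMF.uniformOfFintype _).map fun ω => (signMat (fun (η : P.Seed) x => sgn η x) ω)ᵀ,
      (PMF.uniformOfFintype _).map (signMat fun (η : P.Seed) x => sgn η x),
      (P.machine 0 (P.d * (P.qT * P.G)) (P.qW * P.G * (P.n * P.d))).L,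
      (P.machine 0 (P.d * (P.qT * P.G)) (P.qW * P.G * (P.n * P.d))).B,
      (s_le hk hε0 hε1).trans (mul_le_mul_of_nonneg_right (by nlinarith) (by positivity)),
      (t_le hε0 hε1 hm).trans (mul_le_mul_of_nonneg_right (by nlinarith) (by positivity)),
      (w_le hk hε0 hε1 hnD).trans (mul_le_mul_of_nonneg_right (by nlinarith) (by positivity)),
      fun A => ?_⟩
    rw [uniform_sketches, PMF.toOuterMeasure_map_apply]
    have hgood := pr_not_good_le hτ hκ hr hrk hD hε0 hε1 hnD A
    rw [pr_not] at hgood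
    have h5 : 5 / τ ≤ δ := by
      rw [div_le_iff₀ hδ0] at hτδ
      rw [div_le_iff₀ hτ0]; linarith
    calc ENNReal.ofReal (1 - δ)
        ≤ ENNReal.ofReal (pr fun ω : P.Rand =>
            SketchGood P.r P.D (matS ω) (matT ω) (matW ω) A P.k P.ε) :=
          ENNReal.ofReal_le_ofReal (by linarith)
      _ = _ := (toOuterMeasure_uniform _).symm
      _ ≤ _ := by
        refine MeasureTheory.OuterMeasure.mono _ fun ω hω => ?_
        exact recover_succeeds hε0 hk hrk (qT_pos hκ0 hk hr hnD) (qW_pos hκ0 hk hε0 hnD) hnD _ _ _ A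
          hω
  · have h1 : P.n = 1 ∧ P.D = 1 := by constructor <;> nlinarith
    refine ⟨1, 0, 0, PMF.pure (Matrix.of fun _ _ => 1), PMF.pure 0, PMF.pure 0,
      (P.machine 0 0 0).L, (P.machine 0 0 0).B, ?_, ?_, ?_,
      fun A => ?_⟩
    · push_cast
      nlinarith [sq_nonneg ((P.κ : ℝ) + 1), mul_nonneg hκR hκR]
    · push_cast; positivity
    · push_cast; positivity
    · rw [PMF.pure_bind, PMF.pure_bind, PMF.pure_map, PMF.toOuterMeasure_pure_apply, if_pos]
      · exact ENNReal.ofReal_le_one.2 (by linarith)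
      · exact copy_succeeds hε0 hκ0 hk hr h1.1 h1.2 0 0 A

end Params

end SparseDict

namespace SparseDict

open RealRAM

namespace Params

variable {P : Params}

theorem space_machine (m : ℕ) : (P.machine m 0 0).L.space =
    128 + m + 3 * (P.n * P.r) + 2 * (P.s * P.k) + P.r + 2 * (P.k * P.d) + P.s * P.d +
      P.n * (P.qT * P.G) + 2 * (P.qW * P.G) + P.k + P.s + P.k * (P.qT * P.G) + P.qT * P.G +
      P.qT + P.qW := by
  have h : ∀ f : ℕ → ℕ, ((List.range 64).map fun a => f a + 1).sum =
      ∑ a ∈ Finset.range 64, f a + 64 := fun f => by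
    rw [List.sum_map_add]
    simp [Finset.sum, Finset.range, Multiset.range]
  rw [Layout.space, machine, h, h]
  simp only [Finset.sum_range_succ, Finset.sum_range_zero, intCells, realCells]
  ring

/-- The parameters in the range of the streaming algorithm. -/
structure Large (P : Params) : Prop where
  r_pos : 1 ≤ P.r
  r_le : P.r ≤ P.k
  D_pos : 1 ≤ P.D
  ε_pos : 0 < P.ε
  ε_lt : P.ε < 1
  n_large : 4 * ((P.k : ℝ) / P.ε) ^ 2 ≤ P.n
  d_large : 4 * ((P.k : ℝ) / P.ε) ^ 2 ≤ P.d

namespace Large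

theorem k_pos (h : P.Large) : 1 ≤ P.k := h.r_pos.trans h.r_le

theorem one_le_k (h : P.Large) : (1 : ℝ) ≤ P.k := by exact_mod_cast h.k_pos

theorem one_le_r (h : P.Large) : (1 : ℝ) ≤ P.r := by exact_mod_cast h.r_pos

theorem r_le_k (h : P.Large) : (P.r : ℝ) ≤ P.k := by exact_mod_cast h.r_le

theorem one_le_D (h : P.Large) : (1 : ℝ) ≤ P.D := by exact_mod_cast h.D_pos

theorem one_le_inv (h : P.Large) : 1 ≤ 1 / P.ε := by
  rw [le_div_iff₀ h.ε_pos]; linarith [h.ε_lt]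

theorem k_le_div (h : P.Large) : (P.k : ℝ) ≤ P.k / P.ε := by
  rw [le_div_iff₀ h.ε_pos]
  nlinarith [h.ε_lt, h.one_le_k]

theorem one_le_div (h : P.Large) : (1 : ℝ) ≤ P.k / P.ε := h.one_le_k.trans h.k_le_div

theorem sq_div_le (h : P.Large) : (P.k : ℝ) ^ 2 / P.ε ≤ (P.k / P.ε) ^ 2 := by
  have := h.one_le_inv
  rw [div_pow, div_le_div_iff₀ h.ε_pos (pow_pos h.ε_pos 2)]
  nlinarith [mul_nonneg (sq_nonneg (P.k : ℝ)) h.ε_pos.le, h.ε_lt]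

theorem four_le_n (h : P.Large) : (4 : ℝ) ≤ P.n := by
  nlinarith [h.n_large, h.one_le_div]

theorem four_le_d (h : P.Large) : (4 : ℝ) ≤ P.d := by
  nlinarith [h.d_large, h.one_le_div]

theorem div_le_n (h : P.Large) : (P.k : ℝ) / P.ε ≤ P.n := by
  nlinarith [h.n_large, h.one_le_div]

theorem k_le_n (h : P.Large) : (P.k : ℝ) ≤ P.n := h.k_le_div.trans h.div_le_n

theorem k_le_d (h : P.Large) : (P.k : ℝ) ≤ P.d := by
  nlinarith [h.d_large, h.one_le_div, h.k_le_div]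

theorem two_le_nD (h : P.Large) : 2 ≤ P.n * P.D := by
  have h1 : 4 ≤ P.n := by exact_mod_cast h.four_le_n
  nlinarith [h.D_pos]

theorem two_le_nkD (h : P.Large) : 2 ≤ P.n * P.k * P.D := by
  have := h.two_le_nD
  nlinarith [h.k_pos]

end Large

variable (P)

/-- The product of the parameters. -/
noncomputable def X : ℝ := P.n * P.d * P.k * P.D / P.ε

variable {P}

namespace Large

theorem one_le_n (h : P.Large) : (1 : ℝ) ≤ P.n := by linarith [h.four_le_n]

theorem one_le_d (h : P.Large) : (1 : ℝ) ≤ P.d := by linarith [h.four_le_d]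

theorem mul_le_X {a b c e f : ℝ} (ha : a ≤ P.n) (hb : b ≤ P.d) (hc : c ≤ P.k) (he : e ≤ P.D)
    (hf : f ≤ 1 / P.ε) (hb0 : 0 ≤ b) (hc0 : 0 ≤ c) (he0 : 0 ≤ e) (hf0 : 0 ≤ f) :
    a * b * c * e * f ≤ P.X := by
  have : P.X = P.n * P.d * P.k * P.D * (1 / P.ε) := by rw [X]; ring
  rw [this]
  gcongr

theorem nkD_le_X (h : P.Large) : (P.n * P.k * P.D : ℝ) ≤ P.X := by
  simpa using mul_le_X (P := P) le_rfl h.one_le_d le_rfl le_rfl h.one_le_inv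

theorem nD_le_X (h : P.Large) : (P.n * P.D : ℝ) ≤ P.X := by
  simpa using mul_le_X (P := P) le_rfl h.one_le_d h.one_le_k le_rfl h.one_le_inv

theorem nd_le_X (h : P.Large) : (P.n * P.d : ℝ) ≤ P.X := by
  simpa using mul_le_X (P := P) le_rfl le_rfl h.one_le_k h.one_le_D h.one_le_inv

theorem kd_le_X (h : P.Large) : (P.k * P.d : ℝ) ≤ P.X := by
  have := mul_le_X (P := P) h.one_le_n le_rfl le_rfl h.one_le_D h.one_le_inv
  rw [mul_comm]
  simpa using this

theorem nk_le_X (h : P.Large) : (P.n * P.k : ℝ) ≤ P.X := by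
  simpa using mul_le_X (P := P) le_rfl h.one_le_d le_rfl h.one_le_D h.one_le_inv

theorem kD_le_X (h : P.Large) : (P.k * P.D : ℝ) ≤ P.X := by
  simpa using mul_le_X (P := P) h.one_le_n h.one_le_d le_rfl le_rfl h.one_le_inv

theorem inv_le_X (h : P.Large) : 1 / P.ε ≤ P.X := by
  simpa [h.ε_pos.le] using mul_le_X (P := P) h.one_le_n h.one_le_d h.one_le_k h.one_le_D le_rfl

theorem div_le_X (h : P.Large) : P.k / P.ε ≤ P.X := by
  simpa [h.ε_pos.le, div_eq_mul_inv] using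
    mul_le_X (P := P) h.one_le_n h.one_le_d le_rfl h.one_le_D le_rfl

theorem n_le_X (h : P.Large) : (P.n : ℝ) ≤ P.X := by
  simpa using mul_le_X (P := P) le_rfl h.one_le_d h.one_le_k h.one_le_D h.one_le_inv

theorem d_le_X (h : P.Large) : (P.d : ℝ) ≤ P.X := by
  simpa using mul_le_X (P := P) h.one_le_n le_rfl h.one_le_k h.one_le_D h.one_le_inv

theorem D_le_X (h : P.Large) : (P.D : ℝ) ≤ P.X := by
  simpa using mul_le_X (P := P) h.one_le_n h.one_le_d h.one_le_k le_rfl h.one_le_inv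

theorem four_le_X (h : P.Large) : 4 ≤ P.X := h.four_le_n.trans h.n_le_X

theorem X_nonneg (h : P.Large) : 0 ≤ P.X := by linarith [h.four_le_X]

theorem k_le_X (h : P.Large) : (P.k : ℝ) ≤ P.X := h.k_le_n.trans h.n_le_X

theorem r_le_X (h : P.Large) : (P.r : ℝ) ≤ P.X := h.r_le_k.trans h.k_le_X

theorem nr_le_X (h : P.Large) : (P.n * P.r : ℝ) ≤ P.X :=
  (mul_le_mul_of_nonneg_left h.r_le_k (Nat.cast_nonneg _)).trans h.nk_le_X

theorem rD_le_X (h : P.Large) : (P.r * P.D : ℝ) ≤ P.X :=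
  (mul_le_mul_of_nonneg_right h.r_le_k (Nat.cast_nonneg _)).trans h.kD_le_X

theorem s_le_X (h : P.Large) : (P.s : ℝ) ≤ 512 * (P.κ + 1) * P.X :=
  (s_le h.k_pos h.ε_pos h.ε_lt).trans (mul_le_mul_of_nonneg_left h.div_le_X (by positivity))

theorem G_le_X (h : P.Large) : (P.G : ℝ) ≤ 12801 * P.X ^ 2 := by
  refine (G_le h.ε_pos h.ε_lt).trans ?_
  have e : 12801 / P.ε ^ 2 = 12801 * (1 / P.ε) ^ 2 := by ring
  rw [e]
  exact mul_le_mul_of_nonneg_left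
    (pow_le_pow_left₀ (zero_le_one.trans h.one_le_inv) h.inv_le_X 2) (by norm_num)

theorem clog_nkD_le_X (h : P.Large) : (Nat.clog 2 (P.n * P.k * P.D) : ℝ) ≤ P.X :=
  le_trans (by exact_mod_cast clog_two_le (P.n * P.k * P.D)) h.nkD_le_X

theorem clog_nD_le_X (h : P.Large) : (Nat.clog 2 (P.n * P.D) : ℝ) ≤ P.X :=
  le_trans (by exact_mod_cast clog_two_le (P.n * P.D)) h.nD_le_X

theorem qT_le_X (h : P.Large) : (P.qT : ℝ) ≤ 2 * (P.κ + 1) * P.X ^ 2 := by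
  have h0 := h.X_nonneg
  have h1 := h.r_le_X
  have h2 := h.clog_nkD_le_X
  rw [qT]; push_cast
  calc (2 * P.κ * P.r * Nat.clog 2 (P.n * P.k * P.D) : ℝ) ≤ 2 * (P.κ + 1) * P.X * P.X := by
        gcongr; linarith
    _ = _ := by ring

theorem qW_le_X (h : P.Large) : (P.qW : ℝ) ≤ 1024 * (P.κ + 1) ^ 2 * P.X ^ 3 := by
  have h0 := h.X_nonneg
  have h1 := h.k_le_X
  have h2 := h.clog_nD_le_X
  have h3 := h.s_le_X
  rw [qW]; push_cast
  calc (2 * P.κ * P.s * P.k * Nat.clog 2 (P.n * P.D) : ℝ) ≤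
      2 * (P.κ + 1) * (512 * (P.κ + 1) * P.X) * P.X * P.X := by gcongr; linarith
    _ = _ := by ring

theorem qTG_le_X (h : P.Large) : (P.qT * P.G : ℝ) ≤ 25602 * (P.κ + 1) * P.X ^ 4 := by
  refine (mul_le_mul h.qT_le_X h.G_le_X (by positivity) (by positivity)).trans_eq ?_
  ring

theorem qWG_le_X (h : P.Large) : (P.qW * P.G : ℝ) ≤ 13108224 * (P.κ + 1) ^ 2 * P.X ^ 5 := by
  have h0 := h.X_nonneg
  refine (mul_le_mul h.qW_le_X h.G_le_X (by positivity) (by positivity)).trans_eq ?_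
  ring

theorem kqTG_le_X (h : P.Large) : (P.k * (P.qT * P.G) : ℝ) ≤ 25602 * (P.κ + 1) * P.X ^ 5 := by
  refine (mul_le_mul h.k_le_X h.qTG_le_X (by positivity) h.X_nonneg).trans_eq ?_
  ring

theorem sk_le_X (h : P.Large) : (P.s * P.k : ℝ) ≤ 512 * (P.κ + 1) * P.X ^ 2 := by
  have h0 := h.X_nonneg
  refine (mul_le_mul h.s_le_X h.k_le_X (by positivity) (by positivity)).trans_eq ?_
  ring

theorem monomial_le {u X : ℝ} (hu : 1 ≤ u) (hX : 1 ≤ X) {i j : ℕ} (hi : i ≤ 2) (hj : j ≤ 5) :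
    u ^ i * X ^ j ≤ u ^ 2 * X ^ 5 :=
  mul_le_mul (pow_le_pow_right₀ hu hi) (pow_le_pow_right₀ hX hj) (by positivity) (by positivity)

theorem V_le (h : P.Large) : (P.V : ℝ) ≤ 2 * 10 ^ 9 * (P.κ + 1) ^ 2 * P.X ^ 5 := by
  have hX : 1 ≤ P.X := by linarith [h.four_le_X]
  have hu : 1 ≤ (P.κ + 1 : ℝ) := by linarith [Nat.cast_nonneg (α := ℝ) P.κ]
  have p0 := monomial_le hu hX (i := 1) (j := 0) (by norm_num) (by norm_num)
  have p1 := monomial_le hu hX (i := 1) (j := 1) (by norm_num) (by norm_num)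
  have p2 := monomial_le hu hX (i := 1) (j := 2) (by norm_num) (by norm_num)
  have p4 := monomial_le hu hX (i := 1) (j := 4) (by norm_num) (by norm_num)
  have p5 := monomial_le hu hX (i := 1) (j := 5) (by norm_num) (by norm_num)
  have q0 := monomial_le hu hX (i := 0) (j := 0) (by norm_num) (by norm_num)
  have q1 := monomial_le hu hX (i := 0) (j := 1) (by norm_num) (by norm_num)
  have q2 := monomial_le hu hX (i := 0) (j := 2) (by norm_num) (by norm_num)
  have q3 := monomial_le hu hX (i := 2) (j := 3) (by norm_num) (by norm_num)
  simp only [pow_zero, pow_one, mul_one, one_mul] at p0 p1 p2 p4 p5 q0 q1 q2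
  have b1 := h.s_le_X
  have b2 := h.G_le_X
  have b3 := h.qT_le_X
  have b4 := h.qW_le_X
  have b5 := h.qTG_le_X
  have b6 := h.qWG_le_X
  have b7 := h.kqTG_le_X
  have b8 := h.sk_le_X
  have a1 := h.nkD_le_X
  have a2 := h.nD_le_X
  have a3 := h.nd_le_X
  have a4 := h.kd_le_X
  have a5 := h.nr_le_X
  have a6 := h.rD_le_X
  have a7 := h.kD_le_X
  have a8 := h.k_le_X
  have a9 := h.r_le_X
  have a10 := h.D_le_X
  have a11 := h.n_le_X
  have a12 := h.d_le_X
  rw [V]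
  push_cast
  linarith

/-- The exponent in the bound of the word size. -/
theorem V_pow_le (h : P.Large) {c : ℕ} (hc : 2 * 10 ^ 9 * (P.κ + 1) ^ 2 ≤ c) (i : ℕ) :
    (P.V : ℝ) ^ i ≤ P.X ^ (i * (c + 5)) := by
  have h4 := h.four_le_X
  have h0 := h.X_nonneg
  have h1 : (c : ℝ) ≤ P.X ^ c := by
    calc (c : ℝ) ≤ 2 ^ c := by exact_mod_cast Nat.lt_two_pow_self.le
      _ ≤ P.X ^ c := pow_le_pow_left₀ (by norm_num) (by linarith) c
  have h2 : (P.V : ℝ) ≤ P.X ^ (c + 5) := by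
    refine h.V_le.trans ?_
    rw [pow_add]
    refine mul_le_mul_of_nonneg_right (le_trans ?_ h1) (by positivity)
    exact_mod_cast hc
  rw [mul_comm, pow_mul]
  exact pow_le_pow_left₀ (Nat.cast_nonneg _) h2 i

theorem X_le (h : P.Large) : P.X ≤ (P.n * P.D : ℝ) ^ 2 * P.d := by
  have h1 := h.div_le_n
  have h2 := h.one_le_D
  have h3 : P.X = (P.k / P.ε) * (P.n * P.d * P.D) := by rw [X]; ring
  calc P.X = (P.k / P.ε) * (P.n * P.d * P.D) := h3
    _ ≤ (P.n * P.D) * (P.n * P.d * P.D) := by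
      refine mul_le_mul_of_nonneg_right (h1.trans ?_) (by positivity)
      exact le_mul_of_one_le_right (Nat.cast_nonneg _) h2
    _ = _ := by ring

theorem sq_le_div (h : P.Large) : (1 : ℝ) ≤ P.k ^ 2 / P.ε := by
  rw [sq, mul_div_assoc]
  exact one_le_mul_of_one_le_of_one_le h.one_le_k h.one_le_div

/-- The running time. -/
theorem time_le (h : P.Large) {c C : ℕ} (hc : 2 * 10 ^ 9 * (P.κ + 1) ^ 2 ≤ c)
    (hC : 120 * (c + 5) ≤ C) :
    ((((2 * (P.n * P.D) + 1) ^ (P.s * P.k) * (P.k * (2 * P.D + 1)) ^ P.r : ℕ) : ℝ) *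
      (P.V : ℝ) ^ 40) ≤
    (P.k : ℝ) ^ P.r *
      ((P.n : ℝ) * P.D) ^ (C * (P.k ^ 2 / P.ε) * (1 + Real.log (P.k / P.ε)) ^ C : ℝ) *
      (P.d : ℝ) ^ C := by
  obtain ⟨E, hE⟩ : ∃ E, E = 40 * (c + 5) := ⟨_, rfl⟩
  have hN : (4 : ℝ) ≤ P.n * P.D := by nlinarith [h.four_le_n, h.one_le_D]
  have hDN : (P.D : ℝ) ≤ P.n * P.D := le_mul_of_one_le_left (Nat.cast_nonneg _) h.one_le_n
  obtain ⟨N, hN'⟩ : ∃ N : ℝ, N = P.n * P.D := ⟨_, rfl⟩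
  rw [← hN'] at hN hDN ⊢
  have e1 : (P.V : ℝ) ^ 40 ≤ N ^ (2 * E) * P.d ^ C := by
    refine (h.V_pow_le hc 40).trans ?_
    rw [← hE]
    refine (pow_le_pow_left₀ h.X_nonneg h.X_le E).trans ?_
    rw [mul_pow, ← pow_mul, ← hN']
    exact mul_le_mul_of_nonneg_left (pow_le_pow_right₀ h.one_le_d (by omega)) (by positivity)
  have e2 : 2 * N + 1 ≤ N ^ 3 := by nlinarith [mul_le_mul hN hN (by norm_num) (by linarith)]
  have e3 : (2 * P.D + 1 : ℝ) ≤ N ^ 3 := by linarith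
  have e4 : ((((2 * (P.n * P.D) + 1) ^ (P.s * P.k) * (P.k * (2 * P.D + 1)) ^ P.r : ℕ) : ℝ)) ≤
      N ^ (3 * (P.s * P.k)) * (P.k ^ P.r * N ^ (3 * P.r)) := by
    push_cast
    rw [← hN', mul_pow, pow_mul N, pow_mul N]
    have : (0 : ℝ) ≤ N := by linarith
    gcongr
  have e5 : ((3 * (P.s * P.k) + 3 * P.r + 2 * E : ℕ) : ℝ) ≤
      C * (P.k ^ 2 / P.ε) * (1 + Real.log (P.k / P.ε)) ^ C := by
    have f1 : (P.s * P.k : ℝ) ≤ 512 * (P.κ + 1) * (P.k ^ 2 / P.ε) := by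
      refine (mul_le_mul_of_nonneg_right (s_le h.k_pos h.ε_pos h.ε_lt)
        (Nat.cast_nonneg _)).trans_eq ?_
      ring
    have f2 : (P.r : ℝ) ≤ P.k ^ 2 / P.ε := by
      rw [sq, mul_div_assoc]
      exact h.r_le_k.trans (le_mul_of_one_le_right (Nat.cast_nonneg _) h.one_le_div)
    have f3 := h.sq_le_div
    have f4 : (1 : ℝ) ≤ (1 + Real.log (P.k / P.ε)) ^ C :=
      one_le_pow₀ (by linarith [Real.log_nonneg h.one_le_div])
    have f5 : 512 * (P.κ + 1) ≤ c := by nlinarith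
    have f6 : (512 * (P.κ + 1) : ℝ) ≤ c := by exact_mod_cast f5
    have f7 : (120 * (c + 5) : ℝ) ≤ C := by exact_mod_cast hC
    obtain ⟨y, hy⟩ : ∃ y : ℝ, y = P.k ^ 2 / P.ε := ⟨_, rfl⟩
    rw [← hy] at f1 f2 f3 ⊢
    have f8 : (P.s * P.k : ℝ) ≤ c * y := f1.trans (mul_le_mul_of_nonneg_right f6 (by linarith))
    have f9 : (3 * (P.s * P.k) + 3 * P.r + 2 * E : ℝ) ≤ C * y := by
      have : (E : ℝ) = 40 * (c + 5) := by rw [hE]; push_cast; ring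
      rw [this]
      have g1 : (c + 5 : ℝ) ≤ (c + 5) * y := le_mul_of_one_le_right (by positivity) f3
      have g2 : (120 * (c + 5) : ℝ) * y ≤ C * y := mul_le_mul_of_nonneg_right f7 (by linarith)
      have g3 : (0 : ℝ) ≤ c * y := by positivity
      linarith
    push_cast
    exact f9.trans (le_mul_of_one_le_right (by positivity) f4)
  calc _ ≤ (N ^ (3 * (P.s * P.k)) * (P.k ^ P.r * N ^ (3 * P.r))) * (N ^ (2 * E) * P.d ^ C) :=
        mul_le_mul e4 e1 (by positivity) (by positivity)
    _ = P.k ^ P.r * N ^ (3 * (P.s * P.k) + 3 * P.r + 2 * E) * P.d ^ C := by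
      rw [pow_add, pow_add]; ring
    _ ≤ _ := by
      rw [← Real.rpow_natCast N]
      have := Real.rpow_le_rpow_of_exponent_le (by linarith : 1 ≤ N) e5
      gcongr

end Large

end Params

end SparseDict

namespace SparseDict

namespace Params

variable (P : Params)

/-- The space bound, up to a logarithmic factor. -/
noncomputable def U : ℝ := P.n * P.r / P.ε ^ 2 + P.d * P.k / P.ε

/-- The logarithmic factor in the space bound. -/
noncomputable def logX : ℝ := 1 + Real.log P.X

variable {P}

namespace Large

theorem one_le_inv_sq (h : P.Large) : 1 ≤ 1 / P.ε ^ 2 := by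
  have := one_le_pow₀ h.one_le_inv (n := 2)
  rwa [div_pow, one_pow] at this

theorem nr_div_le_U (h : P.Large) : P.n * P.r / P.ε ^ 2 ≤ P.U :=
  le_add_of_nonneg_right (div_nonneg (by positivity) h.ε_pos.le)

theorem dk_div_le_U : P.d * P.k / P.ε ≤ P.U :=
  le_add_of_nonneg_left (div_nonneg (by positivity) (sq_nonneg _))

theorem nr_le_U (h : P.Large) : (P.n * P.r : ℝ) ≤ P.U := by
  refine le_trans ?_ h.nr_div_le_U
  rw [← mul_one_div]
  exact le_mul_of_one_le_right (by positivity) h.one_le_inv_sq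

theorem dk_le_U (h : P.Large) : (P.d * P.k : ℝ) ≤ P.U := by
  refine le_trans ?_ dk_div_le_U
  rw [← mul_one_div]
  exact le_mul_of_one_le_right (by positivity) h.one_le_inv

theorem k_le_U (h : P.Large) : (P.k : ℝ) ≤ P.U :=
  (le_mul_of_one_le_left (Nat.cast_nonneg _) h.one_le_d).trans h.dk_le_U

theorem four_le_U (h : P.Large) : 4 ≤ P.U := by
  refine (h.four_le_d.trans ?_).trans h.dk_le_U
  exact le_mul_of_one_le_right (Nat.cast_nonneg _) h.one_le_k

theorem one_le_logX (h : P.Large) : 1 ≤ P.logX := by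
  rw [logX]
  linarith [Real.log_nonneg (by linarith [h.four_le_X] : 1 ≤ P.X)]

theorem log_le {m : ℕ} (hm : 0 < m) (hX : (m : ℝ) ≤ P.X) :
    Real.log m ≤ P.logX := by
  have := Real.log_le_log (by exact_mod_cast hm) hX
  rw [logX]
  linarith

theorem b_le (h : P.Large) : (P.b : ℝ) ≤ 6 * P.logX := by
  have hn : 4 ≤ P.n := by exact_mod_cast h.four_le_n
  have hm : 2 ≤ P.n * P.d + P.n + P.d := by omega
  have h1 : ((P.n * P.d + P.n + P.d : ℕ) : ℝ) ≤ P.X ^ 2 := by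
    push_cast
    nlinarith [h.four_le_X, h.nd_le_X, h.n_le_X, h.d_le_X]
  have h2 := Real.log_le_log (by exact_mod_cast (by omega : 0 < P.n * P.d + P.n + P.d)) h1
  rw [Real.log_pow] at h2
  have h3 := clog_le_log hm
  rw [b, logX]
  push_cast at h2 h3 ⊢
  linarith

theorem s_le_U (h : P.Large) : (P.s : ℝ) ≤ 512 * (P.κ + 1) * P.U := by
  refine (s_le h.k_pos h.ε_pos h.ε_lt).trans (mul_le_mul_of_nonneg_left ?_ (by positivity))
  refine le_trans ?_ dk_div_le_U
  rw [mul_div_assoc]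
  exact le_mul_of_one_le_left (zero_le_one.trans h.one_le_div) h.one_le_d

theorem sd_le_U (h : P.Large) : (P.s * P.d : ℝ) ≤ 512 * (P.κ + 1) * P.U := by
  refine (mul_le_mul_of_nonneg_right (s_le h.k_pos h.ε_pos h.ε_lt) (Nat.cast_nonneg _)).trans ?_
  rw [mul_assoc]
  refine mul_le_mul_of_nonneg_left (le_of_eq_of_le ?_ dk_div_le_U) (by positivity)
  ring

theorem sk_le_U (h : P.Large) : (P.s * P.k : ℝ) ≤ 512 * (P.κ + 1) * P.U :=
  (mul_le_mul_of_nonneg_left h.k_le_d (Nat.cast_nonneg _)).trans h.sd_le_U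

theorem nt_le_U (h : P.Large) : (P.n * (P.qT * P.G) : ℝ) ≤
    76806 * (P.κ + 1) * (P.U * P.logX) := by
  have h1 := t_le h.ε_pos h.ε_lt h.two_le_nkD
  have h2 := log_le (m := P.n * P.k * P.D) (by linarith [h.two_le_nkD])
    (by exact_mod_cast h.nkD_le_X)
  have h3 := h.one_le_logX
  have h4 := h.nr_div_le_U
  have h5 := h.ε_pos
  push_cast at h1 h2
  have h6 : (P.n * (P.r * Real.log (P.n * P.k * P.D) / P.ε ^ 2) : ℝ) ≤ P.U * P.logX := by
    calc _ = P.n * P.r / P.ε ^ 2 * Real.log (P.n * P.k * P.D) := by ring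
      _ ≤ P.n * P.r / P.ε ^ 2 * P.logX := mul_le_mul_of_nonneg_left h2 (by positivity)
      _ ≤ _ := mul_le_mul_of_nonneg_right h4 (by linarith)
  calc _ ≤ P.n * (76806 * P.κ * (P.r * Real.log (P.n * P.k * P.D) / P.ε ^ 2)) :=
        mul_le_mul_of_nonneg_left h1 (Nat.cast_nonneg _)
    _ = 76806 * P.κ * (P.n * (P.r * Real.log (P.n * P.k * P.D) / P.ε ^ 2)) := by ring
    _ ≤ 76806 * P.κ * (P.U * P.logX) := mul_le_mul_of_nonneg_left h6 (by positivity)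
    _ ≤ _ := by
      have : 0 ≤ P.U * P.logX := mul_nonneg (by linarith [h.four_le_U]) (by linarith)
      exact mul_le_mul_of_nonneg_right (by linarith) this

theorem kt_le_U (h : P.Large) : (P.k * (P.qT * P.G) : ℝ) ≤
    76806 * (P.κ + 1) * (P.U * P.logX) :=
  (mul_le_mul_of_nonneg_right h.k_le_n (by positivity)).trans h.nt_le_U

theorem t_le_U (h : P.Large) : (P.qT * P.G : ℝ) ≤ 76806 * (P.κ + 1) * (P.U * P.logX) :=
  (le_mul_of_one_le_left (by positivity) h.one_le_n).trans h.nt_le_U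

theorem w_le_U (h : P.Large) : (P.qW * P.G : ℝ) ≤
    39324672 * (P.κ + 1) ^ 2 * (P.U * P.logX) := by
  have h1 := w_le h.k_pos h.ε_pos h.ε_lt h.two_le_nD
  have h2 := log_le (m := P.n * P.D) (by linarith [h.two_le_nD]) (by exact_mod_cast h.nD_le_X)
  have h3 := h.one_le_logX
  have h4 := h.nr_div_le_U
  have h5 := h.ε_pos
  have h7 : (P.k ^ 2 / P.ε : ℝ) ≤ P.n * P.r := by
    refine (h.sq_div_le.trans ?_).trans (le_mul_of_one_le_right (Nat.cast_nonneg _) h.one_le_r)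
    linarith [h.n_large, sq_nonneg (P.k / P.ε)]
  push_cast at h1 h2
  have h6 : (P.k ^ 2 / P.ε ^ 3 * Real.log (P.n * P.D) : ℝ) ≤ P.U * P.logX := by
    calc (P.k ^ 2 / P.ε ^ 3 * Real.log (P.n * P.D) : ℝ) ≤ P.k ^ 2 / P.ε ^ 3 * P.logX :=
          mul_le_mul_of_nonneg_left h2 (by positivity)
      _ = P.k ^ 2 / P.ε / P.ε ^ 2 * P.logX := by rw [div_div]; ring
      _ ≤ P.n * P.r / P.ε ^ 2 * P.logX := by
        refine mul_le_mul_of_nonneg_right ?_ (by linarith)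
        exact div_le_div_of_nonneg_right h7 (by positivity)
      _ ≤ _ := mul_le_mul_of_nonneg_right h4 (by linarith)
  have h8 : 0 ≤ P.U * P.logX := mul_nonneg (by linarith [h.four_le_U]) (by linarith)
  refine h1.trans ((mul_le_mul_of_nonneg_left h6 (by positivity)).trans
    (mul_le_mul_of_nonneg_right ?_ h8))
  nlinarith [Nat.cast_nonneg (α := ℝ) P.κ]

theorem G_pos (h : P.Large) : 1 ≤ P.G := by
  have := h.ε_pos
  exact Nat.ceil_pos.2 (by positivity)

theorem qT_le_U (h : P.Large) : (P.qT : ℝ) ≤ 76806 * (P.κ + 1) * (P.U * P.logX) :=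
  (le_mul_of_one_le_right (Nat.cast_nonneg _) (by exact_mod_cast h.G_pos)).trans h.t_le_U

theorem qW_le_U (h : P.Large) : (P.qW : ℝ) ≤ 39324672 * (P.κ + 1) ^ 2 * (P.U * P.logX) :=
  (le_mul_of_one_le_right (Nat.cast_nonneg _) (by exact_mod_cast h.G_pos)).trans h.w_le_U

theorem monomial_mul_le {u U L : ℝ} (hu : 1 ≤ u) (hU : 0 ≤ U) (hL : 1 ≤ L) {i j : ℕ} (hi : i ≤ 2)
    (hj : j ≤ 3) : u ^ i * (U * L ^ j) ≤ u ^ 2 * (U * L ^ 3) :=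
  mul_le_mul (pow_le_pow_right₀ hu hi)
    (mul_le_mul_of_nonneg_left (pow_le_pow_right₀ hL hj) hU) (by positivity) (by positivity)

theorem bits_le (h : P.Large) :
    (P.bits : ℝ) ≤ 1500000000 * ((P.κ + 1) ^ 2 * (P.U * P.logX ^ 3)) := by
  have hL := h.one_le_logX
  have hU : 0 ≤ P.U := by linarith [h.four_le_U]
  have hu : 1 ≤ (P.κ + 1 : ℝ) := by linarith [Nat.cast_nonneg (α := ℝ) P.κ]
  have p0 := monomial_mul_le hu hU hL (i := 1) (j := 2) (by norm_num) (by norm_num)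
  have p1 := monomial_mul_le hu hU hL (i := 1) (j := 3) (by norm_num) (by norm_num)
  have h1 := mul_le_mul h.b_le h.b_le (Nat.cast_nonneg _) (by positivity)
  have h2 : (P.s + P.qT * P.G + P.qW * P.G : ℝ) ≤ 512 * (P.κ + 1) * P.U +
      76806 * (P.κ + 1) * (P.U * P.logX) + 39324672 * (P.κ + 1) ^ 2 * (P.U * P.logX) := by
    linarith [h.s_le_U, h.t_le_U, h.w_le_U]
  rw [bits]
  push_cast
  refine (mul_le_mul h2 h1 (by positivity) (by positivity)).trans ?_
  have p2 : 0 ≤ (P.κ + 1 : ℝ) ^ 2 * (P.U * P.logX ^ 3) := by positivity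
  have e : (512 * (P.κ + 1) * P.U + 76806 * (P.κ + 1) * (P.U * P.logX) +
      39324672 * (P.κ + 1) ^ 2 * (P.U * P.logX)) * (6 * P.logX * (6 * P.logX)) =
      18432 * ((P.κ + 1) ^ 1 * (P.U * P.logX ^ 2)) +
      2765016 * ((P.κ + 1) ^ 1 * (P.U * P.logX ^ 3)) +
      1415688192 * ((P.κ + 1) ^ 2 * (P.U * P.logX ^ 3)) := by ring
  rw [e]
  linarith

theorem space_le (h : P.Large) : ((P.machine P.bits 0 0).L.space : ℝ) ≤
    2 * 10 ^ 9 * (P.κ + 1) ^ 2 * P.U * P.logX ^ 3 := by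
  have hL := h.one_le_logX
  have h4 := h.four_le_U
  have hU : 0 ≤ P.U := by linarith
  have hu : 1 ≤ (P.κ + 1 : ℝ) := by linarith [Nat.cast_nonneg (α := ℝ) P.κ]
  have p0 := monomial_mul_le hu hU hL (i := 0) (j := 0) (by norm_num) (by norm_num)
  have p1 := monomial_mul_le hu hU hL (i := 1) (j := 0) (by norm_num) (by norm_num)
  have p2 := monomial_mul_le hu hU hL (i := 1) (j := 1) (by norm_num) (by norm_num)
  have p3 := monomial_mul_le hu hU hL (i := 2) (j := 1) (by norm_num) (by norm_num)
  simp only [pow_zero, pow_one, mul_one, one_mul] at p0 p1 p2 p3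
  have b1 := h.bits_le
  have b2 := h.nr_le_U
  have b3 := h.dk_le_U
  have b4 := h.k_le_U
  have b5 := h.r_le_k
  have b6 := h.s_le_U
  have b7 := h.sd_le_U
  have b8 := h.sk_le_U
  have b9 := h.nt_le_U
  have b10 := h.kt_le_U
  have b11 := h.t_le_U
  have b12 := h.w_le_U
  have b13 := h.qT_le_U
  have b14 := h.qW_le_U
  rw [mul_comm (P.d : ℝ)] at b3
  rw [space_machine]
  push_cast
  have e : (2 * 10 ^ 9 * (P.κ + 1) ^ 2 * P.U * P.logX ^ 3 : ℝ) =
      2 * 10 ^ 9 * ((P.κ + 1) ^ 2 * (P.U * P.logX ^ 3)) := by ring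
  rw [e]
  linarith

end Large

/-- The success probability of the streaming algorithm. -/
theorem Large.success (h : P.Large) {τ : ℕ} {δ : ℝ} (hδ0 : 0 < δ) (hτδ : 5 / δ ≤ τ)
    (hκ : P.κ = 20 * τ) (A : Matrix (Fin P.n) (Fin P.d) ℝ) :
    (1 - δ) * 2 ^ P.bits ≤ ({seed | SketchGood P.r P.D (matS (P.seedEquiv seed))
      (matT (P.seedEquiv seed)) (matW (P.seedEquiv seed)) A P.k P.ε}.ncard : ℝ) := by
  have hτ0 : (0 : ℝ) < τ := lt_of_lt_of_le (by positivity) hτδ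
  have hτ : 1 ≤ τ := by exact_mod_cast hτ0
  have hgood := pr_not_good_le hτ hκ h.r_pos h.r_le h.D_pos h.ε_pos h.ε_lt h.two_le_nD A
  rw [pr_not, ← pr_equiv P.seedEquiv, pr_eq_card] at hgood
  have h5 : 5 / τ ≤ δ := by
    rw [div_le_iff₀ hδ0] at hτδ
    rw [div_le_iff₀ hτ0]; linarith
  have hc : (Fintype.card (Fin P.bits → Bool) : ℝ) = 2 ^ P.bits := by simp
  rw [hc] at hgood
  rw [← le_div_iff₀ (by positivity)]
  linarith

/-- The streaming algorithm. -/
theorem exists_stream {τ : ℕ} {δ : ℝ} (hδ0 : 0 < δ) (hτδ : 5 / δ ≤ τ) (hκ : P.κ = 20 * τ)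
    {C : ℕ} (hC : 120 * (2 * 10 ^ 9 * (P.κ + 1) ^ 2 + 5) ≤ C) (hr : 1 ≤ P.r) (hrk : P.r ≤ P.k)
    (hD : 1 ≤ P.D) (hε0 : 0 < P.ε) (hε1 : P.ε < 1) (hn : (C * (P.k / P.ε)) ^ C < (P.n : ℝ))
    (hd : (C * (P.k / P.ε)) ^ C < (P.d : ℝ)) :
    ∃ (m : ℕ) (L : RealRAM.Layout) (B : ℕ),
      (L.space : ℝ) ≤
        C * (P.n * P.r / P.ε ^ 2 + P.d * P.k / P.ε) *
          (1 + Real.log (P.n * P.d * P.k * P.D / P.ε)) ^ C ∧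
      (B : ℝ) ≤ (P.n * P.d * P.k * P.D / P.ε) ^ C ∧
      ∀ us : List (Fin P.n × Fin P.d × ℝ),
        ∃ out : (Fin m → Bool) → RealRAM.Mem,
          (∀ seed, StreamRun L B
            ((P.k : ℝ) ^ P.r *
              ((P.n : ℝ) * P.D) ^
                (C * (P.k ^ 2 / P.ε) * (1 + Real.log (P.k / P.ε)) ^ C : ℝ) *
              (P.d : ℝ) ^ C)
            ⟨sizesCmd P.κ, updateCmd, finishCmd⟩ P.k P.r P.D P.ε seed us (out seed)) ∧
          (1 - δ) * 2 ^ m ≤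
            ({seed | Solved P.k P.r P.D P.ε (streamMatrix us) (out seed)}.ncard : ℝ) := by
  have hC2 : 2 ≤ C := by omega
  have hq : (1 : ℝ) ≤ P.k / P.ε := by
    rw [le_div_iff₀ hε0]
    have : (1 : ℝ) ≤ P.k := by exact_mod_cast hr.trans hrk
    linarith
  have hC2' : (2 : ℝ) ≤ C := by exact_mod_cast hC2
  have hlarge : 4 * ((P.k : ℝ) / P.ε) ^ 2 ≤ (C * (P.k / P.ε)) ^ C := by
    calc 4 * ((P.k : ℝ) / P.ε) ^ 2 = (2 * (P.k / P.ε)) ^ 2 := by ring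
      _ ≤ (C * (P.k / P.ε)) ^ 2 :=
        pow_le_pow_left₀ (by linarith) (mul_le_mul_of_nonneg_right hC2' (by linarith)) 2
      _ ≤ _ := pow_le_pow_right₀ (by nlinarith) hC2
  have h : P.Large := ⟨hr, hrk, hD, hε0, hε1, hlarge.trans hn.le, hlarge.trans hd.le⟩
  have hκ0 : 0 < P.κ := by
    have hτ0 : (0 : ℝ) < τ := lt_of_lt_of_le (by positivity) hτδ
    have hτ : 1 ≤ τ := by exact_mod_cast hτ0
    omega
  have hX1 : 1 ≤ P.X := by linarith [h.four_le_X]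
  refine ⟨P.bits, (P.machine P.bits 0 0).L, (P.machine P.bits 0 0).B, ?_, ?_, fun us => ?_⟩
  · refine h.space_le.trans ?_
    have hU : 0 ≤ P.U := by linarith [h.four_le_U]
    have hCc : (2 * 10 ^ 9 * (P.κ + 1) ^ 2 : ℝ) ≤ C := by
      exact_mod_cast (by omega : 2 * 10 ^ 9 * (P.κ + 1) ^ 2 ≤ C)
    exact mul_le_mul (mul_le_mul_of_nonneg_right hCc hU)
      (pow_le_pow_right₀ h.one_le_logX (by omega))
      (pow_nonneg (by linarith [h.one_le_logX]) 3) (by positivity)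
  · have := h.V_pow_le le_rfl 24
    change ((P.V ^ 24 : ℕ) : ℝ) ≤ _
    push_cast
    exact this.trans (pow_le_pow_right₀ hX1 (by omega))
  · choose out hout using fun seed => streamRun (P := P) hε0 (hr.trans hrk) hrk
      (qT_pos hκ0 (hr.trans hrk) hr h.two_le_nD) (qW_pos hκ0 (hr.trans hrk) hε0 h.two_le_nD)
      (h.time_le le_rfl hC) us seed
    refine ⟨out, fun seed => (hout seed).1, (h.success hδ0 hτδ hκ (streamMatrix us)).trans ?_⟩
    exact_mod_cast Set.ncard_le_ncard (fun seed hs => (hout seed).2 hs) (Set.toFinite _)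

end Params

end SparseDict

theorem mainTheorem5 :
    -- sketches of the stated sizes suffice to compute an approximate solution
    (∀ δ : ℝ, 0 < δ → δ < 1 →
      ∃ (C : ℕ) (p : RealRAM.Cmd),
        ∀ (n d k r D : ℕ) (ε : ℝ), 1 ≤ n → 1 ≤ r → r ≤ k → 1 ≤ D → 0 < ε → ε < 1 →
          ∃ (s t w : ℕ)
            (μS : PMF (Matrix (Fin s) (Fin n) ℝ))
            (μT : PMF (Matrix (Fin d) (Fin t) ℝ))
            (μW : PMF (Matrix (Fin w) (Fin (n * d)) ℝ))
            (L : RealRAM.Layout) (B : ℕ),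
            (s : ℝ) ≤ C * (k / ε) ∧
            (t : ℝ) ≤ C * (r * Real.log (n * k * D) / ε ^ 2) ∧
            (w : ℝ) ≤ C * (k ^ 2 / ε ^ 3 * Real.log (n * D)) ∧
            ∀ A : Matrix (Fin n) (Fin d) ℝ,
              ENNReal.ofReal (1 - δ) ≤
                (μS.bind fun S => μT.bind fun T => μW.map fun W => (S, T, W)).toOuterMeasure
                  {x | SparseDict.RecoverySucceeds L B p k r D ε A x.1 x.2.1 x.2.2}) ∧
    -- the turnstile streaming algorithm
    (∀ δ : ℝ, 0 < δ → δ < 1 →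
      ∃ (C : ℕ) (P : SparseDict.StreamAlg),
        ∀ (n d k r D : ℕ) (ε : ℝ), 1 ≤ r → r ≤ k → 1 ≤ D → 0 < ε → ε < 1 →
          (C * (k / ε)) ^ C < (n : ℝ) → (C * (k / ε)) ^ C < (d : ℝ) →
          ∃ (m : ℕ) (L : RealRAM.Layout) (B : ℕ),
            (L.space : ℝ) ≤
              C * (n * r / ε ^ 2 + d * k / ε) * (1 + Real.log (n * d * k * D / ε)) ^ C ∧
            (B : ℝ) ≤ (n * d * k * D / ε) ^ C ∧
            ∀ us : List (Fin n × Fin d × ℝ),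
              ∃ out : (Fin m → Bool) → RealRAM.Mem,
                (∀ seed, SparseDict.StreamRun L B
                  ((k : ℝ) ^ r *
                    ((n : ℝ) * D) ^ (C * (k ^ 2 / ε) * (1 + Real.log (k / ε)) ^ C : ℝ) *
                    (d : ℝ) ^ C)
                  P k r D ε seed us (out seed)) ∧
                (1 - δ) * 2 ^ m ≤
                  ({seed | SparseDict.Solved k r D ε (SparseDict.streamMatrix us)
                    (out seed)}.ncard : ℝ)) := by
  constructor
  · intro δ hδ0 hδ1
    refine ⟨39324672 * (20 * ⌈5 / δ⌉₊ + 1) ^ 2, SparseDict.recoverCmd (20 * ⌈5 / δ⌉₊), ?_⟩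
    intro n d k r D ε hn hr hrk hD hε0 hε1
    exact SparseDict.Params.exists_sketches (P := ⟨20 * ⌈5 / δ⌉₊, n, d, k, r, D, ε⟩) hδ0
      (Nat.le_ceil _) rfl hn hr hrk hD hε0 hε1
  · intro δ hδ0 hδ1
    refine ⟨120 * (2 * 10 ^ 9 * (20 * ⌈5 / δ⌉₊ + 1) ^ 2 + 5),
      ⟨SparseDict.sizesCmd (20 * ⌈5 / δ⌉₊), SparseDict.updateCmd, SparseDict.Params.finishCmd⟩, ?_⟩
    intro n d k r D ε hr hrk hD hε0 hε1 hn hd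
    exact SparseDict.Params.exists_stream (P := ⟨20 * ⌈5 / δ⌉₊, n, d, k, r, D, ε⟩) hδ0
      (Nat.le_ceil _) rfl le_rfl hr hrk hD hε0 hε1 hn hd
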